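/- **Proposition (Markov property of the continuum GFF).** Let $d\ge 2$ and let $D\subset\mathbb R^d$ be open, with $D\neq\mathbb R^2$ if $d=2$, such that every point of $\partial D$ is regular for $D$. Here $z\in\partial U$ is called regular for an open set $U$ if a $d$-dimensional Brownian motion $B$ started from $z$ satisfies $\inf\{t>0: B_t\notin U\}=0$ almost surely. Let $A\subset\overline D$ be compact, put $O:=D\setminus A$, and assume that every point of $\partial O$ is regular for $O$. *Notation.* For $U$ open and $x\in U$ let $\tau_U$ be the exit time of Brownian motion from $U$ and let $\nu_{x,\partial U}$ be the law under $P^x$ of $B_{\tau_U}$ on the event $\{\tau_U<\infty\}$. Let $a_d$ be the surface measure of the unit sphere of $\mathbb R^d$, and let $H_y(x)=a_2^{-1}\log(1/|x-y|)$ if $d=2$ and $H_y(x)=a_d^{-1}|x-y|^{2-d}$ if $d\ge3$. For $U$ bounded and open, and $x\ne y$ in $U$, the Green's function is $G_U(x,y)=H_y(x)-E^x[H_y(B_{\tau_U})]$; moreover $G_U(x,x)=\infty$ for $x\in U$, and $G_U(x,y)=0$ if $x\notin U$ or $y\notin U$. For a general open set $U$, $G_U=\lim_{n\to\infty}G_{U\cap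 B(0,n)}$ (an increasing limit). Let $\mathcal M_U^+$ be the set of finite Borel measures $\mu$ with $\mu(\mathbb R^d\setminus U)=0$ and $\iint G_U(x,y)\,\mu(dx)\mu(dy)<\infty$, and let $\mathcal M_U$ be the set of differences of two elements of $\mathcal M_U^+$. A (Dirichlet) Gaussian free field (GFF) in $U$ is a centred Gaussian process $(\Gamma(\mu))_{\mu\in\mathcal M_U}$ with covariance $E[\Gamma(\mu)\Gamma(\nu)]=\iint G_U(x,y)\,\mu(dx)\nu(dy)$. Let $\Gamma$ be a GFF in $D$. For $\mu\in\mathcal M_D$ let $\nu_{\mu,\partial O}$ be the restriction to $D$ of $\int_O \nu_{x,\partial O}\,\mu(dx)$, and likewise regard $\nu_{z,\partial O}$, $z\in O$, as a measure on $D$ by restriction. Then: 1. For every $\mu\in\mathcal M_D$ the measures $\mu\mathbf 1_A$ and $\nu_{\mu,\partial O}$ belong to $\mathcal M_D$, so that $$\Gamma_A(\mu):=\Gamma(\mu\mathbf 1_A)+\Gamma(\nu_{\mu,\partial O}),\qquad \Gamma^A(\mu):=\Gamma(\mu)-\Gamma_A(\mu),\qquad \mu\in\mathcal M_D,$$ are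 well defined. 2. $(\Gamma_A(\mu))_{\mu\in\mathcal M_D}$ and $(\Gamma^A(\mu))_{\mu\in\mathcal M_D}$ are independent Gaussian processes. 3. $\Gamma^A$ is a Dirichlet GFF in $O$: there is a GFF $\Gamma^O$ in $O$, defined on the same probability space, such that for every $\mu\in\mathcal M_D$ one has $\mu\mathbf 1_O\in\mathcal M_O$ and $\Gamma^A(\mu)=\Gamma^O(\mu\mathbf 1_O)$ almost surely. 4. There are a version $\tilde\Gamma_A$ of $\Gamma_A$ (that is, $\tilde\Gamma_A(\mu)=\Gamma_A(\mu)$ almost surely for each $\mu\in\mathcal M_D$) and a random function $h_A$ such that almost surely $h_A$ is harmonic in $O$ and $\tilde\Gamma_A(\mu)=\int h_A\,d\mu$ for all $\mu\in\mathcal M_D$ carried by a compact subset of $O$. Moreover, for each $z\in O$, $\nu_{z,\partial O}\in\mathcal M_D$ and $h_A(z)=\Gamma(\nu_{z,\partial O})$ almost surely. -/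

import Mathlib

open MeasureTheory ProbabilityTheory Set
open scoped ENNReal NNReal

/-- The space `ℝ^d` with its Euclidean norm. -/
abbrev Space (d : ℕ) : Type := EuclideanSpace ℝ (Fin d)

section BrownianMotion

/-- A standard `d`-dimensional Brownian motion started from `0`: its coordinates are independent
standard real Brownian motions. The Brownian motion started from `x` is `x + B`. -/
structure IsBrownianMotion {d : ℕ} {Ω' : Type*} [MeasurableSpace Ω'] (B : ℝ≥0 → Ω' → Space d)
    (Q : Measure Ω') : Prop where
  coord : ∀ i : Fin d, IsBrownianReal (fun t ω => B t ω i) Q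
  indep : iIndepFun (fun (i : Fin d) (ω : Ω') (t : ℝ≥0) => B t ω i) Q

/-- All boundary points `z` of `U` are regular: for the Brownian motion started from `z`,
`inf {t > 0 : z + B t ∉ U} = 0` almost surely. -/
def HasRegularBoundary {d : ℕ} {Ω' : Type*} [MeasurableSpace Ω'] (B : ℝ≥0 → Ω' → Space d)
    (Q : Measure Ω') (U : Set (Space d)) : Prop :=
  ∀ z ∈ frontier U, ∀ᵐ ω ∂Q, ∀ ε : ℝ≥0, 0 < ε → ∃ t : ℝ≥0, 0 < t ∧ t < ε ∧ z + B t ω ∉ U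

/-- The exit time from `U` of the Brownian motion started from `x`
(meaningful for the paths that do leave `U`). -/
noncomputable def exitTime {d : ℕ} {Ω' : Type*} (B : ℝ≥0 → Ω' → Space d) (U : Set (Space d))
    (x : Space d) (ω : Ω') : ℝ≥0 :=
  sInf {t : ℝ≥0 | x + B t ω ∉ U}

/-- The harmonic measure `ν_{x, ∂U}`: the law of the position, at its exit time from `U`, of the
Brownian motion started from `x`, on the event that it leaves `U` in finite time. -/
noncomputable def harmonicMeasure {d : ℕ} {Ω' : Type*} [MeasurableSpace Ω']
    (B : ℝ≥0 → Ω' → Space d) (Q : Measure Ω') (U : Set (Space d)) (x : Space d) :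
    Measure (Space d) :=
  (Q.restrict {ω | ∃ t : ℝ≥0, x + B t ω ∉ U}).map (fun ω => x + B (exitTime B U x ω) ω)

instance {d : ℕ} {Ω' : Type*} [MeasurableSpace Ω'] (B : ℝ≥0 → Ω' → Space d)
    (Q : Measure Ω') [IsProbabilityMeasure Q] (U : Set (Space d)) (x : Space d) :
    IsFiniteMeasure (harmonicMeasure B Q U x) := by
  unfold harmonicMeasure
  infer_instance

theorem harmonicMeasure_univ_le {d : ℕ} {Ω' : Type*} [MeasurableSpace Ω']
    (B : ℝ≥0 → Ω' → Space d) (Q : Measure Ω') [IsProbabilityMeasure Q] (U : Set (Space d))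
    (x : Space d) : harmonicMeasure B Q U x univ ≤ 1 := by
  unfold harmonicMeasure
  by_cases h : AEMeasurable (fun ω => x + B (exitTime B U x ω) ω)
      (Q.restrict {ω | ∃ t : ℝ≥0, x + B t ω ∉ U})
  · rw [Measure.map_apply_of_aemeasurable h MeasurableSet.univ]
    exact (Measure.restrict_apply_le _ _).trans prob_le_one
  · rw [Measure.map_of_not_aemeasurable h]
    simp

/-- The swept measure `ν_{μ, ∂U} = ∫_U ν_{x, ∂U} μ(dx)` of a nonnegative measure `μ`. -/
noncomputable def sweptMeasure {d : ℕ} {Ω' : Type*} [MeasurableSpace Ω']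
    (B : ℝ≥0 → Ω' → Space d) (Q : Measure Ω') (U : Set (Space d)) (μ : Measure (Space d)) :
    Measure (Space d) :=
  (μ.restrict U).bind (harmonicMeasure B Q U)

instance {d : ℕ} {Ω' : Type*} [MeasurableSpace Ω'] (B : ℝ≥0 → Ω' → Space d)
    (Q : Measure Ω') [IsProbabilityMeasure Q] (U : Set (Space d)) (μ : Measure (Space d))
    [IsFiniteMeasure μ] : IsFiniteMeasure (sweptMeasure B Q U μ) := by
  constructor
  unfold sweptMeasure
  by_cases h : AEMeasurable (harmonicMeasure B Q U) (μ.restrict U)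
  · rw [Measure.bind_apply MeasurableSet.univ h]
    calc ∫⁻ x, harmonicMeasure B Q U x univ ∂(μ.restrict U)
        ≤ ∫⁻ _, 1 ∂(μ.restrict U) :=
          lintegral_mono fun x => harmonicMeasure_univ_le B Q U x
      _ < ∞ := by simp
  · simp [Measure.bind, Measure.map_of_not_aemeasurable h]

/-- The part in `D` of the swept measure `ν_{μ, ∂U}` of a signed measure `μ`, defined by linearity.
(The rest of `ν_{μ, ∂U}` lives on `∂D`, where the field vanishes.) -/
noncomputable def sweptSignedMeasure {d : ℕ} {Ω' : Type*} [MeasurableSpace Ω']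
    (B : ℝ≥0 → Ω' → Space d) (Q : Measure Ω') [IsProbabilityMeasure Q] (D U : Set (Space d))
    (μ : SignedMeasure (Space d)) : SignedMeasure (Space d) :=
  ((sweptMeasure B Q U μ.toJordanDecomposition.posPart).restrict D).toSignedMeasure -
    ((sweptMeasure B Q U μ.toJordanDecomposition.negPart).restrict D).toSignedMeasure

end BrownianMotion

section Green

/-- The fundamental solution: `H_y(x) = fundamentalSolution d (x - y)` is `log (1 / |x - y|) / a_2`
if `d = 2` and `|x - y|^(2 - d) / a_d` if `d ≥ 3`, where `a_d` is the surface measure of the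
unit sphere of `ℝ^d`. -/
noncomputable def fundamentalSolution (d : ℕ) (z : Space d) : ℝ :=
  (if d = 2 then Real.log (1 / ‖z‖) else 1 / ‖z‖ ^ (d - 2)) /
    ((volume : Measure (Space d)).toSphere.real univ)

open scoped Classical in
/-- The Green's function of a bounded open set `U`: `G_U(x, y) = H_y(x) - E^x[H_y(B_τ)]` for
distinct `x, y` in `U`, infinite on the diagonal of `U`, and `0` unless `x` and `y` are in `U`. -/
noncomputable def boundedGreen {d : ℕ} {Ω' : Type*} [MeasurableSpace Ω']
    (B : ℝ≥0 → Ω' → Space d) (Q : Measure Ω') (U : Set (Space d)) (x y : Space d) : ℝ≥0∞ :=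
  if x ∈ U ∧ y ∈ U then
    if x = y then ∞
    else ENNReal.ofReal (fundamentalSolution d (x - y) -
      ∫ z, fundamentalSolution d (z - y) ∂(harmonicMeasure B Q U x))
  else 0

/-- The Green's function of an open set `U`, as the increasing limit of the Green's functions of
the bounded open sets `U ∩ B(0, n)` (a sequence that is eventually constant if `U` is bounded). -/
noncomputable def green {d : ℕ} {Ω' : Type*} [MeasurableSpace Ω']
    (B : ℝ≥0 → Ω' → Space d) (Q : Measure Ω') (U : Set (Space d)) (x y : Space d) : ℝ≥0∞ :=
  ⨆ n : ℕ, boundedGreen B Q (U ∩ Metric.ball 0 (n : ℝ)) x y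

/-- `∫∫ G_U(x, y) μ(dx) ν(dy)` for nonnegative measures. -/
noncomputable def greenEnergy {d : ℕ} {Ω' : Type*} [MeasurableSpace Ω']
    (B : ℝ≥0 → Ω' → Space d) (Q : Measure Ω') (U : Set (Space d)) (μ ν : Measure (Space d)) :
    ℝ≥0∞ :=
  ∫⁻ x, ∫⁻ y, green B Q U x y ∂ν ∂μ

/-- `∫∫ G_U(x, y) μ(dx) ν(dy)` for signed measures. -/
noncomputable def greenCovariance {d : ℕ} {Ω' : Type*} [MeasurableSpace Ω']
    (B : ℝ≥0 → Ω' → Space d) (Q : Measure Ω') (U : Set (Space d))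
    (μ ν : SignedMeasure (Space d)) : ℝ :=
  (greenEnergy B Q U μ.toJordanDecomposition.posPart ν.toJordanDecomposition.posPart).toReal
  + (greenEnergy B Q U μ.toJordanDecomposition.negPart ν.toJordanDecomposition.negPart).toReal
  - (greenEnergy B Q U μ.toJordanDecomposition.posPart ν.toJordanDecomposition.negPart).toReal
  - (greenEnergy B Q U μ.toJordanDecomposition.negPart ν.toJordanDecomposition.posPart).toReal

/-- The class `M_U^+` of finite measures carried by `U` with finite energy. -/
def energyMeasures {d : ℕ} {Ω' : Type*} [MeasurableSpace Ω']
    (B : ℝ≥0 → Ω' → Space d) (Q : Measure Ω') (U : Set (Space d)) : Set (Measure (Space d)) :=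
  {μ | IsFiniteMeasure μ ∧ μ Uᶜ = 0 ∧ greenEnergy B Q U μ μ < ∞}

/-- The class `M_U` of differences of two elements of `M_U^+`. -/
def signedEnergyMeasures {d : ℕ} {Ω' : Type*} [MeasurableSpace Ω']
    (B : ℝ≥0 → Ω' → Space d) (Q : Measure Ω') (U : Set (Space d)) :
    Set (SignedMeasure (Space d)) :=
  {μ | ∃ (p m : Measure (Space d)) (_ : IsFiniteMeasure p) (_ : IsFiniteMeasure m),
    p ∈ energyMeasures B Q U ∧ m ∈ energyMeasures B Q U ∧
      μ = p.toSignedMeasure - m.toSignedMeasure}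

end Green

section GFF

/-- `(Γ μ)`, `μ ∈ M_U`, is a (Dirichlet) Gaussian free field in `U`: a centred Gaussian process
with covariance `∫∫ G_U(x, y) μ(dx) ν(dy)`. The values of `Γ` outside `M_U` play no role. -/
structure IsGFF {d : ℕ} {Ω' : Type*} [MeasurableSpace Ω'] (B : ℝ≥0 → Ω' → Space d)
    (Q : Measure Ω') {Ω : Type*} [MeasurableSpace Ω] (U : Set (Space d))
    (Γ : SignedMeasure (Space d) → Ω → ℝ) (P : Measure Ω) : Prop where
  gaussian : IsGaussianProcess (fun μ : signedEnergyMeasures B Q U => Γ μ) P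
  centred : ∀ μ ∈ signedEnergyMeasures B Q U, ∫ ω, Γ μ ω ∂P = 0
  covariance : ∀ μ ∈ signedEnergyMeasures B Q U, ∀ ν ∈ signedEnergyMeasures B Q U,
    ∫ ω, Γ μ ω * Γ ν ω ∂P = greenCovariance B Q U μ ν

/-- `Γ_A(μ) = Γ(μ 1_A) + Γ(ν_{μ, ∂O})` with `O = D \ A`. -/
noncomputable def fieldOn {d : ℕ} {Ω' : Type*} [MeasurableSpace Ω'] (B : ℝ≥0 → Ω' → Space d)
    (Q : Measure Ω') [IsProbabilityMeasure Q] {Ω : Type*} (D A : Set (Space d))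
    (Γ : SignedMeasure (Space d) → Ω → ℝ) (μ : SignedMeasure (Space d)) (ω : Ω) : ℝ :=
  Γ (μ.restrict A) ω + Γ (sweptSignedMeasure B Q D (D \ A) μ) ω

/-- `Γ^A = Γ - Γ_A`. -/
noncomputable def fieldOff {d : ℕ} {Ω' : Type*} [MeasurableSpace Ω'] (B : ℝ≥0 → Ω' → Space d)
    (Q : Measure Ω') [IsProbabilityMeasure Q] {Ω : Type*} (D A : Set (Space d))
    (Γ : SignedMeasure (Space d) → Ω → ℝ) (μ : SignedMeasure (Space d)) (ω : Ω) : ℝ :=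
  Γ μ ω - fieldOn B Q D A Γ μ ω

/-- The signed measure `μ` is carried by a compact subset of `U`. -/
def CompactlyCarriedIn {d : ℕ} (U : Set (Space d)) (μ : SignedMeasure (Space d)) : Prop :=
  ∃ K : Set (Space d), IsCompact K ∧ K ⊆ U ∧ μ.totalVariation Kᶜ = 0

end GFF

/-! By its covariance, the field is an isometry from measures with the Green energy of `D` into L².
Everything rests on one identity of potential theory, `green_balayage`: with `O = D \ A` and `x ∈
O`, `G_D(x, y) = G_O(x, y) + ∫ G_D(z, y) ν_{x,∂O}(dz)`. Let `bal p` be the restriction of `p` to `A`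
plus the part in `D` of its swept measure. Integrating the identity gives `E_D(p, q) = E_D(bal p, q)
+ E_O(p, q)` (`greenEnergy_eq_add`). Since `bal q` does not charge `O`, it follows that `E_D(bal p,
bal q) = E_D(bal p, q)`: balayage is an orthogonal projection. Hence `Γ_A` and `Γ^A` are orthogonal,
thus independent because they lie in one Gaussian space, and `Γ^A` has covariance `E_O`. A measure
of finite energy in `O` may have infinite energy in `D`, so the field in `O` is defined by L² limits
along compact subsets of `O`, on which `G_D` is bounded away from its pole (`exists_green_le`).

The identity is proved with heat kernels. The kernel killed off a closed set is the decreasing limit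
of kernels that check the path at dyadic times only; these are symmetric by construction. The simple
Markov property at grid times gives a first exit decomposition, which passes to the limit
(`heat_eq_killedKernel_add`); the strong Markov property is never used. In Laplace transform, the
free resolvent at rate `l > 0` from `x` is the killed resolvent plus the free resolvent averaged
over the discounted exit law, for a target `y` in the open set. For `y` outside there is an
inequality, and equality of total masses makes it an equality almost everywhere; heat smoothing
makes it hold everywhere when all boundary points are regular, because the killed resolvent then
tends to `0` there (`heatResolvent_eq`). Using this splitting for `D` from `y` and for `O` from `x`,
Fubini's theorem gives the balayage identity at rate `l`, and `l ↓ 0` gives it for Green's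
functions. The time integral of the killed kernel is identified with a multiple of `green` by
comparing differences of resolvents, which have a limit as `l ↓ 0` even in dimension two.

The Cauchy-Schwarz inequality for the energy comes from the semigroup property: the energy of `p`
and `q` is an integral of products of their heat smoothings at time `t / 2`.

For the harmonic part, put `m z = Γ(ν_{z,∂O})` in L². The inner product of `m w` and `m z` is the
potential at `z` of `ν_{w,∂O}`, a superposition of Green's functions with poles outside `O`. It has
the mean value property in `z` and is locally bounded uniformly in `w`. Hence `m` is continuous and
has the mean value property in L². Averaging a jointly measurable version of `m` against smooth
radial bumps changes nothing almost surely and makes paths smooth; the paths are then harmonic by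
the converse of the mean value property. Testing against inner products shows that the integral of
`m` against `p` represents the field at `bal p`. -/

/-! ### The heat kernel and its resolvent -/

section HeatKernel

variable {d : ℕ}

/-- The real heat kernel `(2πt)^(-d/2) exp(-|z|²/(2t))`. -/
noncomputable def heatReal (t : ℝ) (z : Space d) : ℝ :=
  (√(2 * Real.pi * t))⁻¹ ^ d * Real.exp (-‖z‖ ^ 2 / (2 * t))

/-- The heat kernel with values in `[0, ∞]`. -/
noncomputable def heat (t : ℝ) (z : Space d) : ℝ≥0∞ := ENNReal.ofReal (heatReal t z)

theorem heatReal_nonneg (t : ℝ) (z : Space d) : 0 ≤ heatReal t z := by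
  unfold heatReal; positivity

theorem measurable_heatReal : Measurable (fun q : ℝ × Space d => heatReal q.1 q.2) := by
  unfold heatReal; fun_prop

theorem measurable_heat : Measurable (fun q : ℝ × Space d => heat q.1 q.2) :=
  measurable_heatReal.ennreal_ofReal

@[fun_prop]
theorem Measurable.heat {α : Type*} [MeasurableSpace α] {f : α → ℝ} {g : α → Space d}
    (hf : Measurable f) (hg : Measurable g) : Measurable (fun a => heat (f a) (g a)) :=
  measurable_heat.comp (hf.prodMk hg)

theorem heat_ne_top (t : ℝ) (z : Space d) : heat t z ≠ ∞ := ENNReal.ofReal_ne_top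

theorem heat_sub_comm (t : ℝ) (x y : Space d) : heat t (x - y) = heat t (y - x) := by
  unfold heat heatReal; rw [norm_sub_rev]

theorem continuousAt_heatReal {t : ℝ} (ht : 0 < t) (z : Space d) :
    ContinuousAt (fun q : ℝ × Space d => heatReal q.1 q.2) (t, z) := by
  unfold heatReal
  have h1 : √(2 * Real.pi * t) ≠ 0 := (Real.sqrt_pos.2 (by positivity)).ne'
  have h2 : 2 * t ≠ 0 := by positivity
  have h3 : ContinuousAt (fun q : ℝ × Space d => √(2 * Real.pi * q.1)) (t, z) := by fun_prop
  refine ContinuousAt.mul ((h3.inv₀ h1).pow _) ?_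
  refine Real.continuous_exp.continuousAt.comp ?_
  exact ContinuousAt.div (by fun_prop) (by fun_prop) h2

theorem continuousAt_heat {t : ℝ} (ht : 0 < t) (z : Space d) :
    ContinuousAt (fun q : ℝ × Space d => heat q.1 q.2) (t, z) :=
  ENNReal.continuous_ofReal.continuousAt.comp (continuousAt_heatReal ht z)

theorem integral_exp_neg_norm_sq {t : ℝ} (ht : 0 < t) :
    ∫ z : Space d, Real.exp (-‖z‖ ^ 2 / (2 * t)) = √(2 * Real.pi * t) ^ d := by
  have h := GaussianFourier.integral_rexp_neg_mul_sq_norm (V := Space d)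
    (b := 1 / (2 * t)) (by positivity)
  have e : ∀ z : Space d, Real.exp (-‖z‖ ^ 2 / (2 * t)) = Real.exp (-(1 / (2 * t)) * ‖z‖ ^ 2) := by
    intro z; congr 1; ring
  simp_rw [e]
  rw [h, finrank_euclideanSpace_fin, show Real.pi / (1 / (2 * t)) = 2 * Real.pi * t by field_simp,
    Real.sqrt_eq_rpow, ← Real.rpow_natCast, ← Real.rpow_mul (by positivity)]
  congr 1; ring

theorem integral_heatReal {t : ℝ} (ht : 0 < t) : ∫ z : Space d, heatReal t z = 1 := by
  unfold heatReal
  rw [integral_const_mul, integral_exp_neg_norm_sq ht, ← mul_pow, inv_mul_cancel₀, one_pow]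
  exact (Real.sqrt_pos.2 (by positivity)).ne'

theorem integrable_heatReal {t : ℝ} (ht : 0 < t) :
    Integrable (fun z : Space d => heatReal t z) := by
  -- The integral of a nonintegrable function is `0` by convention, which contradicts the value `1`.
  by_contra h
  have := integral_heatReal (d := d) ht
  rw [integral_undef h] at this
  norm_num at this

theorem lintegral_heat {t : ℝ} (ht : 0 < t) : ∫⁻ z : Space d, heat t z = 1 := by
  unfold heat
  rw [← ofReal_integral_eq_lintegral_ofReal (integrable_heatReal ht)
    (Filter.Eventually.of_forall fun z => heatReal_nonneg t z), integral_heatReal ht,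
    ENNReal.ofReal_one]

theorem lintegral_heat_sub_left {t : ℝ} (ht : 0 < t) (x : Space d) :
    ∫⁻ z : Space d, heat t (x - z) = 1 := by
  rw [lintegral_sub_left_eq_self (fun z => heat t z) x, lintegral_heat ht]

/-- Completing the square in `u`: the second factor on the right is the density of a Brownian bridge
at time `s`, with mean `(s / (s + t)) • v` and variance `s * t / (s + t)`. Integrating it out gives
the Chapman-Kolmogorov equation. -/
theorem heatReal_mul_heatReal {s t : ℝ} (hs : 0 < s) (ht : 0 < t) (u v : Space d) :
    heatReal s u * heatReal t (v - u) =
      heatReal (s + t) v * heatReal (s * t / (s + t)) (u - (s / (s + t)) • v) := by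
  have hst : 0 < s + t := by positivity
  have e1 : (√(2 * Real.pi * s))⁻¹ * (√(2 * Real.pi * t))⁻¹ =
      (√(2 * Real.pi * (s + t)))⁻¹ * (√(2 * Real.pi * (s * t / (s + t))))⁻¹ := by
    rw [← mul_inv, ← mul_inv, ← Real.sqrt_mul (by positivity), ← Real.sqrt_mul (by positivity)]
    congr 2
    field_simp
  have e2 : -‖u‖ ^ 2 / (2 * s) + -‖v - u‖ ^ 2 / (2 * t) =
      -‖v‖ ^ 2 / (2 * (s + t)) +
        -‖u - (s / (s + t)) • v‖ ^ 2 / (2 * (s * t / (s + t))) := by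
    rw [norm_sub_sq_real, norm_sub_sq_real, inner_smul_right, norm_smul, mul_pow,
      Real.norm_of_nonneg (by positivity), real_inner_comm]
    field_simp
    ring
  unfold heatReal
  calc _ = ((√(2 * Real.pi * s))⁻¹ * (√(2 * Real.pi * t))⁻¹) ^ d *
        (Real.exp (-‖u‖ ^ 2 / (2 * s)) * Real.exp (-‖v - u‖ ^ 2 / (2 * t))) := by
        rw [mul_pow]; ring
    _ = _ := by
        rw [e1, ← Real.exp_add, e2, Real.exp_add, mul_pow]; ring

theorem lintegral_heat_mul_heat {s t : ℝ} (hs : 0 < s) (ht : 0 < t) (x y : Space d) :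
    ∫⁻ z, heat s (x - z) * heat t (z - y) = heat (s + t) (x - y) := by
  have h : ∀ z : Space d, heat s (x - z) * heat t (z - y) =
      heat (s + t) (x - y) * heat (s * t / (s + t)) ((x - (s / (s + t)) • (x - y)) - z) := by
    intro z
    unfold heat
    rw [← ENNReal.ofReal_mul (heatReal_nonneg _ _), ← ENNReal.ofReal_mul (heatReal_nonneg _ _)]
    have := heatReal_mul_heatReal hs ht (x - z) (x - y)
    rw [show x - y - (x - z) = z - y by abel] at this
    rw [this]
    congr 3
    abel
  simp_rw [h]
  rw [lintegral_const_mul _ (by fun_prop), lintegral_heat_sub_left (by positivity), mul_one]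

theorem heatReal_le_inv_sqrt_pow (t : ℝ) (z : Space d) :
    heatReal t z ≤ (√(2 * Real.pi * t))⁻¹ ^ d := by
  by_cases ht : 0 ≤ t
  · unfold heatReal
    refine mul_le_of_le_one_right (by positivity) (Real.exp_le_one_iff.2 ?_)
    rw [neg_div]
    exact neg_nonpos.2 (by positivity)
  · push Not at ht
    unfold heatReal
    -- At negative times the normalizing factor is `0⁻¹ ^ d`, hence `0`, except that `0 ^ 0 = 1` if
    -- `d = 0`; then the exponential is `1` as well.
    rw [Real.sqrt_eq_zero_of_nonpos (by nlinarith [Real.pi_pos]), inv_zero]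
    rcases Nat.eq_zero_or_pos d with rfl | hd
    · have : ‖z‖ = 0 := by rw [Subsingleton.elim z 0, norm_zero]
      simp [this]
    · simp [zero_pow hd.ne']

/-- Away from the origin the heat kernel is small at small times. -/
theorem heatReal_le_mul_sqrt_pow {δ : ℝ} (hδ : 0 < δ) :
    ∃ C : ℝ, 0 < C ∧ ∀ t : ℝ, 0 < t → ∀ z : Space d, δ ≤ ‖z‖ → heatReal t z ≤ C * √t ^ d := by
  -- The constant comes from `u ^ d / d! ≤ exp u` at `u = ‖z‖ ^ 2 / (2 * t)`. This gains a factor `t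
  -- ^ d`, half of which pays for the normalization of the kernel.
  refine ⟨d.factorial * (2 / δ ^ 2) ^ d, by positivity, fun t ht z hz => ?_⟩
  have hu : 0 < ‖z‖ ^ 2 / (2 * t) := by have := hδ.trans_le hz; positivity
  have h1 : Real.exp (-‖z‖ ^ 2 / (2 * t)) ≤ d.factorial / (δ ^ 2 / (2 * t)) ^ d := by
    rw [neg_div, Real.exp_neg, ← one_div, div_le_div_iff₀ (Real.exp_pos _) (by positivity), one_mul]
    have h2 := Real.pow_div_factorial_le_exp (‖z‖ ^ 2 / (2 * t)) hu.le d
    rw [div_le_iff₀ (by positivity)] at h2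
    calc (δ ^ 2 / (2 * t)) ^ d ≤ (‖z‖ ^ 2 / (2 * t)) ^ d := by gcongr
      _ ≤ _ := h2.trans_eq (mul_comm _ _)
  have h3 : (√(2 * Real.pi * t))⁻¹ ≤ (√t)⁻¹ := by
    gcongr
    nlinarith [Real.pi_gt_three]
  unfold heatReal
  calc (√(2 * Real.pi * t))⁻¹ ^ d * Real.exp (-‖z‖ ^ 2 / (2 * t))
      ≤ (√t)⁻¹ ^ d * (d.factorial / (δ ^ 2 / (2 * t)) ^ d) := by gcongr
    _ = d.factorial * (2 / δ ^ 2) ^ d * √t ^ d := by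
      have h4 : t ^ d = √t ^ d * √t ^ d := by rw [← mul_pow, Real.mul_self_sqrt ht.le]
      have h5 : 0 < √t := Real.sqrt_pos.2 ht
      rw [inv_pow, div_pow, div_pow, mul_pow, h4]
      field_simp
      
theorem heatReal_le_of_le_norm {δ : ℝ} (hδ : 0 < δ) :
    ∃ C : ℝ, 0 < C ∧ ∀ t : ℝ, 0 < t → ∀ z : Space d, δ ≤ ‖z‖ → heatReal t z ≤ C := by
  obtain ⟨C, hC, h⟩ := heatReal_le_mul_sqrt_pow (d := d) hδ
  refine ⟨max C 1, by positivity, fun t ht z hz => ?_⟩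
  rcases le_total t 1 with h1 | h1
  · refine (h t ht z hz).trans (le_max_of_le_left ?_)
    exact mul_le_of_le_one_right hC.le (pow_le_one₀ (Real.sqrt_nonneg _) (Real.sqrt_le_one.2 h1))
  · refine (heatReal_le_inv_sqrt_pow t z).trans (le_max_of_le_right ?_)
    refine pow_le_one₀ (by positivity) (inv_le_one_of_one_le₀ ?_)
    rw [Real.one_le_sqrt]
    nlinarith [Real.pi_gt_three]

/-- The `l`-resolvent density of Brownian motion. -/
noncomputable def heatResolvent (l : ℝ) (z : Space d) : ℝ≥0∞ :=
  ∫⁻ t in Ioi (0 : ℝ), ENNReal.ofReal (Real.exp (-(l * t))) * heat t z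

theorem measurable_heatResolvent (l : ℝ) : Measurable (heatResolvent l : Space d → ℝ≥0∞) := by
  unfold heatResolvent
  exact Measurable.lintegral_prod_right' (f := fun q : Space d × ℝ =>
    ENNReal.ofReal (Real.exp (-(l * q.2))) * heat q.2 q.1) (by fun_prop)

theorem heatResolvent_sub_comm (l : ℝ) (x y : Space d) :
    heatResolvent l (x - y) = heatResolvent l (y - x) := by
  unfold heatResolvent; simp_rw [heat_sub_comm _ x y]

theorem lintegral_exp_neg_mul {l : ℝ} (hl : 0 < l) :
    ∫⁻ t in Ioi (0 : ℝ), ENNReal.ofReal (Real.exp (-(l * t))) = ENNReal.ofReal l⁻¹ := by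
  have h := integrableOn_Ioi_comp_mul_left_iff (fun t => Real.exp (-t)) 0 hl
  rw [mul_zero] at h
  have h2 := h.2 (by simpa using integrableOn_exp_neg_Ioi 0)
  rw [← ofReal_integral_eq_lintegral_ofReal h2
    (Filter.Eventually.of_forall fun t => (Real.exp_pos _).le),
    integral_comp_mul_left_Ioi (fun t => Real.exp (-t)) 0 hl]
  rw [mul_zero, integral_exp_neg_Ioi_zero, smul_eq_mul, mul_one]

theorem lintegral_heatResolvent {l : ℝ} (hl : 0 < l) (x : Space d) :
    ∫⁻ z : Space d, heatResolvent l (x - z) = ENNReal.ofReal l⁻¹ := by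
  unfold heatResolvent
  rw [lintegral_lintegral_swap (by fun_prop), ← lintegral_exp_neg_mul hl]
  refine setLIntegral_congr_fun measurableSet_Ioi fun t ht => ?_
  rw [lintegral_const_mul _ (by fun_prop), lintegral_heat_sub_left ht, mul_one]

theorem heatResolvent_le_of_le_norm {l δ : ℝ} (hl : 0 < l) (hδ : 0 < δ) :
    ∃ C : ℝ≥0, ∀ z : Space d, δ ≤ ‖z‖ → heatResolvent l z ≤ C := by
  obtain ⟨C, hC, h⟩ := heatReal_le_of_le_norm (d := d) hδ
  refine ⟨Real.toNNReal l⁻¹ * Real.toNNReal C, fun z hz => ?_⟩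
  calc heatResolvent l z ≤ ∫⁻ t in Ioi (0 : ℝ), ENNReal.ofReal (Real.exp (-(l * t))) *
          ENNReal.ofReal C :=
        setLIntegral_mono' measurableSet_Ioi fun t ht => by
          gcongr; exact ENNReal.ofReal_le_ofReal (h t ht z hz)
    _ = _ := by
        rw [lintegral_mul_const _ (by fun_prop), lintegral_exp_neg_mul hl]
        simp [ENNReal.ofReal]

theorem heatResolvent_ne_top {l : ℝ} (hl : 0 < l) {z : Space d} (hz : z ≠ 0) : heatResolvent l z ≠ ∞ := by
  obtain ⟨C, hC⟩ := heatResolvent_le_of_le_norm (d := d) hl (norm_pos_iff.2 hz)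
  exact ((hC z le_rfl).trans_lt ENNReal.coe_lt_top).ne

/-- Smoothing by the heat kernel at time `s` removes the times before `s` from the resolvent
integral. With this, an identity between resolvents known almost everywhere becomes one valid
everywhere after smoothing. -/
theorem lintegral_heat_mul_heatResolvent (l : ℝ) {s : ℝ} (hs : 0 < s) (x y : Space d) :
    ENNReal.ofReal (Real.exp (-(l * s))) * ∫⁻ z, heat s (y - z) * heatResolvent l (x - z) =
      ∫⁻ t in Ioi s, ENNReal.ofReal (Real.exp (-(l * t))) * heat t (x - y) := by
  have h1 : ∀ z : Space d, heat s (y - z) * heatResolvent l (x - z) = ∫⁻ t in Ioi (0 : ℝ),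
      ENNReal.ofReal (Real.exp (-(l * t))) * (heat t (x - z) * heat s (z - y)) := by
    intro z
    unfold heatResolvent
    rw [← lintegral_const_mul _ (by fun_prop)]
    refine lintegral_congr fun t => ?_
    rw [heat_sub_comm s y z]
    ring
  simp_rw [h1]
  rw [lintegral_lintegral_swap (by fun_prop), ← lintegral_const_mul' _ _ ENNReal.ofReal_ne_top]
  have h2 : ∫⁻ t in Ioi s, ENNReal.ofReal (Real.exp (-(l * t))) * heat t (x - y) =
      ∫⁻ t in Ioi (0 : ℝ), ENNReal.ofReal (Real.exp (-(l * (t + s)))) * heat (t + s) (x - y) := by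
    have := (measurePreserving_add_right (volume : Measure ℝ) s).setLIntegral_comp_preimage
      (s := Ioi s) measurableSet_Ioi
      (f := fun t => ENNReal.ofReal (Real.exp (-(l * t))) * heat t (x - y)) (by fun_prop)
    rw [← this]
    simp
  rw [h2]
  refine setLIntegral_congr_fun measurableSet_Ioi fun t ht => ?_
  rw [lintegral_const_mul _ (by fun_prop), lintegral_heat_mul_heat ht hs, ← mul_assoc,
    ← ENNReal.ofReal_mul (Real.exp_pos _).le, ← Real.exp_add]
  congr 3
  ring

end HeatKernel

/-! ### Exhaustion of open sets by compact sets -/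

section Exhaustion

variable {d : ℕ}

/-- An exhaustion of an open set by compact sets. -/
def exhaustion (U : Set (Space d)) (j : ℕ) : Set (Space d) :=
  -- With extended distances the whole space needs no separate treatment: the distance to the empty
  -- complement is `∞`.
  {z | ((j : ℝ≥0∞) + 1)⁻¹ ≤ Metric.infEDist z Uᶜ} ∩ Metric.closedBall 0 (j : ℝ)

theorem isClosed_exhaustion (U : Set (Space d)) (j : ℕ) : IsClosed (exhaustion U j) :=
  (isClosed_le continuous_const Metric.continuous_infEDist).inter Metric.isClosed_closedBall

theorem isCompact_exhaustion (U : Set (Space d)) (j : ℕ) : IsCompact (exhaustion U j) :=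
  (isCompact_closedBall _ _).of_isClosed_subset (isClosed_exhaustion U j) inter_subset_right

theorem exhaustion_subset (U : Set (Space d)) (j : ℕ) : exhaustion U j ⊆ U := by
  intro z hz
  by_contra h
  have h1 : ((j : ℝ≥0∞) + 1)⁻¹ ≤ 0 := hz.1.trans_eq (Metric.infEDist_zero_of_mem h)
  simp only [nonpos_iff_eq_zero, ENNReal.inv_eq_zero] at h1
  exact (ENNReal.add_ne_top.2 ⟨ENNReal.natCast_ne_top j, ENNReal.one_ne_top⟩) h1

theorem exhaustion_mono {U V : Set (Space d)} (h : U ⊆ V) (j : ℕ) :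
    exhaustion U j ⊆ exhaustion V j := fun _ hz =>
  ⟨hz.1.trans (Metric.infEDist_anti (compl_subset_compl.2 h)), hz.2⟩

theorem monotone_exhaustion (U : Set (Space d)) : Monotone (exhaustion U) := by
  intro i j hij z hz
  refine ⟨le_trans (ENNReal.inv_le_inv.2 ?_) hz.1,
    Metric.closedBall_subset_closedBall (by exact_mod_cast hij) hz.2⟩
  gcongr

theorem exists_subset_exhaustion {U C : Set (Space d)} (hU : IsOpen U) (hC : IsCompact C)
    (hCU : C ⊆ U) : ∃ j, C ⊆ exhaustion U j := by
  obtain ⟨δ, hδ, h⟩ := hC.exists_thickening_subset_open hU hCU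
  obtain ⟨R, hR⟩ := hC.isBounded.subset_closedBall 0
  obtain ⟨j, hj⟩ := exists_nat_gt (max R δ⁻¹)
  refine ⟨j, fun z hz => ⟨?_, Metric.closedBall_subset_closedBall
    ((le_max_left _ _).trans hj.le) (hR hz)⟩⟩
  refine Metric.le_infEDist.2 fun y hy => ?_
  by_contra hlt
  push Not at hlt
  refine hy (h (Metric.mem_thickening_iff.2 ⟨z, hz, ?_⟩))
  rw [dist_comm]
  have h2 : ENNReal.ofReal (dist z y) < ENNReal.ofReal δ := by
    rw [← edist_dist]
    refine hlt.trans ?_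
    rw [ENNReal.inv_lt_iff_inv_lt, ← ENNReal.ofReal_inv_of_pos hδ]
    calc ENNReal.ofReal δ⁻¹ < ENNReal.ofReal ((j : ℝ)) :=
          (ENNReal.ofReal_lt_ofReal_iff (lt_of_le_of_lt (by positivity)
            ((le_max_right R δ⁻¹).trans_lt hj))).2 ((le_max_right _ _).trans_lt hj)
      _ ≤ (j : ℝ≥0∞) + 1 := by rw [ENNReal.ofReal_natCast]; exact le_self_add
  exact (ENNReal.ofReal_lt_ofReal_iff hδ).1 h2

theorem exists_closedBall_subset_exhaustion {U : Set (Space d)} (hU : IsOpen U) {x : Space d}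
    (hx : x ∈ U) : ∃ r > 0, ∃ j, Metric.closedBall x r ⊆ exhaustion U j := by
  obtain ⟨r, hr, h⟩ := Metric.nhds_basis_closedBall.mem_iff.1 (hU.mem_nhds hx)
  exact ⟨r, hr, exists_subset_exhaustion hU (isCompact_closedBall x r) h⟩

theorem iUnion_exhaustion {U : Set (Space d)} (hU : IsOpen U) : ⋃ j, exhaustion U j = U := by
  refine subset_antisymm (iUnion_subset (exhaustion_subset U)) fun x hx => ?_
  obtain ⟨r, hr, j, h⟩ := exists_closedBall_subset_exhaustion hU hx
  exact mem_iUnion.2 ⟨j, h (Metric.mem_closedBall_self hr.le)⟩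

end Exhaustion

/-! ### Transition densities of killed Brownian motion -/

section KilledKernel

variable {d : ℕ}

/-- Transition density over `n + 1` steps of length `h` of Brownian motion required to be in `K` at
the intermediate times. -/
noncomputable def gridKernel (K : Set (Space d)) (h : ℝ) : ℕ → Space d → Space d → ℝ≥0∞
  | 0, x, y => heat h (x - y)
  | n + 1, x, y => ∫⁻ z in K, heat h (x - z) * gridKernel K h n z y

theorem measurable_gridKernel (K : Set (Space d)) (n : ℕ) :
    Measurable (fun q : ℝ × Space d × Space d => gridKernel K q.1 n q.2.1 q.2.2) := by
  induction n with
  | zero => unfold gridKernel; fun_prop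
  | succ n ih =>
    simp only [gridKernel]
    refine Measurable.lintegral_prod_right' (f := fun q : (ℝ × Space d × Space d) × Space d =>
      heat q.1.1 (q.1.2.1 - q.2) * gridKernel K q.1.1 n q.2 q.1.2.2) ?_
    refine Measurable.mul (by fun_prop) ?_
    have hg : Measurable fun q : (ℝ × Space d × Space d) × Space d => (q.1.1, q.2, q.1.2.2) := by
      fun_prop
    exact ih.comp hg

@[fun_prop]
theorem Measurable.gridKernel {α : Type*} [MeasurableSpace α] {K : Set (Space d)} {n : ℕ}
    {f : α → ℝ} {g g' : α → Space d} (hf : Measurable f) (hg : Measurable g)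
    (hg' : Measurable g') : Measurable (fun a => gridKernel K (f a) n (g a) (g' a)) :=
  (measurable_gridKernel K n).comp (hf.prodMk (hg.prodMk hg'))

/-- The index counts the intermediate times, so the point where two pieces are glued adds one. -/
theorem gridKernel_add (K : Set (Space d)) (h : ℝ) (m n : ℕ) (x y : Space d) :
    gridKernel K h (m + n + 1) x y =
      ∫⁻ z in K, gridKernel K h m x z * gridKernel K h n z y := by
  induction m generalizing x with
  | zero => rw [zero_add]; rfl
  | succ m ih =>
    rw [show m + 1 + n + 1 = (m + n + 1) + 1 by ring]
    change ∫⁻ z in K, heat h (x - z) * gridKernel K h (m + n + 1) z y =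
      ∫⁻ w in K, (∫⁻ z in K, heat h (x - z) * gridKernel K h m z w) * gridKernel K h n w y
    simp_rw [ih]
    calc ∫⁻ z in K, heat h (x - z) * ∫⁻ w in K, gridKernel K h m z w * gridKernel K h n w y
        = ∫⁻ z in K, ∫⁻ w in K, heat h (x - z) * gridKernel K h m z w * gridKernel K h n w y := by
          refine lintegral_congr fun z => ?_
          rw [← lintegral_const_mul _ (by fun_prop)]
          simp_rw [mul_assoc]
      _ = ∫⁻ w in K, ∫⁻ z in K, heat h (x - z) * gridKernel K h m z w * gridKernel K h n w y :=
          lintegral_lintegral_swap (by fun_prop)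
      _ = _ := by
          refine lintegral_congr fun w => ?_
          rw [lintegral_mul_const _ (by fun_prop)]

/-- Time reversal: the recursion peels off the first step, `gridKernel_add` peels off the last. -/
theorem gridKernel_comm (K : Set (Space d)) (h : ℝ) (n : ℕ) (x y : Space d) :
    gridKernel K h n x y = gridKernel K h n y x := by
  induction n generalizing x y with
  | zero => exact heat_sub_comm h x y
  | succ n ih =>
    have := gridKernel_add K h n 0 y x
    rw [add_zero] at this
    rw [this]
    simp only [gridKernel]
    refine lintegral_congr fun z => ?_
    rw [heat_sub_comm h x z, ih z y, mul_comm]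

theorem gridKernel_mono {K L : Set (Space d)} (hKL : K ⊆ L) (h : ℝ) (n : ℕ) (x y : Space d) :
    gridKernel K h n x y ≤ gridKernel L h n x y := by
  induction n generalizing x with
  | zero => exact le_rfl
  | succ n ih =>
    simp only [gridKernel]
    exact lintegral_mono' (Measure.restrict_mono hKL le_rfl) fun z => by gcongr; exact ih z

theorem gridKernel_le_heat (K : Set (Space d)) {h : ℝ} (hh : 0 < h) (n : ℕ) (x y : Space d) :
    gridKernel K h n x y ≤ heat ((n + 1) * h) (x - y) := by
  induction n generalizing x with
  | zero => simp [gridKernel]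
  | succ n ih =>
    simp only [gridKernel]
    calc ∫⁻ z in K, heat h (x - z) * gridKernel K h n z y
        ≤ ∫⁻ z, heat h (x - z) * heat ((n + 1) * h) (z - y) := by
          refine lintegral_mono' Measure.restrict_le_self fun z => ?_
          gcongr; exact ih z
      _ = _ := by
          rw [lintegral_heat_mul_heat hh (by positivity)]
          push_cast; congr 1; ring

/-- A finer grid imposes more constraints: dropping those at the new midpoints leaves the coarser
kernel. Hence the dyadic kernels decrease. -/
theorem gridKernel_refine (K : Set (Space d)) {h : ℝ} (hh : 0 < h) (n : ℕ) (x y : Space d) :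
    gridKernel K h (2 * n + 1) x y ≤ gridKernel K (2 * h) n x y := by
  have h1 : ∀ x y, gridKernel K h 1 x y ≤ heat (2 * h) (x - y) := fun x y => by
    refine (gridKernel_le_heat K hh 1 x y).trans_eq ?_
    norm_num [one_add_one_eq_two]
  induction n generalizing x with
  | zero => exact h1 x y
  | succ n ih =>
    rw [show 2 * (n + 1) + 1 = 1 + (2 * n + 1) + 1 by ring, gridKernel_add]
    simp only [gridKernel]
    exact lintegral_mono fun z => mul_le_mul' (h1 x z) (ih z)

/-- Transition density at time `t` of Brownian motion killed outside the closed set `K`. -/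
noncomputable def closedKernel (K : Set (Space d)) (t : ℝ) (x y : Space d) : ℝ≥0∞ :=
  ⨅ m : ℕ, gridKernel K (t / 2 ^ m) (2 ^ m - 1) x y

theorem antitone_gridKernel (K : Set (Space d)) {t : ℝ} (ht : 0 < t) (x y : Space d) :
    Antitone fun m : ℕ => gridKernel K (t / 2 ^ m) (2 ^ m - 1) x y := by
  refine antitone_nat_of_succ_le fun m => ?_
  have h := gridKernel_refine K (h := t / 2 ^ (m + 1)) (by positivity) (2 ^ m - 1) x y
  have e1 : 2 * (2 ^ m - 1) + 1 = 2 ^ (m + 1) - 1 := by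
    have := Nat.one_le_two_pow (n := m); rw [pow_succ]; omega
  have e2 : 2 * (t / 2 ^ (m + 1)) = t / 2 ^ m := by rw [pow_succ]; field_simp
  rwa [e1, e2] at h

@[fun_prop]
theorem Measurable.closedKernel {α : Type*} [MeasurableSpace α] {K : Set (Space d)}
    {f : α → ℝ} {g g' : α → Space d} (hf : Measurable f) (hg : Measurable g)
    (hg' : Measurable g') : Measurable (fun a => closedKernel K (f a) (g a) (g' a)) := by
  unfold _root_.closedKernel; fun_prop

theorem closedKernel_comm (K : Set (Space d)) (t : ℝ) (x y : Space d) :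
    closedKernel K t x y = closedKernel K t y x := by
  unfold closedKernel; simp_rw [gridKernel_comm K _ _ x y]

theorem closedKernel_le_heat (K : Set (Space d)) (t : ℝ) (x y : Space d) :
    closedKernel K t x y ≤ heat t (x - y) := by
  refine (iInf_le _ 0).trans ?_
  simp [gridKernel]

theorem closedKernel_mono {K L : Set (Space d)} (hKL : K ⊆ L) (t : ℝ) (x y : Space d) :
    closedKernel K t x y ≤ closedKernel L t x y :=
  iInf_mono fun _ => gridKernel_mono hKL _ _ x y

theorem tendsto_gridKernel (K : Set (Space d)) {t : ℝ} (ht : 0 < t) (x y : Space d) :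
    Filter.Tendsto (fun m : ℕ => gridKernel K (t / 2 ^ m) (2 ^ m - 1) x y) Filter.atTop
      (nhds (closedKernel K t x y)) :=
  tendsto_atTop_iInf (antitone_gridKernel K ht x y)

theorem gridKernel_dyadic_le_heat (K : Set (Space d)) {t : ℝ} (ht : 0 < t) (m : ℕ)
    (x y : Space d) : gridKernel K (t / 2 ^ m) (2 ^ m - 1) x y ≤ heat t (x - y) := by
  refine (antitone_gridKernel K ht x y (Nat.zero_le m)).trans ?_
  simp [gridKernel]

/-- The midpoint belongs to every dyadic grid but the coarsest, so the grid identity can be passed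
to the decreasing limit, with the heat kernels as dominating functions. Splitting at the midpoint is
all that the energy form requires. -/
theorem closedKernel_half (K : Set (Space d)) {t : ℝ} (ht : 0 < t) (x y : Space d) :
    closedKernel K t x y =
      ∫⁻ z in K, closedKernel K (t / 2) x z * closedKernel K (t / 2) z y := by
  have h2 : 0 < t / 2 := by positivity
  refine tendsto_nhds_unique ((tendsto_gridKernel K ht x y).comp (Filter.tendsto_add_atTop_nat 1)) ?_
  have e : ∀ m : ℕ, gridKernel K (t / 2 ^ (m + 1)) (2 ^ (m + 1) - 1) x y =
      ∫⁻ z in K, gridKernel K (t / 2 / 2 ^ m) (2 ^ m - 1) x z *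
        gridKernel K (t / 2 / 2 ^ m) (2 ^ m - 1) z y := by
    intro m
    rw [← gridKernel_add]
    congr 1
    · rw [pow_succ]; field_simp
    · have := Nat.one_le_two_pow (n := m); rw [pow_succ]; omega
  simp only [Function.comp_def, e]
  refine lintegral_tendsto_of_tendsto_of_antitone (fun m => by fun_prop) ?_ ?_ ?_
  · exact Filter.Eventually.of_forall fun z m n hmn =>
      mul_le_mul' (antitone_gridKernel K h2 x z hmn) (antitone_gridKernel K h2 z y hmn)
  · refine ((setLIntegral_le_lintegral K _).trans_lt (lt_of_le_of_lt (lintegral_mono fun z =>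
      mul_le_mul' (gridKernel_dyadic_le_heat K h2 0 x z) (gridKernel_dyadic_le_heat K h2 0 z y))
      ?_)).ne
    rw [lintegral_heat_mul_heat h2 h2]
    exact (heat_ne_top _ _).lt_top
  · refine Filter.Eventually.of_forall fun z => ?_
    exact ENNReal.Tendsto.mul (tendsto_gridKernel K h2 x z)
      (Or.inr ((closedKernel_le_heat K _ _ _).trans_lt (heat_ne_top _ _).lt_top).ne)
      (tendsto_gridKernel K h2 z y)
      (Or.inr ((closedKernel_le_heat K _ _ _).trans_lt (heat_ne_top _ _).lt_top).ne)

/-- Transition density of Brownian motion killed outside `K`, extended by `0` outside `K`. -/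
noncomputable def closedKernelZero (K : Set (Space d)) (t : ℝ) (x y : Space d) : ℝ≥0∞ :=
  -- The grids constrain the intermediate times only, so membership of the end points is imposed
  -- separately.
  K.indicator 1 x * K.indicator 1 y * closedKernel K t x y

/-- Transition density at time `t` of Brownian motion killed on leaving the open set `U`. -/
noncomputable def killedKernel (U : Set (Space d)) (t : ℝ) (x y : Space d) : ℝ≥0∞ :=
  ⨆ j : ℕ, closedKernelZero (exhaustion U j) t x y

theorem closedKernelZero_of_mem {K : Set (Space d)} {t : ℝ} {x y : Space d} (hx : x ∈ K)
    (hy : y ∈ K) : closedKernelZero K t x y = closedKernel K t x y := by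
  simp [closedKernelZero, hx, hy]

theorem closedKernelZero_of_notMem {K : Set (Space d)} {t : ℝ} {x y : Space d}
    (h : ¬ (x ∈ K ∧ y ∈ K)) : closedKernelZero K t x y = 0 := by
  by_cases hx : x ∈ K
  · have hy : y ∉ K := fun hy => h ⟨hx, hy⟩
    simp [closedKernelZero, hy]
  · simp [closedKernelZero, hx]

theorem measurable_closedKernelZero {K : Set (Space d)} (hK : IsClosed K) {α : Type*}
    [MeasurableSpace α] {f : α → ℝ} {g g' : α → Space d} (hf : Measurable f) (hg : Measurable g)
    (hg' : Measurable g') : Measurable (fun a => closedKernelZero K (f a) (g a) (g' a)) := by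
  have h1 : Measurable (K.indicator (1 : Space d → ℝ≥0∞)) :=
    measurable_one.indicator hK.measurableSet
  unfold closedKernelZero
  exact ((h1.comp hg).mul (h1.comp hg')).mul (by fun_prop)

@[fun_prop]
theorem Measurable.killedKernel {α : Type*} [MeasurableSpace α] {U : Set (Space d)}
    {f : α → ℝ} {g g' : α → Space d} (hf : Measurable f) (hg : Measurable g)
    (hg' : Measurable g') : Measurable (fun a => killedKernel U (f a) (g a) (g' a)) := by
  unfold _root_.killedKernel
  exact Measurable.iSup fun j => measurable_closedKernelZero (isClosed_exhaustion U j) hf hg hg'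

theorem closedKernelZero_comm (K : Set (Space d)) (t : ℝ) (x y : Space d) :
    closedKernelZero K t x y = closedKernelZero K t y x := by
  unfold closedKernelZero
  rw [closedKernel_comm, mul_comm (K.indicator 1 x)]

theorem killedKernel_comm (U : Set (Space d)) (t : ℝ) (x y : Space d) :
    killedKernel U t x y = killedKernel U t y x := by
  unfold killedKernel; simp_rw [closedKernelZero_comm _ t x y]

theorem closedKernelZero_mono {K L : Set (Space d)} (hKL : K ⊆ L) (t : ℝ) (x y : Space d) :
    closedKernelZero K t x y ≤ closedKernelZero L t x y := by
  unfold closedKernelZero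
  have h : ∀ z, K.indicator (1 : Space d → ℝ≥0∞) z ≤ L.indicator 1 z :=
    indicator_le_indicator_of_subset hKL fun _ => zero_le
  exact mul_le_mul' (mul_le_mul' (h x) (h y)) (closedKernel_mono hKL t x y)

theorem monotone_closedKernelZero_exhaustion (U : Set (Space d)) (t : ℝ) (x y : Space d) :
    Monotone fun j => closedKernelZero (exhaustion U j) t x y := fun _ _ hij =>
  closedKernelZero_mono (monotone_exhaustion U hij) t x y

theorem closedKernelZero_le_heat (K : Set (Space d)) (t : ℝ) (x y : Space d) :
    closedKernelZero K t x y ≤ heat t (x - y) := by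
  by_cases h : x ∈ K ∧ y ∈ K
  · rw [closedKernelZero_of_mem h.1 h.2]; exact closedKernel_le_heat K t x y
  · rw [closedKernelZero_of_notMem h]; exact zero_le

theorem killedKernel_le_heat (U : Set (Space d)) (t : ℝ) (x y : Space d) :
    killedKernel U t x y ≤ heat t (x - y) := iSup_le fun _ => closedKernelZero_le_heat _ t x y

theorem killedKernel_mono {U V : Set (Space d)} (h : U ⊆ V) (t : ℝ) (x y : Space d) :
    killedKernel U t x y ≤ killedKernel V t x y :=
  iSup_mono fun j => closedKernelZero_mono (exhaustion_mono h j) t x y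

theorem killedKernel_of_notMem {U : Set (Space d)} {t : ℝ} {x y : Space d}
    (h : ¬ (x ∈ U ∧ y ∈ U)) : killedKernel U t x y = 0 := by
  unfold killedKernel
  simp only [ENNReal.iSup_eq_zero]
  exact fun j => closedKernelZero_of_notMem fun hj =>
    h ⟨exhaustion_subset U j hj.1, exhaustion_subset U j hj.2⟩

theorem closedKernelZero_half {K : Set (Space d)} (hK : IsClosed K) {t : ℝ} (ht : 0 < t)
    (x y : Space d) : closedKernelZero K t x y =
      ∫⁻ z, closedKernelZero K (t / 2) x z * closedKernelZero K (t / 2) z y := by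
  unfold closedKernelZero
  rw [closedKernel_half K ht, ← lintegral_indicator hK.measurableSet,
    ← lintegral_const_mul _ (Measurable.indicator (by fun_prop) hK.measurableSet)]
  refine lintegral_congr fun z => ?_
  by_cases hz : z ∈ K
  · simp only [indicator_of_mem hz, Pi.one_apply]; ring
  · simp [indicator_of_notMem hz]

theorem killedKernel_half (U : Set (Space d)) {t : ℝ} (ht : 0 < t) (x y : Space d) :
    killedKernel U t x y = ∫⁻ z, killedKernel U (t / 2) x z * killedKernel U (t / 2) z y := by
  unfold killedKernel
  simp_rw [closedKernelZero_half (isClosed_exhaustion U _) ht x y]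
  rw [← lintegral_iSup]
  · refine lintegral_congr fun z => ?_
    have hfin : ∀ u v : Space d,
        ⨆ j, closedKernelZero (exhaustion U j) (t / 2) u v ≠ ∞ := fun u v =>
      ((killedKernel_le_heat U (t / 2) u v).trans_lt (heat_ne_top _ _).lt_top).ne
    refine tendsto_nhds_unique (tendsto_atTop_iSup fun i j hij => ?_)
      (ENNReal.Tendsto.mul
        (tendsto_atTop_iSup (monotone_closedKernelZero_exhaustion U (t / 2) x z))
        (Or.inr (hfin z y))
        (tendsto_atTop_iSup (monotone_closedKernelZero_exhaustion U (t / 2) z y))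
        (Or.inr (hfin x z)))
    exact mul_le_mul' (monotone_closedKernelZero_exhaustion U (t / 2) x z hij)
      (monotone_closedKernelZero_exhaustion U (t / 2) z y hij)
  · exact fun j => (measurable_closedKernelZero (isClosed_exhaustion U j) measurable_const
      measurable_const measurable_id).mul (measurable_closedKernelZero (isClosed_exhaustion U j)
      measurable_const measurable_id measurable_const)
  · exact fun i j hij z => mul_le_mul' (monotone_closedKernelZero_exhaustion U (t / 2) x z hij)
      (monotone_closedKernelZero_exhaustion U (t / 2) z y hij)

/-- A point of norm at most `j` is at distance at least `1` from the complement of the ball of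
radius `j + 1`, so the truncation costs nothing. This matches the killed kernels with the
truncations in the definition of `green`. -/
theorem exhaustion_subset_exhaustion_inter_ball (U : Set (Space d)) (j : ℕ) :
    exhaustion U j ⊆ exhaustion (U ∩ Metric.ball 0 ((j + 1 : ℕ) : ℝ)) j := by
  intro z hz
  refine ⟨Metric.le_infEDist.2 fun y hy => ?_, hz.2⟩
  by_cases hyU : y ∈ U
  · have h1 : y ∉ Metric.ball (0 : Space d) ((j + 1 : ℕ) : ℝ) := fun h => hy ⟨hyU, h⟩
    have h2 : ((j + 1 : ℕ) : ℝ) ≤ ‖y‖ := by simpa using h1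
    have h3 : ‖z‖ ≤ j := by simpa using hz.2
    have h4 : 1 ≤ dist z y := by
      rw [dist_comm, dist_eq_norm]
      have := norm_sub_norm_le y z
      push_cast at h2
      linarith
    calc ((j : ℝ≥0∞) + 1)⁻¹ ≤ 1 := ENNReal.inv_le_one.2 le_add_self
      _ ≤ edist z y := by
        rw [edist_dist, ← ENNReal.ofReal_one]; exact ENNReal.ofReal_le_ofReal h4
  · exact hz.1.trans (Metric.infEDist_le_edist_of_mem hyU)

theorem killedKernel_eq_iSup_inter_ball (U : Set (Space d)) (t : ℝ) (x y : Space d) :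
    killedKernel U t x y = ⨆ n : ℕ, killedKernel (U ∩ Metric.ball 0 (n : ℝ)) t x y := by
  refine le_antisymm (iSup_le fun j => ?_) (iSup_le fun n => killedKernel_mono inter_subset_left _ _ _)
  refine le_trans ?_ (le_iSup _ (j + 1))
  exact (closedKernelZero_mono (exhaustion_subset_exhaustion_inter_ball U j) t x y).trans
    (le_iSup (fun i => closedKernelZero (exhaustion (U ∩ Metric.ball 0 ((j + 1 : ℕ) : ℝ)) i) t x y) j)

end KilledKernel

/-! ### A version of the Brownian motion with continuous paths -/

section GoodVersion

variable {d : ℕ} {Ω' : Type*} [MeasurableSpace Ω'] {B : ℝ≥0 → Ω' → Space d} {Q : Measure Ω'}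

/-- A Brownian motion started from `0` all of whose paths are continuous. -/
structure IsContinuousBM (B : ℝ≥0 → Ω' → Space d) (Q : Measure Ω') : Prop extends
    IsBrownianMotion B Q where
  cont : ∀ ω, Continuous fun t => B t ω
  meas : ∀ t, Measurable (B t)
  zero : ∀ ω, B 0 ω = 0

/-- The path is replaced by `0` on a measurable null set containing all the bad paths. Off this set
the values at a dense sequence of times agree with measurable versions, and continuity gives
measurability at every other time. -/
theorem IsBrownianMotion.exists_continuous (hB : IsBrownianMotion B Q) :
    ∃ B' : ℝ≥0 → Ω' → Space d, IsContinuousBM B' Q ∧ ∀ᵐ ω ∂Q, ∀ t, B t ω = B' t ω := by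
  have hmeas : ∀ t, AEMeasurable (B t) Q := fun t => by
    have h1 : AEMeasurable (fun ω (i : Fin d) => B t ω i) Q :=
      aemeasurable_pi_lambda _ fun i => (hB.coord i).toIsPreBrownianReal.aemeasurable t
    exact (WithLp.measurable_toLp 2 (Fin d → ℝ)).comp_aemeasurable h1
  let q : ℕ → ℝ≥0 := TopologicalSpace.denseSeq ℝ≥0
  have h0 : ∀ᵐ ω ∂Q, (∀ i : Fin d, Continuous fun t => B t ω i) ∧ (∀ i : Fin d, B 0 ω i = 0) ∧
      ∀ n, B (q n) ω = (hmeas (q n)).mk _ ω := by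
    filter_upwards [ae_all_iff.2 fun i => (hB.coord i).cont,
      ae_all_iff.2 fun i => (hB.coord i).toIsPreBrownianReal.eval_zero_ae_eq_zero,
      ae_all_iff.2 fun n => (hmeas (q n)).ae_eq_mk] with ω h1 h2 h3 using ⟨h1, h2, h3⟩
  obtain ⟨N, hN, hNm, hNQ⟩ := exists_measurable_superset_of_null (ae_iff.1 h0)
  have hgood : ∀ ω ∉ N, (∀ i : Fin d, Continuous fun t => B t ω i) ∧ (∀ i : Fin d, B 0 ω i = 0) ∧
      ∀ n, B (q n) ω = (hmeas (q n)).mk _ ω := fun ω hω => by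
    by_contra h
    exact hω (hN h)
  classical
  let B' : ℝ≥0 → Ω' → Space d := fun t ω => if ω ∈ N then 0 else B t ω
  have hae : ∀ᵐ ω ∂Q, ∀ t, B t ω = B' t ω := by
    filter_upwards [measure_eq_zero_iff_ae_notMem.1 hNQ] with ω hω t
    simp [B', hω]
  have hcont : ∀ ω, Continuous fun t => B' t ω := by
    intro ω
    by_cases hω : ω ∈ N
    · simpa [B', hω] using continuous_const
    · simp only [B', hω, if_false]
      exact (PiLp.continuous_toLp 2 _).comp (continuous_pi (hgood ω hω).1)
  have hmq : ∀ n, Measurable (B' (q n)) := fun n => by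
    have : B' (q n) = fun ω => if ω ∈ N then 0 else (hmeas (q n)).mk _ ω := by
      ext1 ω
      by_cases hω : ω ∈ N
      · simp [B', hω]
      · simp only [B', hω, if_false]; exact (hgood ω hω).2.2 n
    rw [this]
    exact Measurable.ite hNm measurable_const (hmeas (q n)).measurable_mk
  refine ⟨B', ⟨⟨fun i => ⟨?_, ?_⟩, ?_⟩, hcont, fun t => ?_, fun ω => ?_⟩, hae⟩
  · refine (hB.coord i).toIsPreBrownianReal.congr fun t => ?_
    filter_upwards [hae] with ω h
    rw [h]
  · exact Filter.Eventually.of_forall fun ω =>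
      (EuclideanSpace.proj (𝕜 := ℝ) i).continuous.comp (hcont ω)
  · refine hB.indep.congr fun i => ?_
    filter_upwards [hae] with ω h
    ext t
    rw [h]
  · have ht : t ∈ closure (range q) := by
      rw [(TopologicalSpace.denseRange_denseSeq ℝ≥0).closure_eq]; trivial
    obtain ⟨u, hu, hut⟩ := mem_closure_iff_seq_limit.1 ht
    refine measurable_of_tendsto_metrizable (f := fun n => B' (u n)) (fun n => ?_) ?_
    · obtain ⟨k, hk⟩ := hu n
      rw [← hk]; exact hmq k
    · rw [tendsto_pi_nhds]
      exact fun ω => ((hcont ω).tendsto t).comp hut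
  · by_cases hω : ω ∈ N
    · simp [B', hω]
    · simp only [B', hω, if_false]
      ext i
      exact (hgood ω hω).2.1 i

theorem harmonicMeasure_congr {B' : ℝ≥0 → Ω' → Space d} (h : ∀ᵐ ω ∂Q, ∀ t, B t ω = B' t ω)
    (U : Set (Space d)) : harmonicMeasure B Q U = harmonicMeasure B' Q U := by
  funext x
  unfold harmonicMeasure
  have h1 : {ω | ∃ t : ℝ≥0, x + B t ω ∉ U} =ᵐ[Q] {ω | ∃ t : ℝ≥0, x + B' t ω ∉ U} := by
    filter_upwards [h] with ω hω
    exact propext ⟨fun ⟨t, ht⟩ => ⟨t, by rwa [← hω]⟩, fun ⟨t, ht⟩ => ⟨t, by rwa [hω]⟩⟩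
  rw [Measure.restrict_congr_set h1]
  refine Measure.map_congr (ae_restrict_of_ae ?_)
  filter_upwards [h] with ω hω
  simp only [exitTime, hω]

theorem HasRegularBoundary.congr {B' : ℝ≥0 → Ω' → Space d} (h : ∀ᵐ ω ∂Q, ∀ t, B t ω = B' t ω)
    {U : Set (Space d)} (hU : HasRegularBoundary B Q U) : HasRegularBoundary B' Q U := by
  intro z hz
  filter_upwards [h, hU z hz] with ω hω h1 ε hε
  obtain ⟨t, h2⟩ := h1 ε hε
  exact ⟨t, by rwa [hω] at h2⟩

end GoodVersion

/-! ### The Gaussian law of an increment -/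

section GaussianDensity

variable {d : ℕ}

theorem prod_gaussianPDFReal (h : ℝ≥0) (z : Space d) :
    ∏ i, gaussianPDFReal 0 h (z i) = heatReal h z := by
  unfold gaussianPDFReal heatReal
  rw [Finset.prod_mul_distrib, Finset.prod_const, Finset.card_univ, Fintype.card_fin,
    ← Real.exp_sum, EuclideanSpace.norm_sq_eq, ← Finset.sum_div, Finset.sum_neg_distrib]
  simp

theorem pi_gaussianReal_map (h : ℝ≥0) (hh : h ≠ 0) :
    (Measure.pi fun _ : Fin d => gaussianReal 0 h).map (WithLp.toLp 2) =
      (volume : Measure (Space d)).withDensity (heat h) := by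
  have h1 : (Measure.pi fun _ : Fin d => gaussianReal 0 h) =
      (volume : Measure (Fin d → ℝ)).withDensity (fun z => heat h (WithLp.toLp 2 z)) := by
    refine Measure.pi_eq fun s hs => ?_
    rw [withDensity_apply _ (MeasurableSet.univ_pi hs)]
    have hint : ∀ i, Integrable ((s i).indicator (gaussianPDFReal 0 h)) := fun i =>
      (integrable_gaussianPDFReal 0 h).indicator (hs i)
    have e1 : ∀ i, gaussianReal 0 h (s i) =
        ENNReal.ofReal (∫ x, (s i).indicator (gaussianPDFReal 0 h) x) := fun i => by
      rw [gaussianReal_apply_eq_integral 0 hh, integral_indicator (hs i)]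
    simp_rw [e1]
    rw [← ENNReal.ofReal_prod_of_nonneg (fun i _ => integral_nonneg fun x =>
      indicator_nonneg (fun y _ => gaussianPDFReal_nonneg 0 h y) x),
      ← integral_fintype_prod_eq_prod (fun i => (s i).indicator (gaussianPDFReal 0 h)),
      ← lintegral_indicator (MeasurableSet.univ_pi hs), ofReal_integral_eq_lintegral_ofReal]
    · refine lintegral_congr fun z => ?_
      by_cases hz : z ∈ univ.pi s
      · rw [indicator_of_mem hz]
        unfold heat
        rw [← prod_gaussianPDFReal]
        congr 1
        exact Finset.prod_congr rfl fun i _ => (indicator_of_mem (hz i trivial) _).symm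
      · rw [indicator_of_notMem hz]
        simp only [mem_univ_pi, not_forall] at hz
        obtain ⟨i, hi⟩ := hz
        rw [Finset.prod_eq_zero (Finset.mem_univ i) (indicator_of_notMem hi _), ENNReal.ofReal_zero]
    · exact Integrable.fintype_prod hint
    · exact Filter.Eventually.of_forall fun z => Finset.prod_nonneg fun i _ =>
        indicator_nonneg (fun y _ => gaussianPDFReal_nonneg 0 h y) _
  rw [h1]
  ext s hs
  rw [Measure.map_apply (by fun_prop) hs, withDensity_apply _ (by measurability),
    withDensity_apply _ hs,
    (PiLp.volume_preserving_toLp (Fin d)).setLIntegral_comp_preimage hs (f := heat h)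
      (by fun_prop)]

end GaussianDensity

/-! ### The simple Markov property -/

section Markov

variable {d : ℕ} {Ω' : Type*} [MeasurableSpace Ω'] {B : ℝ≥0 → Ω' → Space d} {Q : Measure Ω'}

/-- The events that depend on the path up to time `r` only. -/
@[reducible] def pastSigma (B : ℝ≥0 → Ω' → Space d) (r : ℝ≥0) : MeasurableSpace Ω' :=
  MeasurableSpace.comap (fun ω (s : Iic r) => B s ω) inferInstance

theorem measurable_pastSigma (B : ℝ≥0 → Ω' → Space d) {s r : ℝ≥0} (hs : s ≤ r) :
    Measurable[pastSigma B r] (B s) :=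
  (measurable_pi_apply (⟨s, hs⟩ : Iic r)).comp
    (comap_measurable fun ω (s : Iic r) => B s ω)

theorem pastSigma_mono (B : ℝ≥0 → Ω' → Space d) {s r : ℝ≥0} (hs : s ≤ r) :
    pastSigma B s ≤ pastSigma B r := by
  refine Measurable.comap_le ?_
  refine @measurable_pi_lambda _ _ _ (pastSigma B r) _ _ fun u => ?_
  exact measurable_pastSigma B (u.2.trans hs)

theorem IsContinuousBM.pastSigma_le (hB : IsContinuousBM B Q) (r : ℝ≥0) :
    pastSigma B r ≤ (inferInstance : MeasurableSpace Ω') :=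
  Measurable.comap_le (measurable_pi_lambda _ fun u => hB.meas u)

theorem IsContinuousBM.meas_coord (hB : IsContinuousBM B Q) (t : ℝ≥0) (i : Fin d) :
    Measurable fun ω => B t ω i :=
  (EuclideanSpace.proj (𝕜 := ℝ) i).measurable.comp (hB.meas t)

/-- In each coordinate the increment is independent of the past, and the coordinates are independent
of each other. The joint law is thus a product over coordinates of products, and regrouping the
factors separates the vector of increments from the vector of pasts. -/
theorem IsContinuousBM.indepFun_increment [IsProbabilityMeasure Q] (hB : IsContinuousBM B Q)
    (r h : ℝ≥0) : IndepFun (fun ω => B (r + h) ω - B r ω) (fun ω (s : Iic r) => B s ω) Q := by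
  let I : Fin d → Ω' → ℝ := fun i ω => B (r + h) ω i - B r ω i
  let P : Fin d → Ω' → (Iic r → ℝ) := fun i ω s => B s ω i
  have hI : ∀ i, Measurable (I i) := fun i => (hB.meas_coord _ i).sub (hB.meas_coord _ i)
  have hP : ∀ i, Measurable (P i) := fun i => measurable_pi_lambda _ fun s => hB.meas_coord _ i
  have hIP : ∀ i, Q.map (fun ω => (I i ω, P i ω)) = (Q.map (I i)).prod (Q.map (P i)) := fun i => by
    refine (indepFun_iff_map_prod_eq_prod_map_map (hI i).aemeasurable (hP i).aemeasurable).1 ?_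
    exact ((hB.coord i).toIsPreBrownianReal.indepFun_shift r).comp
      (φ := fun p : ℝ≥0 → ℝ => p h) (ψ := id) (measurable_pi_apply h) measurable_id
  have hX : Q.map (fun ω i => (I i ω, P i ω)) =
      Measure.pi fun i => (Q.map (I i)).prod (Q.map (P i)) := by
    simp_rw [← hIP]
    refine (iIndepFun_iff_map_fun_eq_pi_map
      (fun i => ((hI i).prodMk (hP i)).aemeasurable)).1 ?_
    exact hB.indep.comp (fun _ (p : ℝ≥0 → ℝ) => (p (r + h) - p r, fun s : Iic r => p s))
      (fun _ => by fun_prop)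
  have hprob1 : ∀ i, IsProbabilityMeasure (Q.map (I i)) := fun i =>
    Measure.isProbabilityMeasure_map (hI i).aemeasurable
  have hprob2 : ∀ i, IsProbabilityMeasure (Q.map (P i)) := fun i =>
    Measure.isProbabilityMeasure_map (hP i).aemeasurable
  have hmp := (measurePreserving_arrowProdEquivProdArrow ℝ (Iic r → ℝ) (Fin d)
    (fun i => Q.map (I i)) (fun i => Q.map (P i))).map_eq
  rw [← hX, Measure.map_map (MeasurableEquiv.measurable _)
    (measurable_pi_lambda _ fun i => (hI i).prodMk (hP i))] at hmp
  have hm1 : Measurable fun ω i => I i ω := measurable_pi_lambda _ hI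
  have hm2 : Measurable fun ω i => P i ω := measurable_pi_lambda _ hP
  have hmp' : Q.map (fun ω => ((fun i => I i ω), (fun i => P i ω))) =
      (Measure.pi fun i => Q.map (I i)).prod (Measure.pi fun i => Q.map (P i)) := hmp
  have hfst : Q.map (fun ω i => I i ω) = Measure.pi fun i => Q.map (I i) := by
    have := congrArg (Measure.map Prod.fst) hmp'
    rwa [Measure.map_map measurable_fst (hm1.prodMk hm2), Measure.map_fst_prod, measure_univ,
      one_smul] at this
  have hsnd : Q.map (fun ω i => P i ω) = Measure.pi fun i => Q.map (P i) := by
    have := congrArg (Measure.map Prod.snd) hmp'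
    rwa [Measure.map_map measurable_snd (hm1.prodMk hm2), Measure.map_snd_prod, measure_univ,
      one_smul] at this
  rw [← hfst, ← hsnd] at hmp'
  have hind : IndepFun (fun ω i => I i ω) (fun ω i => P i ω) Q :=
    (indepFun_iff_map_prod_eq_prod_map_map hm1.aemeasurable hm2.aemeasurable).2 hmp'
  exact hind.comp (φ := fun v => (WithLp.toLp 2 v : Space d))
    (ψ := fun p (s : Iic r) => (WithLp.toLp 2 fun i => p i s : Space d))
    (by fun_prop) (by fun_prop)

theorem IsContinuousBM.map_increment [IsProbabilityMeasure Q] (hB : IsContinuousBM B Q)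
    (r : ℝ≥0) {h : ℝ≥0} (hh : h ≠ 0) : Q.map (fun ω => B (r + h) ω - B r ω) =
      (volume : Measure (Space d)).withDensity (heat h) := by
  let I : Fin d → Ω' → ℝ := fun i ω => B (r + h) ω i - B r ω i
  have hI : ∀ i, Measurable (I i) := fun i => (hB.meas_coord _ i).sub (hB.meas_coord _ i)
  have h1 : Q.map (fun ω i => I i ω) = Measure.pi fun i => Q.map (I i) := by
    refine (iIndepFun_iff_map_fun_eq_pi_map (fun i => (hI i).aemeasurable)).1 ?_
    exact hB.indep.comp (fun _ (p : ℝ≥0 → ℝ) => p (r + h) - p r) (fun _ => by fun_prop)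
  have h2 : ∀ i, Q.map (I i) = gaussianReal 0 h := fun i => by
    have := ((hB.coord i).toIsPreBrownianReal.hasLaw_sub (r + h) r).map_eq
    have e : nndist ((r + h : ℝ≥0) : ℝ) (r : ℝ) = h := by
      rw [← NNReal.coe_inj, coe_nndist, Real.dist_eq]
      simp
    exact this.trans (congrArg _ e)
  simp_rw [h2] at h1
  rw [← pi_gaussianReal_map h hh, ← h1, Measure.map_map (by fun_prop) (measurable_pi_lambda _ hI)]
  rfl

/-- The simple Markov property. -/
theorem IsContinuousBM.lintegral_markov [IsProbabilityMeasure Q] (hB : IsContinuousBM B Q)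
    (r : ℝ≥0) {h : ℝ≥0} (hh : h ≠ 0) {Φ : Ω' → ℝ≥0∞} (hΦ : Measurable[pastSigma B r] Φ)
    {f : Space d → ℝ≥0∞} (hf : Measurable f) (x : Space d) :
    ∫⁻ ω, Φ ω * f (x + B (r + h) ω) ∂Q =
      ∫⁻ ω, Φ ω * (∫⁻ z, heat h (x + B r ω - z) * f z) ∂Q := by
  have hΦm : Measurable Φ := hΦ.mono (hB.pastSigma_le r) le_rfl
  have hinc : Measurable fun ω => B (r + h) ω - B r ω := (hB.meas _).sub (hB.meas _)
  have hind : IndepFun (fun ω => (Φ ω, B r ω)) (fun ω => B (r + h) ω - B r ω) Q := by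
    have h1 := (hB.indepFun_increment r h).symm
    have h2 : Measurable[pastSigma B r] fun ω => (Φ ω, B r ω) :=
      Measurable.prodMk hΦ (measurable_pastSigma B le_rfl)
    -- A variable measurable for the past is a measurable function of the past path, so it inherits
    -- the independence from the increment.
    obtain ⟨g, hg, hge⟩ := h2.exists_eq_measurable_comp
    rw [hge]
    exact h1.comp hg measurable_id
  have hmap := (indepFun_iff_map_prod_eq_prod_map_map
    (hΦm.prodMk (hB.meas r)).aemeasurable hinc.aemeasurable).1 hind
  rw [hB.map_increment r hh] at hmap
  let F : (ℝ≥0∞ × Space d) × Space d → ℝ≥0∞ := fun q => q.1.1 * f (x + q.1.2 + q.2)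
  have hF : Measurable F := by
    refine measurable_fst.fst.mul (hf.comp ?_)
    fun_prop
  have hsf : SFinite ((volume : Measure (Space d)).withDensity (heat h)) := by
    infer_instance
  calc ∫⁻ ω, Φ ω * f (x + B (r + h) ω) ∂Q
      = ∫⁻ ω, F ((Φ ω, B r ω), B (r + h) ω - B r ω) ∂Q := by
        refine lintegral_congr fun ω => ?_
        simp only [F]
        congr 2; abel
    _ = ∫⁻ q, F q ∂(Q.map fun ω => ((Φ ω, B r ω), B (r + h) ω - B r ω)) :=
        (lintegral_map hF ((hΦm.prodMk (hB.meas r)).prodMk hinc)).symm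
    _ = ∫⁻ p, ∫⁻ z, F (p, z) ∂((volume : Measure (Space d)).withDensity (heat h))
          ∂(Q.map fun ω => (Φ ω, B r ω)) := by
        rw [hmap, lintegral_prod _ hF.aemeasurable]
    _ = ∫⁻ ω, ∫⁻ z, F ((Φ ω, B r ω), z) ∂((volume : Measure (Space d)).withDensity (heat h)) ∂Q :=
        lintegral_map hF.lintegral_prod_right' (hΦm.prodMk (hB.meas r))
    _ = _ := by
        refine lintegral_congr fun ω => ?_
        have hfm : Measurable fun z => f (x + B r ω + z) := hf.comp (by fun_prop)
        rw [lintegral_withDensity_eq_lintegral_mul _ (by fun_prop) (by simp only [F]; fun_prop)]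
        simp only [F, Pi.mul_apply]
        rw [← lintegral_const_mul _ (by fun_prop),
          ← lintegral_add_left_eq_self (fun z => Φ ω * (heat h (x + B r ω - z) * f z)) (x + B r ω)]
        refine lintegral_congr fun z => ?_
        rw [heat_sub_comm, add_sub_cancel_left]
        ring

end Markov

/-! ### The killed kernel as the law of the surviving path -/

section Survival

variable {d : ℕ} {Ω' : Type*} [MeasurableSpace Ω'] {B : ℝ≥0 → Ω' → Space d} {Q : Measure Ω'}

theorem IsContinuousBM.cont_add (hB : IsContinuousBM B Q) (x : Space d) (ω : Ω') :
    Continuous fun s => x + B s ω := continuous_const.add (hB.cont ω)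

/-- The event that the Brownian motion started from `x` stays in `U` during `[a, b]`. -/
def aliveOn (B : ℝ≥0 → Ω' → Space d) (U : Set (Space d)) (a b : ℝ≥0) (x : Space d) : Set Ω' :=
  {ω | ∀ s ∈ Icc a b, x + B s ω ∈ U}

theorem aliveOn_mono (B : ℝ≥0 → Ω' → Space d) {U V : Set (Space d)} (hUV : U ⊆ V) (a b : ℝ≥0)
    (x : Space d) : aliveOn B U a b x ⊆ aliveOn B V a b x := fun _ h s hs => hUV (h s hs)

/-- For a continuous path and a closed set a dense set of times decides. The map `q ↦ a + min q 1 *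
(b - a)` sends `ℝ≥0` onto `[a, b]` continuously, so one dense sequence serves all intervals,
including the degenerate ones. -/
theorem IsContinuousBM.mem_aliveOn_iff_of_isClosed (hB : IsContinuousBM B Q) {K : Set (Space d)}
    (hK : IsClosed K) {a b : ℝ≥0} (hab : a ≤ b) (x : Space d) (ω : Ω') :
    ω ∈ aliveOn B K a b x ↔ ∀ n, x + B (a + min (TopologicalSpace.denseSeq ℝ≥0 n) 1 * (b - a)) ω
      ∈ K := by
  constructor
  · intro h n
    refine h _ ⟨le_self_add, ?_⟩
    calc a + min (TopologicalSpace.denseSeq ℝ≥0 n) 1 * (b - a) ≤ a + 1 * (b - a) := by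
          gcongr; exact min_le_right _ _
      _ = b := by rw [one_mul, add_tsub_cancel_of_le hab]
  · intro h s hs
    have hc : Continuous fun q : ℝ≥0 => x + B (a + min q 1 * (b - a)) ω :=
      (hB.cont_add x ω).comp (by fun_prop)
    have hcl : IsClosed {q : ℝ≥0 | x + B (a + min q 1 * (b - a)) ω ∈ K} := hK.preimage hc
    have huniv : ∀ q : ℝ≥0, x + B (a + min q 1 * (b - a)) ω ∈ K := by
      have h1 : closure (range (TopologicalSpace.denseSeq ℝ≥0)) ⊆
          {q : ℝ≥0 | x + B (a + min q 1 * (b - a)) ω ∈ K} :=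
        hcl.closure_subset_iff.2 (by rintro _ ⟨n, rfl⟩; exact h n)
      intro q
      refine h1 ?_
      rw [(TopologicalSpace.denseRange_denseSeq ℝ≥0).closure_eq]
      trivial
    rcases hab.eq_or_lt with rfl | hlt
    · have : s = a := le_antisymm hs.2 hs.1
      simpa [this] using huniv 0
    · have hpos : 0 < b - a := tsub_pos_of_lt hlt
      have h2 := huniv ((s - a) / (b - a))
      have h3 : (s - a) / (b - a) ≤ 1 := div_le_one_of_le₀ (tsub_le_tsub_right hs.2 a) zero_le
      rwa [min_eq_left h3, div_mul_cancel₀ _ hpos.ne', add_tsub_cancel_of_le hs.1] at h2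

/-- The path over `[a, b]` is a compact set, so it lies in a single member of the exhaustion. -/
theorem IsContinuousBM.aliveOn_eq_iUnion (hB : IsContinuousBM B Q) {U : Set (Space d)}
    (hU : IsOpen U) (a b : ℝ≥0) (x : Space d) :
    aliveOn B U a b x = ⋃ j, aliveOn B (exhaustion U j) a b x := by
  refine subset_antisymm (fun ω hω => ?_) (iUnion_subset fun j =>
    aliveOn_mono B (exhaustion_subset U j) a b x)
  obtain ⟨j, hj⟩ := exists_subset_exhaustion hU
    ((isCompact_Icc (a := a) (b := b)).image (hB.cont_add x ω)) (by
      rintro _ ⟨s, hs, rfl⟩; exact hω s hs)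
  exact mem_iUnion.2 ⟨j, fun s hs => hj ⟨s, hs, rfl⟩⟩

theorem IsContinuousBM.measurableSet_aliveOn_prod (hB : IsContinuousBM B Q) {U : Set (Space d)}
    (hU : IsOpen U) {a b : ℝ≥0} (hab : a ≤ b) :
    MeasurableSet {q : Space d × Ω' | q.2 ∈ aliveOn B U a b q.1} := by
  have h1 : {q : Space d × Ω' | q.2 ∈ aliveOn B U a b q.1} = ⋃ j, ⋂ n,
      {q | q.1 + B (a + min (TopologicalSpace.denseSeq ℝ≥0 n) 1 * (b - a)) q.2
        ∈ exhaustion U j} := by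
    ext q
    rw [mem_ofPred_eq, hB.aliveOn_eq_iUnion hU]
    simp only [mem_iUnion, mem_iInter, mem_ofPred_eq,
      hB.mem_aliveOn_iff_of_isClosed (isClosed_exhaustion U _) hab]
  rw [h1]
  refine MeasurableSet.iUnion fun j => MeasurableSet.iInter fun n => ?_
  exact (measurable_fst.add ((hB.meas _).comp measurable_snd))
    (isClosed_exhaustion U j).measurableSet

theorem IsContinuousBM.measurableSet_aliveOn_closed (hB : IsContinuousBM B Q) {K : Set (Space d)}
    (hK : IsClosed K) {a b : ℝ≥0} (hab : a ≤ b) (x : Space d) :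
    MeasurableSet[pastSigma B b] (aliveOn B K a b x) := by
  have h1 : aliveOn B K a b x = ⋂ n,
      {ω | x + B (a + min (TopologicalSpace.denseSeq ℝ≥0 n) 1 * (b - a)) ω ∈ K} := by
    ext ω
    simp only [hB.mem_aliveOn_iff_of_isClosed hK hab, mem_iInter, mem_ofPred_eq]
  rw [h1]
  refine MeasurableSet.iInter fun n => ?_
  have h2 : a + min (TopologicalSpace.denseSeq ℝ≥0 n) 1 * (b - a) ≤ b := by
    calc a + min (TopologicalSpace.denseSeq ℝ≥0 n) 1 * (b - a) ≤ a + 1 * (b - a) := by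
          gcongr; exact min_le_right _ _
      _ = b := by rw [one_mul, add_tsub_cancel_of_le hab]
  exact (measurable_pastSigma B h2).const_add x hK.measurableSet

theorem IsContinuousBM.measurableSet_aliveOn_pastSigma (hB : IsContinuousBM B Q)
    {U : Set (Space d)} (hU : IsOpen U) {a b : ℝ≥0} (hab : a ≤ b) (x : Space d) :
    MeasurableSet[pastSigma B b] (aliveOn B U a b x) := by
  rw [hB.aliveOn_eq_iUnion hU]
  exact MeasurableSet.iUnion fun j =>
    hB.measurableSet_aliveOn_closed (isClosed_exhaustion U j) hab x

theorem IsContinuousBM.measurableSet_aliveOn (hB : IsContinuousBM B Q)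
    {U : Set (Space d)} (hU : IsOpen U) {a b : ℝ≥0} (hab : a ≤ b) (x : Space d) :
    MeasurableSet (aliveOn B U a b x) :=
  hB.pastSigma_le b _ (hB.measurableSet_aliveOn_pastSigma hU hab x)

/-- Induction with the Markov property at the first grid time. The past weight `Φ` is kept arbitrary
so that it can absorb the indicator at that time. -/
theorem IsContinuousBM.lintegral_grid [IsProbabilityMeasure Q] (hB : IsContinuousBM B Q)
    {K : Set (Space d)} (hK : MeasurableSet K) {h : ℝ≥0} (hh : h ≠ 0) (n : ℕ) (r : ℝ≥0)
    {Φ : Ω' → ℝ≥0∞} (hΦ : Measurable[pastSigma B r] Φ) {φ : Space d → ℝ≥0∞} (hφ : Measurable φ)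
    (x : Space d) :
    ∫⁻ ω, Φ ω * ((∏ k ∈ Finset.range n, K.indicator 1 (x + B (r + (k + 1) * h) ω)) *
        φ (x + B (r + (n + 1) * h) ω)) ∂Q =
      ∫⁻ ω, Φ ω * (∫⁻ y, gridKernel K h n (x + B r ω) y * φ y) ∂Q := by
  induction n generalizing r Φ with
  | zero =>
    simp only [Finset.range_zero, Finset.prod_empty, one_mul, gridKernel, Nat.cast_zero, zero_add]
    exact hB.lintegral_markov r hh hΦ hφ x
  | succ n ih =>
    have hΦ' : Measurable[pastSigma B (r + h)]
        fun ω => Φ ω * K.indicator 1 (x + B (r + h) ω) := by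
      refine Measurable.mul (hΦ.mono (pastSigma_mono B le_self_add) le_rfl) ?_
      exact (measurable_one.indicator hK).comp ((measurable_pastSigma B le_rfl).const_add x)
    have h1 := ih (r + h) hΦ'
    have e1 : ∀ k : ℕ, r + h + (k + 1) * h = r + (((k + 1 : ℕ) : ℝ≥0) + 1) * h := fun k => by
      push_cast; ring
    simp only [e1] at h1
    calc _ = ∫⁻ ω, Φ ω * K.indicator 1 (x + B (r + h) ω) *
          ((∏ k ∈ Finset.range n, K.indicator 1 (x + B (r + (((k + 1 : ℕ) : ℝ≥0) + 1) * h) ω)) *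
            φ (x + B (r + (((n + 1 : ℕ) : ℝ≥0) + 1) * h) ω)) ∂Q := by
          refine lintegral_congr fun ω => ?_
          rw [Finset.prod_range_succ']
          simp only [Nat.cast_zero, zero_add, one_mul]
          ring
      _ = ∫⁻ ω, Φ ω * (K.indicator 1 (x + B (r + h) ω) *
            ∫⁻ y, gridKernel K h n (x + B (r + h) ω) y * φ y) ∂Q := by
          rw [h1]; simp_rw [mul_assoc]
      _ = ∫⁻ ω, Φ ω * (∫⁻ z, heat h (x + B r ω - z) *
            (K.indicator 1 z * ∫⁻ y, gridKernel K h n z y * φ y)) ∂Q := by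
          refine hB.lintegral_markov r hh hΦ (f := fun z =>
            K.indicator 1 z * ∫⁻ y, gridKernel K h n z y * φ y) ?_ x
          refine (measurable_one.indicator hK).mul ?_
          exact Measurable.lintegral_prod_right' (f := fun q : Space d × Space d =>
            gridKernel K h n q.1 q.2 * φ q.2) (by fun_prop)
      _ = _ := by
          refine lintegral_congr fun ω => ?_
          congr 1
          simp only [gridKernel]
          calc _ = ∫⁻ z in K, ∫⁻ y, heat h (x + B r ω - z) * gridKernel K h n z y * φ y := by
                rw [← lintegral_indicator hK]
                refine lintegral_congr fun z => ?_
                by_cases hz : z ∈ K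
                · simp only [indicator_of_mem hz, Pi.one_apply, one_mul]
                  rw [← lintegral_const_mul _ (by fun_prop)]
                  simp_rw [mul_assoc]
                · simp [indicator_of_notMem hz]
            _ = ∫⁻ y, ∫⁻ z in K, heat h (x + B r ω - z) * gridKernel K h n z y * φ y :=
                lintegral_lintegral_swap (by fun_prop)
            _ = _ := by
                refine lintegral_congr fun y => ?_
                rw [lintegral_mul_const _ (by fun_prop)]

/-- A path that leaves the closed set `K` after time `r` and before time `r + t` is outside `K` at
arbitrarily close later dyadic times. -/
theorem exists_dyadic_notMem {X : ℝ≥0 → Space d} (hX : Continuous X) {K : Set (Space d)}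
    (hK : IsClosed K) {r t s u : ℝ≥0} (hs : X (r + s) ∉ K) (hst : s < t) (hu : s < u) :
    ∀ᶠ m : ℕ in Filter.atTop, ∃ k : ℕ, k < 2 ^ m - 1 ∧
      X (r + (k + 1) * (t / 2 ^ m)) ∉ K ∧ (k + 1) * (t / 2 ^ m) < u := by
  have ht : 0 < t := zero_le.trans_lt hst
  have hcont : Continuous fun v => X (r + v) := hX.comp (by fun_prop)
  have hnhds : ∀ᶠ v in nhds s, X (r + v) ∉ K ∧ v < t ∧ v < u :=
    ((hcont.tendsto s).eventually (hK.isOpen_compl.mem_nhds hs)).and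
      ((eventually_lt_nhds hst).and (eventually_lt_nhds hu))
  have hh : Filter.Tendsto (fun m : ℕ => t / 2 ^ m) Filter.atTop (nhds 0) := by
    have := (tendsto_inv_atTop_zero (𝕜 := ℝ≥0)).comp
      (tendsto_pow_atTop_atTop_of_one_lt (r := (2 : ℝ≥0)) one_lt_two)
    simpa [div_eq_mul_inv] using this.const_mul t
  have hv : Filter.Tendsto (fun m : ℕ => ((⌊s / (t / 2 ^ m)⌋₊ : ℝ≥0) + 1) * (t / 2 ^ m))
      Filter.atTop (nhds s) := by
    refine tendsto_of_tendsto_of_tendsto_of_le_of_le tendsto_const_nhds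
      (by simpa using hh.const_add s) (fun m => ?_) (fun m => ?_)
    · have hpos : 0 < t / 2 ^ m := by positivity
      have h1 := (Nat.lt_floor_add_one (s / (t / 2 ^ m))).le
      rwa [div_le_iff₀ hpos] at h1
    · have hpos : 0 < t / 2 ^ m := by positivity
      have h1 := Nat.floor_le (a := s / (t / 2 ^ m)) zero_le
      rw [le_div_iff₀ hpos] at h1
      rw [add_mul, one_mul]
      gcongr
  filter_upwards [hv.eventually hnhds] with m hm
  refine ⟨⌊s / (t / 2 ^ m)⌋₊, ?_, hm.1, hm.2.2⟩
  have h1 := hm.2.1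
  rw [mul_div_assoc', div_lt_iff₀ (by positivity), mul_comm, mul_lt_mul_iff_right₀ ht] at h1
  have h2 : ⌊s / (t / 2 ^ m)⌋₊ + 1 < 2 ^ m := by exact_mod_cast h1
  omega

theorem dyadic_last_eq (t : ℝ≥0) (m : ℕ) : (((2 ^ m - 1 : ℕ) : ℝ≥0) + 1) * (t / 2 ^ m) = t := by
  have h1 : (((2 ^ m - 1 : ℕ) : ℝ≥0) + 1) = 2 ^ m := by
    exact_mod_cast Nat.sub_add_cancel (Nat.one_le_two_pow (n := m))
  rw [h1]
  field_simp

theorem IsContinuousBM.tendsto_prod_indicator (hB : IsContinuousBM B Q) {K : Set (Space d)}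
    (hK : IsClosed K) (r : ℝ≥0) {t : ℝ≥0} (ht : t ≠ 0) (x : Space d) (ω : Ω') :
    Filter.Tendsto (fun m : ℕ => (∏ k ∈ Finset.range (2 ^ m - 1),
        K.indicator (1 : Space d → ℝ≥0∞) (x + B (r + (k + 1) * (t / 2 ^ m)) ω)))
      Filter.atTop (nhds ((aliveOn B K r (r + t) x).indicator 1 ω)) := by
  by_cases hω : ω ∈ aliveOn B K r (r + t) x
  · rw [indicator_of_mem hω]
    refine tendsto_const_nhds.congr fun m => (Finset.prod_eq_one fun k hk => ?_).symm
    refine indicator_of_mem (hω _ ⟨le_self_add, ?_⟩) _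
    gcongr
    refine le_trans ?_ (dyadic_last_eq t m).le
    gcongr
    exact (Finset.mem_range.1 hk).le
  · rw [indicator_of_notMem hω]
    -- A path in `K` throughout `[r, r + t)` is in `K` at `r + t` too, since `K` is closed. The exit
    -- can thus be placed strictly before the end, where grids of small mesh see it.
    have h1 : ∃ s < t, x + B (r + s) ω ∉ K := by
      by_contra! hcon
      refine hω fun s hs => ?_
      have hcl : IsClosed {s : ℝ≥0 | x + B (r + s) ω ∈ K} :=
        hK.preimage ((hB.cont_add x ω).comp (by fun_prop))
      have hsub : closure (Iio t) ⊆ {s : ℝ≥0 | x + B (r + s) ω ∈ K} :=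
        hcl.closure_subset_iff.2 hcon
      have hne : (Iio t).Nonempty := ⟨0, pos_of_ne_zero ht⟩
      rw [closure_Iio' hne] at hsub
      have := hsub (show s - r ∈ Iic t from tsub_le_iff_left.2 hs.2)
      simpa [add_tsub_cancel_of_le hs.1] using this
    obtain ⟨s, hst, hs⟩ := h1
    refine tendsto_const_nhds.congr' ?_
    filter_upwards [exists_dyadic_notMem (hB.cont_add x ω) hK hs hst hst] with m hm
    obtain ⟨k, hk, hkK, _⟩ := hm
    exact (Finset.prod_eq_zero (Finset.mem_range.2 hk) (indicator_of_notMem hkK _)).symm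

/-- This is the limit of `lintegral_grid` along dyadic meshes, by dominated convergence on both
sides. The grid checks neither end point, so these two constraints are put into `Ψ` and into the
test function. -/
theorem IsContinuousBM.lintegral_alive_closed [IsProbabilityMeasure Q] (hB : IsContinuousBM B Q)
    {K : Set (Space d)} (hK : IsClosed K) (r : ℝ≥0) {t : ℝ≥0} (ht : t ≠ 0)
    {Φ : Ω' → ℝ≥0∞} (hΦ : Measurable[pastSigma B r] Φ) (hΦ1 : ∀ ω, Φ ω ≤ 1)
    {φ : Space d → ℝ≥0∞} (hφ : Measurable φ) (hφ1 : ∀ y, φ y ≤ 1) (x : Space d) :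
    ∫⁻ ω, Φ ω * ((aliveOn B K r (r + t) x).indicator 1 ω * φ (x + B (r + t) ω)) ∂Q =
      ∫⁻ ω, Φ ω * (∫⁻ y, closedKernelZero K t (x + B r ω) y * φ y) ∂Q := by
  have htpos : 0 < t := pos_of_ne_zero ht
  have hΦm : Measurable Φ := hΦ.mono (hB.pastSigma_le r) le_rfl
  have hKi : Measurable (K.indicator (1 : Space d → ℝ≥0∞)) :=
    measurable_one.indicator hK.measurableSet
  have hK1 : ∀ z, K.indicator (1 : Space d → ℝ≥0∞) z ≤ 1 :=
    fun z => indicator_le_self' (f := (1 : Space d → ℝ≥0∞)) (fun _ _ => zero_le) z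
  let Ψ : Ω' → ℝ≥0∞ := fun ω => Φ ω * K.indicator 1 (x + B r ω)
  have hΨ : Measurable[pastSigma B r] Ψ :=
    Measurable.mul hΦ (hKi.comp ((measurable_pastSigma B le_rfl).const_add x))
  have hΨ1 : ∀ ω, Ψ ω ≤ 1 := fun ω => mul_le_one' (hΦ1 ω) (hK1 _)
  have hΨm : Measurable Ψ := hΨ.mono (hB.pastSigma_le r) le_rfl
  have hφK : Measurable fun y => K.indicator 1 y * φ y := hKi.mul hφ
  have hgrid : ∀ m : ℕ, _ := fun m => hB.lintegral_grid hK.measurableSet (h := t / 2 ^ m)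
    (by positivity) (2 ^ m - 1) r hΨ hφK x
  simp only [dyadic_last_eq] at hgrid
  have hlim1 := tendsto_lintegral_of_dominated_convergence (μ := Q) (fun _ => 1)
    (F := fun (m : ℕ) ω => Ψ ω * ((∏ k ∈ Finset.range (2 ^ m - 1),
      K.indicator 1 (x + B (r + (k + 1) * (t / 2 ^ m)) ω)) *
        (K.indicator 1 (x + B (r + t) ω) * φ (x + B (r + t) ω))))
    (f := fun ω => Ψ ω * ((aliveOn B K r (r + t) x).indicator 1 ω *
        (K.indicator 1 (x + B (r + t) ω) * φ (x + B (r + t) ω))))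
    (fun m => hΨm.mul ((Finset.measurable_prod _ fun k _ =>
      hKi.comp ((hB.meas _).const_add x)).mul (hφK.comp ((hB.meas _).const_add x))))
    (fun m => Filter.Eventually.of_forall fun ω => mul_le_one' (hΨ1 ω)
      (mul_le_one' (Finset.prod_le_one' fun k _ => hK1 _) (mul_le_one' (hK1 _) (hφ1 _))))
    (by simp) (Filter.Eventually.of_forall fun ω => by
      have hfin : K.indicator 1 (x + B (r + t) ω) * φ (x + B (r + t) ω) ≠ ∞ :=
        ((mul_le_one' (hK1 _) (hφ1 _)).trans_lt ENNReal.one_lt_top).ne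
      refine ENNReal.Tendsto.const_mul ?_ (Or.inr ((hΨ1 ω).trans_lt ENNReal.one_lt_top).ne)
      exact ENNReal.Tendsto.mul_const (hB.tendsto_prod_indicator hK r ht x ω) (Or.inr hfin))
  have hlim2 := tendsto_lintegral_of_dominated_convergence (μ := Q) (fun _ => 1)
    (F := fun (m : ℕ) ω => Ψ ω * (∫⁻ y, gridKernel K (t / 2 ^ m : ℝ≥0) (2 ^ m - 1) (x + B r ω) y *
        (K.indicator 1 y * φ y)))
    (f := fun ω => Ψ ω * (∫⁻ y, closedKernel K t (x + B r ω) y * (K.indicator 1 y * φ y)))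
    (fun m => hΨm.mul (Measurable.lintegral_prod_right' (f := fun q : Ω' × Space d =>
      gridKernel K (t / 2 ^ m : ℝ≥0) (2 ^ m - 1) (x + B r q.1) q.2 *
        (K.indicator 1 q.2 * φ q.2)) (Measurable.mul (Measurable.gridKernel measurable_const
          (((hB.meas r).comp measurable_fst).const_add x) measurable_snd)
          (hφK.comp measurable_snd))))
    (fun m => Filter.Eventually.of_forall fun ω => mul_le_one' (hΨ1 ω) (by
      rw [← lintegral_heat_sub_left (t := (t : ℝ)) (by exact_mod_cast htpos) (x + B r ω)]
      refine lintegral_mono fun y => ?_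
      refine (mul_le_mul' ?_ (mul_le_one' (hK1 _) (hφ1 _))).trans_eq (mul_one _)
      push_cast
      exact gridKernel_dyadic_le_heat K (by exact_mod_cast htpos) m _ _))
    (by simp) (Filter.Eventually.of_forall fun ω => by
      refine ENNReal.Tendsto.const_mul ?_ (Or.inr ((hΨ1 ω).trans_lt ENNReal.one_lt_top).ne)
      push_cast
      refine lintegral_tendsto_of_tendsto_of_antitone (fun m => Measurable.aemeasurable (by
        exact Measurable.mul (by fun_prop) hφK)) ?_ ?_ ?_
      · exact Filter.Eventually.of_forall fun y m m' hm => mul_le_mul_left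
          (antitone_gridKernel K (by exact_mod_cast htpos) _ y hm) _
      · refine (lt_of_le_of_lt (lintegral_mono fun y => (mul_le_mul'
          (gridKernel_dyadic_le_heat K (by exact_mod_cast htpos) 0 _ y)
          (mul_le_one' (hK1 _) (hφ1 _))).trans_eq (mul_one _)) ?_).ne
        rw [lintegral_heat_sub_left (by exact_mod_cast htpos)]
        exact ENNReal.one_lt_top
      · exact Filter.Eventually.of_forall fun y => ENNReal.Tendsto.mul_const
          (tendsto_gridKernel K (by exact_mod_cast htpos) _ y)
          (Or.inr ((mul_le_one' (hK1 _) (hφ1 _)).trans_lt ENNReal.one_lt_top).ne))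
  simp only [hgrid] at hlim1
  have heq := tendsto_nhds_unique hlim1 hlim2
  calc _ = _ := by
        refine lintegral_congr fun ω => ?_
        by_cases hω : ω ∈ aliveOn B K r (r + t) x
        · have h1 : x + B r ω ∈ K := hω r ⟨le_rfl, le_self_add⟩
          have h2 : x + B (r + t) ω ∈ K := hω _ ⟨le_self_add, le_rfl⟩
          simp only [Ψ, indicator_of_mem hω, indicator_of_mem h1, indicator_of_mem h2,
            Pi.one_apply, one_mul, mul_one]
        · simp [Ψ, indicator_of_notMem hω]
    _ = _ := heq
    _ = _ := by
        refine lintegral_congr fun ω => ?_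
        simp only [Ψ, mul_assoc]
        congr 1
        have hm : Measurable fun y =>
            closedKernel K t (x + B r ω) y * (K.indicator 1 y * φ y) :=
          Measurable.mul (by fun_prop) hφK
        rw [← lintegral_const_mul _ hm]
        refine lintegral_congr fun y => ?_
        unfold closedKernelZero
        ring

theorem IsContinuousBM.lintegral_alive [IsProbabilityMeasure Q] (hB : IsContinuousBM B Q)
    {U : Set (Space d)} (hU : IsOpen U) (r : ℝ≥0) {t : ℝ≥0} (ht : t ≠ 0)
    {Φ : Ω' → ℝ≥0∞} (hΦ : Measurable[pastSigma B r] Φ) (hΦ1 : ∀ ω, Φ ω ≤ 1)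
    {φ : Space d → ℝ≥0∞} (hφ : Measurable φ) (hφ1 : ∀ y, φ y ≤ 1) (x : Space d) :
    ∫⁻ ω, Φ ω * ((aliveOn B U r (r + t) x).indicator 1 ω * φ (x + B (r + t) ω)) ∂Q =
      ∫⁻ ω, Φ ω * (∫⁻ y, killedKernel U t (x + B r ω) y * φ y) ∂Q := by
  have hΦm : Measurable Φ := hΦ.mono (hB.pastSigma_le r) le_rfl
  have hcl : ∀ j, IsClosed (exhaustion U j) := isClosed_exhaustion U
  have hmK : ∀ j, Measurable fun q : Ω' × Space d =>
      closedKernelZero (exhaustion U j) t (x + B r q.1) q.2 * φ q.2 := fun j =>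
    (measurable_closedKernelZero (hcl j) measurable_const
      (((hB.meas r).comp measurable_fst).const_add x) measurable_snd).mul (hφ.comp measurable_snd)
  have e1 : ∀ ω, Φ ω * ((aliveOn B U r (r + t) x).indicator 1 ω * φ (x + B (r + t) ω)) =
      ⨆ j, Φ ω * ((aliveOn B (exhaustion U j) r (r + t) x).indicator 1 ω *
        φ (x + B (r + t) ω)) := by
    intro ω
    rw [← ENNReal.mul_iSup, ← ENNReal.iSup_mul, hB.aliveOn_eq_iUnion hU]
    congr 2
    by_cases hω : ω ∈ ⋃ j, aliveOn B (exhaustion U j) r (r + t) x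
    · obtain ⟨j, hj⟩ := mem_iUnion.1 hω
      rw [indicator_of_mem hω]
      refine le_antisymm (le_iSup_of_le j (by rw [indicator_of_mem hj])) (iSup_le fun i => ?_)
      exact indicator_le_self' (f := (1 : Ω' → ℝ≥0∞)) (fun _ _ => zero_le) ω
    · rw [indicator_of_notMem hω]
      symm
      simp only [ENNReal.iSup_eq_zero]
      exact fun j => indicator_of_notMem (fun h => hω (mem_iUnion.2 ⟨j, h⟩)) _
  have e2 : ∀ ω, Φ ω * (∫⁻ y, killedKernel U t (x + B r ω) y * φ y) =
      ⨆ j, Φ ω * (∫⁻ y, closedKernelZero (exhaustion U j) t (x + B r ω) y * φ y) := by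
    intro ω
    have hm : ∀ j, Measurable fun y => closedKernelZero (exhaustion U j) t (x + B r ω) y * φ y :=
      fun j => (measurable_closedKernelZero (hcl j) measurable_const measurable_const
        measurable_id).mul hφ
    have hmono : Monotone fun j y =>
        closedKernelZero (exhaustion U j) t (x + B r ω) y * φ y := fun i j hij y =>
      mul_le_mul' (closedKernelZero_mono (monotone_exhaustion U hij) _ _ y) le_rfl
    rw [← ENNReal.mul_iSup, ← lintegral_iSup hm hmono]
    congr 1
    refine lintegral_congr fun y => ?_
    rw [← ENNReal.iSup_mul]
    rfl
  simp_rw [e1, e2]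
  rw [lintegral_iSup, lintegral_iSup]
  · congr 1
    funext j
    exact hB.lintegral_alive_closed (hcl j) r ht hΦ hΦ1 hφ hφ1 x
  · exact fun j => hΦm.mul (hmK j).lintegral_prod_right'
  · intro i j hij ω
    refine mul_le_mul' le_rfl (lintegral_mono fun y => ?_)
    exact mul_le_mul' (closedKernelZero_mono (monotone_exhaustion U hij) _ _ y) le_rfl
  · intro j
    refine hΦm.mul (Measurable.mul ?_ (hφ.comp ((hB.meas _).const_add x)))
    exact measurable_one.indicator
      (hB.pastSigma_le _ _ (hB.measurableSet_aliveOn_closed (hcl j) le_self_add x))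
  · intro i j hij ω
    refine mul_le_mul' le_rfl (mul_le_mul' ?_ le_rfl)
    exact indicator_le_indicator_of_subset (aliveOn_mono B (monotone_exhaustion U hij) _ _ x)
      (fun _ => zero_le) ω

/-- The probability that Brownian motion started from `x` stays in `U` up to time `t`. -/
noncomputable def survival (U : Set (Space d)) (t : ℝ) (x : Space d) : ℝ≥0∞ :=
  ∫⁻ y, killedKernel U t x y

theorem measurable_survival (U : Set (Space d)) :
    Measurable fun q : ℝ × Space d => survival U q.1 q.2 := by
  have h : Measurable fun q : (ℝ × Space d) × Space d => killedKernel U q.1.1 q.1.2 q.2 := by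
    fun_prop
  exact h.lintegral_prod_right'

theorem measurable_survival_const (U : Set (Space d)) (t : ℝ) : Measurable (survival U t) := by
  have h : Measurable fun q : Space d × Space d => killedKernel U t q.1 q.2 := by fun_prop
  exact h.lintegral_prod_right'

theorem survival_le_one (U : Set (Space d)) {t : ℝ} (ht : 0 < t) (x : Space d) :
    survival U t x ≤ 1 :=
  (lintegral_mono fun y => killedKernel_le_heat U t x y).trans_eq (lintegral_heat_sub_left ht x)

theorem IsContinuousBM.survival_eq [IsProbabilityMeasure Q] (hB : IsContinuousBM B Q)
    {U : Set (Space d)} (hU : IsOpen U) {t : ℝ≥0} (ht : t ≠ 0) (x : Space d) :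
    survival U t x = Q (aliveOn B U 0 t x) := by
  have h := hB.lintegral_alive hU 0 ht (Φ := fun _ => 1) (φ := fun _ => 1)
    (@measurable_const _ _ _ (pastSigma B _) 1) (fun _ => le_rfl)
    measurable_const (fun _ => le_rfl) x
  simp only [one_mul, mul_one, zero_add, hB.zero, add_zero, lintegral_const,
    measure_univ] at h
  rw [lintegral_indicator_one (hB.measurableSet_aliveOn hU zero_le x)] at h
  exact h.symm

/-- When the path is free until time `r`, the probability of staying in `U` afterwards is a heat
smoothing, hence continuous in `x`. Survival from points near a regular boundary point is bounded in
this way. -/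
theorem IsContinuousBM.lintegral_heat_survival [IsProbabilityMeasure Q] (hB : IsContinuousBM B Q)
    {U : Set (Space d)} (hU : IsOpen U) {r t : ℝ≥0} (hr : r ≠ 0) (ht : t ≠ 0) (x : Space d) :
    ∫⁻ z, heat r (x - z) * survival U t z = Q (aliveOn B U r (r + t) x) := by
  have h := hB.lintegral_alive hU r ht (Φ := fun _ => 1) (φ := fun _ => 1)
    (@measurable_const _ _ _ (pastSigma B _) 1) (fun _ => le_rfl)
    measurable_const (fun _ => le_rfl) x
  simp only [one_mul, mul_one] at h
  rw [lintegral_indicator_one (hB.measurableSet_aliveOn hU le_self_add x)] at h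
  have h2 := hB.lintegral_markov 0 hr (Φ := fun _ => 1) (@measurable_const _ _ _ (pastSigma B _) 1)
    (f := survival U t) (measurable_survival_const U t) x
  simp only [one_mul, zero_add, hB.zero, add_zero, lintegral_const, measure_univ,
    mul_one] at h2
  rw [h, ← h2]
  rfl

/-- The dyadic construction splits only at midpoints. For arbitrary times the splitting comes from
the paths: surviving up to `r + t` is surviving up to `r` and then during `[r, r + t]`. -/
theorem IsContinuousBM.survival_add [IsProbabilityMeasure Q] (hB : IsContinuousBM B Q)
    {U : Set (Space d)} (hU : IsOpen U) {r t : ℝ≥0} (hr : r ≠ 0) (ht : t ≠ 0) (x : Space d) :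
    survival U (r + t) x = ∫⁻ z, killedKernel U r x z * survival U t z := by
  have h := hB.lintegral_alive hU r ht (Φ := (aliveOn B U 0 r x).indicator fun _ => 1)
    (φ := fun _ => 1) ((@measurable_const _ _ _ (pastSigma B _) 1).indicator (hB.measurableSet_aliveOn_pastSigma hU zero_le x))
    (fun ω => indicator_le_self' (f := fun _ : Ω' => (1 : ℝ≥0∞)) (fun _ _ => zero_le) ω)
    measurable_const (fun _ => le_rfl) x
  simp only [mul_one] at h
  have h2 := hB.lintegral_alive hU 0 hr (Φ := fun _ => 1) (φ := survival U t)
    (@measurable_const _ _ _ (pastSigma B _) 1)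
    (fun _ => le_rfl) (measurable_survival_const U t)
    (fun y => survival_le_one U (by exact_mod_cast pos_of_ne_zero ht) y) x
  simp only [one_mul, zero_add, hB.zero, add_zero, lintegral_const, measure_univ,
    mul_one] at h2
  have h3 : ∫⁻ ω, (aliveOn B U 0 r x).indicator (fun _ => 1) ω *
      (aliveOn B U r (r + t) x).indicator 1 ω ∂Q = Q (aliveOn B U 0 (r + t) x) := by
    rw [← lintegral_indicator_one (hB.measurableSet_aliveOn hU zero_le x)]
    refine lintegral_congr fun ω => ?_
    have hiff : ω ∈ aliveOn B U 0 (r + t) x ↔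
        ω ∈ aliveOn B U 0 r x ∧ ω ∈ aliveOn B U r (r + t) x := by
      refine ⟨fun hω => ⟨fun s hs => hω s ⟨hs.1, hs.2.trans le_self_add⟩,
        fun s hs => hω s ⟨zero_le, hs.2⟩⟩, fun hω s hs => ?_⟩
      rcases le_total s r with h | h
      · exact hω.1 s ⟨hs.1, h⟩
      · exact hω.2 s ⟨h, hs.2⟩
    by_cases h1 : ω ∈ aliveOn B U 0 r x <;> by_cases h2 : ω ∈ aliveOn B U r (r + t) x <;>
      simp [indicator, hiff, h1, h2]
  rw [← NNReal.coe_add, hB.survival_eq hU (by positivity), ← h3, h, ← h2]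
  refine lintegral_congr fun ω => ?_
  by_cases h1 : ω ∈ aliveOn B U 0 r x
  · simp only [indicator_of_mem h1, Pi.one_apply, one_mul]; rfl
  · simp [indicator_of_notMem h1]

end Survival

/-! ### First exit decomposition of the heat kernel -/

section FirstExit

variable {d : ℕ} {Ω' : Type*} [MeasurableSpace Ω'] {B : ℝ≥0 → Ω' → Space d} {Q : Measure Ω'}

/-- The values of `√` and `⁻¹` at `0` make the kernel vanish at nonpositive times, so `exitHeat`
automatically ignores the paths that exit after time `t`. -/
theorem heat_of_nonpos (hd : d ≠ 0) {t : ℝ} (ht : t ≤ 0) (z : Space d) : heat t z = 0 := by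
  unfold heat heatReal
  rw [Real.sqrt_eq_zero_of_nonpos (by nlinarith [Real.pi_pos]), inv_zero, zero_pow hd, zero_mul,
    ENNReal.ofReal_zero]

/-- The first exit decomposition along a time grid, before its evaluation. -/
noncomputable def gridExit (B : ℝ≥0 → Ω' → Space d) (K : Set (Space d)) (h : ℝ≥0) (n : ℕ)
    (x y : Space d) (ω : Ω') : ℝ≥0∞ :=
  ∑ l ∈ Finset.range n, (∏ k ∈ Finset.range l, K.indicator 1 (x + B ((k + 1) * h) ω)) *
    (Kᶜ.indicator 1 (x + B ((l + 1) * h) ω) *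
      heat ((n + 1) * h - (l + 1) * h) (x + B ((l + 1) * h) ω - y))

theorem IsContinuousBM.measurable_gridExit (hB : IsContinuousBM B Q) {K : Set (Space d)}
    (hK : IsClosed K) (h : ℝ≥0) (n : ℕ) (x y : Space d) : Measurable (gridExit B K h n x y) := by
  unfold gridExit
  have hX : ∀ s, Measurable fun ω => x + B s ω := fun s => (hB.meas s).const_add x
  refine Finset.measurable_sum _ fun l _ => Measurable.mul ?_ (Measurable.mul ?_ ?_)
  · exact Finset.measurable_prod _ fun k _ => (measurable_one.indicator hK.measurableSet).comp (hX _)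
  · exact (measurable_one.indicator hK.measurableSet.compl).comp (hX _)
  · exact Measurable.heat measurable_const ((hX _).sub_const y)

theorem indicator_add_compl_indicator (K : Set (Space d)) (z : Space d) :
    K.indicator (1 : Space d → ℝ≥0∞) z + Kᶜ.indicator 1 z = 1 := by
  by_cases hz : z ∈ K <;> simp [hz]

/-- One step of the Markov property preserves the expectation of the heat kernel over the remaining
time. At each grid time the paths found outside `K` are split off, and the sum telescopes. Only
deterministic times occur. -/
theorem IsContinuousBM.heat_eq_gridKernel_add [IsProbabilityMeasure Q] (hB : IsContinuousBM B Q)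
    {K : Set (Space d)} (hK : IsClosed K) {h : ℝ≥0} (hh : h ≠ 0) (n : ℕ) (x y : Space d) :
    heat ((n + 1) * h) (x - y) = gridKernel K h n x y + ∫⁻ ω, gridExit B K h n x y ω ∂Q := by
  have hhpos : (0 : ℝ) < h := by exact_mod_cast pos_of_ne_zero hh
  have hX : ∀ s, Measurable fun ω => x + B s ω := fun s => (hB.meas s).const_add x
  have hKi : Measurable (K.indicator (1 : Space d → ℝ≥0∞)) :=
    measurable_one.indicator hK.measurableSet
  have hKc : Measurable (Kᶜ.indicator (1 : Space d → ℝ≥0∞)) :=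
    measurable_one.indicator hK.measurableSet.compl
  let Φ : ℕ → Ω' → ℝ≥0∞ := fun l ω =>
    ∏ k ∈ Finset.range l, K.indicator 1 (x + B ((k + 1) * h) ω)
  have hΦ : ∀ l : ℕ, Measurable[pastSigma B (l * h)] (Φ l) := fun l => by
    refine Finset.measurable_prod _ fun k hk => hKi.comp ?_
    refine (measurable_pastSigma B ?_).const_add x
    have : (k : ℝ≥0) + 1 ≤ l := by exact_mod_cast Finset.mem_range.1 hk
    gcongr
  have hΦm : ∀ l, Measurable (Φ l) := fun l => (hΦ l).mono (hB.pastSigma_le _) le_rfl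
  have hhm : ∀ (s : ℝ) (r : ℝ≥0), Measurable fun ω => heat s (x + B r ω - y) := fun s r =>
    Measurable.heat measurable_const ((hX r).sub_const y)
  let T : ℕ → Ω' → ℝ≥0∞ := fun l ω => Φ l ω * (Kᶜ.indicator 1 (x + B ((l + 1) * h) ω) *
      heat ((n + 1) * h - (l + 1) * h) (x + B ((l + 1) * h) ω - y))
  have hT : ∀ l, Measurable (T l) := fun l =>
    (hΦm l).mul ((hKc.comp (hX _)).mul (hhm _ _))
  have key : ∀ i : ℕ, i ≤ n → heat ((n + 1) * h) (x - y) =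
      ∫⁻ ω, Φ i ω * heat ((n + 1) * h - i * h) (x + B (i * h) ω - y) ∂Q +
        ∑ l ∈ Finset.range i, ∫⁻ ω, T l ω ∂Q := by
    intro i
    induction i with
    | zero => intro _; simp [Φ, hB.zero]
    | succ i ih =>
      intro hi
      rw [ih (by omega), Finset.sum_range_succ, ← add_assoc, add_right_comm]
      congr 1
      have hpos : 0 < ((n : ℝ) + 1) * h - ((i : ℝ) + 1) * h := by
        have : (i : ℝ) + 1 < n + 1 := by exact_mod_cast Nat.lt_succ_of_le hi
        nlinarith
      have hm := hB.lintegral_markov (i * h) hh (hΦ i)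
        (f := fun z => heat (((n : ℝ) + 1) * h - ((i : ℝ) + 1) * h) (z - y)) (by fun_prop) x
      simp_rw [lintegral_heat_mul_heat hhpos hpos] at hm
      have e1 : (h : ℝ) + (((n : ℝ) + 1) * h - ((i : ℝ) + 1) * h) = ((n : ℝ) + 1) * h - i * h := by
        ring
      have e2 : (i : ℝ≥0) * h + h = (i + 1) * h := by ring
      rw [e1, e2] at hm
      have hm' : Measurable fun ω => Φ (i + 1) ω *
          heat (((n : ℝ) + 1) * h - ((i + 1 : ℕ) : ℝ) * h) (x + B (((i + 1 : ℕ) : ℝ≥0) * h) ω - y) :=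
        (hΦm _).mul (hhm _ _)
      rw [← hm, ← lintegral_add_left hm' (T i)]
      refine lintegral_congr fun ω => ?_
      simp only [T, Φ, Finset.prod_range_succ]
      push_cast
      calc _ = (∏ k ∈ Finset.range i, K.indicator 1 (x + B ((k + 1) * h) ω)) *
            ((K.indicator 1 (x + B ((i + 1) * h) ω) + Kᶜ.indicator 1 (x + B ((i + 1) * h) ω)) *
              heat (((n : ℝ) + 1) * h - ((i : ℝ) + 1) * h) (x + B ((i + 1) * h) ω - y)) := by
            rw [indicator_add_compl_indicator, one_mul]
        _ = _ := by ring
  rw [key n le_rfl]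
  unfold gridExit
  rw [lintegral_finsetSum _ fun l _ => hT l]
  congr 1
  rcases n with _ | n
  · simp [Φ, gridKernel, hB.zero]
  · have hg := hB.lintegral_grid hK.measurableSet hh n 0 (Φ := fun _ => 1)
      (@measurable_const _ _ _ (pastSigma B _) 1)
      (φ := fun z => K.indicator 1 z * heat h (z - y)) (hKi.mul (by fun_prop)) x
    simp only [one_mul, zero_add, hB.zero, add_zero, lintegral_const, measure_univ, mul_one] at hg
    have hadd := gridKernel_add K h n 0 x y
    rw [add_zero] at hadd
    rw [hadd, ← lintegral_indicator hK.measurableSet]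
    refine Eq.trans ?_ (hg.trans ?_)
    · refine lintegral_congr fun ω => ?_
      simp only [Φ, Finset.prod_range_succ]
      push_cast
      rw [mul_assoc, show ((n : ℝ) + 1 + 1) * h - (n + 1) * h = h by ring]
    · refine lintegral_congr fun z => ?_
      by_cases hz : z ∈ K
      · simp [hz, gridKernel]
      · simp [hz]

theorem gridExit_eq_zero {K : Set (Space d)} {h : ℝ≥0} {n : ℕ} {x : Space d} (y : Space d)
    {ω : Ω'} (hK : ∀ l < n, x + B ((l + 1) * h) ω ∈ K) : gridExit B K h n x y ω = 0 := by
  unfold gridExit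
  refine Finset.sum_eq_zero fun l hl => ?_
  rw [indicator_of_notMem (show x + B ((l + 1) * h) ω ∉ Kᶜ from
    fun hc => hc (hK l (Finset.mem_range.1 hl))), zero_mul, mul_zero]

theorem gridExit_eq {K : Set (Space d)} {h : ℝ≥0} {n : ℕ} {x : Space d} (y : Space d)
    {ω : Ω'} {l : ℕ} (hl : l < n) (hlK : x + B ((l + 1) * h) ω ∉ K)
    (hmin : ∀ k < l, x + B ((k + 1) * h) ω ∈ K) : gridExit B K h n x y ω =
      heat ((n + 1) * h - (l + 1) * h) (x + B ((l + 1) * h) ω - y) := by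
  unfold gridExit
  rw [Finset.sum_eq_single_of_mem l (Finset.mem_range.2 hl)]
  · rw [Finset.prod_eq_one fun k hk => indicator_of_mem (hmin k (Finset.mem_range.1 hk)) _,
      indicator_of_mem (show x + B ((l + 1) * h) ω ∈ Kᶜ from hlK), one_mul, Pi.one_apply, one_mul]
  · intro k _ hkl
    rcases lt_or_gt_of_ne hkl with h1 | h1
    · rw [indicator_of_notMem (show x + B ((k + 1) * h) ω ∉ Kᶜ from
        fun hc => hc (hmin k h1)), zero_mul, mul_zero]
    · rw [Finset.prod_eq_zero (Finset.mem_range.2 h1) (indicator_of_notMem hlK _), zero_mul]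

theorem dyadic_last_real (t : ℝ≥0) (m : ℕ) :
    (((2 ^ m - 1 : ℕ) : ℝ) + 1) * ((t / 2 ^ m : ℝ≥0) : ℝ) = t := by
  rw [Nat.cast_sub Nat.one_le_two_pow, NNReal.coe_div]
  push_cast
  rw [sub_add_cancel, mul_div_cancel₀ _ (by positivity)]

theorem tendsto_heat {d : ℕ} {ι : Type*} {l : Filter ι} {u : ι → ℝ} {v : ι → Space d} {t : ℝ} {z : Space d}
    (ht : 0 < t) (hu : Filter.Tendsto u l (nhds t)) (hv : Filter.Tendsto v l (nhds z)) :
    Filter.Tendsto (fun i => heat (u i) (v i)) l (nhds (heat t z)) := by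
  have h3 := hu.prodMk_nhds hv
  have := Filter.Tendsto.comp (g := fun q : ℝ × Space d => heat q.1 q.2) (continuousAt_heat ht z) h3
  exact this

theorem IsContinuousBM.tendsto_heat_comp (hB : IsContinuousBM B Q) {t : ℝ} {T : ℕ → ℝ≥0} {σ : ℝ≥0}
    (hσ : (σ : ℝ) < t) (hT : Filter.Tendsto T Filter.atTop (nhds σ)) (x y : Space d) (ω : Ω') :
    Filter.Tendsto (fun m => heat (t - T m) (x + B (T m) ω - y)) Filter.atTop
      (nhds (heat (t - σ) (x + B σ ω - y))) := by
  have h1 : Filter.Tendsto (fun m => t - (T m : ℝ)) Filter.atTop (nhds (t - σ)) :=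
    (NNReal.tendsto_coe.2 hT).const_sub t
  have h0 : Filter.Tendsto (fun m => x + B (T m) ω) Filter.atTop (nhds (x + B σ ω)) :=
    Filter.Tendsto.comp (g := fun s => x + B s ω) ((hB.cont_add x ω).tendsto σ) hT
  have h2 : Filter.Tendsto (fun m => x + B (T m) ω - y) Filter.atTop (nhds (x + B σ ω - y)) :=
    h0.sub_const y
  exact tendsto_heat (sub_pos.2 hσ) h1 h2

/-- The event that Brownian motion started from `x` leaves `U`. -/
def exits (B : ℝ≥0 → Ω' → Space d) (U : Set (Space d)) (x : Space d) : Set Ω' :=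
  {ω | ∃ t : ℝ≥0, x + B t ω ∉ U}

/-- The heat kernel from the exit position, over the time remaining until `t`. -/
noncomputable def exitHeat (B : ℝ≥0 → Ω' → Space d) (U : Set (Space d)) (t : ℝ) (x y : Space d)
    (ω : Ω') : ℝ≥0∞ :=
  (exits B U x).indicator (fun ω => heat (t - exitTime B U x ω)
    (x + B (exitTime B U x ω) ω - y)) ω

theorem exitTime_le {U : Set (Space d)} {x : Space d} {ω : Ω'} {s : ℝ≥0} (hs : x + B s ω ∉ U) :
    exitTime B U x ω ≤ s := csInf_le (OrderBot.bddBelow _) hs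

theorem le_exitTime {U : Set (Space d)} {x : Space d} {ω : Ω'} (hω : ω ∈ exits B U x) {s : ℝ≥0}
    (hs : ∀ r < s, x + B r ω ∈ U) : s ≤ exitTime B U x ω :=
  le_csInf hω fun r hr => by
    by_contra h
    exact hr (hs r (not_le.1 h))

theorem exitHeat_eq_zero (hd : d ≠ 0) {U : Set (Space d)} {t : ℝ≥0} {x : Space d} (y : Space d)
    {ω : Ω'} (h : ∀ s < t, x + B s ω ∈ U) : exitHeat B U t x y ω = 0 := by
  unfold exitHeat
  by_cases hω : ω ∈ exits B U x
  · rw [indicator_of_mem hω, heat_of_nonpos hd]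
    have := le_exitTime hω h
    rw [sub_nonpos]
    exact_mod_cast this
  · rw [indicator_of_notMem hω]

theorem IsContinuousBM.exit_mem_closure (hB : IsContinuousBM B Q) {U : Set (Space d)}
    {x : Space d} {ω : Ω'} (hω : ω ∈ exits B U x) :
    x + B (exitTime B U x ω) ω ∈ closure Uᶜ := by
  have h1 : exitTime B U x ω ∈ closure {t : ℝ≥0 | x + B t ω ∉ U} :=
    csInf_mem_closure hω (OrderBot.bddBelow _)
  exact map_mem_closure (f := fun s => x + B s ω) (hB.cont_add x ω) h1 fun s hs => hs

theorem IsContinuousBM.exit_notMem (hB : IsContinuousBM B Q) {U : Set (Space d)} (hU : IsOpen U)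
    {x : Space d} {ω : Ω'} (hω : ω ∈ exits B U x) : x + B (exitTime B U x ω) ω ∉ U := by
  have := hB.exit_mem_closure hω
  rwa [hU.isClosed_compl.closure_eq] at this

/-- The first grid time outside `K` is at or after the exit time. It converges to the exit time:
being outside `K` is an open condition that holds at times arbitrarily close to the exit time, and
fine grids detect it. If the path is in `K` at all times before `t`, both sides are `0`. -/
theorem IsContinuousBM.tendsto_gridExit (hd : d ≠ 0) (hB : IsContinuousBM B Q)
    {K : Set (Space d)} (hK : IsClosed K) {t : ℝ≥0} (ht : t ≠ 0) (x y : Space d) (ω : Ω') :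
    Filter.Tendsto (fun m : ℕ => gridExit B K (t / 2 ^ m) (2 ^ m - 1) x y ω) Filter.atTop
      (nhds (exitHeat B K t x y ω)) := by
  have htime : ∀ m l : ℕ, l < 2 ^ m - 1 → ((l : ℝ≥0) + 1) * (t / 2 ^ m) < t := fun m l hl => by
    conv_rhs => rw [← dyadic_last_eq t m]
    have : (0 : ℝ≥0) < t / 2 ^ m := by have := pos_of_ne_zero ht; positivity
    gcongr
  by_cases hex : ∃ s < t, x + B s ω ∉ K
  swap
  · push Not at hex
    rw [exitHeat_eq_zero hd y hex]
    refine tendsto_const_nhds.congr fun m => ?_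
    exact (gridExit_eq_zero y fun l hl => hex _ (htime m l hl)).symm
  obtain ⟨s₀, hs₀t, hs₀⟩ := hex
  have hω : ω ∈ exits B K x := ⟨s₀, hs₀⟩
  set σ := exitTime B K x ω with hσ
  have hσt : σ < t := (exitTime_le hs₀).trans_lt hs₀t
  have hclose : ∀ u > σ, ∃ s, s < t ∧ s < u ∧ x + B s ω ∉ K := fun u hu => by
    obtain ⟨s, hs, hsu⟩ := exists_lt_of_csInf_lt (s := {t : ℝ≥0 | x + B t ω ∉ K}) hω
      (show exitTime B K x ω < min t u from lt_min hσt hu)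
    exact ⟨s, hsu.trans_le (min_le_left _ _), hsu.trans_le (min_le_right _ _), hs⟩
  classical
  let p : ℕ → ℕ → Prop := fun m l => l < 2 ^ m - 1 ∧ x + B ((l + 1) * (t / 2 ^ m)) ω ∉ K
  -- The default value `σ` for grids that detect nothing keeps `σ ≤ T m`; such grids are eventually
  -- absent.
  let T : ℕ → ℝ≥0 := fun m =>
    if h : ∃ l, p m l then ((Nat.find h : ℝ≥0) + 1) * (t / 2 ^ m) else σ
  have hσT : ∀ m, σ ≤ T m := fun m => by
    by_cases h : ∃ l, p m l
    · simp only [T, h, dif_pos]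
      exact exitTime_le (Nat.find_spec h).2
    · simp only [T, h, dif_neg, not_false_iff]
      exact le_rfl
  have hT : ∀ u > σ, ∀ᶠ m in Filter.atTop, (∃ l, p m l) ∧ T m < u := fun u hu => by
    obtain ⟨s, hst, hsu, hs⟩ := hclose u hu
    have := exists_dyadic_notMem (hB.cont_add x ω) hK (r := 0) (by rwa [zero_add]) hst hsu
    filter_upwards [this] with m ⟨k, hk, hkK, hku⟩
    rw [zero_add] at hkK
    have h : ∃ l, p m l := ⟨k, hk, hkK⟩
    refine ⟨h, ?_⟩
    simp only [T, h, dif_pos]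
    refine lt_of_le_of_lt ?_ hku
    gcongr
    exact Nat.find_le ⟨hk, hkK⟩
  have hTlim : Filter.Tendsto T Filter.atTop (nhds σ) := by
    refine tendsto_order.2 ⟨fun a ha => Filter.Eventually.of_forall fun m => ha.trans_le (hσT m),
      fun u hu => (hT u hu).mono fun m hm => hm.2⟩
  have hval : ∀ᶠ m in Filter.atTop, gridExit B K (t / 2 ^ m) (2 ^ m - 1) x y ω =
      heat (t - T m) (x + B (T m) ω - y) := by
    filter_upwards [hT t hσt] with m ⟨h, _⟩
    have hspec := Nat.find_spec h
    rw [gridExit_eq y hspec.1 hspec.2 fun k hk => by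
      by_contra hc
      exact Nat.find_min h hk ⟨hk.trans hspec.1, hc⟩]
    have hTm : T m = ((Nat.find h : ℝ≥0) + 1) * (t / 2 ^ m) := dif_pos h
    rw [hTm, dyadic_last_real]
    norm_cast
  unfold exitHeat
  rw [indicator_of_mem hω]
  refine Filter.Tendsto.congr' (hval.mono fun m hm => hm.symm) ?_
  exact hB.tendsto_heat_comp (by exact_mod_cast hσt) hTlim x y ω

theorem IsContinuousBM.measurable_exitHeat_closed (hd : d ≠ 0) (hB : IsContinuousBM B Q)
    {K : Set (Space d)} (hK : IsClosed K) {t : ℝ≥0} (ht : t ≠ 0) (x y : Space d) :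
    Measurable (exitHeat B K t x y) :=
  measurable_of_tendsto_metrizable
    (f := fun m : ℕ => gridExit B K (t / 2 ^ m) (2 ^ m - 1) x y)
    (fun m => hB.measurable_gridExit hK _ _ x y)
    (tendsto_pi_nhds.2 fun ω => hB.tendsto_gridExit hd hK ht x y ω)

theorem IsContinuousBM.heat_eq_grid_dyadic [IsProbabilityMeasure Q] (hB : IsContinuousBM B Q)
    {K : Set (Space d)} (hK : IsClosed K) {t : ℝ≥0} (ht : t ≠ 0) (m : ℕ) (x y : Space d) :
    heat t (x - y) = gridKernel K (t / 2 ^ m) (2 ^ m - 1) x y +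
      ∫⁻ ω, gridExit B K (t / 2 ^ m) (2 ^ m - 1) x y ω ∂Q := by
  have h := hB.heat_eq_gridKernel_add hK (h := t / 2 ^ m)
    (by have := pos_of_ne_zero ht; positivity) (2 ^ m - 1) x y
  rwa [dyadic_last_real] at h

/-- Fatou's lemma gives only an inequality, but without any condition on the position of `y`.
Targets outside the open set will need exactly this. -/
theorem IsContinuousBM.lintegral_exitHeat_closed_le [IsProbabilityMeasure Q] (hd : d ≠ 0)
    (hB : IsContinuousBM B Q) {K : Set (Space d)} (hK : IsClosed K) {t : ℝ≥0} (ht : t ≠ 0)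
    (x y : Space d) : ∫⁻ ω, exitHeat B K t x y ω ∂Q ≤ heat t (x - y) := by
  have h1 : ∀ ω, exitHeat B K t x y ω =
      Filter.liminf (fun m : ℕ => gridExit B K (t / 2 ^ m) (2 ^ m - 1) x y ω) Filter.atTop :=
    fun ω => (hB.tendsto_gridExit hd hK ht x y ω).liminf_eq.symm
  simp_rw [h1]
  refine (lintegral_liminf_le fun m => hB.measurable_gridExit hK _ _ x y).trans ?_
  refine Filter.liminf_le_of_le (by isBoundedDefault) fun b hb => ?_
  obtain ⟨m, hm⟩ := hb.exists
  refine hm.trans ?_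
  rw [hB.heat_eq_grid_dyadic hK ht m]
  exact le_add_self

theorem exists_heat_le {δ : ℝ} (hδ : 0 < δ) (hd : d ≠ 0) : ∃ C : ℝ≥0, ∀ (t : ℝ) (z : Space d),
    δ ≤ ‖z‖ → heat t z ≤ C := by
  obtain ⟨C, hC, h⟩ := heatReal_le_of_le_norm (d := d) hδ
  refine ⟨C.toNNReal, fun t z hz => ?_⟩
  rcases le_or_gt t 0 with h0 | h0
  · rw [heat_of_nonpos hd h0]; exact zero_le
  · exact ENNReal.ofReal_le_ofReal (h t h0 z hz)

theorem le_norm_sub_of_notMem_interior {K : Set (Space d)} {y z : Space d} {δ : ℝ}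
    (hy : Metric.ball y δ ⊆ K) (hz : z ∈ closure Kᶜ) : δ ≤ ‖z - y‖ := by
  by_contra h
  push Not at h
  have h1 : z ∈ interior K := interior_maximal hy Metric.isOpen_ball (by
    rwa [Metric.mem_ball, dist_eq_norm])
  rw [closure_compl] at hz
  exact hz h1

/-- Exit positions stay at distance `δ` from `y`, where the heat kernel is bounded uniformly in
time. So dominated convergence applies to the grid decomposition. -/
theorem IsContinuousBM.heat_eq_closedKernel_add [IsProbabilityMeasure Q] (hd : d ≠ 0)
    (hB : IsContinuousBM B Q) {K : Set (Space d)} (hK : IsClosed K) {t : ℝ≥0} (ht : t ≠ 0)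
    (x : Space d) {y : Space d} {δ : ℝ} (hδ : 0 < δ) (hy : Metric.ball y δ ⊆ K) :
    heat t (x - y) = closedKernel K t x y + ∫⁻ ω, exitHeat B K t x y ω ∂Q := by
  obtain ⟨C, hC⟩ := exists_heat_le (d := d) hδ hd
  have hbound : ∀ (m : ℕ) ω, gridExit B K (t / 2 ^ m) (2 ^ m - 1) x y ω ≤ C := fun m ω => by
    classical
    by_cases h : ∃ l : ℕ, l < 2 ^ m - 1 ∧ x + B (((l : ℝ≥0) + 1) * (t / 2 ^ m)) ω ∉ K
    · have hspec := Nat.find_spec h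
      rw [gridExit_eq y hspec.1 hspec.2 fun k hk => by
        by_contra hc
        exact Nat.find_min h hk ⟨hk.trans hspec.1, hc⟩]
      exact hC _ _ (le_norm_sub_of_notMem_interior hy (subset_closure hspec.2))
    · push Not at h
      rw [gridExit_eq_zero y h]
      exact zero_le
  have hlim := tendsto_lintegral_of_dominated_convergence (μ := Q) (fun _ => (C : ℝ≥0∞))
    (fun m => hB.measurable_gridExit hK (t / 2 ^ m) (2 ^ m - 1) x y)
    (fun m => Filter.Eventually.of_forall (hbound m)) (by simp)
    (Filter.Eventually.of_forall fun ω => hB.tendsto_gridExit hd hK ht x y ω)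
  have hk := tendsto_gridKernel K (t := (t : ℝ)) (by exact_mod_cast pos_of_ne_zero ht) x y
  refine tendsto_nhds_unique (tendsto_const_nhds.congr fun m => ?_) (hk.add hlim)
  exact hB.heat_eq_grid_dyadic hK ht m x y

/-- Up to any time before the exit from `U`, the path stays in one member of the exhaustion; and the
exit position from `U` is outside all of them. -/
theorem IsContinuousBM.tendsto_exitTime_exhaustion (hB : IsContinuousBM B Q) {U : Set (Space d)}
    (hU : IsOpen U) {x : Space d} {ω : Ω'} (hω : ω ∈ exits B U x) :
    Filter.Tendsto (fun j => exitTime B (exhaustion U j) x ω) Filter.atTop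
      (nhds (exitTime B U x ω)) := by
  have hnot : ∀ j, x + B (exitTime B U x ω) ω ∉ exhaustion U j := fun j hj =>
    hB.exit_notMem hU hω (exhaustion_subset U j hj)
  refine tendsto_order.2 ⟨fun a ha => ?_, fun u hu =>
    Filter.Eventually.of_forall fun j => (exitTime_le (hnot j)).trans_lt hu⟩
  obtain ⟨b, hab, hb⟩ := exists_between ha
  have h1 : ω ∈ aliveOn B U 0 b x := fun s hs => by
    by_contra hc
    exact absurd (exitTime_le hc) (not_le.2 (hs.2.trans_lt hb))
  rw [hB.aliveOn_eq_iUnion hU] at h1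
  obtain ⟨i, hi⟩ := mem_iUnion.1 h1
  filter_upwards [Filter.eventually_ge_atTop i] with j hij
  refine hab.trans_le (le_exitTime ⟨_, hnot j⟩ fun r hr => ?_)
  exact monotone_exhaustion U hij (hi r ⟨zero_le, hr.le⟩)

theorem IsContinuousBM.exitHeat_le_liminf (hd : d ≠ 0) (hB : IsContinuousBM B Q)
    {U : Set (Space d)} (hU : IsOpen U) (t : ℝ) (x y : Space d) (ω : Ω') :
    exitHeat B U t x y ω ≤
      Filter.liminf (fun j => exitHeat B (exhaustion U j) t x y ω) Filter.atTop := by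
  by_cases hω : ω ∈ exits B U x
  swap
  · rw [exitHeat, indicator_of_notMem hω]; exact zero_le
  rcases le_or_gt t (exitTime B U x ω) with h | h
  · rw [exitHeat, indicator_of_mem hω, heat_of_nonpos hd (sub_nonpos.2 h)]; exact zero_le
  refine le_of_eq (Filter.Tendsto.liminf_eq ?_).symm
  have hT := hB.tendsto_exitTime_exhaustion hU hω
  have hωj : ∀ j, ω ∈ exits B (exhaustion U j) x := fun j =>
    ⟨_, fun hj => hB.exit_notMem hU hω (exhaustion_subset U j hj)⟩
  unfold exitHeat
  rw [indicator_of_mem hω]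
  simp only [indicator_of_mem (hωj _)]
  exact hB.tendsto_heat_comp h hT x y ω

theorem IsContinuousBM.lintegral_exitHeat_le [IsProbabilityMeasure Q] (hd : d ≠ 0)
    (hB : IsContinuousBM B Q) {U : Set (Space d)} (hU : IsOpen U) {t : ℝ≥0} (ht : t ≠ 0)
    (x y : Space d) : ∫⁻ ω, exitHeat B U t x y ω ∂Q ≤ heat t (x - y) := by
  refine (lintegral_mono fun ω => hB.exitHeat_le_liminf hd hU t x y ω).trans ?_
  refine (lintegral_liminf_le fun j =>
    hB.measurable_exitHeat_closed hd (isClosed_exhaustion U j) ht x y).trans ?_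
  refine Filter.liminf_le_of_le (by isBoundedDefault) fun b hb => ?_
  obtain ⟨j, hj⟩ := hb.exists
  exact hj.trans (hB.lintegral_exitHeat_closed_le hd (isClosed_exhaustion U j) ht x y)

/-- The delicate paths leave `U` exactly at time `t`. Their remaining times tend to `0`, and the
heat kernel at small times is small because the exit positions stay away from `y ∈ U`. -/
theorem IsContinuousBM.tendsto_exitHeat (hd : d ≠ 0) (hB : IsContinuousBM B Q)
    {U : Set (Space d)} (hU : IsOpen U) (t : ℝ≥0) (x : Space d) {y : Space d} (hy : y ∈ U)
    (ω : Ω') : Filter.Tendsto (fun j => exitHeat B (exhaustion U j) t x y ω) Filter.atTop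
      (nhds (exitHeat B U t x y ω)) := by
  by_cases hex : ω ∈ aliveOn B U 0 t x
  · rw [exitHeat_eq_zero hd y fun s hs => hex s ⟨zero_le, hs.le⟩]
    rw [hB.aliveOn_eq_iUnion hU] at hex
    obtain ⟨i, hi⟩ := mem_iUnion.1 hex
    refine tendsto_const_nhds.congr' ?_
    filter_upwards [Filter.eventually_ge_atTop i] with j hij
    exact (exitHeat_eq_zero hd y fun s hs =>
      monotone_exhaustion U hij (hi s ⟨zero_le, hs.le⟩)).symm
  have hex' : ∃ s ≤ t, x + B s ω ∉ U := by
    simp only [aliveOn, mem_ofPred_eq, not_forall] at hex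
    obtain ⟨s, hs, h⟩ := hex
    exact ⟨s, hs.2, h⟩
  obtain ⟨s₀, hs₀t, hs₀⟩ := hex'
  have hω : ω ∈ exits B U x := ⟨s₀, hs₀⟩
  have hτt : exitTime B U x ω ≤ t := (exitTime_le hs₀).trans hs₀t
  have hT := hB.tendsto_exitTime_exhaustion hU hω
  have hωj : ∀ j, ω ∈ exits B (exhaustion U j) x := fun j =>
    ⟨_, fun hj => hB.exit_notMem hU hω (exhaustion_subset U j hj)⟩
  unfold exitHeat
  rw [indicator_of_mem hω]
  simp only [indicator_of_mem (hωj _)]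
  rcases hτt.lt_or_eq with h | h
  · exact hB.tendsto_heat_comp (by exact_mod_cast h) hT x y ω
  · rw [heat_of_nonpos hd (by rw [h, sub_self])]
    obtain ⟨δ, hδ, i, hi⟩ := exists_closedBall_subset_exhaustion hU hy
    obtain ⟨C, hC, hCb⟩ := heatReal_le_mul_sqrt_pow (d := d) hδ
    have hup : Filter.Tendsto (fun j => ENNReal.ofReal
        (C * √((t : ℝ) - exitTime B (exhaustion U j) x ω) ^ d)) Filter.atTop (nhds 0) := by
      have h1 : Filter.Tendsto (fun j => (t : ℝ) - exitTime B (exhaustion U j) x ω) Filter.atTop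
          (nhds 0) := by
        have := ((NNReal.continuous_coe.tendsto _).comp hT).const_sub (t : ℝ)
        rwa [h, sub_self] at this
      have h2 := ((Real.continuous_sqrt.tendsto 0).comp h1).pow d
      rw [Real.sqrt_zero, zero_pow hd] at h2
      have h3 := (ENNReal.continuous_ofReal.tendsto _).comp (h2.const_mul C)
      rwa [mul_zero, ENNReal.ofReal_zero] at h3
    refine tendsto_of_tendsto_of_tendsto_of_le_of_le' tendsto_const_nhds hup
      (Filter.Eventually.of_forall fun j => zero_le) ?_
    filter_upwards [Filter.eventually_ge_atTop i] with j hij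
    rcases le_or_gt ((t : ℝ) - exitTime B (exhaustion U j) x ω) 0 with h0 | h0
    · rw [heat_of_nonpos hd h0]; exact zero_le
    · refine ENNReal.ofReal_le_ofReal (hCb _ h0 _ ?_)
      exact le_norm_sub_of_notMem_interior ((Metric.ball_subset_closedBall.trans hi).trans
        (monotone_exhaustion U hij)) (hB.exit_mem_closure (hωj j))

/-- The killed transition density is the heat kernel minus the contribution of the paths that
have left `U`. -/
theorem IsContinuousBM.heat_eq_killedKernel_add [IsProbabilityMeasure Q] (hd : d ≠ 0)
    (hB : IsContinuousBM B Q) {U : Set (Space d)} (hU : IsOpen U) {t : ℝ≥0} (ht : t ≠ 0)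
    {x y : Space d} (hx : x ∈ U) (hy : y ∈ U) :
    heat t (x - y) = killedKernel U t x y + ∫⁻ ω, exitHeat B U t x y ω ∂Q := by
  obtain ⟨δ, hδ, i, hi⟩ := exists_closedBall_subset_exhaustion hU hy
  obtain ⟨r, hr, i', hi'⟩ := exists_closedBall_subset_exhaustion hU hx
  obtain ⟨C, hC⟩ := exists_heat_le (d := d) hδ hd
  have hball : ∀ j, i ≤ j → Metric.ball y δ ⊆ exhaustion U j := fun j hij =>
    (Metric.ball_subset_closedBall.trans hi).trans (monotone_exhaustion U hij)
  have hk : Filter.Tendsto (fun j => closedKernelZero (exhaustion U j) t x y) Filter.atTop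
      (nhds (killedKernel U t x y)) :=
    tendsto_atTop_iSup (monotone_closedKernelZero_exhaustion U t x y)
  have hlim : Filter.Tendsto (fun j => ∫⁻ ω, exitHeat B (exhaustion U (j + i)) t x y ω ∂Q)
      Filter.atTop (nhds (∫⁻ ω, exitHeat B U t x y ω ∂Q)) := by
    refine tendsto_lintegral_of_dominated_convergence (fun _ => (C : ℝ≥0∞))
      (fun j => hB.measurable_exitHeat_closed hd (isClosed_exhaustion U _) ht x y)
      (fun j => Filter.Eventually.of_forall fun ω => ?_) (by simp)
      (Filter.Eventually.of_forall fun ω =>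
        (hB.tendsto_exitHeat hd hU t x hy ω).comp (Filter.tendsto_add_atTop_nat i))
    refine indicator_apply_le' (fun hω => ?_) (fun _ => zero_le)
    exact hC _ _ (le_norm_sub_of_notMem_interior (hball _ (Nat.le_add_left i j))
      (hB.exit_mem_closure hω))
  refine tendsto_nhds_unique (tendsto_const_nhds.congr' ?_)
    ((hk.comp (Filter.tendsto_add_atTop_nat i)).add hlim)
  filter_upwards [Filter.eventually_ge_atTop i'] with j hj
  have hxj : x ∈ exhaustion U (j + i) :=
    monotone_exhaustion U (by omega) (hi' (Metric.mem_closedBall_self hr.le))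
  have hyj : y ∈ exhaustion U (j + i) := hball _ (Nat.le_add_left i j) (Metric.mem_ball_self hδ)
  simp only [Function.comp_apply]
  rw [closedKernelZero_of_mem hxj hyj]
  exact hB.heat_eq_closedKernel_add hd (isClosed_exhaustion U _) ht x hδ
    (hball _ (Nat.le_add_left i j))

end FirstExit

/-! ### Exit laws and killed resolvents -/

section Resolvent

variable {d : ℕ} {Ω' : Type*} [MeasurableSpace Ω'] {B : ℝ≥0 → Ω' → Space d} {Q : Measure Ω'}
  {U : Set (Space d)}

theorem IsContinuousBM.measurableSet_exits_prod (hB : IsContinuousBM B Q) (hU : IsOpen U) :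
    MeasurableSet {q : Space d × Ω' | q.2 ∈ exits B U q.1} := by
  have : {q : Space d × Ω' | q.2 ∈ exits B U q.1} =
      (⋂ n : ℕ, {q : Space d × Ω' | q.2 ∈ aliveOn B U 0 n q.1})ᶜ := by
    ext ⟨x, ω⟩
    simp only [exits, aliveOn, mem_compl_iff, mem_iInter, mem_ofPred_eq, not_forall]
    constructor
    · rintro ⟨t, ht⟩
      obtain ⟨n, hn⟩ := exists_nat_ge t
      exact ⟨n, t, ⟨zero_le, hn⟩, ht⟩
    · rintro ⟨n, t, _, ht⟩
      exact ⟨t, ht⟩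
  rw [this]
  exact (MeasurableSet.iInter fun n => hB.measurableSet_aliveOn_prod hU zero_le).compl

theorem IsContinuousBM.measurableSet_exits (hB : IsContinuousBM B Q) (hU : IsOpen U)
    (x : Space d) : MeasurableSet (exits B U x) :=
  measurable_prodMk_left (hB.measurableSet_exits_prod hU)

theorem IsContinuousBM.exitTime_le_iff (hB : IsContinuousBM B Q) (hU : IsOpen U) {x : Space d}
    {ω : Ω'} (hω : ω ∈ exits B U x) {t : ℝ≥0} :
    exitTime B U x ω ≤ t ↔ ω ∉ aliveOn B U 0 t x := by
  constructor
  · intro h hal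
    exact hB.exit_notMem hU hω (hal _ ⟨zero_le, h⟩)
  · intro h
    simp only [aliveOn, mem_ofPred_eq, not_forall] at h
    obtain ⟨s, hs, h⟩ := h
    exact (exitTime_le h).trans hs.2

theorem exitTime_of_notMem {x : Space d} {ω : Ω'} (hω : ω ∉ exits B U x) :
    exitTime B U x ω = 0 := by
  have : {t : ℝ≥0 | x + B t ω ∉ U} = ∅ := eq_empty_of_forall_notMem fun t ht => hω ⟨t, ht⟩
  unfold exitTime
  rw [this, NNReal.sInf_empty]

theorem IsContinuousBM.measurable_exitTime_prod (hB : IsContinuousBM B Q) (hU : IsOpen U) :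
    Measurable fun q : Space d × Ω' => exitTime B U q.1 q.2 := by
  refine measurable_of_Iic fun t => ?_
  have : (fun q : Space d × Ω' => exitTime B U q.1 q.2) ⁻¹' Iic t =
      {q : Space d × Ω' | q.2 ∈ exits B U q.1}ᶜ ∪
        {q : Space d × Ω' | q.2 ∈ aliveOn B U 0 t q.1}ᶜ := by
    ext ⟨x, ω⟩
    simp only [mem_preimage, mem_Iic, mem_union, mem_compl_iff, mem_ofPred_eq]
    by_cases hω : ω ∈ exits B U x
    · rw [hB.exitTime_le_iff hU hω]
      simp [hω]
    · rw [exitTime_of_notMem hω]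
      simp [hω]
  rw [this]
  exact (hB.measurableSet_exits_prod hU).compl.union
    (hB.measurableSet_aliveOn_prod hU zero_le).compl

theorem IsContinuousBM.measurable_exitTime (hB : IsContinuousBM B Q) (hU : IsOpen U)
    (x : Space d) : Measurable (exitTime B U x) := by
  have h : Measurable fun ω : Ω' => (x, ω) := measurable_prodMk_left
  exact Measurable.comp (g := fun q : Space d × Ω' => exitTime B U q.1 q.2)
    (hB.measurable_exitTime_prod hU) h

theorem IsContinuousBM.measurable_exitPos_prod (hB : IsContinuousBM B Q) (hU : IsOpen U) :
    Measurable fun q : Space d × Ω' => q.1 + B (exitTime B U q.1 q.2) q.2 := by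
  have h1 : Measurable (Function.uncurry B) :=
    measurable_uncurry_of_continuous_of_measurable hB.cont hB.meas
  have h2 : Measurable fun q : Space d × Ω' => (exitTime B U q.1 q.2, q.2) :=
    (hB.measurable_exitTime_prod hU).prodMk measurable_snd
  exact measurable_fst.add (h1.comp h2)

theorem IsContinuousBM.measurable_exitPos (hB : IsContinuousBM B Q) (hU : IsOpen U)
    (x : Space d) : Measurable fun ω => x + B (exitTime B U x ω) ω := by
  have h : Measurable fun ω : Ω' => (x, ω) := measurable_prodMk_left
  exact Measurable.comp (g := fun q : Space d × Ω' => q.1 + B (exitTime B U q.1 q.2) q.2)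
    (hB.measurable_exitPos_prod hU) h

/-- The law of the exit position from `U`, discounted at rate `l` along the path. -/
noncomputable def discountedHarmonic (B : ℝ≥0 → Ω' → Space d) (Q : Measure Ω')
    (U : Set (Space d)) (l : ℝ) (x : Space d) : Measure (Space d) :=
  ((Q.restrict (exits B U x)).withDensity fun ω =>
    ENNReal.ofReal (Real.exp (-(l * exitTime B U x ω)))).map
    (fun ω => x + B (exitTime B U x ω) ω)

theorem discountedHarmonic_zero (B : ℝ≥0 → Ω' → Space d) (Q : Measure Ω')
    (U : Set (Space d)) (x : Space d) :
    discountedHarmonic B Q U 0 x = harmonicMeasure B Q U x := by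
  unfold discountedHarmonic harmonicMeasure exits
  simp only [zero_mul, neg_zero, Real.exp_zero, ENNReal.ofReal_one]
  rw [show (fun _ : Ω' => (1 : ℝ≥0∞)) = 1 from rfl, withDensity_one]

theorem IsContinuousBM.lintegral_discountedHarmonic (hB : IsContinuousBM B Q) (hU : IsOpen U)
    (l : ℝ) (x : Space d) {f : Space d → ℝ≥0∞} (hf : Measurable f) :
    ∫⁻ z, f z ∂(discountedHarmonic B Q U l x) = ∫⁻ ω in exits B U x,
      ENNReal.ofReal (Real.exp (-(l * exitTime B U x ω))) *
        f (x + B (exitTime B U x ω) ω) ∂Q := by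
  have hτ := hB.measurable_exitTime hU x
  have hX := hB.measurable_exitPos hU x
  unfold discountedHarmonic
  rw [lintegral_map hf hX]
  have hfX : Measurable fun ω => f (x + B (exitTime B U x ω) ω) := hf.comp hX
  exact lintegral_withDensity_eq_lintegral_mul _ (by fun_prop) hfX

theorem IsContinuousBM.lintegral_harmonicMeasure (hB : IsContinuousBM B Q) (hU : IsOpen U)
    (x : Space d) {f : Space d → ℝ≥0∞} (hf : Measurable f) :
    ∫⁻ z, f z ∂(harmonicMeasure B Q U x) =
      ∫⁻ ω in exits B U x, f (x + B (exitTime B U x ω) ω) ∂Q := by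
  rw [← discountedHarmonic_zero, hB.lintegral_discountedHarmonic hU 0 x hf]
  simp

theorem isFiniteMeasure_discountedHarmonic (B : ℝ≥0 → Ω' → Space d) (Q : Measure Ω')
    [IsProbabilityMeasure Q] (U : Set (Space d)) {l : ℝ} (hl : 0 ≤ l) (x : Space d) :
    IsFiniteMeasure (discountedHarmonic B Q U l x) := by
  unfold discountedHarmonic
  have : IsFiniteMeasure ((Q.restrict (exits B U x)).withDensity fun ω =>
      ENNReal.ofReal (Real.exp (-(l * exitTime B U x ω)))) := by
    refine isFiniteMeasure_withDensity (ne_of_lt ?_)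
    refine (lintegral_mono (g := fun _ => 1) fun ω => ?_).trans_lt (by simp [measure_lt_top])
    rw [← ENNReal.ofReal_one]
    refine ENNReal.ofReal_le_ofReal (Real.exp_le_one_iff.2 ?_)
    have : 0 ≤ l * exitTime B U x ω := mul_nonneg hl NNReal.zero_le_coe
    linarith
  infer_instance

theorem IsContinuousBM.ae_discountedHarmonic (hB : IsContinuousBM B Q) (hU : IsOpen U)
    (l : ℝ) (x : Space d) : ∀ᵐ z ∂(discountedHarmonic B Q U l x), z ∉ U := by
  rw [discountedHarmonic, ae_map_iff (hB.measurable_exitPos hU x).aemeasurable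
    hU.measurableSet.compl]
  refine withDensity_absolutelyContinuous _ _ ?_
  refine (ae_restrict_iff' (hB.measurableSet_exits hU x)).2 (Filter.Eventually.of_forall ?_)
  exact fun ω hω => hB.exit_notMem hU hω

theorem IsContinuousBM.ae_harmonicMeasure (hB : IsContinuousBM B Q) (hU : IsOpen U)
    (x : Space d) : ∀ᵐ z ∂(harmonicMeasure B Q U x), z ∉ U := by
  rw [← discountedHarmonic_zero]
  exact hB.ae_discountedHarmonic hU 0 x

theorem IsContinuousBM.exit_mem_closure_of_mem (hB : IsContinuousBM B Q) {x : Space d}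
    (hx : x ∈ U) (ω : Ω') : x + B (exitTime B U x ω) ω ∈ closure U := by
  have hlt : ∀ s < exitTime B U x ω, x + B s ω ∈ U := fun s hs => by
    by_contra hc
    exact absurd (exitTime_le hc) (not_le.2 hs)
  rcases eq_zero_or_pos (exitTime B U x ω) with h | h
  · rw [h, hB.zero, add_zero]
    exact subset_closure hx
  · have h1 : exitTime B U x ω ∈ closure (Iio (exitTime B U x ω)) := by
      rw [closure_Iio' (a := exitTime B U x ω) ⟨0, h⟩]
      exact self_mem_Iic
    exact map_mem_closure (f := fun s => x + B s ω) (hB.cont_add x ω) h1 fun s hs => hlt s hs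

theorem IsContinuousBM.ae_discountedHarmonic_closure (hB : IsContinuousBM B Q) (hU : IsOpen U)
    (l : ℝ) {x : Space d} (hx : x ∈ U) :
    ∀ᵐ z ∂(discountedHarmonic B Q U l x), z ∈ closure U := by
  refine (ae_map_iff (p := fun z => z ∈ closure U) (hB.measurable_exitPos hU x).aemeasurable
    (isClosed_closure (s := U)).measurableSet).2 ?_
  refine withDensity_absolutelyContinuous _ _ ?_
  refine (ae_restrict_iff' (hB.measurableSet_exits hU x)).2 (Filter.Eventually.of_forall ?_)
  exact fun ω _ => hB.exit_mem_closure_of_mem hx ω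

/-- Joint measurability of the exit time and position in the starting point and the path. Without
measurability in `x`, the `Measure.bind` in `sweptMeasure` could take a default value. -/
theorem IsContinuousBM.measurable_harmonicMeasure [SFinite Q] (hB : IsContinuousBM B Q)
    (hU : IsOpen U) : Measurable (harmonicMeasure B Q U) := by
  refine Measure.measurable_of_measurable_coe _ fun s hs => ?_
  have h1 : ∀ x, harmonicMeasure B Q U x s =
      ∫⁻ ω, ({q : Space d × Ω' | q.2 ∈ exits B U q.1}.indicator (fun q => s.indicator 1
        (q.1 + B (exitTime B U q.1 q.2) q.2)) (x, ω) : ℝ≥0∞) ∂Q := fun x => by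
    rw [← lintegral_indicator_one hs,
      hB.lintegral_harmonicMeasure hU x (measurable_one.indicator hs),
      ← lintegral_indicator (hB.measurableSet_exits hU x)]
    rfl
  simp_rw [h1]
  refine Measurable.lintegral_prod_right' (f := fun q => {q : Space d × Ω' | q.2 ∈ exits B U q.1}.indicator
    (fun q => s.indicator 1 (q.1 + B (exitTime B U q.1 q.2) q.2)) q) ?_
  refine Measurable.indicator ?_ (hB.measurableSet_exits_prod hU)
  exact (measurable_one.indicator hs).comp (hB.measurable_exitPos_prod hU)

theorem lintegral_exp_neg_mul_shift (l : ℝ) {φ : ℝ → ℝ≥0∞} (hφ : ∀ s < 0, φ s = 0) (τ : ℝ≥0) :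
    ∫⁻ t in Ioi (0 : ℝ), ENNReal.ofReal (Real.exp (-(l * t))) * φ (t - τ) =
      ENNReal.ofReal (Real.exp (-(l * τ))) *
        ∫⁻ t in Ioi (0 : ℝ), ENNReal.ofReal (Real.exp (-(l * t))) * φ t := by
  rw [setLIntegral_congr Ioi_ae_eq_Ici, setLIntegral_congr Ioi_ae_eq_Ici,
    ← lintegral_indicator measurableSet_Ici, ← lintegral_indicator measurableSet_Ici,
    ← lintegral_const_mul' _ _ ENNReal.ofReal_ne_top,
    ← lintegral_sub_right_eq_self (μ := (volume : Measure ℝ)) (fun t =>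
      ENNReal.ofReal (Real.exp (-(l * τ))) * (Ici (0 : ℝ)).indicator
        (fun t => ENNReal.ofReal (Real.exp (-(l * t))) * φ t) t) (τ : ℝ)]
  refine lintegral_congr fun t => ?_
  rcases lt_or_ge (t - (τ : ℝ)) 0 with h | h
  · rw [indicator_of_notMem (show t - (τ : ℝ) ∉ Ici 0 from not_le.2 h), mul_zero]
    refine indicator_apply_eq_zero.2 fun _ => ?_
    rw [hφ _ h, mul_zero]
  · have h0 : 0 ≤ t := le_trans NNReal.zero_le_coe (sub_nonneg.1 h)
    rw [indicator_of_mem (show t - (τ : ℝ) ∈ Ici 0 from h),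
      indicator_of_mem (show t ∈ Ici 0 from h0), ← mul_assoc,
      ← ENNReal.ofReal_mul (Real.exp_nonneg _), ← Real.exp_add]
    congr 4
    ring

/-- By Fubini's theorem and the translation of time by the exit time, restarting at the exit becomes
the discount factor `exp (-(l * τ))` in the Laplace transform. -/
theorem IsContinuousBM.lintegral_exit_shift [SFinite Q] (hB : IsContinuousBM B Q) (hU : IsOpen U)
    (l : ℝ) (x : Space d) {φ : ℝ × Space d → ℝ≥0∞} (hφm : Measurable φ)
    (hφ : ∀ s < 0, ∀ z, φ (s, z) = 0) :
    ∫⁻ t in Ioi (0 : ℝ), ENNReal.ofReal (Real.exp (-(l * t))) *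
        ∫⁻ ω in exits B U x, φ (t - exitTime B U x ω, x + B (exitTime B U x ω) ω) ∂Q =
      ∫⁻ z, (∫⁻ t in Ioi (0 : ℝ), ENNReal.ofReal (Real.exp (-(l * t))) * φ (t, z))
        ∂(discountedHarmonic B Q U l x) := by
  have hτ := hB.measurable_exitTime hU x
  have hX := hB.measurable_exitPos hU x
  have hm : Measurable fun q : ℝ × Ω' => ENNReal.ofReal (Real.exp (-(l * q.1))) *
      φ (q.1 - exitTime B U x q.2, x + B (exitTime B U x q.2) q.2) := by
    have h1 : Measurable fun q : ℝ × Ω' =>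
        (q.1 - (exitTime B U x q.2 : ℝ), x + B (exitTime B U x q.2) q.2) :=
      (measurable_fst.sub (hτ.comp measurable_snd).coe_nnreal_real).prodMk
        (hX.comp measurable_snd)
    exact Measurable.mul (by fun_prop) (hφm.comp h1)
  have hm2 : Measurable fun q : Space d × ℝ => ENNReal.ofReal (Real.exp (-(l * q.2))) *
      φ (q.2, q.1) := by
    have h1 : Measurable fun q : Space d × ℝ => (q.2, q.1) := measurable_snd.prodMk measurable_fst
    exact Measurable.mul (by fun_prop) (hφm.comp h1)
  rw [hB.lintegral_discountedHarmonic hU l x hm2.lintegral_prod_right']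
  simp_rw [← lintegral_const_mul' _ _ ENNReal.ofReal_ne_top]
  rw [lintegral_lintegral_swap hm.aemeasurable]
  refine lintegral_congr fun ω => ?_
  rw [lintegral_const_mul' _ _ ENNReal.ofReal_ne_top]
  exact lintegral_exp_neg_mul_shift l (φ := fun s => φ (s, x + B (exitTime B U x ω) ω))
    (fun s hs => hφ s hs _) _

/-- The resolvent density of Brownian motion killed outside `U`; for `l = 0` it is a multiple
of the Green's function. -/
noncomputable def killedResolvent (U : Set (Space d)) (l : ℝ) (x y : Space d) : ℝ≥0∞ :=
  ∫⁻ t in Ioi (0 : ℝ), ENNReal.ofReal (Real.exp (-(l * t))) * killedKernel U t x y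

theorem measurable_killedResolvent (U : Set (Space d)) (l : ℝ) :
    Measurable fun q : Space d × Space d => killedResolvent U l q.1 q.2 := by
  have h : Measurable fun q : (Space d × Space d) × ℝ =>
      ENNReal.ofReal (Real.exp (-(l * q.2))) * killedKernel U q.2 q.1.1 q.1.2 := by fun_prop
  exact h.lintegral_prod_right'

theorem Measurable.killedResolvent {α : Type*} [MeasurableSpace α] {U : Set (Space d)} {l : ℝ}
    {f g : α → Space d} (hf : Measurable f) (hg : Measurable g) :
    Measurable fun a => killedResolvent U l (f a) (g a) := by
  have h1 : Measurable fun a => (f a, g a) := hf.prodMk hg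
  have h2 := (measurable_killedResolvent U l).comp h1
  exact h2

theorem killedResolvent_comm (U : Set (Space d)) (l : ℝ) (x y : Space d) :
    killedResolvent U l x y = killedResolvent U l y x := by
  unfold killedResolvent
  simp_rw [killedKernel_comm U _ x y]

theorem killedResolvent_le (U : Set (Space d)) (l : ℝ) (x y : Space d) :
    killedResolvent U l x y ≤ heatResolvent l (x - y) :=
  lintegral_mono fun _ => mul_le_mul' le_rfl (killedKernel_le_heat U _ x y)

theorem killedResolvent_of_notMem {l : ℝ} {x y : Space d} (h : ¬ (x ∈ U ∧ y ∈ U)) :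
    killedResolvent U l x y = 0 := by
  unfold killedResolvent
  simp [killedKernel_of_notMem h]

theorem IsContinuousBM.lintegral_exitHeat_resolvent [SFinite Q] (hd : d ≠ 0)
    (hB : IsContinuousBM B Q) (hU : IsOpen U) (l : ℝ) (x y : Space d) :
    ∫⁻ t in Ioi (0 : ℝ), ENNReal.ofReal (Real.exp (-(l * t))) * ∫⁻ ω, exitHeat B U t x y ω ∂Q =
      ∫⁻ z, heatResolvent l (z - y) ∂(discountedHarmonic B Q U l x) := by
  have h := hB.lintegral_exit_shift hU l x (φ := fun q => heat q.1 (q.2 - y))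
    (Measurable.heat measurable_fst (measurable_snd.sub_const y))
    (fun s hs z => heat_of_nonpos hd hs.le _)
  unfold heatResolvent
  rw [← h]
  refine lintegral_congr fun t => ?_
  rw [← lintegral_indicator (hB.measurableSet_exits hU x)]
  rfl

/-- The resolvent density of Brownian motion splits at the exit time from `U`. -/
theorem IsContinuousBM.heatResolvent_eq_of_mem [IsProbabilityMeasure Q] (hd : d ≠ 0)
    (hB : IsContinuousBM B Q) (hU : IsOpen U) (l : ℝ) {x y : Space d} (hx : x ∈ U) (hy : y ∈ U) :
    heatResolvent l (x - y) = killedResolvent U l x y +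
      ∫⁻ z, heatResolvent l (z - y) ∂(discountedHarmonic B Q U l x) := by
  rw [← hB.lintegral_exitHeat_resolvent hd hU l x y, killedResolvent,
    ← lintegral_add_left (by fun_prop), heatResolvent]
  refine setLIntegral_congr_fun measurableSet_Ioi fun t ht => ?_
  lift t to ℝ≥0 using (mem_Ioi.1 ht).le
  have ht0 : t ≠ 0 := by rintro rfl; simp at ht
  simp only [hB.heat_eq_killedKernel_add hd hU ht0 hx hy, mul_add]

theorem IsContinuousBM.lintegral_heatResolvent_exit_le [IsProbabilityMeasure Q] (hd : d ≠ 0)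
    (hB : IsContinuousBM B Q) (hU : IsOpen U) (l : ℝ) (x y : Space d) :
    ∫⁻ z, heatResolvent l (z - y) ∂(discountedHarmonic B Q U l x) ≤ heatResolvent l (x - y) := by
  rw [← hB.lintegral_exitHeat_resolvent hd hU l x y, heatResolvent]
  refine setLIntegral_mono' measurableSet_Ioi fun t ht => ?_
  lift t to ℝ≥0 using (mem_Ioi.1 ht).le
  have ht0 : t ≠ 0 := by rintro rfl; simp at ht
  exact mul_le_mul' le_rfl (hB.lintegral_exitHeat_le hd hU ht0 x y)

theorem measurable_survival_left (U : Set (Space d)) (x : Space d) :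
    Measurable fun t : ℝ => survival U t x := by
  have h1 : Measurable fun t : ℝ => (t, x) := measurable_prodMk_right
  have h2 := (measurable_survival U).comp h1
  exact h2

theorem lintegral_killedResolvent (U : Set (Space d)) (l : ℝ) (x : Space d) :
    ∫⁻ y, killedResolvent U l x y =
      ∫⁻ t in Ioi (0 : ℝ), ENNReal.ofReal (Real.exp (-(l * t))) * survival U t x := by
  unfold killedResolvent
  rw [lintegral_lintegral_swap (by fun_prop)]
  refine lintegral_congr fun t => ?_
  rw [lintegral_const_mul' _ _ ENNReal.ofReal_ne_top, survival]

/-- The Laplace transform of the fact that at each time the path either is still alive or has left.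
-/
theorem IsContinuousBM.resolvent_mass [IsProbabilityMeasure Q] (hB : IsContinuousBM B Q)
    (hU : IsOpen U) {l : ℝ} (hl : 0 < l) (x : Space d) :
    (∫⁻ y, killedResolvent U l x y) +
      ENNReal.ofReal l⁻¹ * discountedHarmonic B Q U l x univ = ENNReal.ofReal l⁻¹ := by
  have h := hB.lintegral_exit_shift hU l x (φ := fun q => (Ici (0 : ℝ)).indicator 1 q.1)
    ((measurable_one.indicator measurableSet_Ici).comp measurable_fst)
    (fun s hs z => indicator_of_notMem (not_le.2 hs) _)
  have h1 : ∫⁻ t in Ioi (0 : ℝ), ENNReal.ofReal (Real.exp (-(l * t))) *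
      (Ici (0 : ℝ)).indicator 1 t = ENNReal.ofReal l⁻¹ := by
    rw [← lintegral_exp_neg_mul hl]
    refine setLIntegral_congr_fun measurableSet_Ioi fun t ht => ?_
    simp [(mem_Ioi.1 ht).le]
  simp only [h1, lintegral_const] at h
  have hexp : Measurable fun t : ℝ => ENNReal.ofReal (Real.exp (-(l * t))) * survival U t x :=
    Measurable.mul (by fun_prop) (measurable_survival_left U x)
  rw [lintegral_killedResolvent, ← h, ← lintegral_add_left hexp, ← lintegral_exp_neg_mul hl]
  refine setLIntegral_congr_fun measurableSet_Ioi fun t ht => ?_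
  lift t to ℝ≥0 using (mem_Ioi.1 ht).le
  have ht0 : t ≠ 0 := by rintro rfl; simp at ht
  rw [← mul_add, hB.survival_eq hU ht0]
  have hal := hB.measurableSet_aliveOn hU (zero_le (a := t)) x
  have h3 : ∫⁻ ω in exits B U x, (Ici (0 : ℝ)).indicator 1 ((t : ℝ) - exitTime B U x ω) ∂Q =
      Q (aliveOn B U 0 t x)ᶜ := by
    rw [← lintegral_indicator (hB.measurableSet_exits hU x), ← lintegral_indicator_one hal.compl]
    refine lintegral_congr fun ω => ?_
    by_cases hω : ω ∈ exits B U x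
    · rw [indicator_of_mem hω]
      have h4 := hB.exitTime_le_iff hU hω (t := t)
      by_cases h5 : ω ∈ aliveOn B U 0 t x
      · have h6 : ¬ exitTime B U x ω ≤ t := fun h => h4.1 h h5
        have h7 : ¬ (exitTime B U x ω : ℝ) ≤ t := by exact_mod_cast h6
        simp [h5, h7]
      · have h7 : (exitTime B U x ω : ℝ) ≤ t := by exact_mod_cast h4.2 h5
        simp [h5, h7]
    · rw [indicator_of_notMem hω]
      have h5 : ω ∈ aliveOn B U 0 t x := fun s _ => by
        by_contra hc
        exact hω ⟨s, hc⟩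
      simp [h5]
  rw [h3, prob_add_prob_compl hal, mul_one]

/-- The left side is at most the right side for every `y`, and by `resolvent_mass` both have
integral `1 / l` over `y`. No property of the boundary is used, so the exceptional null set cannot
be avoided here. -/
theorem IsContinuousBM.ae_heatResolvent_eq [IsProbabilityMeasure Q] (hd : d ≠ 0)
    (hB : IsContinuousBM B Q) (hU : IsOpen U) {l : ℝ} (hl : 0 < l) {x : Space d} (hx : x ∈ U) :
    ∀ᵐ y, killedResolvent U l x y +
      ∫⁻ z, heatResolvent l (z - y) ∂(discountedHarmonic B Q U l x) = heatResolvent l (x - y) := by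
  have := isFiniteMeasure_discountedHarmonic B Q U hl.le x
  have hR := measurable_heatResolvent (d := d) l
  have hm : Measurable fun y => killedResolvent U l x y :=
    Measurable.killedResolvent measurable_const measurable_id
  have hsub : Measurable fun q : Space d × Space d => heatResolvent l (q.2 - q.1) :=
    hR.comp (measurable_snd.sub measurable_fst)
  refine ae_eq_of_ae_le_of_lintegral_le (Filter.Eventually.of_forall fun y => ?_) ?_
    (hR.comp (measurable_const.sub measurable_id)).aemeasurable ?_
  · by_cases hy : y ∈ U
    · exact (hB.heatResolvent_eq_of_mem hd hU l hx hy).ge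
    · simp only [killedResolvent_of_notMem fun h : x ∈ U ∧ y ∈ U => hy h.2, zero_add]
      exact hB.lintegral_heatResolvent_exit_le hd hU l x y
  all_goals
    rw [lintegral_add_left hm, lintegral_lintegral_swap hsub.aemeasurable]
    simp_rw [lintegral_heatResolvent hl, lintegral_const]
    rw [hB.resolvent_mass hU hl]
  exact ENNReal.ofReal_ne_top

end Resolvent

/-! ### Regular boundary points and the balayage identity -/

section Balayage

variable {d : ℕ} {Ω' : Type*} [MeasurableSpace Ω'] {B : ℝ≥0 → Ω' → Space d} {Q : Measure Ω'}
  {U : Set (Space d)}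

/-- Moving the centre by at most `1` costs a constant if the variance is doubled, by `‖y - z‖ ^ 2 ≤
2 * ‖v - z‖ ^ 2 + 2`. This is the dominating function for the continuity of heat averages. -/
theorem exists_heat_le_mul_heat {r : ℝ} (hr : 0 < r) (y : Space d) : ∃ C : ℝ≥0, ∀ v : Space d,
    ‖v - y‖ ≤ 1 → ∀ z, heat r (v - z) ≤ C * heat (2 * r) (y - z) := by
  set a := (√(2 * Real.pi * r))⁻¹ ^ d with ha
  set b := (√(2 * Real.pi * (2 * r)))⁻¹ ^ d with hb
  have hb0 : 0 < b := by positivity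
  have ha0 : 0 ≤ a := by positivity
  refine ⟨(a * Real.exp (1 / (2 * r)) / b).toNNReal, fun v hv z => ?_⟩
  unfold heat
  rw [← ENNReal.ofReal, ← ENNReal.ofReal_mul (by positivity)]
  refine ENNReal.ofReal_le_ofReal ?_
  unfold heatReal
  have h1 : ‖y - z‖ ^ 2 ≤ 2 * ‖v - z‖ ^ 2 + 2 := by
    have h2 : ‖y - z‖ ≤ ‖v - z‖ + 1 := by
      calc ‖y - z‖ = ‖(v - z) - (v - y)‖ := by congr 1; abel
        _ ≤ ‖v - z‖ + ‖v - y‖ := norm_sub_le _ _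
        _ ≤ _ := by linarith
    nlinarith [norm_nonneg (y - z), norm_nonneg (v - z), sq_nonneg (‖v - z‖ - 1)]
  calc a * Real.exp (-‖v - z‖ ^ 2 / (2 * r))
      ≤ a * (Real.exp (1 / (2 * r)) * Real.exp (-‖y - z‖ ^ 2 / (2 * (2 * r)))) := by
        rw [← Real.exp_add]
        gcongr
        rw [div_add_div _ _ (by positivity) (by positivity), div_le_div_iff₀ (by positivity)
          (by positivity)]
        nlinarith [mul_pos (mul_pos hr hr) hr, mul_le_mul_of_nonneg_left h1 (by positivity : 0 ≤ 4 * r * r)]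
    _ = a * Real.exp (1 / (2 * r)) / b * (b * Real.exp (-‖y - z‖ ^ 2 / (2 * (2 * r)))) := by
        field_simp

theorem continuous_lintegral_heat {r : ℝ} (hr : 0 < r) {f : Space d → ℝ≥0∞} (hf : Measurable f)
    {M : ℝ≥0} (hM : ∀ z, f z ≤ M) : Continuous fun v => ∫⁻ z, heat r (v - z) * f z := by
  refine continuous_iff_continuousAt.2 fun y => ?_
  obtain ⟨C, hC⟩ := exists_heat_le_mul_heat hr y
  refine tendsto_lintegral_filter_of_dominated_convergence
    (fun z => C * heat (2 * r) (y - z) * M) (Filter.Eventually.of_forall fun v => by fun_prop)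
    ?_ ?_ (Filter.Eventually.of_forall fun z => ?_)
  · filter_upwards [Metric.closedBall_mem_nhds y one_pos] with v hv
    refine Filter.Eventually.of_forall fun z => mul_le_mul' (hC v ?_ z) (hM z)
    rwa [← dist_eq_norm]
  · rw [lintegral_mul_const' _ _ ENNReal.coe_ne_top, lintegral_const_mul' _ _ ENNReal.coe_ne_top,
      lintegral_heat_sub_left (by positivity), mul_one]
    exact ENNReal.mul_ne_top ENNReal.coe_ne_top ENNReal.coe_ne_top
  · refine ENNReal.Tendsto.mul_const ?_ (Or.inr ((hM z).trans_lt ENNReal.coe_lt_top).ne)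
    exact tendsto_heat hr tendsto_const_nhds (Filter.Tendsto.sub_const Filter.tendsto_id z)

theorem IsContinuousBM.survival_anti [IsProbabilityMeasure Q] (hB : IsContinuousBM B Q)
    (hU : IsOpen U) {s t : ℝ} (hs : 0 < s) (hst : s ≤ t) (x : Space d) :
    survival U t x ≤ survival U s x := by
  lift s to ℝ≥0 using hs.le
  lift t to ℝ≥0 using (hs.trans_le hst).le
  have hs0 : s ≠ 0 := by rintro rfl; simp at hs
  have hst' : s ≤ t := by exact_mod_cast hst
  have ht0 : t ≠ 0 := ((pos_of_ne_zero hs0).trans_le hst').ne'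
  rw [hB.survival_eq hU hs0, hB.survival_eq hU ht0]
  exact measure_mono fun ω h u hu => h u ⟨hu.1, hu.2.trans hst'⟩

/-- From a regular point `y`, the probability of staying in `U` during `[r, η]` tends to `0` as `r ↓
0`. For fixed `r` it is continuous in the starting point and dominates the survival up to `η`. So
the survival is small near `y`. -/
theorem IsContinuousBM.tendsto_survival_zero [IsProbabilityMeasure Q] (hB : IsContinuousBM B Q)
    (hU : IsOpen U) {y : Space d}
    (hy : ∀ᵐ ω ∂Q, ∀ ε : ℝ≥0, 0 < ε → ∃ t : ℝ≥0, 0 < t ∧ t < ε ∧ y + B t ω ∉ U)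
    {η : ℝ≥0} (hη : η ≠ 0) :
    Filter.Tendsto (survival U η) (nhds y) (nhds 0) := by
  have hη0 := pos_of_ne_zero hη
  -- The shift by `2` keeps `r n` strictly below `η`, even for `n = 0`.
  let r : ℕ → ℝ≥0 := fun n => η / (n + 2)
  have hr0 : ∀ n, 0 < r n := fun n => by simp only [r]; positivity
  have hrη : ∀ n, r n < η := fun n => by
    refine div_lt_self hη0 ?_
    have : (0 : ℝ≥0) ≤ n := zero_le
    calc (1 : ℝ≥0) < 2 := one_lt_two
      _ ≤ n + 2 := le_add_self
  have hrm : Antitone r := fun m n hmn => by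
    simp only [r]
    gcongr
  have hlim : Filter.Tendsto (fun n => Q (aliveOn B U (r n) η y)) Filter.atTop (nhds 0) := by
    have h0 : Q (⋂ n, aliveOn B U (r n) η y) = 0 := by
      refine measure_mono_null (fun ω hω => ?_) (ae_iff.1 hy)
      simp only [mem_ofPred_eq]
      push Not
      refine ⟨η, hη0, fun t ht htη => ?_⟩
      have hrl : ∃ n, r n ≤ t := by
        obtain ⟨n, hn⟩ := exists_nat_ge (η / t)
        refine ⟨n, ?_⟩
        simp only [r]
        rw [div_le_iff₀ (by positivity)]
        rw [div_le_iff₀ ht] at hn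
        refine hn.trans ?_
        rw [mul_comm t]
        gcongr
        exact le_self_add
      obtain ⟨n, hn⟩ := hrl
      exact mem_iInter.1 hω n t ⟨hn, htη.le⟩
    rw [← h0]
    exact tendsto_measure_iInter_atTop
      (fun n => (hB.measurableSet_aliveOn hU (hrη n).le y).nullMeasurableSet)
      (fun m n hmn ω h s hs => h s ⟨(hrm hmn).trans hs.1, hs.2⟩) ⟨0, measure_ne_top _ _⟩
  refine ENNReal.tendsto_nhds_zero.2 fun ε hε => ?_
  obtain ⟨n, hn⟩ := ((tendsto_order.1 hlim).2 ε hε).exists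
  have hη' : r n + (η - r n) = η := add_tsub_cancel_of_le (hrη n).le
  have hs0 : η - r n ≠ 0 := (tsub_pos_of_lt (hrη n)).ne'
  have hc := continuous_lintegral_heat (r := r n) (by exact_mod_cast hr0 n)
    (measurable_survival_const U ((η - r n : ℝ≥0) : ℝ)) (M := 1)
    (fun z => by
      rw [ENNReal.coe_one]
      exact survival_le_one U (by exact_mod_cast pos_of_ne_zero hs0) z)
  have hc' := hc.tendsto y
  rw [hB.lintegral_heat_survival hU (hr0 n).ne' hs0, hη'] at hc'
  filter_upwards [(tendsto_order.1 hc').2 ε hn] with v hv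
  refine le_trans ?_ hv.le
  rw [hB.lintegral_heat_survival hU (hr0 n).ne' hs0, hη', hB.survival_eq hU hη]
  exact measure_mono fun ω h s hs => h s ⟨zero_le, hs.2⟩

/-- Split at time `t / 2`, bound the half that starts at `x` by the maximum of the heat kernel, and
integrate the other half. -/
theorem killedKernel_le_survival (U : Set (Space d)) {s t : ℝ} (hs : 0 < s) (hst : s ≤ t)
    (x y : Space d) : killedKernel U t x y ≤
      ENNReal.ofReal ((√(2 * Real.pi * (s / 2)))⁻¹ ^ d) * survival U (t / 2) y := by
  rw [killedKernel_half U (hs.trans_le hst), survival,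
    ← lintegral_const_mul' _ _ ENNReal.ofReal_ne_top]
  refine lintegral_mono fun z => mul_le_mul' ?_ (killedKernel_comm U _ _ _).le
  refine (killedKernel_le_heat U _ _ _).trans (ENNReal.ofReal_le_ofReal ?_)
  refine (heatReal_le_inv_sqrt_pow _ _).trans ?_
  have h1 : 0 < √(2 * Real.pi * (s / 2)) := by positivity
  gcongr

/-- Times up to `η` contribute at most `η * C`, since the target stays away from `x`. Later times
are bounded by the survival from the target, which vanishes at a regular boundary point; the
discount makes the time integral finite. -/
theorem IsContinuousBM.tendsto_killedResolvent_zero [IsProbabilityMeasure Q] (hd : d ≠ 0)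
    (hB : IsContinuousBM B Q) (hU : IsOpen U) (hreg : HasRegularBoundary B Q U) {l : ℝ}
    (hl : 0 < l) {x y : Space d} (hx : x ∈ U) (hy : y ∉ U) :
    Filter.Tendsto (killedResolvent U l x) (nhds y) (nhds 0) := by
  by_cases hyc : y ∈ closure U
  swap
  · refine tendsto_const_nhds.congr' ?_
    filter_upwards [isClosed_closure.isOpen_compl.mem_nhds hyc] with v hv
    exact (killedResolvent_of_notMem fun h => hv (subset_closure h.2)).symm
  have hfr : y ∈ frontier U := by
    rw [hU.frontier_eq]
    exact ⟨hyc, hy⟩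
  have hxy : 0 < ‖x - y‖ / 2 := by
    have : x - y ≠ 0 := sub_ne_zero.2 fun h => hy (h ▸ hx)
    have := norm_pos_iff.2 this
    positivity
  obtain ⟨C, hC⟩ := exists_heat_le (d := d) hxy hd
  refine ENNReal.tendsto_nhds_zero.2 fun ε hε => ?_
  have hsmall : ∃ η : ℝ≥0, η ≠ 0 ∧ (η : ℝ≥0∞) * C < ε := by
    have h1 : Filter.Tendsto (fun η : ℝ≥0 => (η : ℝ≥0∞) * C) (nhdsWithin 0 (Ioi 0)) (nhds 0) := by
      have h2 : Continuous fun η : ℝ≥0 => ((η * C : ℝ≥0) : ℝ≥0∞) := by fun_prop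
      have h3 := h2.tendsto 0
      simp only [zero_mul, ENNReal.coe_zero, ENNReal.coe_mul] at h3
      exact h3.mono_left nhdsWithin_le_nhds
    obtain ⟨η, h2, h3⟩ := (((tendsto_order.1 h1).2 ε hε).and self_mem_nhdsWithin).exists
    exact ⟨η, (show (0 : ℝ≥0) < η from h3).ne', h2⟩
  obtain ⟨η, hη, hηC⟩ := hsmall
  have hη0 : (0 : ℝ) < η := by exact_mod_cast pos_of_ne_zero hη
  set c := ENNReal.ofReal ((√(2 * Real.pi * ((η : ℝ) / 2)))⁻¹ ^ d) with hc
  have hbound : ∀ᶠ v in nhds y, killedResolvent U l x v ≤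
      η * C + c * survival U ((η / 2 : ℝ≥0) : ℝ) v * ENNReal.ofReal l⁻¹ := by
    filter_upwards [Metric.ball_mem_nhds y hxy] with v hv
    have hxv : ‖x - y‖ / 2 ≤ ‖x - v‖ := by
      rw [Metric.mem_ball, dist_eq_norm] at hv
      have : ‖x - y‖ ≤ ‖x - v‖ + ‖v - y‖ := by
        calc ‖x - y‖ = ‖(x - v) + (v - y)‖ := by congr 1; abel
          _ ≤ _ := norm_add_le _ _
      linarith
    have hpt : ∀ t ∈ Ioi (0 : ℝ), ENNReal.ofReal (Real.exp (-(l * t))) * killedKernel U t x v ≤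
        (Ioc (0 : ℝ) η).indicator (fun _ => (C : ℝ≥0∞)) t +
          c * survival U ((η / 2 : ℝ≥0) : ℝ) v * ENNReal.ofReal (Real.exp (-(l * t))) := by
      intro t ht
      rcases le_or_gt t η with h | h
      · refine le_add_right ?_
        rw [indicator_of_mem (show t ∈ Ioc (0 : ℝ) η from ⟨ht, h⟩), ← one_mul (C : ℝ≥0∞)]
        refine mul_le_mul' ?_ ((killedKernel_le_heat U _ _ _).trans (hC _ _ hxv))
        rw [← ENNReal.ofReal_one]
        refine ENNReal.ofReal_le_ofReal (Real.exp_le_one_iff.2 ?_)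
        have := mul_pos hl (mem_Ioi.1 ht)
        linarith
      · refine le_add_left ?_
        rw [mul_comm]
        refine mul_le_mul' ((killedKernel_le_survival U hη0 h.le x v).trans
          (mul_le_mul' le_rfl ?_)) le_rfl
        refine hB.survival_anti hU ?_ ?_ v
        · push_cast; positivity
        · push_cast; linarith
    refine (setLIntegral_mono' measurableSet_Ioi hpt).trans ?_
    rw [lintegral_add_left (measurable_const.indicator measurableSet_Ioc),
      lintegral_indicator measurableSet_Ioc,
      Measure.restrict_restrict measurableSet_Ioc, setLIntegral_const, mul_comm (C : ℝ≥0∞)]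
    refine add_le_add (mul_le_mul' ?_ le_rfl) ?_
    · refine (measure_mono inter_subset_left).trans ?_
      rw [Real.volume_Ioc, sub_zero, ENNReal.ofReal_coe_nnreal]
    · rw [lintegral_const_mul _ (by fun_prop), lintegral_exp_neg_mul hl]
  have hS := hB.tendsto_survival_zero hU (hreg y hfr) (η := η / 2)
    (by have := pos_of_ne_zero hη; positivity)
  have hlim : Filter.Tendsto (fun v => (η : ℝ≥0∞) * C +
      c * survival U ((η / 2 : ℝ≥0) : ℝ) v * ENNReal.ofReal l⁻¹) (nhds y) (nhds (η * C)) := by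
    have h1 := (ENNReal.Tendsto.mul_const (ENNReal.Tendsto.const_mul hS
      (Or.inr (ENNReal.ofReal_ne_top (r := (√(2 * Real.pi * ((η : ℝ) / 2)))⁻¹ ^ d))))
      (Or.inr (ENNReal.ofReal_ne_top (r := l⁻¹)))).const_add ((η : ℝ≥0∞) * C)
    rwa [mul_zero, zero_mul, add_zero] at h1
  filter_upwards [hbound, (tendsto_order.1 hlim).2 ε hηC] with v h1 h2
  exact h1.trans h2.le

/-- An approximate identity for a function that is merely integrable: away from `y` the kernel is
uniformly `O(√s ^ d)`, and near `y` the function is small. -/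
theorem tendsto_lintegral_heat_zero (hd : d ≠ 0) {g : Space d → ℝ≥0∞}
    (hint : ∫⁻ v, g v ≠ ∞) {y : Space d} (hlim : Filter.Tendsto g (nhds y) (nhds 0)) :
    Filter.Tendsto (fun s : ℝ => ∫⁻ v, heat s (y - v) * g v) (nhdsWithin 0 (Ioi 0)) (nhds 0) := by
  refine ENNReal.tendsto_nhds_zero.2 fun ε hε => ?_
  obtain ⟨δ, hδ, hδg⟩ := Metric.eventually_nhds_iff.1
    ((ENNReal.tendsto_nhds_zero.1 hlim) (ε / 2) (ENNReal.half_pos hε.ne'))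
  obtain ⟨C, hC, hCb⟩ := heatReal_le_mul_sqrt_pow (d := d) hδ
  have h1 : Filter.Tendsto (fun s : ℝ => ENNReal.ofReal (C * √s ^ d) * ∫⁻ v, g v)
      (nhdsWithin 0 (Ioi 0)) (nhds 0) := by
    have h2 : Continuous fun s : ℝ => ENNReal.ofReal (C * √s ^ d) :=
      ENNReal.continuous_ofReal.comp (by fun_prop)
    have h3 := h2.tendsto 0
    rw [Real.sqrt_zero, zero_pow hd, mul_zero, ENNReal.ofReal_zero] at h3
    have h4 := ENNReal.Tendsto.mul_const (h3.mono_left (nhdsWithin_le_nhds (s := Ioi 0))) (Or.inr hint)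
    rwa [zero_mul] at h4
  filter_upwards [(ENNReal.tendsto_nhds_zero.1 h1) (ε / 2) (ENNReal.half_pos hε.ne'),
    self_mem_nhdsWithin] with s hs hs0
  have hs0 : 0 < s := hs0
  calc ∫⁻ v, heat s (y - v) * g v
      ≤ ∫⁻ v, (heat s (y - v) * (ε / 2) + ENNReal.ofReal (C * √s ^ d) * g v) := by
        refine lintegral_mono fun v => ?_
        rcases lt_or_ge (dist v y) δ with h | h
        · exact le_add_right (mul_le_mul' le_rfl (hδg h))
        · refine le_add_left (mul_le_mul' (ENNReal.ofReal_le_ofReal (hCb s hs0 _ ?_)) le_rfl)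
          rwa [← dist_eq_norm, dist_comm]
    _ = ε / 2 + ENNReal.ofReal (C * √s ^ d) * ∫⁻ v, g v := by
        rw [lintegral_add_left (by fun_prop), lintegral_mul_const _ (by fun_prop),
          lintegral_heat_sub_left hs0, one_mul, lintegral_const_mul' _ _ ENNReal.ofReal_ne_top]
    _ ≤ ε / 2 + ε / 2 := by gcongr
    _ = ε := ENNReal.add_halves ε

theorem tendsto_heatResolvent_tail (l : ℝ) (z : Space d) :
    Filter.Tendsto (fun n : ℕ => ∫⁻ t in Ioi (1 / ((n : ℝ) + 1)),
      ENNReal.ofReal (Real.exp (-(l * t))) * heat t z) Filter.atTop (nhds (heatResolvent l z)) := by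
  have hm : Monotone fun n : ℕ => Ioi (1 / ((n : ℝ) + 1)) := fun m n hmn =>
    Ioi_subset_Ioi (one_div_le_one_div_of_le (by positivity) (by gcongr))
  have hU : ⋃ n : ℕ, Ioi (1 / ((n : ℝ) + 1)) = Ioi 0 := by
    ext t
    simp only [mem_iUnion, mem_Ioi]
    exact ⟨fun ⟨n, hn⟩ => lt_trans (by positivity) hn, fun ht => exists_nat_one_div_lt ht⟩
  rw [heatResolvent, ← hU, setLIntegral_iUnion_of_directed _ hm.directed_le]
  exact tendsto_atTop_iSup fun m n hmn => lintegral_mono_set (hm hmn)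

theorem measurable_heatResolvent_tail (l s : ℝ) : Measurable fun z : Space d =>
    ∫⁻ t in Ioi s, ENNReal.ofReal (Real.exp (-(l * t))) * heat t z := by
  have h : Measurable fun q : Space d × ℝ =>
      ENNReal.ofReal (Real.exp (-(l * q.2))) * heat q.2 q.1 := by fun_prop
  exact h.lintegral_prod_right'

/-- The resolvent density of Brownian motion splits at the exit time from `U`, when all boundary
points of `U` are regular. -/
theorem IsContinuousBM.heatResolvent_eq [IsProbabilityMeasure Q] (hd : d ≠ 0)
    (hB : IsContinuousBM B Q) (hU : IsOpen U) (hreg : HasRegularBoundary B Q U) {l : ℝ}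
    (hl : 0 < l) {x : Space d} (hx : x ∈ U) (y : Space d) :
    heatResolvent l (x - y) = killedResolvent U l x y +
      ∫⁻ z, heatResolvent l (z - y) ∂(discountedHarmonic B Q U l x) := by
  by_cases hy : y ∈ U
  · exact hB.heatResolvent_eq_of_mem hd hU l hx hy
  rw [killedResolvent_of_notMem fun h => hy h.2, zero_add]
  have := isFiniteMeasure_discountedHarmonic B Q U hl.le x
  have hR := measurable_heatResolvent (d := d) l
  have hG : Measurable fun v => killedResolvent U l x v :=
    Measurable.killedResolvent measurable_const measurable_id
  set ν := discountedHarmonic B Q U l x with hν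
  -- For `y ∉ U` the identity known almost everywhere is averaged by the heat kernel at time `s`.
  -- The two free terms become resolvents with the times before `s` deleted and increase to the
  -- desired ones as `s ↓ 0`. The killed term `A s` tends to `0` by regularity.
  let A : ℝ → ℝ≥0∞ := fun s => ENNReal.ofReal (Real.exp (-(l * s))) *
    ∫⁻ v, heat s (y - v) * killedResolvent U l x v
  have hsplit : ∀ s > 0, ∫⁻ t in Ioi s, ENNReal.ofReal (Real.exp (-(l * t))) * heat t (x - y) =
      A s + ∫⁻ z, (∫⁻ t in Ioi s, ENNReal.ofReal (Real.exp (-(l * t))) * heat t (z - y)) ∂ν := by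
    intro s hs
    simp_rw [← lintegral_heat_mul_heatResolvent l hs]
    have hsub : Measurable fun q : Space d × Space d => heatResolvent l (q.2 - q.1) :=
      hR.comp (measurable_snd.sub measurable_fst)
    have hm1 : Measurable fun q : Space d × Space d =>
        heat s (y - q.1) * heatResolvent l (q.2 - q.1) := Measurable.mul (by fun_prop) hsub
    have hm2 : Measurable fun v => heat s (y - v) * killedResolvent U l x v :=
      Measurable.mul (by fun_prop) hG
    rw [lintegral_const_mul' _ _ ENNReal.ofReal_ne_top, ← mul_add,
      lintegral_lintegral_swap (f := fun z v => heat s (y - v) * heatResolvent l (z - v))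
        (hm1.comp measurable_swap).aemeasurable, ← lintegral_add_left hm2]
    congr 1
    refine lintegral_congr_ae ?_
    filter_upwards [hB.ae_heatResolvent_eq hd hU hl hx] with v hv
    rw [← hv, mul_add, lintegral_const_mul' _ _ (heat_ne_top _ _)]
  have hA : Filter.Tendsto A (nhdsWithin 0 (Ioi 0)) (nhds 0) := by
    have hfin : ∫⁻ v, killedResolvent U l x v ≠ ∞ :=
      ((le_self_add.trans (hB.resolvent_mass hU hl x).le).trans_lt ENNReal.ofReal_lt_top).ne
    have h1 := tendsto_lintegral_heat_zero hd hfin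
      (hB.tendsto_killedResolvent_zero hd hU hreg hl hx hy)
    have h2 : Continuous fun s : ℝ => ENNReal.ofReal (Real.exp (-(l * s))) :=
      ENNReal.continuous_ofReal.comp (by fun_prop)
    have h3 := (h2.tendsto 0).mono_left (nhdsWithin_le_nhds (s := Ioi 0))
    have h4 := ENNReal.Tendsto.mul h3 (Or.inr ENNReal.zero_ne_top) h1
      (Or.inr ENNReal.ofReal_ne_top)
    rwa [mul_zero] at h4
  have hseq : Filter.Tendsto (fun n : ℕ => 1 / ((n : ℝ) + 1)) Filter.atTop
      (nhdsWithin 0 (Ioi 0)) :=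
    tendsto_nhdsWithin_iff.2 ⟨tendsto_one_div_add_atTop_nhds_zero_nat,
      Filter.Eventually.of_forall fun n => by simp only [mem_Ioi]; positivity⟩
  have hW : Filter.Tendsto (fun n : ℕ => ∫⁻ z, (∫⁻ t in Ioi (1 / ((n : ℝ) + 1)),
      ENNReal.ofReal (Real.exp (-(l * t))) * heat t (z - y)) ∂ν) Filter.atTop
      (nhds (∫⁻ z, heatResolvent l (z - y) ∂ν)) := by
    refine lintegral_tendsto_of_tendsto_of_monotone (fun n =>
      ((measurable_heatResolvent_tail l _).comp (measurable_id.sub_const y)).aemeasurable)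
      (Filter.Eventually.of_forall fun z m n hmn => lintegral_mono_set (Ioi_subset_Ioi ?_))
      (Filter.Eventually.of_forall fun z => tendsto_heatResolvent_tail l (z - y))
    exact one_div_le_one_div_of_le (by positivity) (by gcongr)
  have h := (hA.comp hseq).add hW
  rw [zero_add] at h
  refine tendsto_nhds_unique (tendsto_heatResolvent_tail l (x - y)) (h.congr fun n => ?_)
  exact (hsplit _ (by positivity)).symm

theorem lintegral_heatResolvent_ne_top {l : ℝ} (hl : 0 < l) {ν : Measure (Space d)}
    [IsFiniteMeasure ν] (hU : IsOpen U) (hν : ∀ᵐ z ∂ν, z ∉ U) {x : Space d} (hx : x ∈ U) :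
    ∫⁻ z, heatResolvent l (z - x) ∂ν ≠ ∞ := by
  obtain ⟨δ, hδ, hball⟩ := Metric.isOpen_iff.1 hU x hx
  obtain ⟨C, hC⟩ := heatResolvent_le_of_le_norm (d := d) hl hδ
  refine ((lintegral_mono_ae (g := fun _ => (C : ℝ≥0∞)) ?_).trans_lt ?_).ne
  · filter_upwards [hν] with z hz
    refine hC _ ?_
    rw [← dist_eq_norm]
    by_contra h
    exact hz (hball (not_le.1 h))
  · rw [lintegral_const]
    exact ENNReal.mul_lt_top ENNReal.coe_lt_top (measure_lt_top _ _)

/-- Inside the exit term from `O`, split the free resolvent from `y` at the exit from `D`. By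
Fubini's theorem the double exit term is the `O`-exit average of the resolvent at points `z' ∉ D`,
where the killed part for `O` vanishes. It therefore reduces to the single exit term from `D`, which
is finite and cancels. -/
theorem IsContinuousBM.killedResolvent_balayage_of_pos [IsProbabilityMeasure Q] (hd : d ≠ 0)
    (hB : IsContinuousBM B Q) {O D : Set (Space d)} (hO : IsOpen O) (hD : IsOpen D) (hOD : O ⊆ D)
    (hOreg : HasRegularBoundary B Q O) (hDreg : HasRegularBoundary B Q D) {l : ℝ} (hl : 0 < l)
    {x y : Space d} (hx : x ∈ O) (hy : y ∈ D) :
    killedResolvent D l x y = killedResolvent O l x y +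
      ∫⁻ z, killedResolvent D l z y ∂(discountedHarmonic B Q O l x) := by
  have := isFiniteMeasure_discountedHarmonic B Q O hl.le x
  have := isFiniteMeasure_discountedHarmonic B Q D hl.le y
  have hR := measurable_heatResolvent (d := d) l
  set ν := discountedHarmonic B Q O l x with hν
  set κ := discountedHarmonic B Q D l y with hκ
  have h1 := hB.heatResolvent_eq hd hD hDreg hl hy
  have h2 := hB.heatResolvent_eq hd hO hOreg hl hx
  have hG : Measurable fun z => killedResolvent D l y z :=
    Measurable.killedResolvent measurable_const measurable_id
  have hsub : Measurable fun q : Space d × Space d => heatResolvent l (q.2 - q.1) :=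
    hR.comp (measurable_snd.sub measurable_fst)
  have h3 : ∫⁻ z, heatResolvent l (z - y) ∂ν = (∫⁻ z, killedResolvent D l z y ∂ν) +
      ∫⁻ z', heatResolvent l (z' - x) ∂κ := by
    calc ∫⁻ z, heatResolvent l (z - y) ∂ν
        = ∫⁻ z, (killedResolvent D l y z + ∫⁻ z', heatResolvent l (z' - z) ∂κ) ∂ν :=
          lintegral_congr fun z => by rw [heatResolvent_sub_comm, h1 z]
      _ = (∫⁻ z, killedResolvent D l z y ∂ν) +
          ∫⁻ z', (∫⁻ z, heatResolvent l (z - z') ∂ν) ∂κ := by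
          rw [lintegral_add_left hG, lintegral_lintegral_swap hsub.aemeasurable]
          simp_rw [killedResolvent_comm D l y, heatResolvent_sub_comm l _ _]
      _ = _ := by
          congr 1
          refine lintegral_congr_ae ?_
          filter_upwards [hB.ae_discountedHarmonic hD l y] with z' hz'
          rw [heatResolvent_sub_comm l z' x, h2 z',
            killedResolvent_of_notMem fun h => hz' (hOD h.2), zero_add]
  have hfin : ∫⁻ z', heatResolvent l (z' - x) ∂κ ≠ ∞ :=
    lintegral_heatResolvent_ne_top hl hD (hB.ae_discountedHarmonic hD l y) (hOD hx)
  have h4 := h1 x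
  rw [heatResolvent_sub_comm, h2 y, h3, killedResolvent_comm D l y x, ← add_assoc] at h4
  exact ((ENNReal.add_left_inj hfin).1 h4).symm

theorem tendsto_exp_neg_div (t : ℝ) : Filter.Tendsto
    (fun n : ℕ => ENNReal.ofReal (Real.exp (-(1 / ((n : ℝ) + 1) * t)))) Filter.atTop (nhds 1) := by
  have h1 : Continuous fun s : ℝ => ENNReal.ofReal (Real.exp (-(s * t))) :=
    ENNReal.continuous_ofReal.comp (by fun_prop)
  have h2 := (h1.tendsto 0).comp tendsto_one_div_add_atTop_nhds_zero_nat
  rw [zero_mul, neg_zero, Real.exp_zero, ENNReal.ofReal_one] at h2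
  exact h2

theorem monotone_exp_neg_div {t : ℝ} (ht : 0 ≤ t) : Monotone
    (fun n : ℕ => ENNReal.ofReal (Real.exp (-(1 / ((n : ℝ) + 1) * t)))) := fun m n hmn => by
  refine ENNReal.ofReal_le_ofReal (Real.exp_le_exp.2 (neg_le_neg ?_))
  exact mul_le_mul_of_nonneg_right (one_div_le_one_div_of_le (by positivity) (by gcongr)) ht

theorem monotone_killedResolvent (U : Set (Space d)) (x y : Space d) :
    Monotone fun n : ℕ => killedResolvent U (1 / ((n : ℝ) + 1)) x y := fun _ _ hmn =>
  setLIntegral_mono' measurableSet_Ioi fun _ ht =>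
    mul_le_mul' (monotone_exp_neg_div (mem_Ioi.1 ht).le hmn) le_rfl

theorem tendsto_killedResolvent (U : Set (Space d)) (x y : Space d) :
    Filter.Tendsto (fun n : ℕ => killedResolvent U (1 / ((n : ℝ) + 1)) x y) Filter.atTop
      (nhds (killedResolvent U 0 x y)) := by
  unfold killedResolvent
  refine lintegral_tendsto_of_tendsto_of_monotone (fun n => by fun_prop) ?_ ?_
  · filter_upwards [ae_restrict_mem measurableSet_Ioi] with t ht m n hmn
    exact mul_le_mul' (monotone_exp_neg_div (mem_Ioi.1 ht).le hmn) le_rfl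
  · refine Filter.Eventually.of_forall fun t => ?_
    have h := ENNReal.Tendsto.mul_const (b := killedKernel U t x y) (tendsto_exp_neg_div t)
      (Or.inl one_ne_zero)
    simpa using h

/-- The Green's function of a domain `D` splits at the exit time from a subdomain `O`. -/
theorem IsContinuousBM.killedResolvent_balayage [IsProbabilityMeasure Q] (hd : d ≠ 0)
    (hB : IsContinuousBM B Q) {O D : Set (Space d)} (hO : IsOpen O) (hD : IsOpen D) (hOD : O ⊆ D)
    (hOreg : HasRegularBoundary B Q O) (hDreg : HasRegularBoundary B Q D)
    {x y : Space d} (hx : x ∈ O) (hy : y ∈ D) :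
    killedResolvent D 0 x y = killedResolvent O 0 x y +
      ∫⁻ z, killedResolvent D 0 z y ∂(harmonicMeasure B Q O x) := by
  have hX := hB.measurable_exitPos hO x
  have hτ := hB.measurable_exitTime hO x
  have hG : ∀ l, Measurable fun z => killedResolvent D l z y := fun l =>
    Measurable.killedResolvent measurable_id measurable_const
  refine tendsto_nhds_unique (tendsto_killedResolvent D x y) ?_
  refine Filter.Tendsto.congr (fun n => (hB.killedResolvent_balayage_of_pos hd hO hD hOD hOreg
    hDreg (l := 1 / ((n : ℝ) + 1)) (by positivity) hx hy).symm) ?_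
  refine (tendsto_killedResolvent O x y).add ?_
  rw [hB.lintegral_harmonicMeasure hO x (hG 0)]
  simp_rw [hB.lintegral_discountedHarmonic hO _ x (hG _)]
  refine lintegral_tendsto_of_tendsto_of_monotone (fun n => ?_)
    (Filter.Eventually.of_forall fun ω m n hmn => ?_) (Filter.Eventually.of_forall fun ω => ?_)
  · exact (Measurable.mul (by fun_prop) ((hG _).comp hX)).aemeasurable
  · exact mul_le_mul' (monotone_exp_neg_div NNReal.zero_le_coe hmn)
      (monotone_killedResolvent D _ y hmn)
  · have h := ENNReal.Tendsto.mul (tendsto_exp_neg_div (exitTime B O x ω))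
      (Or.inl one_ne_zero) (tendsto_killedResolvent D (x + B (exitTime B O x ω) ω) y)
      (Or.inr ENNReal.one_ne_top)
    rwa [one_mul] at h

end Balayage

/-! ### Time integrals of the heat kernel and the fundamental solution -/

section Radial

variable {d : ℕ}

theorem setLIntegral_neg_deriv {f g : ℝ → ℝ} {a b : ℝ} (hab : a ≤ b)
    (hf : ∀ r ∈ Icc a b, HasDerivAt f (-g r) r) (hg : ContinuousOn g (Icc a b))
    (hg0 : ∀ r ∈ Icc a b, 0 ≤ g r) :
    ∫⁻ r in Ioc a b, ENNReal.ofReal (g r) = ENNReal.ofReal (f a - f b) := by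
  have hint : IntervalIntegrable (fun r => -g r) volume a b :=
    ContinuousOn.intervalIntegrable (by rw [uIcc_of_le hab]; exact hg.neg)
  have h := intervalIntegral.integral_eq_sub_of_hasDerivAt
    (fun r hr => hf r (by rwa [uIcc_of_le hab] at hr)) hint
  rw [intervalIntegral.integral_of_le hab, integral_neg] at h
  rw [← neg_sub (f b), ← h, neg_neg, ofReal_integral_eq_lintegral_ofReal]
  · exact (hg.integrableOn_Icc).mono_set Ioc_subset_Icc_self
  · filter_upwards [ae_restrict_mem measurableSet_Ioc] with r hr
    exact hg0 r (Ioc_subset_Icc_self hr)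

/-- The heat kernel as a function of the distance. -/
noncomputable def heatRadial (d : ℕ) (t r : ℝ) : ℝ :=
  (√(2 * Real.pi * t))⁻¹ ^ d * Real.exp (-r ^ 2 / (2 * t))

theorem heatReal_eq_heatRadial (t : ℝ) (z : Space d) : heatReal t z = heatRadial d t ‖z‖ := rfl

theorem heatRadial_nonneg (d : ℕ) (t r : ℝ) : 0 ≤ heatRadial d t r := by
  unfold heatRadial; positivity

theorem hasDerivAt_heatRadial (d : ℕ) {t : ℝ} (ht : 0 < t) (r : ℝ) :
    HasDerivAt (heatRadial d t) (-(r / t * heatRadial d t r)) r := by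
  have h1 : HasDerivAt (fun r : ℝ => -r ^ 2 / (2 * t)) (-(r / t)) r := by
    have h2 := ((hasDerivAt_pow 2 r).neg).div_const (2 * t)
    refine h2.congr_deriv ?_
    field_simp
    simp
  refine (h1.exp.const_mul ((√(2 * Real.pi * t))⁻¹ ^ d)).congr_deriv ?_
  unfold heatRadial
  ring

theorem continuous_heatRadial (d : ℕ) (t : ℝ) : Continuous (heatRadial d t) := by
  unfold heatRadial; fun_prop

theorem measurable_heatRadial (d : ℕ) : Measurable fun q : ℝ × ℝ => heatRadial d q.1 q.2 := by
  unfold heatRadial; fun_prop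

theorem ofReal_heatRadial_sub (d : ℕ) {t : ℝ} (ht : 0 < t) {a b : ℝ} (ha : 0 ≤ a) (hab : a ≤ b) :
    ∫⁻ r in Ioc a b, ENNReal.ofReal (r / t * heatRadial d t r) =
      ENNReal.ofReal (heatRadial d t a - heatRadial d t b) := by
  refine setLIntegral_neg_deriv hab (fun r _ => hasDerivAt_heatRadial d ht r) ?_ fun r hr => ?_
  · have := continuous_heatRadial d t
    fun_prop
  · exact mul_nonneg (div_nonneg (ha.trans hr.1) ht.le) (heatRadial_nonneg d t r)

/-- The total flux of the heat kernel through the unit sphere, up to normalization. -/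
noncomputable def heatFlux (d : ℕ) : ℝ≥0∞ :=
  ∫⁻ t in Ioi (0 : ℝ), ENNReal.ofReal (1 / t * heatRadial d t 1)

/-- Brownian scaling, `t = r ^ 2 * s`. The flux is proportional to `r ^ (1 - d)`, the rate of decay
of the fundamental solution, whatever the value of the constant. -/
theorem lintegral_heatFlux_scale (hd : d ≠ 0) {r : ℝ} (hr : 0 < r) :
    ∫⁻ t in Ioi (0 : ℝ), ENNReal.ofReal (r / t * heatRadial d t r) =
      ENNReal.ofReal ((r ^ (d - 1))⁻¹) * heatFlux d := by
  have himg : (fun s : ℝ => r ^ 2 * s) '' Ioi 0 = Ioi 0 := by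
    rw [image_mul_left_Ioi (by positivity), mul_zero]
  have h := lintegral_image_eq_lintegral_abs_deriv_mul (s := Ioi (0 : ℝ)) measurableSet_Ioi
    (f := fun s : ℝ => r ^ 2 * s) (f' := fun _ => r ^ 2)
    (fun s _ => by simpa using ((hasDerivAt_id s).const_mul (r ^ 2)).hasDerivWithinAt)
    (fun s _ u _ hsu => mul_left_cancel₀ (by positivity) hsu)
    (fun t => ENNReal.ofReal (r / t * heatRadial d t r))
  rw [himg] at h
  rw [h, heatFlux, ← lintegral_const_mul' _ _ ENNReal.ofReal_ne_top]
  refine setLIntegral_congr_fun measurableSet_Ioi fun s hs => ?_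
  have hs : 0 < s := hs
  rw [← ENNReal.ofReal_mul (abs_nonneg _), ← ENNReal.ofReal_mul (by positivity)]
  congr 1
  unfold heatRadial
  rw [abs_of_pos (by positivity), show 2 * Real.pi * (r ^ 2 * s) = r ^ 2 * (2 * Real.pi * s) by ring,
    Real.sqrt_mul (by positivity), Real.sqrt_sq hr.le, mul_inv, mul_pow,
    show -r ^ 2 / (2 * (r ^ 2 * s)) = -1 ^ 2 / (2 * s) by field_simp]
  obtain ⟨k, rfl⟩ := Nat.exists_eq_succ_of_ne_zero hd
  rw [Nat.succ_sub_one, Nat.succ_eq_add_one, pow_succ r⁻¹ k, inv_pow]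
  field_simp

theorem exists_norm_eq_one (hd : d ≠ 0) : ∃ e : Space d, ‖e‖ = 1 :=
  ⟨EuclideanSpace.single ⟨0, Nat.pos_of_ne_zero hd⟩ 1, by simp⟩

theorem inv_sqrt_pow_le_inv (hd : 2 ≤ d) {t : ℝ} (ht : 1 ≤ t) :
    (√(2 * Real.pi * t))⁻¹ ^ d ≤ t⁻¹ := by
  have h1 : 1 ≤ 2 * Real.pi * t := by nlinarith [Real.pi_gt_three]
  have h2 : 1 ≤ √(2 * Real.pi * t) := Real.one_le_sqrt.2 h1
  calc (√(2 * Real.pi * t))⁻¹ ^ d ≤ (√(2 * Real.pi * t))⁻¹ ^ 2 :=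
        pow_le_pow_of_le_one (by positivity) (inv_le_one_of_one_le₀ h2) hd
    _ = (2 * Real.pi * t)⁻¹ := by rw [inv_pow, Real.sq_sqrt (by positivity)]
    _ ≤ t⁻¹ := inv_anti₀ (by positivity) (by nlinarith [Real.pi_gt_three])

theorem heatFlux_ne_top (hd : 2 ≤ d) : heatFlux d ≠ ∞ := by
  obtain ⟨e, he⟩ := exists_norm_eq_one (d := d) (by omega)
  obtain ⟨C, hC, hCb⟩ := heatReal_le_mul_sqrt_pow (d := d) one_pos
  have hsplit : Ioi (0 : ℝ) = Ioc 0 1 ∪ Ioi 1 := (Ioc_union_Ioi_eq_Ioi zero_le_one).symm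
  rw [heatFlux, hsplit]
  refine ((lintegral_union_le _ _ _).trans_lt (ENNReal.add_lt_top.2 ⟨?_, ?_⟩)).ne
  · refine (setLIntegral_mono' (g := fun _ => ENNReal.ofReal C) measurableSet_Ioc
      fun t ht => ENNReal.ofReal_le_ofReal ?_).trans_lt ?_
    · have h1 := hCb t ht.1 e he.ge
      rw [heatReal_eq_heatRadial, he] at h1
      have h2 : √t ^ d ≤ t := by
        calc √t ^ d ≤ √t ^ 2 := pow_le_pow_of_le_one (Real.sqrt_nonneg _)
              (Real.sqrt_le_one.2 ht.2) hd
          _ = t := Real.sq_sqrt ht.1.le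
      calc 1 / t * heatRadial d t 1 ≤ 1 / t * (C * t) := by
            have := ht.1
            gcongr
            exact h1.trans (by gcongr)
        _ = C := by have := ht.1; field_simp
    · rw [setLIntegral_const]
      exact ENNReal.mul_lt_top ENNReal.ofReal_lt_top (by simp)
  · have hint : IntegrableOn (fun t : ℝ => t ^ (-2 : ℝ)) (Ioi 1) :=
      integrableOn_Ioi_rpow_of_lt (by norm_num) one_pos
    refine (setLIntegral_mono' measurableSet_Ioi fun t ht => ENNReal.ofReal_le_ofReal ?_).trans_lt
      hint.lintegral_lt_top
    have ht : 1 < t := ht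
    have ht0 : 0 < t := by linarith
    have h1 := (heatReal_le_inv_sqrt_pow t e).trans (inv_sqrt_pow_le_inv hd ht.le)
    rw [heatReal_eq_heatRadial, he] at h1
    rw [Real.rpow_neg ht0.le, Real.rpow_two, sq, mul_inv, one_div]
    gcongr

theorem heatFlux_ne_zero (d : ℕ) : heatFlux d ≠ 0 := by
  have hm : Measurable fun t : ℝ => ENNReal.ofReal (1 / t * heatRadial d t 1) := by
    unfold heatRadial; fun_prop
  rw [heatFlux, ← pos_iff_ne_zero, setLIntegral_pos_iff hm]
  refine lt_of_lt_of_le ?_ (measure_mono (s := Ioi (0 : ℝ)) fun t ht => ⟨?_, ht⟩)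
  · simp
  · have ht : 0 < t := ht
    rw [Function.mem_support, ← pos_iff_ne_zero, ENNReal.ofReal_pos]
    unfold heatRadial
    positivity

/-- The fundamental solution as a function of the distance, up to normalization. -/
noncomputable def radialProfile (d : ℕ) (r : ℝ) : ℝ :=
  if d = 2 then Real.log (1 / r) else 1 / r ^ (d - 2)

theorem fundamentalSolution_eq (z : Space d) : fundamentalSolution d z =
    radialProfile d ‖z‖ / (volume : Measure (Space d)).toSphere.real univ := rfl

/-- The rate of decay of the radial profile at distance one. -/
noncomputable def radialRate (d : ℕ) : ℝ := if d = 2 then 1 else (d : ℝ) - 2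

theorem radialRate_pos (hd : 2 ≤ d) : 0 < radialRate d := by
  unfold radialRate
  split_ifs with h
  · exact one_pos
  · have : (3 : ℝ) ≤ d := by exact_mod_cast (by omega : 3 ≤ d)
    linarith

theorem hasDerivAt_radialProfile (hd : 2 ≤ d) {r : ℝ} (hr : 0 < r) :
    HasDerivAt (radialProfile d) (-(radialRate d * (r ^ (d - 1))⁻¹)) r := by
  unfold radialProfile radialRate
  split_ifs with h
  · subst h
    have h1 := (Real.hasDerivAt_log hr.ne').neg
    simp only [one_div, Real.log_inv]
    refine h1.congr_deriv ?_
    simp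
  · obtain ⟨k, rfl⟩ : ∃ k, d = k + 3 := ⟨d - 3, by omega⟩
    have h1 := (hasDerivAt_pow (k + 1) r).inv (by positivity)
    have e : (fun r : ℝ => 1 / r ^ (k + 3 - 2)) = (fun r => r ^ (k + 1))⁻¹ := by
      ext r
      simp [show k + 3 - 2 = k + 1 by omega]
    rw [e]
    refine h1.congr_deriv ?_
    rw [show k + 3 - 1 = k + 2 by omega]
    push_cast
    field_simp
    simp
    ring

theorem antitoneOn_radialProfile (hd : 2 ≤ d) : AntitoneOn (radialProfile d) (Ioi 0) := by
  refine antitoneOn_of_deriv_nonpos (convex_Ioi 0)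
    (fun r hr => (hasDerivAt_radialProfile hd hr).continuousAt.continuousWithinAt)
    (fun r hr => (hasDerivAt_radialProfile hd (by simpa using hr)).differentiableAt.differentiableWithinAt)
    fun r hr => ?_
  have hr : 0 < r := by simpa using hr
  rw [(hasDerivAt_radialProfile hd hr).deriv, neg_nonpos]
  have := radialRate_pos hd
  positivity

/-- The ratio between the time integral of the heat kernel and the radial profile. -/
noncomputable def heatConst (d : ℕ) : ℝ := (heatFlux d).toReal / radialRate d

theorem heatConst_pos (hd : 2 ≤ d) : 0 < heatConst d :=
  div_pos (ENNReal.toReal_pos (heatFlux_ne_zero d) (heatFlux_ne_top hd)) (radialRate_pos hd)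

/-- In dimension two the time integral of the heat kernel diverges, so only differences between two
radii are integrated. Each is a radial integral of the flux, and the two integrations are exchanged.
-/
theorem lintegral_heatRadial_sub (hd : 2 ≤ d) {a b : ℝ} (ha : 0 < a) (hab : a ≤ b) :
    ∫⁻ t in Ioi (0 : ℝ), ENNReal.ofReal (heatRadial d t a - heatRadial d t b) =
      ENNReal.ofReal (heatConst d * (radialProfile d a - radialProfile d b)) := by
  have hrate := radialRate_pos hd
  have hm : Measurable fun q : ℝ × ℝ => ENNReal.ofReal (q.2 / q.1 * heatRadial d q.1 q.2) := by
    have := measurable_heatRadial d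
    fun_prop
  calc ∫⁻ t in Ioi (0 : ℝ), ENNReal.ofReal (heatRadial d t a - heatRadial d t b)
      = ∫⁻ t in Ioi (0 : ℝ), ∫⁻ r in Ioc a b, ENNReal.ofReal (r / t * heatRadial d t r) :=
        setLIntegral_congr_fun measurableSet_Ioi fun t ht =>
          (ofReal_heatRadial_sub d ht ha.le hab).symm
    _ = ∫⁻ r in Ioc a b, ∫⁻ t in Ioi (0 : ℝ), ENNReal.ofReal (r / t * heatRadial d t r) :=
        lintegral_lintegral_swap hm.aemeasurable
    _ = ∫⁻ r in Ioc a b, ENNReal.ofReal (heatConst d) *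
          ENNReal.ofReal (radialRate d * (r ^ (d - 1))⁻¹) := by
        refine setLIntegral_congr_fun measurableSet_Ioc fun r hr => ?_
        rw [lintegral_heatFlux_scale (by omega) (ha.trans hr.1),
          ← ENNReal.ofReal_toReal (heatFlux_ne_top hd), ← ENNReal.ofReal_mul (by
            have := ha.trans hr.1; positivity), ← ENNReal.ofReal_mul (heatConst_pos hd).le]
        congr 1
        unfold heatConst
        field_simp
    _ = _ := by
        rw [lintegral_const_mul' _ _ ENNReal.ofReal_ne_top,
          ENNReal.ofReal_mul (heatConst_pos hd).le]
        congr 1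
        refine setLIntegral_neg_deriv hab (fun r hr => hasDerivAt_radialProfile hd
          (ha.trans_le hr.1)) ?_ fun r hr => ?_
        · refine ContinuousOn.mul continuousOn_const (ContinuousOn.inv₀ (by fun_prop) ?_)
          intro r hr
          have := ha.trans_le hr.1
          positivity
        · have := ha.trans_le hr.1
          positivity

theorem heatRadial_anti (d : ℕ) {t : ℝ} (ht : 0 < t) {a b : ℝ} (ha : 0 ≤ a) (hab : a ≤ b) :
    heatRadial d t b ≤ heatRadial d t a := by
  unfold heatRadial
  gcongr

theorem lintegral_abs_heatRadial_sub (hd : 2 ≤ d) {a b : ℝ} (ha : 0 < a) (hb : 0 < b) :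
    ∫⁻ t in Ioi (0 : ℝ), ENNReal.ofReal |heatRadial d t a - heatRadial d t b| =
      ENNReal.ofReal (heatConst d * |radialProfile d a - radialProfile d b|) := by
  wlog hab : a ≤ b generalizing a b
  · simp_rw [abs_sub_comm (heatRadial d _ a), abs_sub_comm (radialProfile d a)]
    exact this hb ha (le_of_not_ge hab)
  rw [abs_of_nonneg (sub_nonneg.2 (antitoneOn_radialProfile hd ha hb hab)),
    ← lintegral_heatRadial_sub hd ha hab]
  refine setLIntegral_congr_fun measurableSet_Ioi fun t ht => ?_
  rw [abs_of_nonneg (sub_nonneg.2 (heatRadial_anti d ht ha.le hab))]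

theorem integrableOn_heatRadial_sub (hd : 2 ≤ d) {a b : ℝ} (ha : 0 < a) (hb : 0 < b) :
    IntegrableOn (fun t => heatRadial d t a - heatRadial d t b) (Ioi 0) := by
  have hm : Measurable fun t => heatRadial d t a - heatRadial d t b := by
    unfold heatRadial; fun_prop
  refine ⟨hm.aestronglyMeasurable, ?_⟩
  rw [hasFiniteIntegral_iff_norm]
  simp_rw [Real.norm_eq_abs]
  rw [lintegral_abs_heatRadial_sub hd ha hb]
  exact ENNReal.ofReal_lt_top

theorem integral_heatRadial_sub (hd : 2 ≤ d) {a b : ℝ} (ha : 0 < a) (hb : 0 < b) :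
    ∫ t in Ioi (0 : ℝ), (heatRadial d t a - heatRadial d t b) =
      heatConst d * (radialProfile d a - radialProfile d b) := by
  wlog hab : a ≤ b generalizing a b
  · have := this hb ha (le_of_not_ge hab)
    rw [← neg_inj, ← integral_neg]
    simp_rw [neg_sub]
    rw [this]
    ring
  have hm : Measurable fun t => heatRadial d t a - heatRadial d t b := by
    unfold heatRadial; fun_prop
  rw [integral_eq_lintegral_of_nonneg_ae ?_ hm.aestronglyMeasurable,
    lintegral_heatRadial_sub hd ha hab, ENNReal.toReal_ofReal]
  · exact mul_nonneg (heatConst_pos hd).le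
      (sub_nonneg.2 (antitoneOn_radialProfile hd ha hb hab))
  · filter_upwards [ae_restrict_mem measurableSet_Ioi] with t ht
    exact sub_nonneg.2 (heatRadial_anti d ht ha.le hab)

/-- The renormalized resolvent density. -/
noncomputable def resolventDiff (d : ℕ) (l a b : ℝ) : ℝ :=
  ∫ t in Ioi (0 : ℝ), Real.exp (-(l * t)) * (heatRadial d t a - heatRadial d t b)

theorem abs_resolventDiff_le (hd : 2 ≤ d) {l : ℝ} (hl : 0 ≤ l) {a b : ℝ} (ha : 0 < a)
    (hb : 0 < b) : |resolventDiff d l a b| ≤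
      heatConst d * |radialProfile d a - radialProfile d b| := by
  have h1 : ∫ t in Ioi (0 : ℝ), |heatRadial d t a - heatRadial d t b| =
      heatConst d * |radialProfile d a - radialProfile d b| := by
    rw [integral_eq_lintegral_of_nonneg_ae (Filter.Eventually.of_forall fun t => abs_nonneg _)
      (integrableOn_heatRadial_sub hd ha hb).abs.aestronglyMeasurable,
      lintegral_abs_heatRadial_sub hd ha hb, ENNReal.toReal_ofReal]
    exact mul_nonneg (heatConst_pos hd).le (abs_nonneg _)
  rw [← h1]
  refine norm_integral_le_of_norm_le (f := fun t => Real.exp (-(l * t)) *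
    (heatRadial d t a - heatRadial d t b)) (integrableOn_heatRadial_sub hd ha hb).abs ?_
  filter_upwards [ae_restrict_mem measurableSet_Ioi] with t ht
  rw [norm_mul, Real.norm_eq_abs, Real.norm_eq_abs, Real.abs_exp]
  refine mul_le_of_le_one_left (abs_nonneg _) (Real.exp_le_one_iff.2 ?_)
  have := mul_nonneg hl (mem_Ioi.1 ht).le
  linarith

theorem tendsto_resolventDiff (hd : 2 ≤ d) {a b : ℝ} (ha : 0 < a) (hb : 0 < b) :
    Filter.Tendsto (fun n : ℕ => resolventDiff d (1 / ((n : ℝ) + 1)) a b) Filter.atTop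
      (nhds (heatConst d * (radialProfile d a - radialProfile d b))) := by
  rw [← integral_heatRadial_sub hd ha hb]
  refine tendsto_integral_of_dominated_convergence
    (fun t => |heatRadial d t a - heatRadial d t b|) (fun n => ?_)
    (integrableOn_heatRadial_sub hd ha hb).abs (fun n => ?_)
    (Filter.Eventually.of_forall fun t => ?_)
  · have hm : Measurable fun t => Real.exp (-(1 / ((n : ℝ) + 1) * t)) *
        (heatRadial d t a - heatRadial d t b) := by unfold heatRadial; fun_prop
    exact hm.aestronglyMeasurable
  · filter_upwards [ae_restrict_mem measurableSet_Ioi] with t ht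
    rw [norm_mul, Real.norm_eq_abs, Real.norm_eq_abs, Real.abs_exp]
    refine mul_le_of_le_one_left (abs_nonneg _) (Real.exp_le_one_iff.2 ?_)
    have : 0 < t := ht
    have : 0 < 1 / ((n : ℝ) + 1) * t := by positivity
    linarith
  · have h1 : Continuous fun s : ℝ => Real.exp (-(s * t)) *
      (heatRadial d t a - heatRadial d t b) := by fun_prop
    have h2 := (h1.tendsto 0).comp tendsto_one_div_add_atTop_nhds_zero_nat
    rw [zero_mul, neg_zero, Real.exp_zero, one_mul] at h2
    exact h2

theorem heatResolvent_toReal {l : ℝ} (z : Space d) : (heatResolvent l z).toReal =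
    ∫ t in Ioi (0 : ℝ), Real.exp (-(l * t)) * heatRadial d t ‖z‖ := by
  have hm : Measurable fun t => Real.exp (-(l * t)) * heatRadial d t ‖z‖ := by
    unfold heatRadial; fun_prop
  rw [integral_eq_lintegral_of_nonneg_ae (Filter.Eventually.of_forall fun t =>
    mul_nonneg (Real.exp_nonneg _) (heatRadial_nonneg d t _)) hm.aestronglyMeasurable,
    heatResolvent]
  congr 1
  refine lintegral_congr fun t => ?_
  rw [heat, heatReal_eq_heatRadial, ENNReal.ofReal_mul (Real.exp_nonneg _)]

theorem integrableOn_exp_mul_heatRadial {l : ℝ} (hl : 0 < l) {z : Space d} (hz : z ≠ 0) :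
    IntegrableOn (fun t => Real.exp (-(l * t)) * heatRadial d t ‖z‖) (Ioi 0) := by
  have hm : Measurable fun t => Real.exp (-(l * t)) * heatRadial d t ‖z‖ := by
    unfold heatRadial; fun_prop
  refine ⟨hm.aestronglyMeasurable, ?_⟩
  rw [hasFiniteIntegral_iff_ofReal (Filter.Eventually.of_forall fun t =>
    mul_nonneg (Real.exp_nonneg _) (heatRadial_nonneg d t _))]
  refine lt_of_eq_of_lt (lintegral_congr fun t => ?_) (heatResolvent_ne_top hl hz).lt_top
  rw [heat, heatReal_eq_heatRadial, ENNReal.ofReal_mul (Real.exp_nonneg _)]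

theorem heatResolvent_toReal_sub {l : ℝ} (hl : 0 < l) {z w : Space d} (hz : z ≠ 0) (hw : w ≠ 0) :
    (heatResolvent l z).toReal - (heatResolvent l w).toReal = resolventDiff d l ‖z‖ ‖w‖ := by
  rw [heatResolvent_toReal, heatResolvent_toReal, ← integral_sub
    (integrableOn_exp_mul_heatRadial hl hz) (integrableOn_exp_mul_heatRadial hl hw)]
  simp_rw [← mul_sub]
  rfl

/-- In dimension two the resolvent diverges as `l ↓ 0`, but more slowly than `1 / l`. Times before
`T` contribute at most `C * T`, and later ones at most `T⁻¹ * l⁻¹`, since the kernel is at most `1 /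
T` there. -/
theorem tendsto_mul_heatResolvent (hd : 2 ≤ d) {z : Space d} (hz : z ≠ 0) :
    Filter.Tendsto (fun n : ℕ => 1 / ((n : ℝ) + 1) *
      (heatResolvent (1 / ((n : ℝ) + 1)) z).toReal) Filter.atTop (nhds 0) := by
  obtain ⟨C, hC, hCb⟩ := heatReal_le_of_le_norm (d := d) (norm_pos_iff.2 hz)
  have hbound : ∀ l > 0, ∀ T ≥ 1, heatResolvent l z ≤
      ENNReal.ofReal (C * T) + ENNReal.ofReal (T⁻¹ * l⁻¹) := by
    intro l hl T hT
    have hT0 : 0 < T := by linarith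
    calc heatResolvent l z ≤ ∫⁻ t in Ioi (0 : ℝ), ((Ioc 0 T).indicator (fun _ => ENNReal.ofReal C) t
            + ENNReal.ofReal T⁻¹ * ENNReal.ofReal (Real.exp (-(l * t)))) := by
          refine setLIntegral_mono' measurableSet_Ioi fun t ht => ?_
          have ht : 0 < t := ht
          rcases le_or_gt t T with h | h
          · refine le_add_right ?_
            rw [indicator_of_mem (show t ∈ Ioc 0 T from ⟨ht, h⟩), ← one_mul (ENNReal.ofReal C)]
            refine mul_le_mul' ?_ (ENNReal.ofReal_le_ofReal (hCb t ht z le_rfl))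
            rw [← ENNReal.ofReal_one]
            refine ENNReal.ofReal_le_ofReal (Real.exp_le_one_iff.2 ?_)
            have := mul_pos hl ht
            linarith
          · refine le_add_left ?_
            rw [mul_comm]
            refine mul_le_mul' (ENNReal.ofReal_le_ofReal ?_) le_rfl
            exact (heatReal_le_inv_sqrt_pow t z).trans ((inv_sqrt_pow_le_inv hd
              (hT.trans h.le)).trans (inv_anti₀ hT0 h.le))
      _ ≤ _ := by
          rw [lintegral_add_left (measurable_const.indicator measurableSet_Ioc),
            lintegral_indicator measurableSet_Ioc, Measure.restrict_restrict measurableSet_Ioc,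
            setLIntegral_const, lintegral_const_mul' _ _ ENNReal.ofReal_ne_top,
            lintegral_exp_neg_mul hl, ENNReal.ofReal_mul hC.le,
            ENNReal.ofReal_mul (inv_nonneg.2 hT0.le)]
          gcongr
          refine (measure_mono inter_subset_left).trans ?_
          rw [Real.volume_Ioc, sub_zero]
  refine Metric.tendsto_atTop'.2 fun ε hε => ?_
  set T := max 1 (2 / ε) with hT
  have hT1 : 1 ≤ T := le_max_left _ _
  have hT0 : 0 < T := by linarith
  have hTε : T⁻¹ ≤ ε / 2 := by
    rw [← inv_div]
    exact inv_anti₀ (by positivity) (le_max_right _ _)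
  obtain ⟨N, hN⟩ := exists_nat_gt (2 * C * T / ε)
  refine ⟨N, fun n hn => ?_⟩
  set l := 1 / ((n : ℝ) + 1) with hl
  have hl0 : 0 < l := by positivity
  have h1 : (heatResolvent l z).toReal ≤ C * T + T⁻¹ * l⁻¹ := by
    refine ENNReal.toReal_le_of_le_ofReal (by positivity) ?_
    rw [ENNReal.ofReal_add (by positivity) (by positivity)]
    exact hbound l hl0 T hT1
  rw [Real.dist_eq, sub_zero, abs_of_nonneg (by positivity)]
  have h2 : l * (C * T) < ε / 2 := by
    have hn' : 2 * C * T / ε < n + 1 := by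
      have : (N : ℝ) < n := by exact_mod_cast hn
      linarith
    rw [div_lt_iff₀ hε] at hn'
    rw [hl, one_div, inv_mul_lt_iff₀ (by positivity)]
    linarith
  calc l * (heatResolvent l z).toReal ≤ l * (C * T + T⁻¹ * l⁻¹) := by gcongr
    _ = l * (C * T) + T⁻¹ := by field_simp
    _ < ε / 2 + ε / 2 := by linarith
    _ = ε := by ring

theorem heatResolvent_zero_eq_top (hd : 2 ≤ d) {l : ℝ} (hl : 0 ≤ l) :
    heatResolvent l (0 : Space d) = ∞ := by
  by_contra h
  have hm : Measurable fun t => Real.exp (-(l * t)) * heatRadial d t 0 := by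
    unfold heatRadial; fun_prop
  have hint : IntegrableOn (fun t => Real.exp (-(l * t)) * heatRadial d t 0) (Ioi 0) := by
    refine ⟨hm.aestronglyMeasurable, ?_⟩
    rw [hasFiniteIntegral_iff_ofReal (Filter.Eventually.of_forall fun t =>
      mul_nonneg (Real.exp_nonneg _) (heatRadial_nonneg d t _))]
    refine lt_of_eq_of_lt (lintegral_congr fun t => ?_) (lt_top_iff_ne_top.2 h)
    rw [heat, heatReal_eq_heatRadial, ENNReal.ofReal_mul (Real.exp_nonneg _), norm_zero]
  -- Below this time `√(2 * π * t) ≤ 1`, so for `d ≥ 2` the kernel at the origin is at least `1 / (2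
  -- * π * t)`, which is not integrable at `0`.
  set a := (2 * Real.pi)⁻¹ with ha
  have ha0 : 0 < a := by positivity
  have hinv : IntegrableOn (fun t : ℝ => t⁻¹) (Ioc 0 a) := by
    have h1 := (hint.mono_set (fun t (ht : t ∈ Ioc 0 a) => ht.1)).const_mul
      (Real.exp (l * a) * (2 * Real.pi))
    refine h1.mono' (measurable_inv.aestronglyMeasurable) ?_
    filter_upwards [ae_restrict_mem measurableSet_Ioc] with t ht
    have ht0 : 0 < t := ht.1
    rw [Real.norm_eq_abs, abs_of_pos (inv_pos.2 ht0)]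
    have h2 : 2 * Real.pi * t ≤ 1 := by
      have := ht.2
      rw [ha, ← one_div, le_div_iff₀ (by positivity)] at this
      linarith
    have h3 : (2 * Real.pi * t)⁻¹ ≤ heatRadial d t 0 := by
      unfold heatRadial
      rw [zero_pow two_ne_zero, neg_zero, zero_div, Real.exp_zero, mul_one]
      calc (2 * Real.pi * t)⁻¹ = (√(2 * Real.pi * t))⁻¹ ^ 2 := by
            rw [inv_pow, Real.sq_sqrt (by positivity)]
        _ ≤ _ := pow_le_pow_right₀ ((one_le_inv₀ (by positivity)).2 (Real.sqrt_le_one.2 h2)) hd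
    have h4 : 1 ≤ Real.exp (l * a) * Real.exp (-(l * t)) := by
      rw [← Real.exp_add]
      refine Real.one_le_exp ?_
      nlinarith [mul_le_mul_of_nonneg_left ht.2 hl]
    calc t⁻¹ = 1 * (2 * Real.pi * (2 * Real.pi * t)⁻¹) := by field_simp
      _ ≤ (Real.exp (l * a) * Real.exp (-(l * t))) * (2 * Real.pi * heatRadial d t 0) := by
        gcongr
      _ = _ := by ring
  have h5 : IntervalIntegrable (fun t : ℝ => t⁻¹) volume 0 a :=
    (intervalIntegrable_iff_integrableOn_Ioc_of_le ha0.le).2 hinv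
  rw [intervalIntegrable_inv_iff] at h5
  rcases h5 with h5 | h5
  · exact ha0.ne h5
  · exact h5 (by rw [uIcc_of_le ha0.le]; exact ⟨le_rfl, ha0.le⟩)

end Radial

/-! ### The Green's function as a time integral -/

section GreenIdentification

variable {d : ℕ} {Ω' : Type*} [MeasurableSpace Ω'] {B : ℝ≥0 → Ω' → Space d} {Q : Measure Ω'}
  {U : Set (Space d)}

theorem survival_le_volume (U : Set (Space d)) (hU : IsOpen U) (t : ℝ) (x : Space d) :
    survival U t x ≤ ENNReal.ofReal ((√(2 * Real.pi * t))⁻¹ ^ d) * volume U := by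
  rw [survival, ← setLIntegral_const, ← lintegral_indicator hU.measurableSet]
  refine lintegral_mono fun y => ?_
  by_cases hy : y ∈ U
  · rw [indicator_of_mem hy]
    exact (killedKernel_le_heat U t x y).trans
      (ENNReal.ofReal_le_ofReal (heatReal_le_inv_sqrt_pow t _))
  · rw [killedKernel_of_notMem fun h => hy h.2]
    exact zero_le

/-- Since survival up to `T` is at most `(2πT) ^ (-d/2) * volume U`, some `T` makes it at most `1 /
2` from every starting point. Restarting at time `T` gives `I ≤ T + I / 2`; because `l > 0`, `I` is
finite and may be subtracted, which leaves the bound `2 * T`, independent of `l`. -/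
theorem IsContinuousBM.exists_lintegral_killedResolvent_le [IsProbabilityMeasure Q] (hd : 2 ≤ d)
    (hB : IsContinuousBM B Q) (hU : IsOpen U) (hvol : volume U ≠ ∞) :
    ∃ T : ℝ≥0, ∀ l > 0, ∀ x, ∫⁻ y, killedResolvent U l x y ≤ T := by
  set v := (volume U).toReal with hv
  set T : ℝ≥0 := max 1 (2 * v.toNNReal) with hT
  have hT1 : 1 ≤ T := le_max_left _ _
  have hT0 : T ≠ 0 := (zero_lt_one.trans_le hT1).ne'
  have hTR : (1 : ℝ) ≤ T := by exact_mod_cast hT1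
  have hTv : 2 * v ≤ T := by
    have h : 2 * v.toNNReal ≤ T := le_max_right _ _
    have h2 : (2 : ℝ) * v.toNNReal ≤ T := by exact_mod_cast h
    rwa [Real.coe_toNNReal _ ENNReal.toReal_nonneg] at h2
  have hhalf : ∀ x, survival U T x ≤ 2⁻¹ := fun x => by
    refine (survival_le_volume U hU T x).trans ?_
    rw [← ENNReal.ofReal_toReal hvol, ← ENNReal.ofReal_mul (by positivity),
      show (2⁻¹ : ℝ≥0∞) = ENNReal.ofReal 2⁻¹ by
        rw [ENNReal.ofReal_inv_of_pos two_pos, ENNReal.ofReal_ofNat]]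
    refine ENNReal.ofReal_le_ofReal ?_
    have h1 := inv_sqrt_pow_le_inv hd hTR
    calc (√(2 * Real.pi * T))⁻¹ ^ d * v ≤ (T : ℝ)⁻¹ * v :=
          mul_le_mul_of_nonneg_right h1 ENNReal.toReal_nonneg
      _ ≤ 2⁻¹ := by
          rw [inv_mul_le_iff₀ (by linarith)]
          linarith
  refine ⟨2 * T, fun l hl x => ?_⟩
  rw [lintegral_killedResolvent]
  set I := ∫⁻ t in Ioi (0 : ℝ), ENNReal.ofReal (Real.exp (-(l * t))) * survival U t x with hI
  have hfin : I ≠ ∞ := by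
    refine ((setLIntegral_mono' (g := fun t => ENNReal.ofReal (Real.exp (-(l * t))))
      measurableSet_Ioi fun t ht => ?_).trans_lt ?_).ne
    · exact mul_le_of_le_one_right' (survival_le_one U ht x)
    · rw [lintegral_exp_neg_mul hl]
      exact ENNReal.ofReal_lt_top
  have hstep : I ≤ T + 2⁻¹ * I := by
    set φ : ℝ → ℝ≥0∞ := (Ioi (0 : ℝ)).indicator fun s => survival U (s + T) x with hφ
    have hsh := lintegral_exp_neg_mul_shift l (φ := φ)
      (fun s hs => indicator_of_notMem (not_lt.2 hs.le) _) T
    have h1 : ∀ t ∈ Ioi (0 : ℝ), ENNReal.ofReal (Real.exp (-(l * t))) * survival U t x ≤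
        (Ioc (0 : ℝ) T).indicator (fun _ => 1) t +
          ENNReal.ofReal (Real.exp (-(l * t))) * φ (t - T) := fun t ht => by
      have ht : 0 < t := ht
      rcases le_or_gt t T with h | h
      · refine le_add_right ?_
        rw [indicator_of_mem (show t ∈ Ioc (0 : ℝ) T from ⟨ht, h⟩), ← one_mul (1 : ℝ≥0∞)]
        refine mul_le_mul' ?_ (survival_le_one U ht x)
        rw [← ENNReal.ofReal_one]
        refine ENNReal.ofReal_le_ofReal (Real.exp_le_one_iff.2 ?_)
        have := mul_pos hl ht
        linarith
      · refine le_add_left ?_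
        rw [hφ, indicator_of_mem (show t - (T : ℝ) ∈ Ioi 0 from sub_pos.2 h), sub_add_cancel]
    refine (setLIntegral_mono' measurableSet_Ioi h1).trans ?_
    rw [lintegral_add_left (measurable_const.indicator measurableSet_Ioc), hsh,
      lintegral_indicator measurableSet_Ioc, Measure.restrict_restrict measurableSet_Ioc,
      setLIntegral_const, one_mul]
    refine add_le_add ?_ ?_
    · refine (measure_mono inter_subset_left).trans ?_
      rw [Real.volume_Ioc, sub_zero, ENNReal.ofReal_coe_nnreal]
    · rw [← one_mul (2⁻¹ * I)]
      refine mul_le_mul' ?_ ?_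
      · rw [← ENNReal.ofReal_one]
        refine ENNReal.ofReal_le_ofReal (Real.exp_le_one_iff.2 ?_)
        have := mul_pos hl (zero_lt_one.trans_le hTR)
        linarith
      · rw [hI, ← lintegral_const_mul' _ _ (by simp)]
        refine setLIntegral_mono' measurableSet_Ioi fun t ht => ?_
        rw [hφ, indicator_of_mem ht, mul_left_comm]
        refine mul_le_mul' le_rfl ?_
        have ht : 0 < t := ht
        lift t to ℝ≥0 using ht.le
        have ht0 : t ≠ 0 := by rintro rfl; simp at ht
        rw [hB.survival_add hU ht0 hT0, mul_comm, survival, ← lintegral_mul_const' _ _ (by simp)]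
        exact lintegral_mono fun z => mul_le_mul' le_rfl (hhalf z)
  have h2 : I = 2⁻¹ * I + 2⁻¹ * I := by
    rw [← add_mul, ENNReal.inv_two_add_inv_two, one_mul]
  have hfin2 : 2⁻¹ * I ≠ ∞ := ENNReal.mul_ne_top (by simp) hfin
  have h3 : 2⁻¹ * I ≤ T := by
    have h4 : 2⁻¹ * I + 2⁻¹ * I ≤ T + 2⁻¹ * I := h2 ▸ hstep
    exact (ENNReal.add_le_add_iff_right hfin2).1 h4
  rw [h2, ENNReal.coe_mul, ENNReal.coe_ofNat, two_mul]
  exact add_le_add h3 h3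

theorem IsContinuousBM.integral_discountedHarmonic (hB : IsContinuousBM B Q) (hU : IsOpen U)
    (l : ℝ) (x : Space d) {f : Space d → ℝ} (hf : Measurable f) :
    ∫ z, f z ∂(discountedHarmonic B Q U l x) = ∫ ω in exits B U x,
      Real.exp (-(l * exitTime B U x ω)) * f (x + B (exitTime B U x ω) ω) ∂Q := by
  have hτ := hB.measurable_exitTime hU x
  have hX := hB.measurable_exitPos hU x
  unfold discountedHarmonic
  rw [integral_map hX.aemeasurable hf.aestronglyMeasurable,
    integral_withDensity_eq_integral_toReal_smul (by fun_prop)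
      (Filter.Eventually.of_forall fun ω => ENNReal.ofReal_lt_top)]
  refine integral_congr_ae (Filter.Eventually.of_forall fun ω => ?_)
  simp only [smul_eq_mul]
  rw [ENNReal.toReal_ofReal (Real.exp_nonneg _)]

theorem abs_radialProfile_sub_le (hd : 2 ≤ d) {δ M r : ℝ} (hδ : 0 < δ) (hr : δ ≤ r) (hM : r ≤ M) :
    |radialProfile d r - radialProfile d 1| ≤
      |radialProfile d δ| + |radialProfile d M| + |radialProfile d 1| := by
  have hr0 : 0 < r := hδ.trans_le hr
  have h1 := antitoneOn_radialProfile hd hδ hr0 hr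
  have h2 := antitoneOn_radialProfile hd hr0 (hr0.trans_le hM) hM
  refine (abs_sub _ _).trans (add_le_add ?_ le_rfl)
  refine abs_le.2 ⟨?_, ?_⟩
  · have := neg_abs_le (radialProfile d M)
    have := abs_nonneg (radialProfile d δ)
    linarith
  · have := le_abs_self (radialProfile d δ)
    have := abs_nonneg (radialProfile d M)
    linarith

theorem measurable_radialProfile (d : ℕ) : Measurable (radialProfile d) := by
  unfold radialProfile
  split_ifs
  · exact Real.measurable_log.comp (by fun_prop)
  · fun_prop

/-- The ratio between the time integral of the killed heat kernel and the Green's function. -/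
noncomputable def greenConst (d : ℕ) : ℝ :=
  heatConst d * (volume : Measure (Space d)).toSphere.real univ

theorem toSphere_real_pos (hd : 2 ≤ d) : 0 < (volume : Measure (Space d)).toSphere.real univ := by
  rw [Measure.toSphere_real_apply_univ]
  have h1 : 0 < Module.finrank ℝ (Space d) := by simp; omega
  have h2 : 0 < (volume : Measure (Space d)).real (Metric.ball 0 1) :=
    ENNReal.toReal_pos (Metric.measure_ball_pos _ _ one_pos).ne' measure_ball_lt_top.ne
  positivity

theorem greenConst_pos (hd : 2 ≤ d) : 0 < greenConst d :=
  mul_pos (heatConst_pos hd) (toSphere_real_pos hd)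

theorem IsContinuousBM.killedResolvent_self [IsProbabilityMeasure Q] (hd : 2 ≤ d)
    (hB : IsContinuousBM B Q) (hU : IsOpen U) {x : Space d} (hx : x ∈ U) :
    killedResolvent U 0 x x = ∞ := by
  have h := hB.heatResolvent_eq_of_mem (by omega) hU 1 hx hx
  have := isFiniteMeasure_discountedHarmonic B Q U zero_le_one x
  have hfin := lintegral_heatResolvent_ne_top one_pos hU (hB.ae_discountedHarmonic hU 1 x) hx
  rw [sub_self, heatResolvent_zero_eq_top hd zero_le_one, eq_comm, ENNReal.add_eq_top] at h
  refine top_le_iff.1 ((h.resolve_right hfin).ge.trans ?_)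
  refine setLIntegral_mono' measurableSet_Ioi fun t ht => mul_le_mul' ?_ le_rfl
  refine ENNReal.ofReal_le_ofReal (Real.exp_le_exp.2 ?_)
  have : 0 < t := ht
  linarith

/-- On a bounded open set, the time integral of the killed heat kernel in terms of the fundamental
solution and of its harmonic extension. -/
theorem IsContinuousBM.killedResolvent_eq_ofReal [IsProbabilityMeasure Q] (hd : 2 ≤ d)
    (hB : IsContinuousBM B Q) (hU : IsOpen U) (hUb : Bornology.IsBounded U) {x y : Space d}
    (hx : x ∈ U) (hy : y ∈ U) (hxy : x ≠ y) :
    0 ≤ fundamentalSolution d (x - y) -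
        ∫ z, fundamentalSolution d (z - y) ∂(harmonicMeasure B Q U x) ∧
      killedResolvent U 0 x y = ENNReal.ofReal (greenConst d * (fundamentalSolution d (x - y) -
        ∫ z, fundamentalSolution d (z - y) ∂(harmonicMeasure B Q U x))) := by
  have hc := greenConst_pos hd
  obtain ⟨e, he⟩ := exists_norm_eq_one (d := d) (by omega)
  have he0 : e ≠ 0 := norm_ne_zero_iff.1 (by rw [he]; exact one_ne_zero)
  obtain ⟨T, hT⟩ := hB.exists_lintegral_killedResolvent_le hd hU hUb.measure_lt_top.ne
  obtain ⟨δ, hδ, hball⟩ := Metric.isOpen_iff.1 hU y hy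
  obtain ⟨M, hM⟩ := hUb.closure.subset_closedBall y
  set η := radialProfile d with hη
  let l : ℕ → ℝ := fun n => 1 / ((n : ℝ) + 1)
  have hl : ∀ n, 0 < l n := fun n => by simp only [l]; positivity
  have hllim : Filter.Tendsto l Filter.atTop (nhds 0) := tendsto_one_div_add_atTop_nhds_zero_nat
  let ν : ℕ → Measure (Space d) := fun n => discountedHarmonic B Q U (l n) x
  have hνfin : ∀ n, IsFiniteMeasure (ν n) := fun n =>
    isFiniteMeasure_discountedHarmonic B Q U (hl n).le x
  -- Subtracting the resolvent at a unit vector makes the limit `l ↓ 0` exist in every dimension.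
  let f : ℕ → Space d → ℝ := fun n z =>
    (heatResolvent (l n) (z - y)).toReal - (heatResolvent (l n) e).toReal
  have hfm : ∀ n, Measurable (f n) := fun n =>
    (((measurable_heatResolvent (l n)).comp (measurable_id.sub_const y)).ennreal_toReal).sub_const _
  have hfe : ∀ n z, z ≠ y → f n z = resolventDiff d (l n) ‖z - y‖ 1 := fun n z hz => by
    simp only [f]
    rw [heatResolvent_toReal_sub (hl n) (sub_ne_zero.2 hz) he0, he]
  -- The mass missing from the discounted exit law is `l` times the resolvent mass, which is bounded
  -- by `T`.
  have hmass : ∀ n, (1 - (ν n).real univ) = l n * (∫⁻ v, killedResolvent U (l n) x v).toReal := by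
    intro n
    have h1 := congrArg ENNReal.toReal (hB.resolvent_mass hU (hl n) x)
    rw [ENNReal.toReal_add ((hT _ (hl n) x).trans_lt ENNReal.coe_lt_top).ne
      (ENNReal.mul_ne_top ENNReal.ofReal_ne_top (measure_ne_top (ν n) _)), ENNReal.toReal_mul,
      ENNReal.toReal_ofReal (inv_pos.2 (hl n)).le] at h1
    have h2 : (∫⁻ v, killedResolvent U (l n) x v).toReal =
      (l n)⁻¹ - (l n)⁻¹ * (ν n).real univ := by rw [measureReal_def]; linarith
    rw [h2]
    have := (hl n).ne'
    field_simp
  have hmass' : ∀ n, 0 ≤ 1 - (ν n).real univ ∧ 1 - (ν n).real univ ≤ l n * T := fun n => by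
    rw [hmass n]
    refine ⟨mul_nonneg (hl n).le ENNReal.toReal_nonneg, mul_le_mul_of_nonneg_left ?_ (hl n).le⟩
    exact ENNReal.toReal_le_coe_of_le_coe (hT _ (hl n) x)
  -- Letting `l ↓ 0` in the mass balance shows that a bounded open set is left almost surely.
  have hone : (harmonicMeasure B Q U x).real univ = 1 := by
    have hle : (harmonicMeasure B Q U x).real univ ≤ 1 := by
      rw [measureReal_def]
      exact ENNReal.toReal_le_of_le_ofReal zero_le_one
        (by rw [ENNReal.ofReal_one]; exact harmonicMeasure_univ_le B Q U x)
    refine le_antisymm hle ?_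
    have hνle : ∀ n, (ν n).real univ ≤ (harmonicMeasure B Q U x).real univ := fun n => by
      refine ENNReal.toReal_mono (measure_ne_top _ _) ?_
      have h1 := hB.lintegral_discountedHarmonic hU (l n) x (f := fun _ => 1) measurable_const
      have h2 := hB.lintegral_harmonicMeasure hU x (f := fun _ => 1) measurable_const
      rw [lintegral_const, one_mul] at h1 h2
      rw [h1, h2]
      refine lintegral_mono fun ω => ?_
      rw [mul_one, ← ENNReal.ofReal_one]
      refine ENNReal.ofReal_le_ofReal (Real.exp_le_one_iff.2 ?_)
      have : 0 ≤ l n * exitTime B U x ω := mul_nonneg (hl n).le NNReal.zero_le_coe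
      linarith
    have hlim : Filter.Tendsto (fun n => 1 - l n * T) Filter.atTop (nhds 1) := by
      simpa using (hllim.mul_const (T : ℝ)).const_sub 1
    exact le_of_tendsto' hlim fun n => by linarith [(hmass' n).2, hνle n]
  -- The subtracted constant reappears multiplied by the missing mass of the exit law. That product
  -- tends to `0`, by `tendsto_mul_heatResolvent`.
  have hreal : ∀ n, (killedResolvent U (l n) x y).toReal = resolventDiff d (l n) ‖x - y‖ 1 -
      ∫ z, f n z ∂(ν n) + (heatResolvent (l n) e).toReal * (1 - (ν n).real univ) := by
    intro n
    have hxy0 : x - y ≠ 0 := sub_ne_zero.2 hxy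
    have h1 := hB.heatResolvent_eq_of_mem (by omega) hU (l n) hx hy
    have hfin := heatResolvent_ne_top (hl n) hxy0
    rw [h1, ENNReal.add_ne_top] at hfin
    have h2 := congrArg ENNReal.toReal h1
    have hm : Measurable fun z => heatResolvent (l n) (z - y) :=
      (measurable_heatResolvent (l n)).comp (measurable_id.sub_const y)
    rw [ENNReal.toReal_add hfin.1 hfin.2, ← integral_toReal hm.aemeasurable
      (ae_lt_top hm hfin.2)] at h2
    have h3 := integrable_toReal_of_lintegral_ne_top hm.aemeasurable hfin.2
    have h4 : ∫ z, f n z ∂(ν n) = (∫ z, (heatResolvent (l n) (z - y)).toReal ∂(ν n)) -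
        (ν n).real univ * (heatResolvent (l n) e).toReal := by
      simp only [f]
      rw [integral_sub h3 (integrable_const _), integral_const, smul_eq_mul]
    have h5 := heatResolvent_toReal_sub (hl n) hxy0 he0
    rw [he] at h5
    rw [h4, ← h5, h2]
    ring
  have hbdry : ∀ ω ∈ exits B U x, δ ≤ ‖x + B (exitTime B U x ω) ω - y‖ ∧
      ‖x + B (exitTime B U x ω) ω - y‖ ≤ M := fun ω hω => by
    constructor
    · rw [← dist_eq_norm]
      by_contra h
      exact hB.exit_notMem hU hω (hball (not_le.1 h))
    · rw [← dist_eq_norm]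
      exact hM (hB.exit_mem_closure_of_mem hx ω)
  have hX := hB.measurable_exitPos hU x
  have hτ := hB.measurable_exitTime hU x
  have hηm : Measurable fun z : Space d => heatConst d * (η ‖z - y‖ - η 1) := by
    have := measurable_radialProfile d
    exact ((this.comp (by fun_prop)).sub_const _).const_mul _
  set K := heatConst d * (|η δ| + |η M| + |η 1|) with hK
  have hlim : Filter.Tendsto (fun n => ∫ z, f n z ∂(ν n)) Filter.atTop
      (nhds (∫ z, heatConst d * (η ‖z - y‖ - η 1) ∂(harmonicMeasure B Q U x))) := by
    rw [← discountedHarmonic_zero, hB.integral_discountedHarmonic hU 0 x hηm]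
    simp only [ν]
    simp_rw [fun n => hB.integral_discountedHarmonic hU (l n) x (hfm n)]
    refine tendsto_integral_of_dominated_convergence (fun _ => K) (fun n => ?_)
      (integrable_const _) (fun n => ?_) ?_
    · exact (Measurable.mul (by fun_prop) ((hfm n).comp hX)).aestronglyMeasurable
    · filter_upwards [ae_restrict_mem (hB.measurableSet_exits hU x)] with ω hω
      obtain ⟨h1, h2⟩ := hbdry ω hω
      have h0 : 0 < ‖x + B (exitTime B U x ω) ω - y‖ := hδ.trans_le h1
      rw [hfe n _ (sub_ne_zero.1 (norm_pos_iff.1 h0)), norm_mul, Real.norm_eq_abs, Real.abs_exp,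
        Real.norm_eq_abs]
      refine (mul_le_of_le_one_left (abs_nonneg _) (Real.exp_le_one_iff.2 ?_)).trans
        ((abs_resolventDiff_le hd (hl n).le h0 one_pos).trans ?_)
      · have : 0 ≤ l n * exitTime B U x ω := mul_nonneg (hl n).le NNReal.zero_le_coe
        linarith
      · exact mul_le_mul_of_nonneg_left (abs_radialProfile_sub_le hd hδ h1 h2)
          (heatConst_pos hd).le
    · filter_upwards [ae_restrict_mem (hB.measurableSet_exits hU x)] with ω hω
      obtain ⟨h1, h2⟩ := hbdry ω hω
      have h0 : 0 < ‖x + B (exitTime B U x ω) ω - y‖ := hδ.trans_le h1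
      simp_rw [hfe _ _ (sub_ne_zero.1 (norm_pos_iff.1 h0))]
      refine Filter.Tendsto.mul ?_ (tendsto_resolventDiff hd h0 one_pos)
      have h3 : Continuous fun s : ℝ => Real.exp (-(s * exitTime B U x ω)) := by fun_prop
      exact (h3.tendsto 0).comp hllim
  have hae : ∀ᵐ z ∂(harmonicMeasure B Q U x), δ ≤ ‖z - y‖ ∧ ‖z - y‖ ≤ M := by
    filter_upwards [hB.ae_harmonicMeasure hU x, (by
      rw [← discountedHarmonic_zero]
      exact hB.ae_discountedHarmonic_closure hU 0 hx :
        ∀ᵐ z ∂(harmonicMeasure B Q U x), z ∈ closure U)] with z hz hzc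
    constructor
    · rw [← dist_eq_norm]
      by_contra h
      exact hz (hball (not_le.1 h))
    · rw [← dist_eq_norm]
      exact hM hzc
  have hηint : Integrable (fun z : Space d => η ‖z - y‖) (harmonicMeasure B Q U x) := by
    refine Integrable.of_bound (((measurable_radialProfile d).comp
      (by fun_prop)).aestronglyMeasurable) (|η δ| + |η M| + |η 1| + |η 1|) ?_
    filter_upwards [hae] with z hz
    have h1 := abs_radialProfile_sub_le hd hδ hz.1 hz.2
    rw [Real.norm_eq_abs]
    calc |η ‖z - y‖| = |(η ‖z - y‖ - η 1) + η 1| := by rw [sub_add_cancel]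
      _ ≤ |η ‖z - y‖ - η 1| + |η 1| := abs_add_le _ _
      _ ≤ _ := add_le_add h1 le_rfl
  have hlast : Filter.Tendsto (fun n => (heatResolvent (l n) e).toReal * (1 - (ν n).real univ))
      Filter.atTop (nhds 0) := by
    have h1 := (tendsto_mul_heatResolvent hd he0).mul_const (T : ℝ)
    rw [zero_mul] at h1
    refine squeeze_zero (fun n => mul_nonneg ENNReal.toReal_nonneg (hmass' n).1) (fun n => ?_) h1
    calc _ ≤ (heatResolvent (l n) e).toReal * (l n * T) :=
          mul_le_mul_of_nonneg_left (hmass' n).2 ENNReal.toReal_nonneg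
      _ = _ := by simp only [l]; ring
  have h0 : 0 < ‖x - y‖ := norm_pos_iff.2 (sub_ne_zero.2 hxy)
  have htot := ((tendsto_resolventDiff hd h0 one_pos).sub hlim).add hlast
  have hval : heatConst d * (η ‖x - y‖ - η 1) -
      (∫ z, heatConst d * (η ‖z - y‖ - η 1) ∂(harmonicMeasure B Q U x)) + 0 =
      greenConst d * (fundamentalSolution d (x - y) -
        ∫ z, fundamentalSolution d (z - y) ∂(harmonicMeasure B Q U x)) := by
    simp_rw [fundamentalSolution_eq]
    rw [integral_const_mul, integral_sub hηint (integrable_const _), integral_const, hone,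
      integral_div, greenConst]
    have := (toSphere_real_pos hd).ne'
    simp only [smul_eq_mul, ← hη]
    field_simp
    ring
  rw [hval] at htot
  constructor
  · refine nonneg_of_mul_nonneg_right (ge_of_tendsto' htot fun n => ?_) hc
    rw [← hreal n]
    exact ENNReal.toReal_nonneg
  · refine tendsto_nhds_unique (tendsto_killedResolvent U x y)
      (((ENNReal.continuous_ofReal.tendsto _).comp htot).congr fun n => ?_)
    have h1 := (killedResolvent_le U (l n) x y).trans_lt
      (heatResolvent_ne_top (hl n) (sub_ne_zero.2 hxy)).lt_top
    simp only [Function.comp_apply]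
    rw [← hreal n, ENNReal.ofReal_toReal h1.ne]

/-- The Green's function of a bounded open set is the time integral of the killed heat kernel. -/
theorem IsContinuousBM.killedResolvent_eq_boundedGreen [IsProbabilityMeasure Q] (hd : 2 ≤ d)
    (hB : IsContinuousBM B Q) (hU : IsOpen U) (hUb : Bornology.IsBounded U) (x y : Space d) :
    killedResolvent U 0 x y = ENNReal.ofReal (greenConst d) * boundedGreen B Q U x y := by
  have hc := greenConst_pos hd
  unfold boundedGreen
  split_ifs with hmem hxy
  · rw [← hxy, hB.killedResolvent_self hd hU hmem.1, ENNReal.mul_top]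
    simpa using hc
  · rw [(hB.killedResolvent_eq_ofReal hd hU hUb hmem.1 hmem.2 hxy).2, ENNReal.ofReal_mul hc.le]
  · rw [killedResolvent_of_notMem hmem, mul_zero]

/-- The Green's function is the time integral of the killed heat kernel, up to a constant. -/
theorem IsContinuousBM.killedResolvent_eq_green [IsProbabilityMeasure Q] (hd : 2 ≤ d)
    (hB : IsContinuousBM B Q) (hU : IsOpen U) (x y : Space d) :
    killedResolvent U 0 x y = ENNReal.ofReal (greenConst d) * green B Q U x y := by
  rw [green, ENNReal.mul_iSup]
  simp_rw [← fun n : ℕ => hB.killedResolvent_eq_boundedGreen hd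
    (hU.inter (Metric.isOpen_ball (x := (0 : Space d)) (ε := n)))
    (Metric.isBounded_ball.subset inter_subset_right) x y]
  unfold killedResolvent
  refine Eq.trans (lintegral_congr fun t => ?_) (lintegral_iSup (f := fun (n : ℕ) (t : ℝ) =>
    ENNReal.ofReal (Real.exp (-(0 * t))) *
      killedKernel (U ∩ Metric.ball 0 (n : ℝ)) t x y) (fun n => by fun_prop) fun m n hmn t =>
    mul_le_mul' le_rfl (killedKernel_mono (inter_subset_inter_right U
      (Metric.ball_subset_ball (by exact_mod_cast hmn))) t x y))
  rw [killedKernel_eq_iSup_inter_ball, ENNReal.mul_iSup]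

end GreenIdentification

/-! ### The mean value property with a smooth radial weight -/

section MeanValue

variable {d : ℕ}

/-- A smooth radial bump function supported in the closed unit ball. -/
noncomputable def radialBump (v : Space d) : ℝ := Real.smoothTransition (1 - ‖v‖ ^ 2)

/-- A radial potential of the vector field `v ↦ radialBump v • v`. -/
noncomputable def radialBumpPotential (v : Space d) : ℝ :=
  -(1 / 2 * ∫ s in (‖v‖ ^ 2)..1, Real.smoothTransition (1 - s))

theorem contDiff_radialBump {n : ℕ∞} : ContDiff ℝ n (radialBump : Space d → ℝ) :=
  Real.smoothTransition.contDiff.comp (contDiff_const.sub (contDiff_norm_sq ℝ))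

theorem continuous_radialBump : Continuous (radialBump : Space d → ℝ) :=
  (contDiff_radialBump (n := 0)).continuous

theorem radialBump_nonneg (v : Space d) : 0 ≤ radialBump v := Real.smoothTransition.nonneg _

theorem radialBump_le_one (v : Space d) : radialBump v ≤ 1 := Real.smoothTransition.le_one _

theorem radialBump_eq_zero {v : Space d} (hv : 1 ≤ ‖v‖) : radialBump v = 0 :=
  Real.smoothTransition.zero_of_nonpos (by nlinarith)

theorem hasCompactSupport_radialBump : HasCompactSupport (radialBump : Space d → ℝ) :=
  HasCompactSupport.intro (isCompact_closedBall 0 1) fun v hv => radialBump_eq_zero (by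
    rw [mem_closedBall_zero_iff, not_le] at hv
    exact hv.le)

theorem integrable_radialBump : Integrable (radialBump : Space d → ℝ) :=
  continuous_radialBump.integrable_of_hasCompactSupport hasCompactSupport_radialBump

theorem integral_radialBump_pos : 0 < ∫ v : Space d, radialBump v := by
  refine continuous_radialBump.integral_pos_of_hasCompactSupport_nonneg_nonzero
    hasCompactSupport_radialBump radialBump_nonneg (x := 0) ?_
  simp [radialBump, Real.smoothTransition.one]

theorem hasFDerivAt_radialBumpPotential (v : Space d) :
    HasFDerivAt (radialBumpPotential : Space d → ℝ) (radialBump v • innerSL ℝ v) v := by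
  have hg : Continuous fun s : ℝ => Real.smoothTransition (1 - s) :=
    Real.smoothTransition.continuous.comp (continuous_const.sub continuous_id)
  have h1 : HasDerivAt (fun u : ℝ => ∫ s in u..1, Real.smoothTransition (1 - s))
      (-Real.smoothTransition (1 - ‖v‖ ^ 2)) (‖v‖ ^ 2) :=
    intervalIntegral.integral_hasDerivAt_left (hg.intervalIntegrable _ _)
      (hg.stronglyMeasurableAtFilter _ _) hg.continuousAt
  have h2 := ((h1.const_mul (1 / 2)).neg).comp_hasFDerivAt v (hasStrictFDerivAt_norm_sq v).hasFDerivAt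
  refine h2.congr_fderiv ?_
  ext w
  simp [radialBump]
  ring

theorem radialBumpPotential_eq_zero {v : Space d} (hv : 1 ≤ ‖v‖) : radialBumpPotential v = 0 := by
  unfold radialBumpPotential
  rw [intervalIntegral.integral_zero_ae, mul_zero, neg_zero]
  refine Filter.Eventually.of_forall fun s hs => Real.smoothTransition.zero_of_nonpos ?_
  rw [uIoc_of_ge (by nlinarith)] at hs
  linarith [hs.1]

theorem continuous_radialBumpPotential : Continuous (radialBumpPotential : Space d → ℝ) :=
  continuous_iff_continuousAt.2 fun v => (hasFDerivAt_radialBumpPotential v).continuousAt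

theorem hasCompactSupport_radialBumpPotential :
    HasCompactSupport (radialBumpPotential : Space d → ℝ) :=
  HasCompactSupport.intro (isCompact_closedBall 0 1) fun v hv => radialBumpPotential_eq_zero (by
    rw [mem_closedBall_zero_iff, not_le] at hv
    exact hv.le)

theorem radialBumpPotential_nonpos (v : Space d) : radialBumpPotential v ≤ 0 := by
  rcases le_or_gt 1 ‖v‖ with h | h
  · rw [radialBumpPotential_eq_zero h]
  · have : 0 ≤ ∫ s in (‖v‖ ^ 2)..1, Real.smoothTransition (1 - s) :=
      intervalIntegral.integral_nonneg (by nlinarith [norm_nonneg v])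
        fun s _ => Real.smoothTransition.nonneg _
    unfold radialBumpPotential
    linarith

theorem integral_radialBumpPotential_neg : ∫ v : Space d, radialBumpPotential v < 0 := by
  have h : 0 < ∫ v : Space d, -radialBumpPotential v := by
    refine continuous_radialBumpPotential.neg.integral_pos_of_hasCompactSupport_nonneg_nonzero
      hasCompactSupport_radialBumpPotential.neg
      (fun v => neg_nonneg.2 (radialBumpPotential_nonpos v)) (x := 0) ?_
    have hg : Continuous fun s : ℝ => Real.smoothTransition (1 - s) :=
      Real.smoothTransition.continuous.comp (continuous_const.sub continuous_id)
    have h1 : 0 < ∫ s in (0 : ℝ)..1, Real.smoothTransition (1 - s) :=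
      intervalIntegral.intervalIntegral_pos_of_pos_on (hg.intervalIntegrable _ _)
        (fun s hs => Real.smoothTransition.pos_of_pos (by linarith [hs.2])) zero_lt_one
    simp only [radialBumpPotential, norm_zero, ne_eq, OfNat.ofNat_ne_zero, not_false_eq_true,
      zero_pow, neg_neg]
    positivity
  rw [integral_neg] at h
  linarith

/-- The mean of `h` over a ball around `z`, with a smooth radial weight. -/
noncomputable def bumpMean (h : Space d → ℝ) (z : Space d) (ρ : ℝ) : ℝ :=
  ∫ v, h (z + ρ • v) * radialBump v

theorem bumpMean_zero (h : Space d → ℝ) (z : Space d) :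
    bumpMean h z 0 = h z * ∫ v : Space d, radialBump v := by
  simp [bumpMean, integral_const_mul]

theorem bumpMean_congr {f g : Space d → ℝ} {z : Space d} {ρ : ℝ} (hρ : 0 ≤ ρ)
    (h : ∀ x ∈ Metric.closedBall z ρ, f x = g x) : bumpMean f z ρ = bumpMean g z ρ := by
  refine integral_congr_ae (Filter.Eventually.of_forall fun v => ?_)
  rcases le_or_gt 1 ‖v‖ with hv | hv
  · simp [radialBump_eq_zero hv]
  · simp only
    rw [h _ (by
      rw [Metric.mem_closedBall, dist_eq_norm, add_sub_cancel_left, norm_smul, Real.norm_eq_abs,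
        abs_of_nonneg hρ]
      exact mul_le_of_le_one_right hρ hv.le)]

theorem hasDerivAt_bumpMean {h : Space d → ℝ} (hh : ContDiff ℝ 2 h) (z : Space d) (ρ : ℝ) :
    HasDerivAt (bumpMean h z) (∫ v, fderiv ℝ h (z + ρ • v) v * radialBump v) ρ := by
  have hh1 : Continuous (fderiv ℝ h) := hh.continuous_fderiv (by norm_num)
  have hcont : ∀ ρ : ℝ, Continuous fun v : Space d => h (z + ρ • v) * radialBump v := fun ρ =>
    (hh.continuous.comp (by fun_prop)).mul continuous_radialBump
  have hcont' : Continuous fun v : Space d => fderiv ℝ h (z + ρ • v) v * radialBump v := by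
    refine Continuous.mul ?_ continuous_radialBump
    exact (hh1.comp (by fun_prop)).clm_apply continuous_id
  obtain ⟨C, hC⟩ := (isCompact_closedBall z (|ρ| + 1)).exists_bound_of_continuousOn
    hh1.continuousOn
  refine (hasDerivAt_integral_of_dominated_loc_of_deriv_le (s := Metric.ball ρ 1)
    (F := fun ρ v => h (z + ρ • v) * radialBump v)
    (F' := fun ρ v => fderiv ℝ h (z + ρ • v) v * radialBump v)
    (bound := fun v => C * radialBump v) (Metric.ball_mem_nhds ρ one_pos)
    (Filter.Eventually.of_forall fun ρ => (hcont ρ).aestronglyMeasurable)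
    ((hcont ρ).integrable_of_hasCompactSupport hasCompactSupport_radialBump.mul_left)
    hcont'.aestronglyMeasurable (Filter.Eventually.of_forall fun v r hr => ?_)
    (integrable_radialBump.const_mul C)
    (Filter.Eventually.of_forall fun v r _ => ?_)).2
  · rw [norm_mul, Real.norm_of_nonneg (radialBump_nonneg v)]
    rcases le_or_gt 1 ‖v‖ with hv | hv
    · simp [radialBump_eq_zero hv]
    refine mul_le_mul_of_nonneg_right ?_ (radialBump_nonneg v)
    have hr' : |r| ≤ |ρ| + 1 := by
      rw [Metric.mem_ball, Real.dist_eq] at hr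
      have := abs_sub_abs_le_abs_sub r ρ
      linarith
    have hmem : z + r • v ∈ Metric.closedBall z (|ρ| + 1) := by
      rw [Metric.mem_closedBall, dist_eq_norm, add_sub_cancel_left, norm_smul, Real.norm_eq_abs]
      exact (mul_le_of_le_one_right (abs_nonneg r) hv.le).trans hr'
    have hCn : 0 ≤ C := (norm_nonneg _).trans (hC _ hmem)
    calc ‖fderiv ℝ h (z + r • v) v‖ ≤ ‖fderiv ℝ h (z + r • v)‖ * ‖v‖ :=
          ContinuousLinearMap.le_opNorm _ _
      _ ≤ C * 1 := mul_le_mul (hC _ hmem) hv.le (norm_nonneg v) hCn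
      _ = C := mul_one C
  · have h1 : HasDerivAt (fun r : ℝ => z + r • v) v r := by
      simpa using ((hasDerivAt_id r).smul_const v).const_add z
    have h2 := (hh.differentiable (by norm_num)).differentiableAt (x := z + r • v)
    exact (h2.hasFDerivAt.comp_hasDerivAt r h1).mul_const _

/-- The field `radialBump v • v` is the gradient of a compactly supported potential, so integrating
by parts in each coordinate turns the derivative of the mean in its radius into an average of the
Laplacian. -/
theorem integral_fderiv_mul_radialBump {h : Space d → ℝ} (hh : ContDiff ℝ 2 h) (z : Space d)
    (ρ : ℝ) : ∫ v, fderiv ℝ h (z + ρ • v) v * radialBump v =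
      -(ρ * ∫ v, Laplacian.laplacian h (z + ρ • v) * radialBumpPotential v) := by
  have hh1 : ContDiff ℝ 1 (fderiv ℝ h) := hh.fderiv_right (by norm_num)
  have hh2 : Continuous (fderiv ℝ (fderiv ℝ h)) := hh1.continuous_fderiv (by norm_num)
  have haff : ∀ v : Space d, HasFDerivAt (fun v : Space d => z + ρ • v)
      (ρ • ContinuousLinearMap.id ℝ (Space d)) v := fun v =>
    ((hasFDerivAt_id v).const_smul ρ).const_add z
  have hcaff : Continuous fun v : Space d => z + ρ • v := by fun_prop
  let b := EuclideanSpace.basisFun (Fin d) ℝ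
  let f : Fin d → Space d → ℝ := fun i v => fderiv ℝ h (z + ρ • v) (b i)
  have hf : ∀ i v, HasFDerivAt (f i)
      (ρ • (ContinuousLinearMap.apply ℝ ℝ (b i)).comp (fderiv ℝ (fderiv ℝ h) (z + ρ • v))) v := by
    intro i v
    have h1 := (hh1.differentiable (by norm_num)).differentiableAt (x := z + ρ • v)
    have h2 := h1.hasFDerivAt.comp v (haff v)
    have h3 := (ContinuousLinearMap.apply ℝ ℝ (b i)).hasFDerivAt.comp v h2
    refine h3.congr_fderiv ?_
    ext w
    simp
  have hfc : ∀ i, Continuous (f i) := fun i =>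
    (hh1.continuous.comp hcaff).clm_apply continuous_const
  have hD2 : ∀ i, Continuous fun v => fderiv ℝ (fderiv ℝ h) (z + ρ • v) (b i) (b i) := fun i =>
    ((hh2.comp hcaff).clm_apply continuous_const).clm_apply continuous_const
  have hint1 : ∀ i, Integrable fun v => f i v * (v i * radialBump v) := fun i => by
    refine Continuous.integrable_of_hasCompactSupport ?_
      (hasCompactSupport_radialBump.mul_left.mul_left)
    have := hfc i
    have := continuous_radialBump (d := d)
    fun_prop
  have hint2 : ∀ i, Integrable fun v =>
      ρ * fderiv ℝ (fderiv ℝ h) (z + ρ • v) (b i) (b i) * radialBumpPotential v := fun i => by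
    refine Continuous.integrable_of_hasCompactSupport ?_
      hasCompactSupport_radialBumpPotential.mul_left
    have := hD2 i
    have := continuous_radialBumpPotential (d := d)
    fun_prop
  have hibp : ∀ i, ∫ v, f i v * (v i * radialBump v) = -∫ v,
      ρ * fderiv ℝ (fderiv ℝ h) (z + ρ • v) (b i) (b i) * radialBumpPotential v := by
    intro i
    have e1 : ∀ v, fderiv ℝ (radialBumpPotential : Space d → ℝ) v (b i) = v i * radialBump v := by
      intro v
      rw [(hasFDerivAt_radialBumpPotential v).fderiv]
      simp [b, EuclideanSpace.inner_single_right, mul_comm]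
    have e2 : ∀ v, fderiv ℝ (f i) v (b i) =
        ρ * fderiv ℝ (fderiv ℝ h) (z + ρ • v) (b i) (b i) := by
      intro v
      rw [(hf i v).fderiv]
      simp
    have h0 : Integrable fun v => f i v * radialBumpPotential v :=
      Continuous.integrable_of_hasCompactSupport ((hfc i).mul continuous_radialBumpPotential)
        hasCompactSupport_radialBumpPotential.mul_left
    have := integral_mul_fderiv_eq_neg_fderiv_mul_of_integrable (μ := volume) (f := f i)
      (g := radialBumpPotential) (v := b i) (by simpa only [e2] using hint2 i)
      (by simpa only [e1] using hint1 i) h0 (fun v _ => (hf i v).differentiableAt)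
      (fun v _ => (hasFDerivAt_radialBumpPotential v).differentiableAt)
    simpa only [e1, e2] using this
  have hsum : ∀ v : Space d, fderiv ℝ h (z + ρ • v) v * radialBump v =
      ∑ i, f i v * (v i * radialBump v) := fun v => by
    conv_lhs => rw [← b.sum_repr v, map_sum, b.sum_repr v]
    rw [Finset.sum_mul]
    refine Finset.sum_congr rfl fun i _ => ?_
    simp [f, b]
    ring
  have hlap : ∀ v : Space d, Laplacian.laplacian h (z + ρ • v) =
      ∑ i, fderiv ℝ (fderiv ℝ h) (z + ρ • v) (b i) (b i) := fun v => by
    rw [InnerProductSpace.laplacian_eq_iteratedFDeriv_orthonormalBasis h b]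
    simp [iteratedFDeriv_two_apply]
  simp_rw [hsum, hlap]
  rw [integral_finsetSum _ fun i _ => hint1 i]
  simp_rw [hibp, Finset.sum_mul]
  rw [Finset.sum_neg_distrib, ← integral_finsetSum _ fun i _ => hint2 i, ← integral_const_mul]
  congr 2
  ext v
  rw [Finset.mul_sum]
  exact Finset.sum_congr rfl fun i _ => mul_assoc _ _ _

theorem bumpMean_eq_of_laplacian_eq_zero {h : Space d → ℝ} (hh : ContDiff ℝ 2 h) {z : Space d}
    {ρ : ℝ} (hρ : 0 ≤ ρ) (hΔ : ∀ w ∈ Metric.closedBall z ρ, Laplacian.laplacian h w = 0) :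
    bumpMean h z ρ = h z * ∫ v : Space d, radialBump v := by
  have hder := fun r => hasDerivAt_bumpMean hh z r
  have h0 : ∀ r ∈ Ico 0 ρ, HasDerivWithinAt (bumpMean h z) 0 (Ici r) r := fun r hr => by
    have h1 := hder r
    rw [integral_fderiv_mul_radialBump hh, integral_eq_zero_of_ae, mul_zero, neg_zero] at h1
    · exact h1.hasDerivWithinAt
    · refine Filter.Eventually.of_forall fun v => ?_
      rcases le_or_gt 1 ‖v‖ with hv | hv
      · simp [radialBumpPotential_eq_zero hv]
      · simp only [Pi.zero_apply]
        rw [hΔ _ (by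
          rw [Metric.mem_closedBall, dist_eq_norm, add_sub_cancel_left, norm_smul,
            Real.norm_eq_abs, abs_of_nonneg hr.1]
          exact (mul_le_of_le_one_right hr.1 hv.le).trans hr.2.le), zero_mul]
  have := constant_of_has_deriv_right_zero (f := bumpMean h z)
    (fun r _ => (hder r).continuousAt.continuousWithinAt) h0 ρ ⟨hρ, le_rfl⟩
  rw [this, bumpMean_zero]

/-- By Rolle's theorem the derivative of the mean vanishes at some radius between `0` and `ρ n`. So
averages of the Laplacian against the potential, whose integral is nonzero, vanish at radii tending
to `0`; continuity gives the value at `z`. -/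
theorem laplacian_eq_zero_of_bumpMean {h : Space d → ℝ} (hh : ContDiff ℝ 2 h) {z : Space d}
    {ρ : ℕ → ℝ} (hρ : ∀ n, 0 < ρ n) (hρ0 : Filter.Tendsto ρ Filter.atTop (nhds 0))
    (hmean : ∀ᶠ n in Filter.atTop, bumpMean h z (ρ n) = h z * ∫ v : Space d, radialBump v) :
    Laplacian.laplacian h z = 0 := by
  have hder := fun r => hasDerivAt_bumpMean hh z r
  have hlapc : Continuous (Laplacian.laplacian h) := by
    have hh1 : ContDiff ℝ 1 (fderiv ℝ h) := hh.fderiv_right (by norm_num)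
    have hh2 : Continuous (fderiv ℝ (fderiv ℝ h)) := hh1.continuous_fderiv (by norm_num)
    rw [InnerProductSpace.laplacian_eq_iteratedFDeriv_orthonormalBasis h
      (EuclideanSpace.basisFun (Fin d) ℝ)]
    simp only [iteratedFDeriv_two_apply]
    refine continuous_finsetSum _ fun i _ => ?_
    exact (hh2.clm_apply continuous_const).clm_apply continuous_const
  have hex : ∀ᶠ n in Filter.atTop, ∃ s ∈ Ioo 0 (ρ n),
      ∫ v, Laplacian.laplacian h (z + s • v) * radialBumpPotential v = 0 := by
    filter_upwards [hmean] with n hn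
    obtain ⟨s, hs, hs0⟩ := exists_hasDerivAt_eq_zero (hρ n)
      (fun r _ => (hder r).continuousAt.continuousWithinAt)
      (by rw [hn, bumpMean_zero]) fun r _ => hder r
    rw [integral_fderiv_mul_radialBump hh, neg_eq_zero, mul_eq_zero] at hs0
    exact ⟨s, hs, hs0.resolve_left hs.1.ne'⟩
  have hcont : Continuous fun s : ℝ =>
      ∫ v, Laplacian.laplacian h (z + s • v) * radialBumpPotential v := by
    refine continuous_parametric_integral_of_continuous (μ := volume)
      (f := fun s v => Laplacian.laplacian h (z + s • v) * radialBumpPotential v) ?_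
      (isCompact_closedBall (0 : Space d) 1) |>.congr fun s => ?_
    · have := continuous_radialBumpPotential (d := d)
      simp only [Function.uncurry_def]
      fun_prop
    · refine setIntegral_eq_integral_of_forall_compl_eq_zero fun v hv => ?_
      rw [mem_closedBall_zero_iff, not_le] at hv
      rw [radialBumpPotential_eq_zero hv.le, mul_zero]
  obtain ⟨N, hN⟩ := Filter.eventually_atTop.1 hex
  choose s hs hs0 using fun n => hN (n + N) (Nat.le_add_left N n)
  have hslim : Filter.Tendsto s Filter.atTop (nhds 0) :=
    squeeze_zero (fun n => (hs n).1.le) (fun n => (hs n).2.le)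
      (hρ0.comp (Filter.tendsto_add_atTop_nat N))
  have hlim := (hcont.tendsto 0).comp hslim
  have h0 : ∫ v, Laplacian.laplacian h (z + (0 : ℝ) • v) * radialBumpPotential v = 0 := by
    refine tendsto_nhds_unique hlim (tendsto_const_nhds.congr fun n => ?_)
    exact (hs0 n).symm
  simp only [zero_smul, add_zero, integral_const_mul, mul_eq_zero] at h0
  exact h0.resolve_right integral_radialBumpPotential_neg.ne

theorem exists_contDiff_eq_on_ball {h : Space d → ℝ} {z : Space d} {R : ℝ}
    (hh : ∀ x ∈ Metric.ball z R, ContDiffAt ℝ 2 h x) {r : ℝ} (hr : 0 < r) (hrR : r < R) :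
    ∃ g : Space d → ℝ, ContDiff ℝ 2 g ∧ ∀ x ∈ Metric.closedBall z r, g =ᶠ[nhds x] h := by
  let χ : ContDiffBump z := ⟨(r + R) / 2, (r + 2 * R) / 3, by linarith, by linarith⟩
  refine ⟨fun x => χ x * h x, ?_, fun x hx => ?_⟩
  · refine contDiff_iff_contDiffAt.2 fun x => ?_
    by_cases hx : x ∈ Metric.ball z R
    · exact χ.contDiff.contDiffAt.mul (hh x hx)
    · have h1 : x ∉ tsupport χ := by
        rw [χ.tsupport_eq]
        intro h2
        rw [Metric.mem_closedBall] at h2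
        rw [Metric.mem_ball] at hx
        have : χ.rOut = (r + 2 * R) / 3 := rfl
        linarith
      refine (contDiffAt_const (c := (0 : ℝ))).congr_of_eventuallyEq ?_
      filter_upwards [(isClosed_tsupport χ).isOpen_compl.mem_nhds h1] with y hy
      rw [image_eq_zero_of_notMem_tsupport hy, zero_mul]
  · have hx' : x ∈ Metric.ball z χ.rIn := by
      rw [Metric.mem_closedBall] at hx
      rw [Metric.mem_ball]
      have : χ.rIn = (r + R) / 2 := rfl
      linarith
    filter_upwards [χ.eventuallyEq_one_of_mem_ball hx'] with y hy
    rw [hy, Pi.one_apply, one_mul]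

/-- The mean value property of harmonic functions, for a smooth radial weight. -/
theorem bumpMean_eq_of_harmonic {h : Space d → ℝ} {z : Space d} {ρ : ℝ} (hρ : 0 < ρ)
    (hh : ∀ x ∈ Metric.closedBall z ρ, InnerProductSpace.HarmonicAt h x) :
    bumpMean h z ρ = h z * ∫ v : Space d, radialBump v := by
  obtain ⟨δ, hδ, hsub⟩ := (isCompact_closedBall z ρ).exists_thickening_subset_open
    (InnerProductSpace.isOpen_setOfPred_harmonicAt h) hh
  have hball : Metric.ball z (ρ + δ) ⊆ {x | InnerProductSpace.HarmonicAt h x} := by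
    rw [add_comm, ← thickening_closedBall hδ hρ.le]
    exact hsub
  obtain ⟨g, hg, hgh⟩ := exists_contDiff_eq_on_ball (z := z) (R := ρ + δ)
    (fun x hx => (hball hx).1) hρ (by linarith)
  have hgz := (hgh z (Metric.mem_closedBall_self hρ.le)).eq_of_nhds
  rw [← hgz, ← bumpMean_eq_of_laplacian_eq_zero hg hρ.le fun w hw => ?_]
  · exact bumpMean_congr hρ.le fun x hx => (hgh x hx).eq_of_nhds.symm
  · rw [(InnerProductSpace.laplacian_congr_nhds (hgh w hw)).eq_of_nhds]
    exact (hh w hw).2.eq_of_nhds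

/-- Functions with the mean value property for small balls are harmonic. -/
theorem harmonicOnNhd_of_bumpMean {h : Space d → ℝ} {U : Set (Space d)} (hU : IsOpen U)
    (hh : ∀ x ∈ U, ContDiffAt ℝ 2 h x) {ρ : ℕ → ℝ} (hρ : ∀ n, 0 < ρ n)
    (hρ0 : Filter.Tendsto ρ Filter.atTop (nhds 0))
    (hmean : ∀ z ∈ U, ∀ᶠ n in Filter.atTop,
      bumpMean h z (ρ n) = h z * ∫ v : Space d, radialBump v) :
    InnerProductSpace.HarmonicOnNhd h U := by
  have key : ∀ z ∈ U, Laplacian.laplacian h z = 0 := fun z hz => by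
    obtain ⟨R, hR, hball⟩ := Metric.isOpen_iff.1 hU z hz
    obtain ⟨g, hg, hgh⟩ := exists_contDiff_eq_on_ball (fun x hx => hh x (hball hx))
      (half_pos hR) (half_lt_self hR)
    have hgz := hgh z (Metric.mem_closedBall_self (half_pos hR).le)
    rw [← (InnerProductSpace.laplacian_congr_nhds hgz).eq_of_nhds]
    refine laplacian_eq_zero_of_bumpMean hg hρ hρ0 ?_
    filter_upwards [hmean z hz, (tendsto_order.1 hρ0).2 _ (half_pos hR)] with n hn hnR
    rw [hgz.eq_of_nhds, ← hn]
    refine bumpMean_congr (hρ n).le fun x hx => ?_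
    exact (hgh x (Metric.closedBall_subset_closedBall hnR.le hx)).eq_of_nhds
  exact fun z hz => ⟨hh z hz, by
    filter_upwards [hU.mem_nhds hz] with w hw
    exact key w hw⟩

theorem laplacian_radial {F F' : ℝ → ℝ} {F'' : ℝ} {z : Space d}
    (hF : ∀ᶠ s in nhds (‖z‖ ^ 2), HasDerivAt F (F' s) s)
    (hF' : HasDerivAt F' F'' (‖z‖ ^ 2)) :
    Laplacian.laplacian (fun w : Space d => F (‖w‖ ^ 2)) z =
      2 * d * F' (‖z‖ ^ 2) + 4 * ‖z‖ ^ 2 * F'' := by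
  let b := EuclideanSpace.basisFun (Fin d) ℝ
  have hn : ∀ w : Space d, HasFDerivAt (fun w : Space d => ‖w‖ ^ 2) (2 • innerSL ℝ w) w := fun w =>
    (hasStrictFDerivAt_norm_sq w).hasFDerivAt
  have h1 : fderiv ℝ (fun w : Space d => F (‖w‖ ^ 2)) =ᶠ[nhds z]
      fun w => (2 * F' (‖w‖ ^ 2)) • innerSL ℝ w := by
    have hc : Continuous fun w : Space d => ‖w‖ ^ 2 := by fun_prop
    filter_upwards [(hc.tendsto z).eventually hF] with w hw
    rw [(show HasFDerivAt (fun w : Space d => F (‖w‖ ^ 2)) _ w from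
      hw.comp_hasFDerivAt w (hn w)).fderiv]
    ext u
    simp
    ring
  let L : Space d →L[ℝ] Space d →L[ℝ] ℝ := innerSL ℝ
  have h2 : HasFDerivAt (fun w : Space d => (2 * F' (‖w‖ ^ 2)) • innerSL ℝ w)
      ((2 * F' (‖z‖ ^ 2)) • L + ContinuousLinearMap.smulRight
        ((2 * F'') • ((2 : ℕ) • innerSL ℝ z)) (innerSL ℝ z)) z := by
    have h3 : HasFDerivAt (fun w : Space d => 2 * F' (‖w‖ ^ 2))
        ((2 * F'') • ((2 : ℕ) • innerSL ℝ z)) z :=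
      (HasDerivAt.comp_hasFDerivAt z (h₂ := fun s => 2 * F' s) (hF'.const_mul 2) (hn z))
    exact h3.smul L.hasFDerivAt
  rw [InnerProductSpace.laplacian_eq_iteratedFDeriv_orthonormalBasis _ b]
  simp only [iteratedFDeriv_two_apply]
  rw [h1.fderiv_eq, h2.fderiv]
  have h4 : ∑ i, (z i) ^ 2 = ‖z‖ ^ 2 := by
    rw [EuclideanSpace.norm_sq_eq]
    simp
  have h6 : ∀ i, innerSL ℝ (EuclideanSpace.single i (1 : ℝ) : Space d)
      (EuclideanSpace.single i (1 : ℝ)) = 1 := fun i => by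
    rw [innerSL_apply_apply, real_inner_self_eq_norm_sq]
    simp
  simp [b, L, h6, EuclideanSpace.inner_single_right, Finset.sum_add_distrib]
  have h5 : ∀ i, 2 * F'' * (2 * z.ofLp i) * z.ofLp i = 4 * F'' * (z i) ^ 2 := fun i => by ring
  simp_rw [h5, ← Finset.mul_sum, h4]
  ring

theorem harmonicAt_comp_sub {h : Space d → ℝ} {z y : Space d}
    (hh : InnerProductSpace.HarmonicAt h (z - y)) :
    InnerProductSpace.HarmonicAt (fun w => h (w - y)) z := by
  have hc : Filter.Tendsto (fun w : Space d => w - y) (nhds z) (nhds (z - y)) :=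
    (by fun_prop : Continuous fun w : Space d => w - y).tendsto z
  refine ⟨hh.1.comp z (by fun_prop), ?_⟩
  filter_upwards [hc.eventually hh.2] with w hw
  refine Eq.trans ?_ hw
  simp only [InnerProductSpace.laplacian_eq_iteratedFDeriv_orthonormalBasis _
    (EuclideanSpace.basisFun (Fin d) ℝ), iteratedFDeriv_comp_sub]

/-- As a function of `s = ‖z‖ ^ 2` the profile has a derivative `F'` proportional to `s ^ (-d/2)`,
the logarithmic case included. For such a power the radial Laplacian `2 * d * F' + 4 * s * F''`
vanishes. -/
theorem harmonicAt_fundamentalSolution (hd : 2 ≤ d) {z : Space d} (hz : z ≠ 0) :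
    InnerProductSpace.HarmonicAt (fundamentalSolution d) z := by
  let F : ℝ → ℝ := fun s => radialProfile d (√s)
  let F' : ℝ → ℝ := fun s => -(radialRate d / 2 * (√s ^ d)⁻¹)
  have hF : ∀ s : ℝ, 0 < s → HasDerivAt F (F' s) s := fun s hs => by
    have h1 := (hasDerivAt_radialProfile hd (Real.sqrt_pos.2 hs)).comp s
      (Real.hasDerivAt_sqrt hs.ne')
    refine h1.congr_deriv ?_
    simp only [F']
    have h2 : √s ^ d = √s ^ (d - 1) * √s := by rw [← pow_succ]; congr 1; omega
    rw [h2, mul_inv]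
    field_simp
  have hF' : ∀ s : ℝ, 0 < s → HasDerivAt F' (radialRate d * d / 4 * (√s ^ d)⁻¹ / s) s :=
    fun s hs => by
    have hs' := Real.sqrt_pos.2 hs
    have h1 := ((((Real.hasDerivAt_sqrt hs.ne').pow d).inv (pow_pos hs' d).ne').const_mul
      (radialRate d / 2)).neg
    refine h1.congr_deriv ?_
    have h2 : √s ^ d = √s ^ (d - 1) * √s := by rw [← pow_succ]; congr 1; omega
    have h3 : s = √s * √s := (Real.mul_self_sqrt hs.le).symm
    rw [Pi.pow_apply, h2]
    nth_rewrite 7 [h3]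
    field_simp
    ring
  have hn : ∀ w : Space d, w ≠ 0 → 0 < ‖w‖ ^ 2 := fun w hw => by positivity
  have hfun : (fundamentalSolution d) =
      ((volume : Measure (Space d)).toSphere.real univ)⁻¹ • fun w : Space d => F (‖w‖ ^ 2) := by
    ext w
    simp only [F, Real.sqrt_sq (norm_nonneg w), Pi.smul_apply, smul_eq_mul]
    rw [fundamentalSolution_eq, div_eq_inv_mul]
  rw [hfun]
  refine InnerProductSpace.HarmonicAt.const_smul ⟨?_, ?_⟩
  · have hnz : ContDiffAt ℝ 2 (fun w : Space d => ‖w‖) z := contDiffAt_norm ℝ hz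
    have hz' : ‖z‖ ≠ 0 := norm_ne_zero_iff.2 hz
    simp only [F, Real.sqrt_sq (norm_nonneg _), radialProfile, one_div, Real.log_inv]
    split_ifs
    · exact (hnz.log hz').neg
    · exact (hnz.pow _).inv (pow_ne_zero _ hz')
  · filter_upwards [isOpen_compl_singleton.mem_nhds (show z ∈ ({0}ᶜ : Set (Space d)) from hz)]
      with w hw
    have hw' := hn w hw
    rw [laplacian_radial (F' := F') (F'' := radialRate d * d / 4 * (√(‖w‖ ^ 2) ^ d)⁻¹ / ‖w‖ ^ 2)
      (Filter.Eventually.mono (isOpen_Ioi.mem_nhds (show ‖w‖ ^ 2 ∈ Ioi (0 : ℝ) from hw'))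
        fun s hs => hF s hs) (hF' _ hw')]
    have hw0 : ‖w‖ ≠ 0 := norm_ne_zero_iff.2 hw
    simp only [F', Pi.zero_apply]
    field_simp
    ring

end MeanValue

/-! ### Balayage, symmetry and positivity of the Green's function -/

section GreenBasics

variable {d : ℕ} {Ω' : Type*} [MeasurableSpace Ω'] {B : ℝ≥0 → Ω' → Space d} {Q : Measure Ω'}
  {U : Set (Space d)}

theorem killedResolvent_mono {U V : Set (Space d)} (h : U ⊆ V) (l : ℝ) (x y : Space d) :
    killedResolvent U l x y ≤ killedResolvent V l x y :=
  lintegral_mono fun t => mul_le_mul' le_rfl (killedKernel_mono h t x y)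

theorem killedResolvent_eq_iSup_inter_ball (U : Set (Space d)) (l : ℝ) (x y : Space d) :
    killedResolvent U l x y = ⨆ n : ℕ, killedResolvent (U ∩ Metric.ball 0 (n : ℝ)) l x y := by
  unfold killedResolvent
  refine Eq.trans (lintegral_congr fun t => ?_) (lintegral_iSup (f := fun (n : ℕ) (t : ℝ) =>
    ENNReal.ofReal (Real.exp (-(l * t))) *
      killedKernel (U ∩ Metric.ball 0 (n : ℝ)) t x y) (fun n => by fun_prop) fun m n hmn t =>
    mul_le_mul' le_rfl (killedKernel_mono (inter_subset_inter_right U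
      (Metric.ball_subset_ball (by exact_mod_cast hmn))) t x y))
  rw [killedKernel_eq_iSup_inter_ball, ENNReal.mul_iSup]

theorem IsContinuousBM.green_eq [IsProbabilityMeasure Q] (hd : 2 ≤ d)
    (hB : IsContinuousBM B Q) (hU : IsOpen U) (x y : Space d) :
    green B Q U x y = (ENNReal.ofReal (greenConst d))⁻¹ * killedResolvent U 0 x y := by
  rw [hB.killedResolvent_eq_green hd hU, ← mul_assoc, ENNReal.inv_mul_cancel _
    ENNReal.ofReal_ne_top, one_mul]
  simpa using greenConst_pos hd

theorem IsContinuousBM.measurable_green [IsProbabilityMeasure Q] (hd : 2 ≤ d)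
    (hB : IsContinuousBM B Q) (hU : IsOpen U) :
    Measurable fun q : Space d × Space d => green B Q U q.1 q.2 := by
  simp_rw [hB.green_eq hd hU]
  exact (measurable_killedResolvent U 0).const_mul _

theorem IsContinuousBM.green_comm [IsProbabilityMeasure Q] (hd : 2 ≤ d)
    (hB : IsContinuousBM B Q) (hU : IsOpen U) (x y : Space d) :
    green B Q U x y = green B Q U y x := by
  rw [hB.green_eq hd hU, hB.green_eq hd hU, killedResolvent_comm]

theorem green_of_notMem {x y : Space d} (h : ¬ (x ∈ U ∧ y ∈ U)) : green B Q U x y = 0 := by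
  simp only [green, ENNReal.iSup_eq_zero]
  exact fun n => if_neg fun h' => h ⟨h'.1.1, h'.2.1⟩

/-- The identity on which the theorem rests. It needs no condition on `y`: off `D` all terms vanish.
-/
theorem IsContinuousBM.green_balayage [IsProbabilityMeasure Q] (hd : 2 ≤ d)
    (hB : IsContinuousBM B Q) {O D : Set (Space d)} (hO : IsOpen O) (hD : IsOpen D) (hOD : O ⊆ D)
    (hOreg : HasRegularBoundary B Q O) (hDreg : HasRegularBoundary B Q D)
    {x : Space d} (hx : x ∈ O) (y : Space d) :
    green B Q D x y = green B Q O x y +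
      ∫⁻ z, green B Q D z y ∂(harmonicMeasure B Q O x) := by
  by_cases hy : y ∈ D
  · simp_rw [hB.green_eq hd hO, hB.green_eq hd hD]
    have hm : Measurable fun z => killedResolvent D 0 z y :=
      Measurable.killedResolvent measurable_id measurable_const
    rw [lintegral_const_mul _ hm, ← mul_add, hB.killedResolvent_balayage (by omega) hO hD hOD hOreg hDreg hx hy]
  · rw [green_of_notMem fun h => hy h.2, green_of_notMem fun h => hy (hOD h.2)]
    simp [green_of_notMem (B := B) (Q := Q) fun h : _ ∈ D ∧ y ∈ D => hy h.2]

theorem ENNReal.two_mul_le_add_mul_self (a b : ℝ≥0∞) : 2 * (a * b) ≤ a * a + b * b := by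
  wlog h : a ≤ b generalizing a b
  · rw [mul_comm a b, add_comm]
    exact this b a (not_le.1 h).le
  obtain ⟨c, rfl⟩ := exists_add_of_le h
  calc 2 * (a * (a + c)) ≤ 2 * (a * (a + c)) + c * c := le_self_add
    _ = _ := by ring

/-- The semigroup property at `t / 2` and symmetry exhibit the energy as an integral of products of
smoothed measures. This is why the energy form is positive. -/
theorem lintegral_killedResolvent_eq (U : Set (Space d)) (p q : Measure (Space d)) [SFinite p]
    [SFinite q] : ∫⁻ x, ∫⁻ y, killedResolvent U 0 x y ∂q ∂p =
      ∫⁻ t in Ioi (0 : ℝ), ∫⁻ z, (∫⁻ x, killedKernel U (t / 2) z x ∂p) *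
        ∫⁻ y, killedKernel U (t / 2) z y ∂q := by
  unfold killedResolvent
  have h1 : ∀ x, ∫⁻ y, (∫⁻ t in Ioi (0 : ℝ), ENNReal.ofReal (Real.exp (-(0 * t))) *
      killedKernel U t x y) ∂q = ∫⁻ t in Ioi (0 : ℝ), ∫⁻ y, killedKernel U t x y ∂q := fun x => by
    rw [lintegral_lintegral_swap (by fun_prop)]
    simp
  simp_rw [h1]
  rw [lintegral_lintegral_swap]
  swap
  · have h2 : Measurable fun r : (Space d × ℝ) × Space d => killedKernel U r.1.2 r.1.1 r.2 := by
      fun_prop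
    exact h2.lintegral_prod_right'.aemeasurable
  refine setLIntegral_congr_fun measurableSet_Ioi fun t ht => ?_
  simp_rw [killedKernel_half U (mem_Ioi.1 ht)]
  have h3 : ∀ x, ∫⁻ y, (∫⁻ z, killedKernel U (t / 2) x z * killedKernel U (t / 2) z y) ∂q =
      ∫⁻ z, killedKernel U (t / 2) z x * ∫⁻ y, killedKernel U (t / 2) z y ∂q := fun x => by
    rw [lintegral_lintegral_swap (by fun_prop)]
    refine lintegral_congr fun z => ?_
    rw [lintegral_const_mul _ (by fun_prop), killedKernel_comm]
  simp_rw [h3]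
  have h4 : Measurable fun z => ∫⁻ y, killedKernel U (t / 2) z y ∂q := by
    have h5 : Measurable fun r : Space d × Space d => killedKernel U (t / 2) r.1 r.2 := by fun_prop
    exact h5.lintegral_prod_right'
  rw [lintegral_lintegral_swap (by fun_prop)]
  refine lintegral_congr fun z => ?_
  rw [lintegral_mul_const _ (by fun_prop)]

/-- The inequality `2ab ≤ a² + b²` under the integral. In this form it makes sense in `[0, ∞]`
without any finiteness, and it shows that mixed energies are finite as soon as the two energies are.
-/
theorem two_mul_lintegral_killedResolvent_le (U : Set (Space d)) (p q : Measure (Space d))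
    [SFinite p] [SFinite q] : 2 * ∫⁻ x, ∫⁻ y, killedResolvent U 0 x y ∂q ∂p ≤
      (∫⁻ x, ∫⁻ y, killedResolvent U 0 x y ∂p ∂p) +
        ∫⁻ x, ∫⁻ y, killedResolvent U 0 x y ∂q ∂q := by
  have h4 : ∀ (p : Measure (Space d)) [SFinite p],
      Measurable fun r : ℝ × Space d => ∫⁻ y, killedKernel U (r.1 / 2) r.2 y ∂p := fun p _ => by
    have h5 : Measurable fun r : (ℝ × Space d) × Space d =>
      killedKernel U (r.1.1 / 2) r.1.2 r.2 := by fun_prop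
    exact h5.lintegral_prod_right'
  have hp := h4 p
  have hq := h4 q
  have h6 : Measurable fun r : ℝ × Space d => (∫⁻ y, killedKernel U (r.1 / 2) r.2 y ∂p) *
      ∫⁻ y, killedKernel U (r.1 / 2) r.2 y ∂p := hp.mul hp
  have h7 : Measurable fun t : ℝ => ∫⁻ z, (∫⁻ y, killedKernel U (t / 2) z y ∂p) *
      ∫⁻ y, killedKernel U (t / 2) z y ∂p := h6.lintegral_prod_right'
  have h8 : ∀ t, Measurable fun z => (∫⁻ y, killedKernel U (t / 2) z y ∂p) *
      ∫⁻ y, killedKernel U (t / 2) z y ∂p := fun t => by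
    have h9 : Measurable fun z : Space d => (t, z) := measurable_prodMk_left
    have h10 := h6.comp h9
    exact h10
  simp_rw [lintegral_killedResolvent_eq]
  rw [← lintegral_const_mul' _ _ (by simp), ← lintegral_add_left h7]
  refine lintegral_mono fun t => ?_
  rw [← lintegral_const_mul' _ _ (by simp), ← lintegral_add_left (h8 t)]
  exact lintegral_mono fun z => ENNReal.two_mul_le_add_mul_self _ _

theorem IsContinuousBM.greenEnergy_eq [IsProbabilityMeasure Q] (hd : 2 ≤ d)
    (hB : IsContinuousBM B Q) (hU : IsOpen U) (p q : Measure (Space d)) [SFinite q] :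
    greenEnergy B Q U p q = (ENNReal.ofReal (greenConst d))⁻¹ *
      ∫⁻ x, ∫⁻ y, killedResolvent U 0 x y ∂q ∂p := by
  unfold greenEnergy
  simp_rw [hB.green_eq hd hU]
  have h1 : ∀ x, Measurable fun y => killedResolvent U 0 x y := fun x =>
    Measurable.killedResolvent measurable_const measurable_id
  rw [← lintegral_const_mul _ (measurable_killedResolvent U 0).lintegral_prod_right']
  exact lintegral_congr fun x => lintegral_const_mul _ (h1 x)

/-- The Cauchy-Schwarz inequality for the Green energy, in arithmetic form. -/
theorem IsContinuousBM.two_mul_greenEnergy_le [IsProbabilityMeasure Q] (hd : 2 ≤ d)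
    (hB : IsContinuousBM B Q) (hU : IsOpen U) (p q : Measure (Space d)) [SFinite p] [SFinite q] :
    2 * greenEnergy B Q U p q ≤ greenEnergy B Q U p p + greenEnergy B Q U q q := by
  simp_rw [hB.greenEnergy_eq hd hU]
  rw [mul_left_comm, ← mul_add]
  exact mul_le_mul' le_rfl (two_mul_lintegral_killedResolvent_le U p q)

end GreenBasics

/-! ### Mean value property of the Green's function -/

section GreenMeanValue

variable {d : ℕ} {Ω' : Type*} [MeasurableSpace Ω'] {B : ℝ≥0 → Ω' → Space d} {Q : Measure Ω'}
  {U : Set (Space d)}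

theorem measurable_fundamentalSolution (d : ℕ) : Measurable (fundamentalSolution d) := by
  have h : fundamentalSolution d = fun z => radialProfile d ‖z‖ /
      (volume : Measure (Space d)).toSphere.real univ := funext fundamentalSolution_eq
  rw [h]
  exact ((measurable_radialProfile d).comp measurable_norm).div_const _

theorem fundamentalSolution_neg (z : Space d) :
    fundamentalSolution d (-z) = fundamentalSolution d z := by
  rw [fundamentalSolution_eq, fundamentalSolution_eq, norm_neg]

theorem exists_abs_fundamentalSolution_le (hd : 2 ≤ d) {δ : ℝ} (hδ : 0 < δ) (M : ℝ) :
    ∃ C, ∀ z : Space d, δ ≤ ‖z‖ → ‖z‖ ≤ M → |fundamentalSolution d z| ≤ C := by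
  set η := radialProfile d with hη
  refine ⟨(|η δ| + |η M| + |η 1| + |η 1|) / (volume : Measure (Space d)).toSphere.real univ,
    fun z h1 h2 => ?_⟩
  rw [fundamentalSolution_eq, abs_div, abs_of_pos (toSphere_real_pos hd)]
  refine div_le_div_of_nonneg_right ?_ (toSphere_real_pos hd).le
  calc |η ‖z‖| = |(η ‖z‖ - η 1) + η 1| := by rw [sub_add_cancel]
    _ ≤ |η ‖z‖ - η 1| + |η 1| := abs_add_le _ _
    _ ≤ _ := add_le_add (abs_radialProfile_sub_le hd hδ h1 h2) le_rfl

/-- By symmetry the pole `y` can serve as the starting point of the harmonic measure. The Green's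
function is then a superposition of fundamental solutions with poles off the ball, and each of these
has the mean value property. -/
theorem IsContinuousBM.lintegral_killedResolvent_bump_of_isBounded [IsProbabilityMeasure Q]
    (hd : 2 ≤ d) (hB : IsContinuousBM B Q) (hU : IsOpen U) (hUb : Bornology.IsBounded U)
    {z y : Space d} {ρ : ℝ} (hρ : 0 < ρ) (hball : Metric.closedBall z ρ ⊆ U)
    (hy : y ∉ Metric.closedBall z ρ) :
    ∫⁻ v, killedResolvent U 0 (z + ρ • v) y * ENNReal.ofReal (radialBump v) =
      killedResolvent U 0 z y * ENNReal.ofReal (∫ v : Space d, radialBump v) := by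
  by_cases hyU : y ∈ U
  swap
  · simp [killedResolvent_of_notMem fun h : _ ∈ U ∧ y ∈ U => hyU h.2]
  set ν := harmonicMeasure B Q U y with hν
  have hc := greenConst_pos hd
  let H := fundamentalSolution d
  have hHm : Measurable H := measurable_fundamentalSolution d
  -- The variable `w` occurs only in the fundamental solutions; the measure `ν` does not depend on
  -- it.
  let u : Space d → ℝ := fun w => H (y - w) - ∫ x, H (x - w) ∂ν
  have hu : ∀ w ∈ Metric.closedBall z ρ, 0 ≤ u w ∧
      killedResolvent U 0 w y = ENNReal.ofReal (greenConst d * u w) := fun w hw => by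
    rw [killedResolvent_comm]
    refine hB.killedResolvent_eq_ofReal hd hU hUb hyU (hball hw) ?_
    rintro rfl
    exact hy hw
  have hmem : ∀ v : Space d, ‖v‖ ≤ 1 → z + ρ • v ∈ Metric.closedBall z ρ := fun v hv => by
    rw [mem_closedBall_iff_norm, add_sub_cancel_left, norm_smul, Real.norm_of_nonneg hρ.le]
    exact mul_le_of_le_one_right hρ.le hv
  have hzmem := Metric.mem_closedBall_self (x := z) hρ.le
  obtain ⟨δ, hδ, hthick⟩ := (isCompact_closedBall z ρ).exists_thickening_subset_open hU hball
  have hdist : ∀ w ∈ Metric.closedBall z ρ, ∀ x ∉ U, δ ≤ ‖x - w‖ := fun w hw x hx => by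
    by_contra h
    refine hx (hthick (Metric.mem_thickening_iff.2 ⟨w, hw, ?_⟩))
    rw [dist_eq_norm]
    exact not_le.1 h
  obtain ⟨M, hM⟩ := hUb.closure.subset_closedBall z
  obtain ⟨C, hC⟩ := exists_abs_fundamentalSolution_le (d := d) hd hδ (M + ρ)
  have hνae : ∀ᵐ x ∂ν, x ∉ U ∧ x ∈ closure U := by
    filter_upwards [hB.ae_harmonicMeasure hU y, (by
      rw [hν, ← discountedHarmonic_zero]
      exact hB.ae_discountedHarmonic_closure hU 0 hyU :
        ∀ᵐ z ∂ν, z ∈ closure U)] with x h1 h2 using ⟨h1, h2⟩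
  have hbd : ∀ w ∈ Metric.closedBall z ρ, ∀ x, x ∉ U ∧ x ∈ closure U → |H (x - w)| ≤ C :=
    fun w hw x hx => by
    refine hC _ (hdist w hw x hx.1) ?_
    have h1 := hM hx.2
    rw [Metric.mem_closedBall] at h1 hw
    rw [← dist_eq_norm]
    calc dist x w ≤ dist x z + dist z w := dist_triangle _ _ _
      _ ≤ M + ρ := add_le_add h1 (by rwa [dist_comm])
  have hψ := integrable_radialBump (d := d)
  have hψm := (continuous_radialBump (d := d)).measurable
  have hprod : Integrable (fun r : Space d × Space d => H (r.2 - (z + ρ • r.1)) * radialBump r.1)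
      (volume.prod ν) := by
    refine Integrable.mono' ((hψ.mul_prod (integrable_const C)))
      (Measurable.aestronglyMeasurable (by fun_prop)) ?_
    have hν2 : ∀ᵐ r ∂((volume : Measure (Space d)).prod ν), r.2 ∉ U ∧ r.2 ∈ closure U :=
      Measure.quasiMeasurePreserving_snd.ae hνae
    filter_upwards [hν2] with r hr
    rw [norm_mul, Real.norm_of_nonneg (radialBump_nonneg _), mul_comm]
    rcases le_or_gt 1 ‖r.1‖ with h | h
    · simp [radialBump_eq_zero h]
    · exact mul_le_mul_of_nonneg_left (hbd _ (hmem _ h.le) _ hr) (radialBump_nonneg _)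
  have hharm : ∀ x ∉ Metric.closedBall z ρ,
      ∫ v, H (x - (z + ρ • v)) * radialBump v = H (x - z) * ∫ v : Space d, radialBump v := by
    intro x hx
    have h1 := bumpMean_eq_of_harmonic (h := fun w => H (w - x)) hρ fun w hw =>
      harmonicAt_comp_sub (harmonicAt_fundamentalSolution hd (sub_ne_zero.2 fun h => hx (h ▸ hw)))
    have h2 : ∀ a b, H (a - b) = H (b - a) := fun a b => by
      rw [← neg_sub]; exact fundamentalSolution_neg _
    simp_rw [h2 x]
    exact h1
  have hyint : Integrable (fun v => H (y - (z + ρ • v)) * radialBump v) := by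
    by_contra h
    obtain ⟨δ', hδ', hfar⟩ := Metric.isOpen_iff.1
      (Metric.isClosed_closedBall (x := z) (ε := ρ)).isOpen_compl y hy
    obtain ⟨C', hC'⟩ := exists_abs_fundamentalSolution_le (d := d) hd hδ' (dist y z + ρ)
    refine h ((hψ.mul_const C').mono' (Measurable.aestronglyMeasurable (by fun_prop)) ?_)
    refine Filter.Eventually.of_forall fun v => ?_
    rw [norm_mul, Real.norm_of_nonneg (radialBump_nonneg _), mul_comm]
    rcases le_or_gt 1 ‖v‖ with h | h
    · simp [radialBump_eq_zero h]
    · refine mul_le_mul_of_nonneg_left (hC' _ ?_ ?_) (radialBump_nonneg _)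
      · by_contra h1
        refine (show z + ρ • v ∉ Metric.closedBall z ρ from hfar ?_) (hmem v h.le)
        rw [Metric.mem_ball, dist_comm, dist_eq_norm]
        exact not_le.1 h1
      · have h1 := hmem v h.le
        rw [Metric.mem_closedBall] at h1
        rw [← dist_eq_norm]
        exact (dist_triangle _ z _).trans (add_le_add le_rfl (by rwa [dist_comm]))
  have hint2 : Integrable (fun v => (∫ x, H (x - (z + ρ • v)) ∂ν) * radialBump v) := by
    have h1 := hprod.integral_prod_left
    simp_rw [integral_mul_const] at h1
    exact h1
  have huint : Integrable (fun v => u (z + ρ • v) * radialBump v) := by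
    refine (hyint.sub hint2).congr (Filter.Eventually.of_forall fun v => ?_)
    simp only [u, Pi.sub_apply]
    ring
  have hmean : ∫ v, u (z + ρ • v) * radialBump v = u z * ∫ v : Space d, radialBump v := by
    have h1 : ∫ v, (∫ x, H (x - (z + ρ • v)) ∂ν) * radialBump v =
        (∫ x, H (x - z) ∂ν) * ∫ v : Space d, radialBump v := by
      simp_rw [← integral_mul_const]
      rw [integral_integral_swap hprod]
      refine integral_congr_ae ?_
      filter_upwards [hνae] with x hx
      exact hharm x fun h => hx.1 (hball h)
    simp only [u, sub_mul]
    rw [integral_sub hyint hint2, h1, hharm y hy]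
  have hnn : ∀ v, 0 ≤ greenConst d * (u (z + ρ • v) * radialBump v) := fun v => by
    rcases le_or_gt 1 ‖v‖ with h | h
    · simp [radialBump_eq_zero h]
    · exact mul_nonneg hc.le (mul_nonneg (hu _ (hmem v h.le)).1 (radialBump_nonneg v))
  calc ∫⁻ v, killedResolvent U 0 (z + ρ • v) y * ENNReal.ofReal (radialBump v)
      = ∫⁻ v, ENNReal.ofReal (greenConst d * (u (z + ρ • v) * radialBump v)) := by
        refine lintegral_congr fun v => ?_
        rcases le_or_gt 1 ‖v‖ with h | h
        · simp [radialBump_eq_zero h]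
        · rw [(hu _ (hmem v h.le)).2, ← ENNReal.ofReal_mul
            (mul_nonneg hc.le (hu _ (hmem v h.le)).1), mul_assoc]
    _ = ENNReal.ofReal (∫ v, greenConst d * (u (z + ρ • v) * radialBump v)) :=
        (ofReal_integral_eq_lintegral_ofReal (huint.const_mul _)
          (Filter.Eventually.of_forall hnn)).symm
    _ = _ := by
        rw [integral_const_mul, hmean, (hu z hzmem).2, ← ENNReal.ofReal_mul
          (mul_nonneg hc.le (hu z hzmem).1), mul_assoc]

/-- The mean value property of the Green's function away from its pole. -/
theorem IsContinuousBM.lintegral_killedResolvent_bump [IsProbabilityMeasure Q]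
    (hd : 2 ≤ d) (hB : IsContinuousBM B Q) (hU : IsOpen U)
    {z y : Space d} {ρ : ℝ} (hρ : 0 < ρ) (hball : Metric.closedBall z ρ ⊆ U)
    (hy : y ∉ Metric.closedBall z ρ) :
    ∫⁻ v, killedResolvent U 0 (z + ρ • v) y * ENNReal.ofReal (radialBump v) =
      killedResolvent U 0 z y * ENNReal.ofReal (∫ v : Space d, radialBump v) := by
  obtain ⟨N, hN⟩ := exists_nat_gt (dist z 0 + ρ)
  have hmono : ∀ w, Monotone fun n : ℕ => killedResolvent (U ∩ Metric.ball 0 (n : ℝ)) 0 w y :=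
    fun w m n hmn => killedResolvent_mono (inter_subset_inter_right U
      (Metric.ball_subset_ball (by exact_mod_cast hmn))) 0 w y
  have hsup : ∀ w, killedResolvent U 0 w y =
      ⨆ n : ℕ, killedResolvent (U ∩ Metric.ball 0 ((n + N : ℕ) : ℝ)) 0 w y := fun w => by
    rw [killedResolvent_eq_iSup_inter_ball, ← (hmono w).iSup_nat_add N]
  have hψm := (continuous_radialBump (d := d)).measurable
  simp_rw [hsup, ENNReal.iSup_mul]
  rw [lintegral_iSup]
  · refine iSup_congr fun n => ?_
    refine hB.lintegral_killedResolvent_bump_of_isBounded hd (hU.inter Metric.isOpen_ball)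
      (Metric.isBounded_ball.subset inter_subset_right) hρ (subset_inter hball fun w hw => ?_) hy
    rw [Metric.mem_closedBall] at hw
    rw [Metric.mem_ball]
    have h1 := dist_triangle w z 0
    have h2 : (N : ℝ) ≤ ((n + N : ℕ) : ℝ) := by exact_mod_cast Nat.le_add_left N n
    linarith
  · exact fun n => Measurable.mul (Measurable.killedResolvent (by fun_prop) measurable_const)
      (by fun_prop)
  · exact fun m n hmn v => mul_le_mul' (hmono _ (by omega)) le_rfl

theorem IsContinuousBM.lintegral_green_bump [IsProbabilityMeasure Q]
    (hd : 2 ≤ d) (hB : IsContinuousBM B Q) (hU : IsOpen U)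
    {z y : Space d} {ρ : ℝ} (hρ : 0 < ρ) (hball : Metric.closedBall z ρ ⊆ U)
    (hy : y ∉ Metric.closedBall z ρ) :
    ∫⁻ v, green B Q U (z + ρ • v) y * ENNReal.ofReal (radialBump v) =
      green B Q U z y * ENNReal.ofReal (∫ v : Space d, radialBump v) := by
  have hψm := (continuous_radialBump (d := d)).measurable
  simp_rw [hB.green_eq hd hU, mul_assoc]
  have hm : Measurable fun v => killedResolvent U 0 (z + ρ • v) y *
      ENNReal.ofReal (radialBump v) :=
    Measurable.mul (Measurable.killedResolvent (by fun_prop) measurable_const) (by fun_prop)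
  rw [lintegral_const_mul _ hm, hB.lintegral_killedResolvent_bump hd hU hρ hball hy]

end GreenMeanValue

/-! ### Boundedness of the Green's function away from its pole -/

section GreenBound

variable {d : ℕ} {Ω' : Type*} [MeasurableSpace Ω'] {B : ℝ≥0 → Ω' → Space d} {Q : Measure Ω'}
  {D : Set (Space d)}

theorem heat_pos {t : ℝ} (ht : 0 < t) (z : Space d) : 0 < heat t z := by
  unfold heat heatReal
  have : 0 < √(2 * Real.pi * t) := by positivity
  rw [ENNReal.ofReal_pos]
  positivity

theorem lintegral_comp_add_smul {ρ : ℝ} (hρ : 0 < ρ) (z : Space d) {f : Space d → ℝ≥0∞}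
    (hf : Measurable f) :
    ∫⁻ v, f (z + ρ • v) = ENNReal.ofReal ((ρ ^ d)⁻¹) * ∫⁻ u, f u := by
  have h1 : ∫⁻ v, f (z + ρ • v) = ∫⁻ u, f (z + u) ∂(Measure.map (ρ • ·) volume) := by
    rw [lintegral_map (by fun_prop) (by fun_prop)]
  rw [h1, Measure.map_addHaar_smul _ hρ.ne', lintegral_smul_measure,
    lintegral_add_left_eq_self (fun u => f u) z, finrank_euclideanSpace_fin, abs_of_pos (by positivity),
    smul_eq_mul]

/-- A set that is neither empty nor the whole space has a boundary point. Near it, by regularity,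
survival is below `1` on a whole ball, which the heat kernel charges. The assumption `D ≠ ℝ²` in
dimension two is used through this lemma. -/
theorem IsContinuousBM.lintegral_heat_survival_lt_one [IsProbabilityMeasure Q]
    (hB : IsContinuousBM B Q) (hD : IsOpen D) (hreg : HasRegularBoundary B Q D)
    (hne : D.Nonempty) (huniv : D ≠ univ) {r : ℝ≥0} (hr : r ≠ 0) (u : Space d) :
    ∫⁻ v, heat r (u - v) * survival D r v < 1 := by
  have hr' : (0 : ℝ) < r := NNReal.coe_pos.2 (pos_of_ne_zero hr)
  obtain ⟨y₀, hy₀⟩ := nonempty_frontier_iff.2 ⟨hne, huniv⟩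
  have hlim := hB.tendsto_survival_zero hD (hreg y₀ hy₀) hr
  obtain ⟨ε, hε, hball⟩ := Metric.eventually_nhds_iff_ball.1
    ((tendsto_order.1 hlim).2 1 one_pos)
  have hS := measurable_survival_const D r
  have hle : ∫⁻ v, heat r (u - v) * survival D r v ≤ 1 := by
    refine (lintegral_mono fun v => mul_le_of_le_one_right' (survival_le_one D hr' v)).trans_eq ?_
    exact lintegral_heat_sub_left hr' u
  refine lt_of_le_of_ne hle fun h => ?_
  have h1 : ∫⁻ v, heat r (u - v) * (1 - survival D r v) = 0 := by
    have h2 : (∫⁻ v, heat r (u - v) * survival D r v) +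
        ∫⁻ v, heat r (u - v) * (1 - survival D r v) = 1 := by
      rw [← lintegral_add_left (by fun_prop)]
      refine Eq.trans (lintegral_congr fun v => ?_) (lintegral_heat_sub_left hr' u)
      rw [← mul_add, add_tsub_cancel_of_le (survival_le_one D hr' v), mul_one]
    rw [h] at h2
    exact (ENNReal.add_right_inj ENNReal.one_ne_top).1 (h2.trans (add_zero 1).symm)
  rw [lintegral_eq_zero_iff (by fun_prop)] at h1
  have h3 : ∀ᵐ v, v ∉ Metric.ball y₀ ε := by
    filter_upwards [h1] with v hv hmem
    simp only [Pi.zero_apply, mul_eq_zero, (heat_pos hr' _).ne', false_or, tsub_eq_zero_iff_le] at hv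
    exact absurd (hball v hmem) (not_lt.2 hv)
  have h4 : volume (Metric.ball y₀ ε) = 0 := by
    refine measure_mono_null (fun v hv => ?_) (ae_iff.1 h3)
    simpa using hv
  exact (Metric.measure_ball_pos volume y₀ hε).ne' h4

/-- Telescoping along `t, t + 1, t + 2, …` bounds the sum of `f (t + n)` by `S t ≤ 1`, and `t` is
then integrated over a unit interval. -/
theorem setLIntegral_Ioi_le_of_shift {f S : ℝ → ℝ≥0∞} (hf : Measurable f)
    (hS : ∀ t, 0 < t → S t ≤ 1) (hfS : ∀ t, 0 < t → S (t + 1) + f t ≤ S t) :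
    ∫⁻ t in Ioi (0 : ℝ), f t ≤ 1 := by
  have hcover : Ioi (0 : ℝ) ⊆ ⋃ n : ℕ, Ioc (n : ℝ) (n + 1) := fun t ht => by
    have ht : 0 < t := ht
    refine mem_iUnion.2 ⟨⌈t⌉₊ - 1, ?_, ?_⟩
    · have h1 := Nat.ceil_lt_add_one ht.le
      have h2 : 1 ≤ ⌈t⌉₊ := Nat.one_le_ceil_iff.2 ht
      push_cast [Nat.cast_sub h2]
      linarith
    · have h2 : 1 ≤ ⌈t⌉₊ := Nat.one_le_ceil_iff.2 ht
      push_cast [Nat.cast_sub h2]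
      linarith [Nat.le_ceil t]
  have hshift : ∀ n : ℕ, ∫⁻ t in Ioc (n : ℝ) (n + 1), f t = ∫⁻ t in Ioc (0 : ℝ) 1, f (t + n) :=
    fun n => by
    have h1 := (measurePreserving_add_right (volume : Measure ℝ) (n : ℝ)).setLIntegral_comp_preimage
      (s := Ioc (n : ℝ) (n + 1)) measurableSet_Ioc hf
    rw [← h1, preimage_add_const_Ioc]
    simp
  have hsum : ∀ t, 0 < t → ∀ N : ℕ, S (t + N) + ∑ n ∈ Finset.range N, f (t + n) ≤ S t := by
    intro t ht N
    induction N with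
    | zero => simp
    | succ N ih =>
      rw [Finset.sum_range_succ, add_comm (∑ n ∈ _, _), ← add_assoc]
      refine le_trans (add_le_add ?_ le_rfl) ih
      have := hfS (t + N) (by positivity)
      push_cast
      rwa [← add_assoc]
  calc ∫⁻ t in Ioi (0 : ℝ), f t ≤ ∫⁻ t in ⋃ n : ℕ, Ioc (n : ℝ) (n + 1), f t :=
        lintegral_mono_set hcover
    _ ≤ ∑' n : ℕ, ∫⁻ t in Ioc (n : ℝ) (n + 1), f t := lintegral_iUnion_le _ _
    _ = ∫⁻ t in Ioc (0 : ℝ) 1, ∑' n : ℕ, f (t + n) := by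
        simp_rw [hshift]
        rw [lintegral_tsum fun n => by fun_prop]
    _ ≤ ∫⁻ t in Ioc (0 : ℝ) 1, 1 := by
        refine setLIntegral_mono' measurableSet_Ioc fun t ht => ?_
        refine ENNReal.tsum_le_of_sum_range_le fun N => ?_
        exact (le_add_self.trans (hsum t ht.1 N)).trans (hS t ht.1)
    _ = 1 := by simp

/-- The probability of dying within unit time is at least some `q > 0` from every point of `K`,
because the bound `g` on survival is continuous and below `1` on a compact set. Being in `K` at time
`t` thus costs a fraction `q` of survival, so the expected time spent in `K` is at most `1 / q` from
every starting point. -/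
theorem IsContinuousBM.exists_setLIntegral_killedResolvent_le [IsProbabilityMeasure Q]
    (hB : IsContinuousBM B Q) (hD : IsOpen D) (hreg : HasRegularBoundary B Q D)
    (hne : D.Nonempty) (huniv : D ≠ univ) {K : Set (Space d)} (hK : IsCompact K) :
    ∃ C : ℝ≥0, ∀ y, ∫⁻ u in K, killedResolvent D 0 y u ≤ C := by
  rcases K.eq_empty_or_nonempty with rfl | hKne
  · exact ⟨0, by simp⟩
  have hhalf : (2⁻¹ : ℝ≥0) ≠ 0 := by simp
  let g : Space d → ℝ≥0∞ := fun u => ∫⁻ v, heat (2⁻¹ : ℝ≥0) (u - v) * survival D (2⁻¹ : ℝ≥0) v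
  have hgc : Continuous g := continuous_lintegral_heat (by simp) (measurable_survival_const D _)
    (M := 1) fun z => by simpa using survival_le_one D (by simp) z
  have hSg : ∀ u, survival D (1 : ℝ≥0) u ≤ g u := fun u => by
    have h1 := hB.survival_add hD hhalf hhalf u
    rw [show (((2⁻¹ : ℝ≥0) : ℝ) + (2⁻¹ : ℝ≥0)) = ((1 : ℝ≥0) : ℝ) by norm_num] at h1
    rw [h1]
    exact lintegral_mono fun v => mul_le_mul' (killedKernel_le_heat _ _ _ _) le_rfl
  obtain ⟨u₀, hu₀, hmax⟩ := hK.exists_isMaxOn hKne hgc.continuousOn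
  have hg1 : g u₀ < 1 := hB.lintegral_heat_survival_lt_one hD hreg hne huniv hhalf u₀
  set q := 1 - g u₀ with hq
  have hq0 : q ≠ 0 := (tsub_pos_of_lt hg1).ne'
  have hqtop : q ≠ ∞ := (tsub_le_self.trans_lt ENNReal.one_lt_top).ne
  have hadd : g u₀ + q = 1 := add_tsub_cancel_of_le hg1.le
  refine ⟨q⁻¹.toNNReal, fun y => ?_⟩
  rw [ENNReal.coe_toNNReal (ENNReal.inv_ne_top.2 hq0)]
  have hswap : ∫⁻ u in K, killedResolvent D 0 y u =
      ∫⁻ t in Ioi (0 : ℝ), ∫⁻ u in K, killedKernel D t y u := by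
    unfold killedResolvent
    rw [lintegral_lintegral_swap (by fun_prop)]
    simp
  have hfm : Measurable fun t : ℝ => ∫⁻ u in K, killedKernel D t y u := by
    have h1 : Measurable fun r : ℝ × Space d => killedKernel D r.1 y r.2 := by fun_prop
    exact h1.lintegral_prod_right'
  have hstep : ∀ t : ℝ, 0 < t → survival D (t + 1) y + q * ∫⁻ u in K, killedKernel D t y u ≤
      survival D t y := fun t ht => by
    lift t to ℝ≥0 using ht.le
    have ht0 : t ≠ 0 := by rintro rfl; simp at ht
    have h1 := hB.survival_add hD ht0 one_ne_zero y
    rw [NNReal.coe_one] at h1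
    have hm1 := measurable_survival_const D (1 : ℝ)
    rw [h1, ← lintegral_indicator hK.measurableSet, ← lintegral_const_mul' _ _ hqtop,
      ← lintegral_add_left (by fun_prop), survival]
    refine lintegral_mono fun u => ?_
    have hS1 : survival D 1 u ≤ 1 := survival_le_one D one_pos u
    by_cases hu : u ∈ K
    · rw [indicator_of_mem hu, mul_comm q, ← mul_add]
      refine mul_le_of_le_one_right' ?_
      rw [← hadd]
      refine add_le_add ?_ le_rfl
      have h2 := hSg u
      rw [NNReal.coe_one] at h2
      exact h2.trans (hmax hu)
    · rw [indicator_of_notMem hu, mul_zero, add_zero]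
      exact mul_le_of_le_one_right' hS1
  have hle := setLIntegral_Ioi_le_of_shift (hfm.const_mul q) (S := fun t => survival D t y)
    (fun t ht => survival_le_one D ht y) hstep
  rw [lintegral_const_mul _ hfm] at hle
  rw [hswap, ← one_div]
  rwa [ENNReal.le_div_iff_mul_le (Or.inl hq0) (Or.inl hqtop), mul_comm]

theorem green_le_fundamentalSolution (hd : 2 ≤ d) (hd2 : d ≠ 2) {x y : Space d} (hxy : x ≠ y) :
    green B Q D x y ≤ ENNReal.ofReal (fundamentalSolution d (x - y)) := by
  refine iSup_le fun n => ?_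
  unfold boundedGreen
  split_ifs with h
  · refine ENNReal.ofReal_le_ofReal (sub_le_self _ (integral_nonneg fun z => ?_))
    unfold fundamentalSolution
    rw [if_neg hd2]
    have := toSphere_real_pos hd
    positivity
  · exact zero_le

/-- The Green's function is bounded away from its pole. -/
theorem IsContinuousBM.exists_green_le [IsProbabilityMeasure Q] (hd : 2 ≤ d)
    (hB : IsContinuousBM B Q) (hD : IsOpen D) (hD2 : d = 2 → D ≠ univ)
    (hreg : HasRegularBoundary B Q D) {O K : Set (Space d)} (hO : IsOpen O) (hOD : O ⊆ D)
    (hK : IsCompact K) (hKO : K ⊆ O) :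
    ∃ C : ℝ≥0, ∀ z ∈ K, ∀ y ∉ O, green B Q D z y ≤ C := by
  rcases K.eq_empty_or_nonempty with rfl | hKne
  · exact ⟨0, by simp⟩
  obtain ⟨ρ, hρ, hsub⟩ := hK.exists_cthickening_subset_open hO hKO
  have hball : ∀ z ∈ K, Metric.closedBall z ρ ⊆ Metric.cthickening ρ K := fun z hz =>
    Metric.closedBall_subset_cthickening hz ρ
  by_cases hd2 : d = 2
  -- In dimension two the logarithm has no sign and gives no direct bound. Instead, the mean value
  -- property on a ball of fixed radius bounds the value at `z` by the integral over a neighbourhood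
  -- of `K`, and hence by an expected occupation time.
  · have hne : D.Nonempty := hKne.mono (hKO.trans hOD)
    obtain ⟨C, hC⟩ := hB.exists_setLIntegral_killedResolvent_le hD hreg hne (hD2 hd2)
      (hK.cthickening (r := ρ))
    have hI : ENNReal.ofReal (∫ v : Space d, radialBump v) ≠ 0 := by
      simpa using integral_radialBump_pos (d := d)
    set a := (ENNReal.ofReal (greenConst d))⁻¹ with ha
    have hatop : a ≠ ∞ := by simpa [ha] using greenConst_pos hd
    set b := a * ((ENNReal.ofReal (∫ v : Space d, radialBump v))⁻¹ *
      (ENNReal.ofReal ((ρ ^ d)⁻¹) * C)) with hb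
    have hbtop : b ≠ ∞ := ENNReal.mul_ne_top hatop (ENNReal.mul_ne_top (ENNReal.inv_ne_top.2 hI)
      (ENNReal.mul_ne_top ENNReal.ofReal_ne_top ENNReal.coe_ne_top))
    refine ⟨b.toNNReal, fun z hz y hy => ?_⟩
    rw [ENNReal.coe_toNNReal hbtop, hB.green_eq hd hD, hb]
    refine mul_le_mul' le_rfl ?_
    rw [mul_comm, ← div_eq_mul_inv, ENNReal.le_div_iff_mul_le (Or.inl hI)
      (Or.inl ENNReal.ofReal_ne_top)]
    have hcb := hball z hz
    rw [← hB.lintegral_killedResolvent_bump hd hD hρ ((hcb.trans hsub).trans hOD)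
      fun h => hy (hsub (hcb h))]
    have hm : Measurable fun u => killedResolvent D 0 u y :=
      Measurable.killedResolvent measurable_id measurable_const
    have hKm : MeasurableSet (Metric.cthickening ρ K) := Metric.isClosed_cthickening.measurableSet
    calc ∫⁻ v, killedResolvent D 0 (z + ρ • v) y * ENNReal.ofReal (radialBump v)
        ≤ ∫⁻ v, (Metric.cthickening ρ K).indicator (fun u => killedResolvent D 0 u y)
            (z + ρ • v) := by
          refine lintegral_mono fun v => ?_
          rcases le_or_gt 1 ‖v‖ with h | h
          · simp [radialBump_eq_zero h]
          · rw [indicator_of_mem (hcb ?_)]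
            · exact mul_le_of_le_one_right' (by simpa using radialBump_le_one v)
            · rw [mem_closedBall_iff_norm, add_sub_cancel_left, norm_smul,
                Real.norm_of_nonneg hρ.le]
              exact mul_le_of_le_one_right hρ.le h.le
      _ = ENNReal.ofReal ((ρ ^ d)⁻¹) * ∫⁻ u in Metric.cthickening ρ K,
            killedResolvent D 0 u y := by
          rw [lintegral_comp_add_smul hρ z (hm.indicator hKm), lintegral_indicator hKm]
      _ ≤ ENNReal.ofReal ((ρ ^ d)⁻¹) * C := by
          refine mul_le_mul' le_rfl ?_
          simp_rw [fun u => killedResolvent_comm D 0 u y]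
          exact hC y
  · refine ⟨(radialProfile d ρ / (volume : Measure (Space d)).toSphere.real univ).toNNReal,
      fun z hz y hy => ?_⟩
    have hdist : ρ ≤ ‖z - y‖ := by
      by_contra h
      refine hy (hsub (hball z hz ?_))
      rw [Metric.mem_closedBall, dist_comm, dist_eq_norm]
      exact (not_le.1 h).le
    have hne : z ≠ y := fun h => by
      rw [h, sub_self, norm_zero] at hdist
      linarith
    refine (green_le_fundamentalSolution hd hd2 hne).trans ?_
    refine ENNReal.ofReal_le_ofReal ?_
    rw [fundamentalSolution_eq]
    exact div_le_div_of_nonneg_right (antitoneOn_radialProfile hd hρ (hρ.trans_le hdist) hdist)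
      (toSphere_real_pos hd).le

end GreenBound

/-! ### Gaussian subspaces of L² -/

section GaussianHilbert

variable {Ω : Type*} [MeasurableSpace Ω] {P : Measure Ω} [IsProbabilityMeasure P]

theorem integral_abs_le_norm_L2 (f : Lp ℝ 2 P) : ∫ ω, |f ω| ∂P ≤ ‖f‖ := by
  have h1 : ∫ ω, |f ω| ∂P = (eLpNorm f 1 P).toReal := by
    simp_rw [← Real.norm_eq_abs]
    rw [integral_norm_eq_lintegral_enorm (Lp.aestronglyMeasurable f), eLpNorm_one_eq_lintegral_enorm]
  rw [h1, Lp.norm_def]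
  exact ENNReal.toReal_mono (Lp.eLpNorm_ne_top f)
    (eLpNorm_le_eLpNorm_of_exponent_le one_le_two (Lp.aestronglyMeasurable f))

theorem integrable_L2 (f : Lp ℝ 2 P) : Integrable f P := (Lp.memLp f).integrable one_le_two

theorem inner_L2_eq (f g : Lp ℝ 2 P) : inner ℝ f g = ∫ ω, f ω * g ω ∂P := by
  rw [L2.inner_def]
  refine integral_congr_ae (Filter.Eventually.of_forall fun ω => ?_)
  simp [mul_comm]

/-- A linear space of square-integrable random variables all of which are centred Gaussian. -/
def IsGaussianSpace (S : Submodule ℝ (Lp ℝ 2 P)) : Prop :=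
  ∀ f ∈ S, P.map f = gaussianReal 0 (‖f‖₊ ^ 2)

theorem charFun_map_L2 (f : Lp ℝ 2 P) (t : ℝ) :
    charFun (P.map f) t = ∫ ω, Complex.exp (Complex.I * ((t * f ω : ℝ) : ℂ)) ∂P := by
  rw [charFun_apply_real, integral_map (Lp.aestronglyMeasurable f).aemeasurable
    (by fun_prop)]
  refine integral_congr_ae (Filter.Eventually.of_forall fun ω => ?_)
  simp only
  congr 1
  push_cast
  ring

/-- Since `|exp (ia) - exp (ib)| ≤ |a - b|`, the characteristic function at `t` is Lipschitz for the
L¹ distance, hence for the L² distance. -/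
theorem continuous_charFun_map_L2 (t : ℝ) : Continuous fun f : Lp ℝ 2 P => charFun (P.map f) t := by
  have hint : ∀ f : Lp ℝ 2 P,
      Integrable (fun ω => Complex.exp (Complex.I * ((t * f ω : ℝ) : ℂ))) P := fun f => by
    refine Integrable.of_bound ?_ 1 (Filter.Eventually.of_forall fun ω => ?_)
    · have := Lp.aestronglyMeasurable f
      fun_prop
    · rw [mul_comm, Complex.norm_exp_ofReal_mul_I]
  have hlip : LipschitzWith ‖t‖₊ fun f : Lp ℝ 2 P => charFun (P.map f) t := by
    refine LipschitzWith.of_dist_le_mul fun f g => ?_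
    rw [dist_eq_norm, dist_eq_norm, charFun_map_L2, charFun_map_L2, ← integral_sub (hint f) (hint g)]
    refine (norm_integral_le_integral_norm _).trans ?_
    refine le_trans ?_ (mul_le_mul_of_nonneg_left (integral_abs_le_norm_L2 (f - g)) (norm_nonneg t))
    rw [← integral_const_mul]
    refine integral_mono_ae ((hint f).sub (hint g)).norm
      ((integrable_L2 (f - g)).abs.const_mul _) ?_
    filter_upwards [Lp.coeFn_sub f g] with ω hω
    rw [hω]
    have h1 : Complex.exp (Complex.I * ((t * f ω : ℝ) : ℂ)) -
        Complex.exp (Complex.I * ((t * g ω : ℝ) : ℂ)) =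
        Complex.exp (((t * g ω : ℝ) : ℂ) * Complex.I) *
          (Complex.exp (Complex.I * ((t * (f ω - g ω) : ℝ) : ℂ)) - 1) := by
      rw [mul_sub, ← Complex.exp_add, mul_one]
      congr 2
      · push_cast; ring
      · ring
    rw [h1, norm_mul, Complex.norm_exp_ofReal_mul_I, one_mul]
    refine Real.norm_exp_I_mul_ofReal_sub_one_le.trans_eq ?_
    rw [norm_mul, Pi.sub_apply, Real.norm_eq_abs (f ω - g ω)]
    rfl
  exact hlip.continuous

/-- In terms of characteristic functions, being centred Gaussian with variance `‖f‖ ^ 2` is a closed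
condition on `f`. -/
theorem IsGaussianSpace.topologicalClosure {S : Submodule ℝ (Lp ℝ 2 P)} (hS : IsGaussianSpace S) :
    IsGaussianSpace S.topologicalClosure := by
  have key : ∀ f ∈ S.topologicalClosure, ∀ t : ℝ,
      charFun (P.map f) t = Complex.exp (-((‖f‖ ^ 2 : ℝ) : ℂ) * t ^ 2 / 2) := by
    intro f hf t
    have hcl : IsClosed {f : Lp ℝ 2 P |
        charFun (P.map f) t = Complex.exp (-((‖f‖ ^ 2 : ℝ) : ℂ) * t ^ 2 / 2)} :=
      isClosed_eq (continuous_charFun_map_L2 t) (by fun_prop)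
    refine closure_minimal (fun g hg => ?_) hcl hf
    rw [mem_ofPred_eq, hS g hg, charFun_gaussianReal]
    congr 1
    push_cast
    simp
    ring
  intro f hf
  have hm : AEMeasurable f P := (Lp.aestronglyMeasurable f).aemeasurable
  have := Measure.isProbabilityMeasure_map hm
  refine Measure.ext_of_charFun (funext fun t => ?_)
  rw [key f hf, charFun_gaussianReal]
  congr 1
  push_cast
  simp
  ring

theorem IsGaussianSpace.isGaussianProcess {S : Submodule ℝ (Lp ℝ 2 P)} (hS : IsGaussianSpace S)
    {T : Type*} {Y : T → Lp ℝ 2 P} (hY : ∀ t, Y t ∈ S) :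
    IsGaussianProcess (fun t => ⇑(Y t)) P := by
  refine ⟨fun I => ⟨isGaussian_of_map_eq_gaussianReal fun L => ?_⟩⟩
  have hYm : ∀ t, AEMeasurable (Y t) P := fun t => (Lp.aestronglyMeasurable (Y t)).aemeasurable
  have hm : AEMeasurable (fun ω => I.restrict fun t => Y t ω) P :=
    aemeasurable_pi_lambda _ fun t => hYm t
  classical
  set f : Lp ℝ 2 P := ∑ i : I, L (Pi.single i 1) • Y i with hf
  have hfS : f ∈ S := Submodule.sum_mem _ fun i _ => S.smul_mem _ (hY i)
  refine ⟨0, ‖f‖₊ ^ 2, ?_⟩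
  rw [AEMeasurable.map_map_of_aemeasurable (by fun_prop) hm, ← hS f hfS]
  refine Measure.map_congr ?_
  have h1 : (f : Ω → ℝ) =ᵐ[P] fun ω => ∑ i : I, L (Pi.single i 1) * Y i ω := by
    refine (Lp.coeFn_finsetSum _ _).trans ?_
    have h2 : ∀ᵐ ω ∂P, ∀ i : I, (L (Pi.single i 1) • Y i : Lp ℝ 2 P) ω =
        L (Pi.single i 1) * Y i ω := ae_all_iff.2 fun i => by
      filter_upwards [Lp.coeFn_smul (L (Pi.single i 1)) (Y i)] with ω hω
      rw [hω]; rfl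
    filter_upwards [h2] with ω hω
    simp [hω]
  filter_upwards [h1] with ω hω
  rw [hω, Function.comp_apply]
  have h2 := LinearMap.pi_apply_eq_sum_univ L.toLinearMap (I.restrict fun t => Y t ω)
  refine h2.trans (Finset.sum_congr rfl fun i _ => ?_)
  have h3 : (fun j => if i = j then (1 : ℝ) else 0) = Pi.single i 1 := by
    ext j
    simp [Pi.single_apply, eq_comm]
  rw [h3, smul_eq_mul, mul_comm]
  rfl

theorem isGaussianSpace_span {T : Type*} {X : T → Ω → ℝ} (hX : IsGaussianProcess X P)
    (hmean : ∀ t, ∫ ω, X t ω ∂P = 0) {u : T → Lp ℝ 2 P} (hu : ∀ t, u t =ᵐ[P] X t) :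
    IsGaussianSpace (Submodule.span ℝ (range u)) := by
  intro f hf
  obtain ⟨c, rfl⟩ := Finsupp.mem_span_range_iff_exists_finsupp.1 hf
  set f : Lp ℝ 2 P := c.sum fun i a => a • u i with hfdef
  have h1 : (f : Ω → ℝ) =ᵐ[P] fun ω => ∑ i ∈ c.support, c i • X i ω := by
    refine (Lp.coeFn_finsetSum _ _).trans ?_
    have h2 : ∀ᵐ ω ∂P, ∀ i ∈ c.support, (c i • u i : Lp ℝ 2 P) ω = c i • X i ω :=
      (ae_ball_iff c.support.countable_toSet).2 fun i _ => by
        filter_upwards [Lp.coeFn_smul (c i) (u i), hu i] with ω hω hω'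
        rw [hω, Pi.smul_apply, hω']
    filter_upwards [h2] with ω hω
    rw [Finset.sum_apply]
    exact Finset.sum_congr rfl fun i hi => hω i hi
  have h3 := ((hX.smul fun t => c t).hasGaussianLaw_fun_sum (I := c.support)).congr h1.symm
  rw [h3.map_eq_gaussianReal]
  have hint : ∀ t, Integrable (X t) P := fun t => (hX.hasGaussianLaw_eval t).integrable
  have h4 : ∫ ω, f ω ∂P = 0 := by
    rw [integral_congr_ae h1, integral_finsetSum (f := fun i ω => c i • X i ω) _
      fun i _ => (hint i).smul (c i)]
    refine Finset.sum_eq_zero fun i _ => ?_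
    rw [integral_smul, hmean, smul_zero]
  rw [variance_of_integral_eq_zero (Lp.aestronglyMeasurable f).aemeasurable h4, h4]
  congr 1
  rw [← NNReal.coe_inj, Real.coe_toNNReal _ (integral_nonneg fun _ => sq_nonneg _)]
  push_cast
  rw [← real_inner_self_eq_norm_sq, inner_L2_eq]
  simp_rw [sq]

theorem IsGaussianSpace.integral_eq_zero {S : Submodule ℝ (Lp ℝ 2 P)} (hS : IsGaussianSpace S)
    {f : Lp ℝ 2 P} (hf : f ∈ S) : ∫ ω, f ω ∂P = 0 := by
  have h1 : ∫ x, x ∂(P.map f) = ∫ ω, f ω ∂P :=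
    integral_map (Lp.aestronglyMeasurable f).aemeasurable (by fun_prop)
  rw [← h1, hS f hf, integral_id_gaussianReal]

end GaussianHilbert

/-! ### Jointly measurable versions and pathwise integrals -/

section JointModification

variable {Ω : Type*} [MeasurableSpace Ω] {P : Measure Ω} [IsProbabilityMeasure P]
  {E : Type*} [MeasurableSpace E]

/-- A strongly measurable family of square-integrable random variables has a jointly measurable
version. -/
theorem exists_measurable_modification {m : E → Lp ℝ 2 P} (hm : StronglyMeasurable m) :
    ∃ M : E × Ω → ℝ, Measurable M ∧ ∀ x, (fun ω => M (x, ω)) =ᵐ[P] m x := by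
  have hex : ∀ n : ℕ, ∀ x, ∃ k, ‖hm.approx k x - m x‖ ≤ (1 / 2) ^ n := fun n x => by
    have h1 := tendsto_iff_norm_sub_tendsto_zero.1 (hm.tendsto_approx x)
    exact (((tendsto_order.1 h1).2 ((1 / 2) ^ n) (by positivity)).exists).imp fun k hk => hk.le
  classical
  -- The first index at which the simple approximation at `x` is within `2 ^ (-n)`. It depends
  -- measurably on `x`, and the errors are summable in `n`, so convergence is almost sure for every
  -- `x`.
  let i : ℕ → E → ℕ := fun n x => Nat.find (hex n x)
  have hi : ∀ n, Measurable (i n) := fun n => measurable_find (hex n) fun k => by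
    have h1 : StronglyMeasurable fun x => ‖hm.approx k x - m x‖ :=
      ((hm.approx k).stronglyMeasurable.sub hm).norm
    exact h1.measurable measurableSet_Iic
  let M : ℕ → E × Ω → ℝ := fun n q => (hm.approx (i n q.1) q.1 : Ω → ℝ) q.2
  have hMm : ∀ n, Measurable (M n) := fun n => by
    have h1 : ∀ k, Measurable fun q : E × Ω => (hm.approx k q.1 : Ω → ℝ) q.2 := fun k =>
      ((hm.approx k).comp Prod.fst measurable_fst).measurable_bind
        (fun f q => (f : Ω → ℝ) q.2) fun f =>
          (Lp.stronglyMeasurable f).measurable.comp measurable_snd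
    have h2 : Measurable fun r : ℕ × (E × Ω) => (hm.approx r.1 r.2.1 : Ω → ℝ) r.2.2 :=
      measurable_from_prod_countable_right h1
    have h3 : Measurable fun q : E × Ω => (i n q.1, q) :=
      ((hi n).comp measurable_fst).prodMk measurable_id
    exact h2.comp h3
  refine ⟨fun q => Filter.limsup (fun n => M n q) Filter.atTop, Measurable.limsup hMm,
    fun x => ?_⟩
  have hbound : ∀ n, ∫ ω, |M n (x, ω) - m x ω| ∂P ≤ (1 / 2) ^ n := fun n => by
    refine le_trans (le_of_eq ?_) ((integral_abs_le_norm_L2 (hm.approx (i n x) x - m x)).trans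
      (Nat.find_spec (hex n x)))
    refine integral_congr_ae ?_
    filter_upwards [Lp.coeFn_sub (hm.approx (i n x) x) (m x)] with ω hω
    rw [hω]; rfl
  have hint : ∀ n, Integrable (fun ω => |M n (x, ω) - m x ω|) P := fun n =>
    ((integrable_L2 (hm.approx (i n x) x)).sub (integrable_L2 (m x))).abs
  have hsum : ∀ᵐ ω ∂P, Summable fun n => |M n (x, ω) - m x ω| := by
    have h1 : ∑' n, ∫⁻ ω, ENNReal.ofReal |M n (x, ω) - m x ω| ∂P ≠ ∞ := by
      refine ne_top_of_le_ne_top (b := ∑' n : ℕ, ENNReal.ofReal ((1 / 2) ^ n)) ?_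
        (ENNReal.tsum_le_tsum fun n => ?_)
      · rw [← ENNReal.ofReal_tsum_of_nonneg (fun n => by positivity) summable_geometric_two]
        exact ENNReal.ofReal_ne_top
      · rw [← ofReal_integral_eq_lintegral_ofReal (hint n)
          (Filter.Eventually.of_forall fun _ => abs_nonneg _)]
        exact ENNReal.ofReal_le_ofReal (hbound n)
    rw [← lintegral_tsum fun n => (hint n).aestronglyMeasurable.aemeasurable.ennreal_ofReal] at h1
    have h2 := ae_lt_top' (AEMeasurable.tsum fun n =>
      (hint n).aestronglyMeasurable.aemeasurable.ennreal_ofReal) h1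
    filter_upwards [h2] with ω hω
    refine (ENNReal.summable_toReal hω.ne).congr fun n => ?_
    rw [ENNReal.toReal_ofReal (abs_nonneg _)]
  filter_upwards [hsum] with ω hω
  have h1 : Filter.Tendsto (fun n => M n (x, ω)) Filter.atTop (nhds (m x ω)) :=
    tendsto_iff_norm_sub_tendsto_zero.2 hω.tendsto_atTop_zero
  exact h1.limsup_eq

/-- Pathwise integrals of a jointly measurable version agree with Bochner integrals. -/
theorem ae_integrable_and_integral_eq_of_modification {lam : Measure E} [SFinite lam]
    {m : E → Lp ℝ 2 P} (hm : Integrable m lam) {M : E × Ω → ℝ} (hM : Measurable M)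
    (hMm : ∀ᵐ x ∂lam, (fun ω => M (x, ω)) =ᵐ[P] m x) :
    (∀ᵐ ω ∂P, Integrable (fun x => M (x, ω)) lam) ∧
      (fun ω => ∫ x, M (x, ω) ∂lam) =ᵐ[P] (∫ x, m x ∂lam : Lp ℝ 2 P) := by
  have hint : Integrable M (lam.prod P) := by
    refine (integrable_prod_iff hM.aestronglyMeasurable).2 ⟨?_, ?_⟩
    · filter_upwards [hMm] with x hx
      exact (integrable_L2 (m x)).congr hx.symm
    · refine hm.norm.mono' hM.aestronglyMeasurable.norm.integral_prod_right' ?_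
      filter_upwards [hMm] with x hx
      rw [Real.norm_of_nonneg (integral_nonneg fun _ => norm_nonneg _)]
      refine le_trans (le_of_eq (integral_congr_ae ?_)) (integral_abs_le_norm_L2 (m x))
      filter_upwards [hx] with ω hω
      rw [← hω]; rfl
  refine ⟨hint.prod_left_ae, ?_⟩
  -- Both sides are tested on events. An integral over an event is an inner product with its
  -- indicator, which commutes with the Bochner integral, while Fubini's theorem handles the
  -- pathwise side.
  refine ae_eq_of_forall_setIntegral_eq_of_sigmaFinite
    (fun s _ _ => hint.integral_prod_right.integrableOn)
    (fun s _ _ => (integrable_L2 _).integrableOn) fun s hs hPs => ?_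
  have hint' : Integrable M (lam.prod (P.restrict s)) := by
    refine hint.mono_measure ?_
    have h1 : lam.prod (P.restrict s) = (lam.prod P).restrict (univ ×ˢ s) := by
      rw [← Measure.prod_restrict, Measure.restrict_univ]
    rw [h1]
    exact Measure.restrict_le_self
  rw [← L2.inner_indicatorConstLp_one hs hPs.ne, ← integral_inner hm,
    ← integral_integral_swap (f := fun x ω => M (x, ω)) hint']
  refine integral_congr_ae ?_
  filter_upwards [hMm] with x hx
  rw [L2.inner_indicatorConstLp_one hs hPs.ne]
  exact integral_congr_ae (ae_restrict_of_ae hx)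

/-- The space L² need not be separable, but the image of a second countable set under a continuous
map is. -/
theorem ContinuousOn.stronglyMeasurable_indicator {E F : Type*} [TopologicalSpace E]
    [SecondCountableTopology E] [MeasurableSpace E] [OpensMeasurableSpace E]
    [NormedAddCommGroup F] {f : E → F} {s : Set E} (hf : ContinuousOn f s)
    (hs : MeasurableSet s) : StronglyMeasurable (s.indicator f) := by
  classical
  borelize F
  refine stronglyMeasurable_iff_measurable_separable.2 ⟨?_, ?_⟩
  · rw [← piecewise_eq_indicator]
    exact hf.measurable_piecewise continuousOn_const hs
  · have h1 : TopologicalSpace.IsSeparable (range (s.domRestrict f)) :=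
      TopologicalSpace.isSeparable_range (continuousOn_iff_continuous_domRestrict.1 hf)
    refine (h1.union (finite_singleton (0 : F)).isSeparable).mono ?_
    rintro _ ⟨x, rfl⟩
    by_cases hx : x ∈ s
    · exact Or.inl ⟨⟨x, hx⟩, by rw [indicator_of_mem hx]; rfl⟩
    · exact Or.inr (by rw [indicator_of_notMem hx]; rfl)

end JointModification

/-! ### Minimality of the Jordan decomposition -/

section Jordan

variable {α : Type*} [MeasurableSpace α]

theorem toJordanDecomposition_toSignedMeasure_sub_add (p m : Measure α) [IsFiniteMeasure p]
    [IsFiniteMeasure m] :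
    p + (p.toSignedMeasure - m.toSignedMeasure).toJordanDecomposition.negPart =
      m + (p.toSignedMeasure - m.toSignedMeasure).toJordanDecomposition.posPart := by
  set J := (p.toSignedMeasure - m.toSignedMeasure).toJordanDecomposition with hJ
  have h1 : J.posPart.toSignedMeasure - J.negPart.toSignedMeasure =
      p.toSignedMeasure - m.toSignedMeasure :=
    SignedMeasure.toSignedMeasure_toJordanDecomposition _
  rw [← Measure.toSignedMeasure_eq_toSignedMeasure_iff, Measure.toSignedMeasure_add,
    Measure.toSignedMeasure_add]
  rw [sub_eq_sub_iff_add_eq_add] at h1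
  rw [← h1, add_comm]

/-- The positive part lives on a set that the negative part does not charge, and on that set `p`
equals `m` plus the positive part. So a difference of finite energy measures has Jordan parts of
finite energy. -/
theorem posPart_toSignedMeasure_sub_le (p m : Measure α) [IsFiniteMeasure p]
    [IsFiniteMeasure m] :
    (p.toSignedMeasure - m.toSignedMeasure).toJordanDecomposition.posPart ≤ p := by
  have h := toJordanDecomposition_toSignedMeasure_sub_add p m
  set J := (p.toSignedMeasure - m.toSignedMeasure).toJordanDecomposition with hJ
  obtain ⟨S, hS, hp, hn⟩ := J.mutuallySingular
  refine Measure.le_intro fun s hs _ => ?_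
  have h1 := congrArg (fun μ => μ (s ∩ Sᶜ)) h
  simp only [Measure.add_apply, measure_mono_null inter_subset_right hn, add_zero] at h1
  calc J.posPart s ≤ J.posPart (s ∩ S) + J.posPart (s ∩ Sᶜ) := by
        rw [← sdiff_eq, measure_inter_add_sdiff _ hS]
    _ = J.posPart (s ∩ Sᶜ) := by rw [measure_mono_null inter_subset_right hp, zero_add]
    _ ≤ p (s ∩ Sᶜ) := by rw [h1]; exact le_add_self
    _ ≤ p s := measure_mono inter_subset_left

theorem negPart_toSignedMeasure_sub_le (p m : Measure α) [IsFiniteMeasure p]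
    [IsFiniteMeasure m] :
    (p.toSignedMeasure - m.toSignedMeasure).toJordanDecomposition.negPart ≤ m := by
  have h := posPart_toSignedMeasure_sub_le m p
  rwa [← neg_sub p.toSignedMeasure, SignedMeasure.toJordanDecomposition_neg,
    JordanDecomposition.neg_posPart] at h

theorem toSignedMeasure_posPart_sub_negPart (μ : SignedMeasure α) :
    μ.toJordanDecomposition.posPart.toSignedMeasure -
      μ.toJordanDecomposition.negPart.toSignedMeasure = μ :=
  SignedMeasure.toSignedMeasure_toJordanDecomposition μ

theorem restrict_toSignedMeasure_sub (p m : Measure α) [IsFiniteMeasure p] [IsFiniteMeasure m]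
    {s : Set α} (hs : MeasurableSet s) :
    (p.toSignedMeasure - m.toSignedMeasure).restrict s =
      (p.restrict s).toSignedMeasure - (m.restrict s).toSignedMeasure := by
  ext i hi
  simp only [VectorMeasure.restrict_apply _ hs hi, _root_.sub_apply,
    Measure.toSignedMeasure_apply, hi.inter hs, hi, if_true, Measure.real,
    Measure.restrict_apply hi]

theorem toJordanDecomposition_restrict (μ : SignedMeasure α) {s : Set α} (hs : MeasurableSet s) :
    (SignedMeasure.toJordanDecomposition (μ.restrict s)).posPart = μ.toJordanDecomposition.posPart.restrict s ∧
      (SignedMeasure.toJordanDecomposition (μ.restrict s)).negPart =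
        μ.toJordanDecomposition.negPart.restrict s := by
  set J := μ.toJordanDecomposition with hJ
  let J' : JordanDecomposition α := ⟨J.posPart.restrict s, J.negPart.restrict s,
    J.mutuallySingular.mono Measure.restrict_le_self Measure.restrict_le_self⟩
  have h : (SignedMeasure.toJordanDecomposition (μ.restrict s)) = J' := by
    refine SignedMeasure.toJordanDecomposition_eq ?_
    rw [JordanDecomposition.toSignedMeasure, ← restrict_toSignedMeasure_sub _ _ hs,
      toSignedMeasure_posPart_sub_negPart]
  rw [h]
  exact ⟨rfl, rfl⟩

end Jordan

/-! ### The energy form and its isometric representations -/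

section Energy

variable {d : ℕ} {Ω' : Type*} [MeasurableSpace Ω'] {B : ℝ≥0 → Ω' → Space d} {Q : Measure Ω'}
  {U : Set (Space d)}

/-- A symmetric measurable kernel whose energy satisfies the Cauchy-Schwarz inequality. -/
structure IsEnergyKernel {α : Type*} [MeasurableSpace α] (G : α → α → ℝ≥0∞) : Prop where
  measurable : Measurable fun q : α × α => G q.1 q.2
  symm : ∀ x y, G x y = G y x
  two_mul_le : ∀ (p q : Measure α) [IsFiniteMeasure p] [IsFiniteMeasure q],
    2 * ∫⁻ x, ∫⁻ y, G x y ∂q ∂p ≤ (∫⁻ x, ∫⁻ y, G x y ∂p ∂p) + ∫⁻ x, ∫⁻ y, G x y ∂q ∂q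

theorem IsContinuousBM.isEnergyKernel_green [IsProbabilityMeasure Q] (hd : 2 ≤ d)
    (hB : IsContinuousBM B Q) (hU : IsOpen U) : IsEnergyKernel (green B Q U) :=
  ⟨hB.measurable_green hd hU, hB.green_comm hd hU, fun p q _ _ =>
    hB.two_mul_greenEnergy_le hd hU p q⟩

theorem IsEnergyKernel.measurable_lintegral (hG : IsEnergyKernel (green B Q U))
    (q : Measure (Space d)) [SFinite q] : Measurable fun x => ∫⁻ y, green B Q U x y ∂q :=
  hG.measurable.lintegral_prod_right'

theorem IsEnergyKernel.measurable_left (hG : IsEnergyKernel (green B Q U)) (x : Space d) :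
    Measurable (green B Q U x) := by
  have h1 : Measurable fun y : Space d => (x, y) := measurable_prodMk_left
  have h2 := hG.measurable.comp h1
  exact h2

theorem greenEnergy_add_left (p p' q : Measure (Space d)) :
    greenEnergy B Q U (p + p') q = greenEnergy B Q U p q + greenEnergy B Q U p' q :=
  lintegral_add_measure _ _ _

theorem IsEnergyKernel.greenEnergy_add_right (hG : IsEnergyKernel (green B Q U))
    (p q q' : Measure (Space d)) [SFinite q] [SFinite q'] :
    greenEnergy B Q U p (q + q') = greenEnergy B Q U p q + greenEnergy B Q U p q' := by
  unfold greenEnergy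
  simp_rw [lintegral_add_measure]
  rw [lintegral_add_left (hG.measurable_lintegral q)]

theorem greenEnergy_mono {p p' q q' : Measure (Space d)} (hp : p ≤ p') (hq : q ≤ q') :
    greenEnergy B Q U p q ≤ greenEnergy B Q U p' q' :=
  lintegral_mono' hp fun _ => lintegral_mono' hq le_rfl

theorem IsEnergyKernel.greenEnergy_comm (hG : IsEnergyKernel (green B Q U))
    (p q : Measure (Space d)) [SFinite p] [SFinite q] :
    greenEnergy B Q U p q = greenEnergy B Q U q p := by
  unfold greenEnergy
  rw [lintegral_lintegral_swap hG.measurable.aemeasurable]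
  simp_rw [fun x y => hG.symm y x]

theorem IsEnergyKernel.greenEnergy_ne_top (hG : IsEnergyKernel (green B Q U))
    {p q : Measure (Space d)} (hp : p ∈ energyMeasures B Q U) (hq : q ∈ energyMeasures B Q U) :
    greenEnergy B Q U p q ≠ ∞ := by
  obtain ⟨hpf, -, hp⟩ := hp
  obtain ⟨hqf, -, hq⟩ := hq
  intro h
  have h1 := hG.two_mul_le p q
  change 2 * greenEnergy B Q U p q ≤ greenEnergy B Q U p p + greenEnergy B Q U q q at h1
  rw [h, ENNReal.mul_top two_ne_zero, top_le_iff] at h1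
  exact (ENNReal.add_lt_top.2 ⟨hp, hq⟩).ne h1

theorem energyMeasures_of_le {p q : Measure (Space d)} (hq : q ∈ energyMeasures B Q U)
    (h : p ≤ q) : p ∈ energyMeasures B Q U := by
  obtain ⟨hf, h0, he⟩ := hq
  exact ⟨isFiniteMeasure_of_le q h, le_antisymm ((h _).trans h0.le) zero_le,
    (greenEnergy_mono h h).trans_lt he⟩

theorem IsEnergyKernel.add_mem (hG : IsEnergyKernel (green B Q U))
    {p q : Measure (Space d)} (hp : p ∈ energyMeasures B Q U) (hq : q ∈ energyMeasures B Q U) :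
    p + q ∈ energyMeasures B Q U := by
  have h1 := hp.1
  have h2 := hq.1
  refine ⟨inferInstance, by simp [hp.2.1, hq.2.1], ?_⟩
  rw [greenEnergy_add_left, hG.greenEnergy_add_right, hG.greenEnergy_add_right]
  exact ENNReal.add_lt_top.2 ⟨ENNReal.add_lt_top.2 ⟨(hG.greenEnergy_ne_top hp hp).lt_top,
    (hG.greenEnergy_ne_top hp hq).lt_top⟩, ENNReal.add_lt_top.2
    ⟨(hG.greenEnergy_ne_top hq hp).lt_top, (hG.greenEnergy_ne_top hq hq).lt_top⟩⟩

theorem zero_mem_energyMeasures : (0 : Measure (Space d)) ∈ energyMeasures B Q U :=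
  ⟨inferInstance, by simp, by simp [greenEnergy]⟩

theorem jordan_mem_energyMeasures {μ : SignedMeasure (Space d)}
    (hμ : μ ∈ signedEnergyMeasures B Q U) :
    μ.toJordanDecomposition.posPart ∈ energyMeasures B Q U ∧
      μ.toJordanDecomposition.negPart ∈ energyMeasures B Q U := by
  obtain ⟨p, m, _, _, hp, hm, rfl⟩ := hμ
  exact ⟨energyMeasures_of_le hp (posPart_toSignedMeasure_sub_le p m),
    energyMeasures_of_le hm (negPart_toSignedMeasure_sub_le p m)⟩

theorem toSignedMeasure_sub_mem {p m : Measure (Space d)} [IsFiniteMeasure p] [IsFiniteMeasure m]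
    (hp : p ∈ energyMeasures B Q U) (hm : m ∈ energyMeasures B Q U) :
    p.toSignedMeasure - m.toSignedMeasure ∈ signedEnergyMeasures B Q U :=
  ⟨p, m, inferInstance, inferInstance, hp, hm, rfl⟩

theorem toSignedMeasure_mem {p : Measure (Space d)} [IsFiniteMeasure p]
    (hp : p ∈ energyMeasures B Q U) : p.toSignedMeasure ∈ signedEnergyMeasures B Q U := by
  have h := toSignedMeasure_sub_mem hp (zero_mem_energyMeasures (B := B) (Q := Q) (U := U))
  rwa [Measure.toSignedMeasure_zero, sub_zero] at h

theorem IsEnergyKernel.toReal_greenEnergy_add_left (hG : IsEnergyKernel (green B Q U))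
    {p p' q : Measure (Space d)} (hp : p ∈ energyMeasures B Q U)
    (hp' : p' ∈ energyMeasures B Q U) (hq : q ∈ energyMeasures B Q U) :
    (greenEnergy B Q U (p + p') q).toReal =
      (greenEnergy B Q U p q).toReal + (greenEnergy B Q U p' q).toReal := by
  rw [greenEnergy_add_left, ENNReal.toReal_add (hG.greenEnergy_ne_top hp hq)
    (hG.greenEnergy_ne_top hp' hq)]

/-- The covariance of differences of measures of finite energy. -/
theorem IsEnergyKernel.greenCovariance_sub (hG : IsEnergyKernel (green B Q U))
    {p m r s : Measure (Space d)} [IsFiniteMeasure p] [IsFiniteMeasure m] [IsFiniteMeasure r]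
    [IsFiniteMeasure s] (hp : p ∈ energyMeasures B Q U)
    (hm : m ∈ energyMeasures B Q U) (hr : r ∈ energyMeasures B Q U)
    (hs : s ∈ energyMeasures B Q U) :
    greenCovariance B Q U (p.toSignedMeasure - m.toSignedMeasure)
        (r.toSignedMeasure - s.toSignedMeasure) =
      (greenEnergy B Q U p r).toReal + (greenEnergy B Q U m s).toReal -
        (greenEnergy B Q U p s).toReal - (greenEnergy B Q U m r).toReal := by
  -- One argument at a time: adding the opposite parts turns the change of representation into an
  -- identity between positive measures, where energies add.
  have key : ∀ (p m t : Measure (Space d)) [IsFiniteMeasure p] [IsFiniteMeasure m],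
      p ∈ energyMeasures B Q U → m ∈ energyMeasures B Q U → t ∈ energyMeasures B Q U →
      (greenEnergy B Q U (p.toSignedMeasure - m.toSignedMeasure).toJordanDecomposition.posPart
          t).toReal -
        (greenEnergy B Q U (p.toSignedMeasure - m.toSignedMeasure).toJordanDecomposition.negPart
          t).toReal = (greenEnergy B Q U p t).toReal - (greenEnergy B Q U m t).toReal := by
    intro p m t _ _ hp hm ht
    have h1 := energyMeasures_of_le hp (posPart_toSignedMeasure_sub_le p m)
    have h2 := energyMeasures_of_le hm (negPart_toSignedMeasure_sub_le p m)
    have h3 := hG.toReal_greenEnergy_add_left hp h2 ht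
    have h4 := hG.toReal_greenEnergy_add_left hm h1 ht
    rw [toJordanDecomposition_toSignedMeasure_sub_add] at h3
    linarith
  have h1 := energyMeasures_of_le hp (posPart_toSignedMeasure_sub_le p m)
  have h2 := energyMeasures_of_le hm (negPart_toSignedMeasure_sub_le p m)
  have h3 := energyMeasures_of_le hr (posPart_toSignedMeasure_sub_le r s)
  have h4 := energyMeasures_of_le hs (negPart_toSignedMeasure_sub_le r s)
  have e1 := key p m _ hp hm h3
  have e2 := key p m _ hp hm h4
  have e3 := key r s p hr hs hp
  have e4 := key r s m hr hs hm
  rw [hG.greenEnergy_comm _ p, hG.greenEnergy_comm _ p, hG.greenEnergy_comm _ p,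
    hG.greenEnergy_comm _ p] at e3
  rw [hG.greenEnergy_comm _ m, hG.greenEnergy_comm _ m, hG.greenEnergy_comm _ m,
    hG.greenEnergy_comm _ m] at e4
  unfold greenCovariance
  linarith

open scoped Classical in
/-- The image of a finite measure under a map defined on signed measures. -/
noncomputable def positiveImage {α H : Type*} [MeasurableSpace α] [Zero H]
    (ι : SignedMeasure α → H) (p : Measure α) : H :=
  if h : IsFiniteMeasure p then ι (@Measure.toSignedMeasure α _ p h) else 0

theorem positiveImage_eq {α H : Type*} [MeasurableSpace α] [Zero H]
    (ι : SignedMeasure α → H) (p : Measure α) [h : IsFiniteMeasure p] :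
    positiveImage ι p = ι p.toSignedMeasure := dif_pos h

/-- An isometric representation of the energy form in a Hilbert space. -/
def IsEnergyIsometry {H : Type*} [NormedAddCommGroup H] [InnerProductSpace ℝ H]
    (B : ℝ≥0 → Ω' → Space d) (Q : Measure Ω') (U : Set (Space d))
    (ι : SignedMeasure (Space d) → H) : Prop :=
  ∀ μ ∈ signedEnergyMeasures B Q U, ∀ ν ∈ signedEnergyMeasures B Q U,
    inner ℝ (ι μ) (ι ν) = greenCovariance B Q U μ ν

variable {H : Type*} [NormedAddCommGroup H] [InnerProductSpace ℝ H]
  {ι : SignedMeasure (Space d) → H}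

theorem IsEnergyIsometry.inner_positiveImage (hι : IsEnergyIsometry B Q U ι)
    (hG : IsEnergyKernel (green B Q U)) {p q : Measure (Space d)}
    (hp : p ∈ energyMeasures B Q U) (hq : q ∈ energyMeasures B Q U) :
    inner ℝ (positiveImage ι p) (positiveImage ι q) = (greenEnergy B Q U p q).toReal := by
  have := hp.1
  have := hq.1
  have h0 := zero_mem_energyMeasures (B := B) (Q := Q) (U := U)
  have h := hG.greenCovariance_sub hp h0 hq h0
  rw [Measure.toSignedMeasure_zero, sub_zero, sub_zero] at h
  rw [positiveImage_eq, positiveImage_eq, hι _ (toSignedMeasure_mem hp) _ (toSignedMeasure_mem hq), h]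
  simp [greenEnergy]

/-- No linearity is assumed of `ι`; the isometry forces it, because the squared norm of the
difference of the two sides expands into energies that cancel. -/
theorem IsEnergyIsometry.map_sub (hι : IsEnergyIsometry B Q U ι)
    (hG : IsEnergyKernel (green B Q U)) {p m : Measure (Space d)} [IsFiniteMeasure p]
    [IsFiniteMeasure m] (hp : p ∈ energyMeasures B Q U) (hm : m ∈ energyMeasures B Q U) :
    ι (p.toSignedMeasure - m.toSignedMeasure) = positiveImage ι p - positiveImage ι m := by
  have h0 := zero_mem_energyMeasures (B := B) (Q := Q) (U := U)
  have hμ := toSignedMeasure_sub_mem hp hm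
  have e1 : ∀ q ∈ energyMeasures B Q U,
      inner ℝ (ι (p.toSignedMeasure - m.toSignedMeasure)) (positiveImage ι q) =
        (greenEnergy B Q U p q).toReal - (greenEnergy B Q U m q).toReal := fun q hq => by
    have := hq.1
    have h := hG.greenCovariance_sub hp hm hq h0
    rw [Measure.toSignedMeasure_zero, sub_zero] at h
    rw [positiveImage_eq, hι _ hμ _ (toSignedMeasure_mem hq), h]
    simp [greenEnergy]
  have e2 := hι _ hμ _ hμ
  rw [hG.greenCovariance_sub hp hm hp hm] at e2
  have e3 := hι.inner_positiveImage hG hp hp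
  have e4 := hι.inner_positiveImage hG hp hm
  have e5 := hι.inner_positiveImage hG hm hm
  rw [← sub_eq_zero, ← inner_self_eq_zero (𝕜 := ℝ)]
  simp only [inner_sub_left, inner_sub_right]
  rw [real_inner_comm (ι _) (positiveImage ι p), real_inner_comm (ι _) (positiveImage ι m),
    real_inner_comm (positiveImage ι p) (positiveImage ι m), e1 p hp, e1 m hm, e2, e3, e4, e5]
  rw [hG.greenEnergy_comm m p]
  ring

theorem IsEnergyIsometry.positiveImage_add (hι : IsEnergyIsometry B Q U ι)
    (hG : IsEnergyKernel (green B Q U)) {p m : Measure (Space d)}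
    (hp : p ∈ energyMeasures B Q U) (hm : m ∈ energyMeasures B Q U) :
    positiveImage ι (p + m) = positiveImage ι p + positiveImage ι m := by
  have := hp.1
  have := hm.1
  have h1 := hι.map_sub hG (hG.add_mem hp hm) hm
  rw [Measure.toSignedMeasure_add, add_sub_cancel_right] at h1
  rw [positiveImage_eq ι p, h1, sub_add_cancel]

theorem IsEnergyIsometry.eq_jordan (hι : IsEnergyIsometry B Q U ι)
    (hG : IsEnergyKernel (green B Q U)) {μ : SignedMeasure (Space d)}
    (hμ : μ ∈ signedEnergyMeasures B Q U) :
    ι μ = positiveImage ι μ.toJordanDecomposition.posPart -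
      positiveImage ι μ.toJordanDecomposition.negPart := by
  obtain ⟨h1, h2⟩ := jordan_mem_energyMeasures hμ
  conv_lhs => rw [← toSignedMeasure_posPart_sub_negPart μ]
  exact hι.map_sub hG h1 h2

end Energy

/-! ### Balayage as an orthogonal projection -/

section Balayage

variable {d : ℕ} {Ω' : Type*} [MeasurableSpace Ω'] {B : ℝ≥0 → Ω' → Space d} {Q : Measure Ω'}
  {D A : Set (Space d)}

/-- A regular open set `D` and a compact set `A` such that `D \ A` is regular. -/
structure IsRegularPair (B : ℝ≥0 → Ω' → Space d) (Q : Measure Ω') (D A : Set (Space d)) :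
    Prop where
  two_le : 2 ≤ d
  bm : IsContinuousBM B Q
  isOpen : IsOpen D
  ne_univ : d = 2 → D ≠ univ
  isCompact : IsCompact A
  regular : HasRegularBoundary B Q D
  regular_diff : HasRegularBoundary B Q (D \ A)

variable [IsProbabilityMeasure Q]

theorem IsRegularPair.isOpen_diff (h : IsRegularPair B Q D A) : IsOpen (D \ A) :=
  h.isOpen.sdiff h.isCompact.isClosed

theorem IsRegularPair.kernel (h : IsRegularPair B Q D A) : IsEnergyKernel (green B Q D) :=
  h.bm.isEnergyKernel_green h.two_le h.isOpen

theorem IsRegularPair.kernel_diff (h : IsRegularPair B Q D A) :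
    IsEnergyKernel (green B Q (D \ A)) :=
  h.bm.isEnergyKernel_green h.two_le h.isOpen_diff

theorem IsRegularPair.measurable_harmonicMeasure (h : IsRegularPair B Q D A) :
    Measurable (harmonicMeasure B Q (D \ A)) := h.bm.measurable_harmonicMeasure h.isOpen_diff

theorem IsRegularPair.lintegral_sweptMeasure (h : IsRegularPair B Q D A) (p : Measure (Space d))
    {f : Space d → ℝ≥0∞} (hf : Measurable f) :
    ∫⁻ z, f z ∂(sweptMeasure B Q (D \ A) p) =
      ∫⁻ x in D \ A, ∫⁻ z, f z ∂(harmonicMeasure B Q (D \ A) x) ∂p :=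
  Measure.lintegral_bind h.measurable_harmonicMeasure.aemeasurable hf.aemeasurable

theorem IsRegularPair.sweptMeasure_diff_eq_zero (h : IsRegularPair B Q D A)
    (p : Measure (Space d)) : sweptMeasure B Q (D \ A) p (D \ A) = 0 := by
  unfold sweptMeasure
  rw [Measure.bind_apply h.isOpen_diff.measurableSet h.measurable_harmonicMeasure.aemeasurable]
  refine (lintegral_eq_zero_iff' ?_).2 (Filter.Eventually.of_forall fun x => ?_)
  · exact ((Measure.measurable_coe h.isOpen_diff.measurableSet).comp
      h.measurable_harmonicMeasure).aemeasurable
  · exact measure_mono_null (fun z hz => not_not.2 hz)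
      (ae_iff.1 (h.bm.ae_harmonicMeasure h.isOpen_diff x))

theorem greenEnergy_restrict_left (U : Set (Space d)) (p q : Measure (Space d)) :
    greenEnergy B Q U (p.restrict U) q = greenEnergy B Q U p q := by
  refine setLIntegral_eq_of_support_subset fun x hx => ?_
  by_contra hxU
  refine hx ((lintegral_congr fun y => ?_).trans lintegral_zero)
  exact green_of_notMem fun h' => hxU h'.1

/-- The measure obtained by sweeping the part of `p` carried by `D \ A` onto `A`. -/
noncomputable def balayage (B : ℝ≥0 → Ω' → Space d) (Q : Measure Ω') (D A : Set (Space d))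
    (p : Measure (Space d)) : Measure (Space d) :=
  p.restrict A + (sweptMeasure B Q (D \ A) p).restrict D

instance (p : Measure (Space d)) [IsFiniteMeasure p] : IsFiniteMeasure (balayage B Q D A p) := by
  unfold balayage
  infer_instance

/-- This integrates `green_balayage` over the part of `p` on `D \ A`. The part on `A` is kept by
balayage, and mass outside `D` has no energy. -/
theorem IsRegularPair.greenEnergy_eq_add (h : IsRegularPair B Q D A) (p q : Measure (Space d))
    [IsFiniteMeasure p] [IsFiniteMeasure q] :
    greenEnergy B Q D p q = greenEnergy B Q D (balayage B Q D A p) q +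
      greenEnergy B Q (D \ A) p q := by
  have hAm := h.isCompact.measurableSet
  have hOm := h.isOpen_diff.measurableSet
  have hF := h.kernel.measurable_lintegral q
  have hFO := h.kernel_diff.measurable_lintegral q
  rw [balayage, greenEnergy_add_left, greenEnergy_restrict_left D,
    ← greenEnergy_restrict_left (D \ A) p, add_assoc]
  conv_lhs => rw [← Measure.restrict_add_restrict_compl (μ := p) hAm, greenEnergy_add_left]
  congr 1
  rw [← greenEnergy_restrict_left D, Measure.restrict_restrict
    h.isOpen.measurableSet, ← sdiff_eq]
  unfold greenEnergy
  rw [h.lintegral_sweptMeasure p hF, ← lintegral_add_right _ hFO]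
  refine setLIntegral_congr_fun hOm fun x hx => ?_
  have h1 : Measurable fun y => ∫⁻ z, green B Q D z y ∂(harmonicMeasure B Q (D \ A) x) := by
    have h2 : Measurable fun r : Space d × Space d => green B Q D r.2 r.1 :=
      h.kernel.measurable.comp measurable_swap
    exact h2.lintegral_prod_right'
  rw [lintegral_congr fun y => h.bm.green_balayage h.two_le h.isOpen_diff h.isOpen sdiff_subset
    h.regular_diff h.regular hx y, lintegral_add_right _ h1, add_comm]
  congr 1
  refine (lintegral_lintegral_swap ?_).symm
  exact h.kernel.measurable.aemeasurable

theorem IsRegularPair.balayage_diff_eq_zero (h : IsRegularPair B Q D A) (p : Measure (Space d)) :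
    balayage B Q D A p (D \ A) = 0 := by
  have hOm := h.isOpen_diff.measurableSet
  rw [balayage, Measure.add_apply, Measure.restrict_apply hOm, Measure.restrict_apply hOm]
  have h1 : D \ A ∩ A = ∅ := by ext; simp
  rw [h1, measure_empty, zero_add]
  exact measure_mono_null inter_subset_left (h.sweptMeasure_diff_eq_zero p)

theorem IsRegularPair.greenEnergy_diff_balayage (h : IsRegularPair B Q D A)
    (p q : Measure (Space d)) : greenEnergy B Q (D \ A) p (balayage B Q D A q) = 0 := by
  refine (lintegral_congr fun x => ?_).trans lintegral_zero
  have h1 : ∀ᵐ y ∂(balayage B Q D A q), y ∉ D \ A := by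
    rw [ae_iff]
    simp only [not_not]
    exact h.balayage_diff_eq_zero q
  refine (lintegral_congr_ae ?_).trans lintegral_zero
  filter_upwards [h1] with y hy
  exact green_of_notMem fun h' => hy h'.2

/-- Expand the energy of `q` with the swept `p` by `greenEnergy_eq_add`: the `D \ A` term vanishes,
because a swept measure does not charge `D \ A`. In a Hilbert space this says that balayage is an
orthogonal projection. -/
theorem IsRegularPair.greenEnergy_balayage_balayage (h : IsRegularPair B Q D A)
    (p q : Measure (Space d)) [IsFiniteMeasure p] [IsFiniteMeasure q] :
    greenEnergy B Q D (balayage B Q D A p) (balayage B Q D A q) =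
      greenEnergy B Q D (balayage B Q D A p) q := by
  rw [h.kernel.greenEnergy_comm _ q, h.greenEnergy_eq_add q, h.greenEnergy_diff_balayage, add_zero,
    h.kernel.greenEnergy_comm]

theorem IsRegularPair.balayage_mem (h : IsRegularPair B Q D A) {p : Measure (Space d)}
    (hp : p ∈ energyMeasures B Q D) : balayage B Q D A p ∈ energyMeasures B Q D := by
  have := hp.1
  refine ⟨inferInstance, ?_, ?_⟩
  · rw [balayage, Measure.add_apply, Measure.restrict_apply h.isOpen.measurableSet.compl,
      Measure.restrict_apply h.isOpen.measurableSet.compl, compl_inter_self, measure_empty,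
      add_zero]
    exact measure_mono_null inter_subset_left hp.2.1
  · rw [h.greenEnergy_balayage_balayage]
    refine lt_of_le_of_lt ?_ hp.2.2
    rw [h.greenEnergy_eq_add p p]
    exact le_self_add

theorem IsRegularPair.swept_mem (h : IsRegularPair B Q D A) {p : Measure (Space d)}
    (hp : p ∈ energyMeasures B Q D) :
    (sweptMeasure B Q (D \ A) p).restrict D ∈ energyMeasures B Q D :=
  energyMeasures_of_le (h.balayage_mem hp) (Measure.le_add_left le_rfl)

theorem restrict_mem_energyMeasures {p : Measure (Space d)} {U : Set (Space d)}
    (hp : p ∈ energyMeasures B Q U) (s : Set (Space d)) : p.restrict s ∈ energyMeasures B Q U :=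
  energyMeasures_of_le hp Measure.restrict_le_self

theorem IsRegularPair.restrict_diff_mem (h : IsRegularPair B Q D A) {p : Measure (Space d)}
    (hp : p ∈ energyMeasures B Q D) : p.restrict (D \ A) ∈ energyMeasures B Q (D \ A) := by
  have := hp.1
  refine ⟨inferInstance, by simp [Measure.restrict_apply h.isOpen_diff.measurableSet.compl], ?_⟩
  refine (greenEnergy_mono Measure.restrict_le_self Measure.restrict_le_self).trans_lt ?_
  refine lt_of_le_of_lt ?_ hp.2.2
  rw [h.greenEnergy_eq_add p p]
  exact le_add_self

/-- Measures of finite energy in `D \ A` with compact support have finite energy in `D`. -/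
theorem IsRegularPair.mem_of_compactlyCarried (h : IsRegularPair B Q D A) {p : Measure (Space d)}
    (hp : p ∈ energyMeasures B Q (D \ A)) {K : Set (Space d)} (hK : IsCompact K) (hKO : K ⊆ D \ A)
    (hpK : p Kᶜ = 0) : p ∈ energyMeasures B Q D := by
  have := hp.1
  refine ⟨inferInstance, measure_mono_null (compl_subset_compl.2 sdiff_subset) hp.2.1, ?_⟩
  rw [h.greenEnergy_eq_add p p]
  refine ENNReal.add_lt_top.2 ⟨?_, hp.2.2⟩
  obtain ⟨C, hC⟩ := h.bm.exists_green_le h.two_le h.isOpen h.ne_univ h.regular h.isOpen_diff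
    sdiff_subset hK hKO
  rw [h.kernel.greenEnergy_comm]
  have h1 : ∀ᵐ x ∂p, x ∈ K := by rw [ae_iff]; exact hpK
  have h2 : ∀ᵐ y ∂(balayage B Q D A p), y ∉ D \ A := by
    rw [ae_iff]
    simp only [not_not]
    exact h.balayage_diff_eq_zero p
  calc greenEnergy B Q D p (balayage B Q D A p)
      ≤ ∫⁻ _, ∫⁻ _, (C : ℝ≥0∞) ∂(balayage B Q D A p) ∂p := by
        refine lintegral_mono_ae ?_
        filter_upwards [h1] with x hx
        refine lintegral_mono_ae ?_
        filter_upwards [h2] with y hy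
        exact hC x hx y hy
    _ < ∞ := by
        simp only [lintegral_const]
        exact ENNReal.mul_lt_top (ENNReal.mul_lt_top ENNReal.coe_lt_top (measure_lt_top _ _))
          (measure_lt_top _ _)

theorem IsRegularPair.restrict_signed_mem (h : IsRegularPair B Q D A)
    {μ : SignedMeasure (Space d)} (hμ : μ ∈ signedEnergyMeasures B Q D) :
    μ.restrict A ∈ signedEnergyMeasures B Q D ∧
      sweptSignedMeasure B Q D (D \ A) μ ∈ signedEnergyMeasures B Q D := by
  obtain ⟨h1, h2⟩ := jordan_mem_energyMeasures hμ
  constructor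
  · rw [← toSignedMeasure_posPart_sub_negPart μ,
      restrict_toSignedMeasure_sub _ _ h.isCompact.measurableSet]
    exact toSignedMeasure_sub_mem (restrict_mem_energyMeasures h1 A)
      (restrict_mem_energyMeasures h2 A)
  · exact toSignedMeasure_sub_mem (h.swept_mem h1) (h.swept_mem h2)

theorem IsRegularPair.restrict_diff_signed_mem (h : IsRegularPair B Q D A)
    {μ : SignedMeasure (Space d)} (hμ : μ ∈ signedEnergyMeasures B Q D) :
    μ.restrict (D \ A) ∈ signedEnergyMeasures B Q (D \ A) := by
  obtain ⟨h1, h2⟩ := jordan_mem_energyMeasures hμ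
  rw [← toSignedMeasure_posPart_sub_negPart μ,
    restrict_toSignedMeasure_sub _ _ h.isOpen_diff.measurableSet]
  exact toSignedMeasure_sub_mem (h.restrict_diff_mem h1) (h.restrict_diff_mem h2)

end Balayage

/-! ### The innovation: the part of the field orthogonal to the balayage -/

section Projection

variable {d : ℕ} {Ω' : Type*} [MeasurableSpace Ω'] {B : ℝ≥0 → Ω' → Space d} {Q : Measure Ω'}
  [IsProbabilityMeasure Q] {D A : Set (Space d)}
  {H : Type*} [NormedAddCommGroup H] [InnerProductSpace ℝ H]
  {ι : SignedMeasure (Space d) → H}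

/-- The image of `p` minus its balayage onto `A`. -/
noncomputable def innovation (B : ℝ≥0 → Ω' → Space d) (Q : Measure Ω') (D A : Set (Space d))
    (ι : SignedMeasure (Space d) → H) (p : Measure (Space d)) : H :=
  positiveImage ι p - positiveImage ι (balayage B Q D A p)

theorem IsRegularPair.inner_balayage_innovation (h : IsRegularPair B Q D A)
    (hι : IsEnergyIsometry B Q D ι) {p q : Measure (Space d)} (hp : p ∈ energyMeasures B Q D)
    (hq : q ∈ energyMeasures B Q D) :
    inner ℝ (positiveImage ι (balayage B Q D A p)) (innovation B Q D A ι q) = 0 := by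
  have := hp.1
  have := hq.1
  rw [innovation, inner_sub_right, hι.inner_positiveImage h.kernel (h.balayage_mem hp) hq,
    hι.inner_positiveImage h.kernel (h.balayage_mem hp) (h.balayage_mem hq),
    h.greenEnergy_balayage_balayage, sub_self]

/-- What remains of the energy in `D` after the projection is the energy in `D \ A`; this is the
covariance required of the field in `D \ A`. -/
theorem IsRegularPair.inner_innovation (h : IsRegularPair B Q D A)
    (hι : IsEnergyIsometry B Q D ι) {p q : Measure (Space d)} (hp : p ∈ energyMeasures B Q D)
    (hq : q ∈ energyMeasures B Q D) :
    inner ℝ (innovation B Q D A ι p) (innovation B Q D A ι q) =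
      (greenEnergy B Q (D \ A) p q).toReal := by
  have := hp.1
  have := hq.1
  rw [innovation, inner_sub_left, h.inner_balayage_innovation hι hp hq, sub_zero, real_inner_comm,
    innovation, inner_sub_left, hι.inner_positiveImage h.kernel hq hp,
    hι.inner_positiveImage h.kernel (h.balayage_mem hq) hp, h.kernel_diff.greenEnergy_comm p q]
  have h1 := h.greenEnergy_eq_add q p
  have h2 := h.kernel.greenEnergy_ne_top hq hp
  rw [h1] at h2 ⊢
  rw [ENNReal.toReal_add (ENNReal.add_ne_top.1 h2).1 (ENNReal.add_ne_top.1 h2).2,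
    add_sub_cancel_left]

theorem IsRegularPair.balayage_add (h : IsRegularPair B Q D A) (p q : Measure (Space d)) :
    balayage B Q D A (p + q) = balayage B Q D A p + balayage B Q D A q := by
  have h1 : sweptMeasure B Q (D \ A) (p + q) =
      sweptMeasure B Q (D \ A) p + sweptMeasure B Q (D \ A) q := by
    refine Measure.ext fun s hs => ?_
    simp only [sweptMeasure, Measure.restrict_add, Measure.add_apply, Measure.bind_apply hs
      h.measurable_harmonicMeasure.aemeasurable, lintegral_add_measure]
  simp only [balayage, h1, Measure.restrict_add]
  abel

theorem IsRegularPair.innovation_add (h : IsRegularPair B Q D A)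
    (hι : IsEnergyIsometry B Q D ι) {p q : Measure (Space d)} (hp : p ∈ energyMeasures B Q D)
    (hq : q ∈ energyMeasures B Q D) :
    innovation B Q D A ι (p + q) = innovation B Q D A ι p + innovation B Q D A ι q := by
  rw [innovation, h.balayage_add, hι.positiveImage_add h.kernel hp hq,
    hι.positiveImage_add h.kernel (h.balayage_mem hp) (h.balayage_mem hq)]
  simp only [innovation]
  abel

/-- The potential of `p` is integrable against `p`, so its integral over sets shrinking to the empty
set tends to `0`. -/
theorem tendsto_greenEnergy_restrict_compl_exhaustion {U : Set (Space d)} (hU : IsOpen U)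
    {p : Measure (Space d)} [IsFiniteMeasure p] (hp : greenEnergy B Q U p p ≠ ∞) :
    Filter.Tendsto (fun n => greenEnergy B Q U (p.restrict (exhaustion U n)ᶜ)
      (p.restrict (exhaustion U n)ᶜ)) Filter.atTop (nhds 0) := by
  have hle : ∀ n, greenEnergy B Q U (p.restrict (exhaustion U n)ᶜ)
      (p.restrict (exhaustion U n)ᶜ) ≤ ∫⁻ x in U \ exhaustion U n, ∫⁻ y, green B Q U x y ∂p ∂p := by
    intro n
    refine (greenEnergy_mono le_rfl Measure.restrict_le_self).trans ?_
    rw [← greenEnergy_restrict_left U, Measure.restrict_restrict hU.measurableSet,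
      ← sdiff_eq]
    exact le_rfl
  refine tendsto_of_tendsto_of_tendsto_of_le_of_le tendsto_const_nhds ?_ (fun _ => zero_le) hle
  refine tendsto_setLIntegral_zero hp ?_
  have h1 := tendsto_measure_iInter_atTop (μ := p) (s := fun n => U \ exhaustion U n)
    (fun n => (hU.measurableSet.diff (isClosed_exhaustion U n).measurableSet).nullMeasurableSet)
    (fun m n hmn => sdiff_subset_sdiff_right (monotone_exhaustion U hmn))
    ⟨0, measure_ne_top _ _⟩
  have h2 : ⋂ n, U \ exhaustion U n = ∅ := by
    rw [← sdiff_iUnion, iUnion_exhaustion hU, sdiff_self]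
  rwa [h2, measure_empty] at h1

end Projection

/-! ### The field as an isometry into a Gaussian Hilbert space -/

section FieldImage

variable {d : ℕ} {Ω' : Type*} [MeasurableSpace Ω'] {B : ℝ≥0 → Ω' → Space d} {Q : Measure Ω'}
  {Ω : Type*} [MeasurableSpace Ω] {P : Measure Ω} [IsProbabilityMeasure P]
  {Γ : SignedMeasure (Space d) → Ω → ℝ} {U : Set (Space d)}

/-- `ι` maps a measure to the class of the value of the field, in the Gaussian Hilbert space
`S`. -/
structure IsFieldImage (B : ℝ≥0 → Ω' → Space d) (Q : Measure Ω') (U : Set (Space d))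
    (Γ : SignedMeasure (Space d) → Ω → ℝ) (P : Measure Ω) [IsProbabilityMeasure P]
    (ι : SignedMeasure (Space d) → Lp ℝ 2 P) (S : Submodule ℝ (Lp ℝ 2 P)) : Prop where
  ae_eq : ∀ μ ∈ signedEnergyMeasures B Q U, ι μ =ᵐ[P] Γ μ
  isometry : IsEnergyIsometry B Q U ι
  mem : ∀ μ ∈ signedEnergyMeasures B Q U, ι μ ∈ S
  gaussian : IsGaussianSpace S
  isClosed : IsClosed (S : Set (Lp ℝ 2 P))

theorem IsGFF.exists_isFieldImage (hΓ : IsGFF B Q U Γ P) :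
    ∃ ι S, IsFieldImage B Q U Γ P ι S := by
  classical
  have hL : ∀ μ ∈ signedEnergyMeasures B Q U, MemLp (Γ μ) 2 P := fun μ hμ =>
    (hΓ.gaussian.hasGaussianLaw_eval ⟨μ, hμ⟩).memLp_two
  let ι : SignedMeasure (Space d) → Lp ℝ 2 P := fun μ =>
    if h : MemLp (Γ μ) 2 P then h.toLp (Γ μ) else 0
  have hι : ∀ μ ∈ signedEnergyMeasures B Q U, ι μ =ᵐ[P] Γ μ := fun μ hμ => by
    simp only [ι, dif_pos (hL μ hμ)]
    exact (hL μ hμ).coeFn_toLp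
  -- The closure is taken because the field in `D \ A` is built from L² limits.
  refine ⟨ι, (Submodule.span ℝ (range fun μ : signedEnergyMeasures B Q U =>
    ι μ)).topologicalClosure, hι, fun μ hμ ν hν => ?_, fun μ hμ => ?_, ?_,
    Submodule.isClosed_topologicalClosure _⟩
  · rw [inner_L2_eq, ← hΓ.covariance μ hμ ν hν]
    refine integral_congr_ae ?_
    filter_upwards [hι μ hμ, hι ν hν] with ω h1 h2
    rw [h1, h2]
  · exact Submodule.le_topologicalClosure _ (Submodule.subset_span ⟨⟨μ, hμ⟩, rfl⟩)
  · exact (isGaussianSpace_span hΓ.gaussian (fun μ => hΓ.centred μ μ.2)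
      fun μ => hι μ μ.2).topologicalClosure

variable {ι : SignedMeasure (Space d) → Lp ℝ 2 P} {S : Submodule ℝ (Lp ℝ 2 P)}

theorem IsFieldImage.positiveImage_mem (hι : IsFieldImage B Q U Γ P ι S) {p : Measure (Space d)}
    (hp : p ∈ energyMeasures B Q U) : positiveImage ι p ∈ S := by
  have := hp.1
  rw [positiveImage_eq]
  exact hι.mem _ (toSignedMeasure_mem hp)

end FieldImage

/-! ### Independence and the Gaussian free field in the complement -/

section Fields

variable {d : ℕ} {Ω' : Type*} [MeasurableSpace Ω'] {B : ℝ≥0 → Ω' → Space d} {Q : Measure Ω'}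
  [IsProbabilityMeasure Q]
  {Ω : Type*} [MeasurableSpace Ω] {P : Measure Ω} [IsProbabilityMeasure P]
  {Γ : SignedMeasure (Space d) → Ω → ℝ} {D A : Set (Space d)}
  {ι : SignedMeasure (Space d) → Lp ℝ 2 P} {S : Submodule ℝ (Lp ℝ 2 P)}

theorem IsFieldImage.innovation_mem (hι : IsFieldImage B Q D Γ P ι S) (h : IsRegularPair B Q D A)
    {p : Measure (Space d)} (hp : p ∈ energyMeasures B Q D) : innovation B Q D A ι p ∈ S :=
  S.sub_mem (hι.positiveImage_mem hp) (hι.positiveImage_mem (h.balayage_mem hp))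

theorem IsFieldImage.fieldOn_ae_eq (hι : IsFieldImage B Q D Γ P ι S) (h : IsRegularPair B Q D A)
    {μ : SignedMeasure (Space d)} (hμ : μ ∈ signedEnergyMeasures B Q D) :
    ⇑(positiveImage ι (balayage B Q D A μ.toJordanDecomposition.posPart) -
      positiveImage ι (balayage B Q D A μ.toJordanDecomposition.negPart)) =ᵐ[P]
      fieldOn B Q D A Γ μ := by
  obtain ⟨h1, h2⟩ := jordan_mem_energyMeasures hμ
  obtain ⟨h3, h4⟩ := h.restrict_signed_mem hμ
  have e : positiveImage ι (balayage B Q D A μ.toJordanDecomposition.posPart) -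
      positiveImage ι (balayage B Q D A μ.toJordanDecomposition.negPart) =
      ι (μ.restrict A) + ι (sweptSignedMeasure B Q D (D \ A) μ) := by
    have e1 : μ.restrict A = (μ.toJordanDecomposition.posPart.restrict A).toSignedMeasure -
        (μ.toJordanDecomposition.negPart.restrict A).toSignedMeasure := by
      conv_lhs => rw [← toSignedMeasure_posPart_sub_negPart μ]
      exact restrict_toSignedMeasure_sub _ _ h.isCompact.measurableSet
    rw [e1, sweptSignedMeasure, hι.isometry.map_sub h.kernel (restrict_mem_energyMeasures h1 A)
      (restrict_mem_energyMeasures h2 A), hι.isometry.map_sub h.kernel (h.swept_mem h1)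
      (h.swept_mem h2), balayage, balayage, hι.isometry.positiveImage_add h.kernel
      (restrict_mem_energyMeasures h1 A) (h.swept_mem h1), hι.isometry.positiveImage_add h.kernel
      (restrict_mem_energyMeasures h2 A) (h.swept_mem h2)]
    abel
  rw [e]
  filter_upwards [Lp.coeFn_add (ι (μ.restrict A)) (ι (sweptSignedMeasure B Q D (D \ A) μ)),
    hι.ae_eq _ h3, hι.ae_eq _ h4] with ω e1 e2 e3
  rw [e1, Pi.add_apply, e2, e3, fieldOn]

theorem IsFieldImage.fieldOff_ae_eq (hι : IsFieldImage B Q D Γ P ι S) (h : IsRegularPair B Q D A)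
    {μ : SignedMeasure (Space d)} (hμ : μ ∈ signedEnergyMeasures B Q D) :
    ⇑(innovation B Q D A ι μ.toJordanDecomposition.posPart -
      innovation B Q D A ι μ.toJordanDecomposition.negPart) =ᵐ[P] fieldOff B Q D A Γ μ := by
  have e : innovation B Q D A ι μ.toJordanDecomposition.posPart -
      innovation B Q D A ι μ.toJordanDecomposition.negPart = ι μ -
      (positiveImage ι (balayage B Q D A μ.toJordanDecomposition.posPart) -
        positiveImage ι (balayage B Q D A μ.toJordanDecomposition.negPart)) := by
    rw [hι.isometry.eq_jordan h.kernel hμ]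
    simp only [innovation]
    abel
  rw [e]
  filter_upwards [Lp.coeFn_sub (ι μ)
      (positiveImage ι (balayage B Q D A μ.toJordanDecomposition.posPart) -
        positiveImage ι (balayage B Q D A μ.toJordanDecomposition.negPart)),
    hι.ae_eq _ hμ, hι.fieldOn_ae_eq h hμ] with ω e1 e2 e3
  rw [e1, Pi.sub_apply, e2, e3, fieldOff]

/-- The two families lie in one Gaussian space, so they form a joint Gaussian process, and the
orthogonality of balayage and innovation makes them independent. -/
theorem IsFieldImage.isGaussianProcess_and_indepFun (hι : IsFieldImage B Q D Γ P ι S)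
    (h : IsRegularPair B Q D A) :
    IsGaussianProcess (fun μ : signedEnergyMeasures B Q D => fieldOn B Q D A Γ μ) P ∧
    IsGaussianProcess (fun μ : signedEnergyMeasures B Q D => fieldOff B Q D A Γ μ) P ∧
    IndepFun (fun ω (μ : signedEnergyMeasures B Q D) => fieldOn B Q D A Γ μ ω)
      (fun ω (μ : signedEnergyMeasures B Q D) => fieldOff B Q D A Γ μ ω) P := by
  let X : signedEnergyMeasures B Q D → Lp ℝ 2 P := fun μ =>
    positiveImage ι (balayage B Q D A μ.1.toJordanDecomposition.posPart) -
      positiveImage ι (balayage B Q D A μ.1.toJordanDecomposition.negPart)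
  let Y : signedEnergyMeasures B Q D → Lp ℝ 2 P := fun μ =>
    innovation B Q D A ι μ.1.toJordanDecomposition.posPart -
      innovation B Q D A ι μ.1.toJordanDecomposition.negPart
  have hXS : ∀ μ, X μ ∈ S := fun μ => by
    obtain ⟨h1, h2⟩ := jordan_mem_energyMeasures μ.2
    exact S.sub_mem (hι.positiveImage_mem (h.balayage_mem h1))
      (hι.positiveImage_mem (h.balayage_mem h2))
  have hYS : ∀ μ, Y μ ∈ S := fun μ => by
    obtain ⟨h1, h2⟩ := jordan_mem_energyMeasures μ.2
    exact S.sub_mem (hι.innovation_mem h h1) (hι.innovation_mem h h2)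
  have hX : ∀ μ, X μ =ᵐ[P] fieldOn B Q D A Γ μ := fun μ => hι.fieldOn_ae_eq h μ.2
  have hY : ∀ μ, Y μ =ᵐ[P] fieldOff B Q D A Γ μ := fun μ => hι.fieldOff_ae_eq h μ.2
  have hZ : IsGaussianProcess (Sum.elim
      (fun μ : signedEnergyMeasures B Q D => fieldOn B Q D A Γ μ)
      (fun μ : signedEnergyMeasures B Q D => fieldOff B Q D A Γ μ)) P :=
    (hι.gaussian.isGaussianProcess (Y := Sum.elim X Y)
      (Sum.rec hXS hYS)).congr (Sum.rec hX hY)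
  refine ⟨hZ.comp_right Sum.inl, hZ.comp_right Sum.inr,
    hZ.indepFun_of_covariance_eq_zero (fun μ => hZ.aemeasurable (Sum.inl μ))
      (fun μ => hZ.aemeasurable (Sum.inr μ)) fun μ ν => ?_⟩
  rw [covariance_eq_sub (((Lp.memLp (X μ)).ae_eq (hX μ))) ((Lp.memLp (Y ν)).ae_eq (hY ν)),
    ← integral_congr_ae (hX μ), hι.gaussian.integral_eq_zero (hXS μ), zero_mul, sub_zero,
    ← integral_congr_ae ((hX μ).mul (hY ν))]
  have e1 : inner ℝ (X μ) (Y ν) = 0 := by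
    obtain ⟨h1, h2⟩ := jordan_mem_energyMeasures μ.2
    obtain ⟨h3, h4⟩ := jordan_mem_energyMeasures ν.2
    simp only [X, Y, inner_sub_left, inner_sub_right, h.inner_balayage_innovation hι.isometry h1 h3,
      h.inner_balayage_innovation hι.isometry h1 h4, h.inner_balayage_innovation hι.isometry h2 h3,
      h.inner_balayage_innovation hι.isometry h2 h4, sub_zero]
  rw [inner_L2_eq] at e1
  exact e1

/-- The extension of `innovation` to all measures of finite energy in `D \ A`. -/
noncomputable def innovationLimit (B : ℝ≥0 → Ω' → Space d) (Q : Measure Ω') (D A : Set (Space d))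
    (ι : SignedMeasure (Space d) → Lp ℝ 2 P) (p : Measure (Space d)) : Lp ℝ 2 P :=
  Filter.limUnder Filter.atTop fun n => innovation B Q D A ι (p.restrict (exhaustion (D \ A) n))

theorem IsRegularPair.restrict_exhaustion_mem (h : IsRegularPair B Q D A) {p : Measure (Space d)}
    (hp : p ∈ energyMeasures B Q (D \ A)) {s : Set (Space d)} (n : ℕ)
    (hs : s ⊆ exhaustion (D \ A) n) : p.restrict s ∈ energyMeasures B Q D := by
  refine h.mem_of_compactlyCarried (restrict_mem_energyMeasures hp s)
    (isCompact_exhaustion (D \ A) n) (exhaustion_subset (D \ A) n) ?_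
  rw [Measure.restrict_apply (isClosed_exhaustion (D \ A) n).measurableSet.compl]
  have h1 : (exhaustion (D \ A) n)ᶜ ∩ s = ∅ := eq_empty_of_forall_notMem fun x hx => hx.1 (hs hx.2)
  rw [h1, measure_empty]

/-- A measure of finite energy in `D \ A` may have infinite energy in `D`, but its restrictions to
compact subsets do not. Increments between them have squared norm at most the `D \ A`-energy of `p`
off the smaller compact set, which tends to `0`. -/
theorem IsFieldImage.tendsto_innovationLimit (hι : IsFieldImage B Q D Γ P ι S)
    (h : IsRegularPair B Q D A) {p : Measure (Space d)} (hp : p ∈ energyMeasures B Q (D \ A)) :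
    Filter.Tendsto (fun n => innovation B Q D A ι (p.restrict (exhaustion (D \ A) n)))
      Filter.atTop (nhds (innovationLimit B Q D A ι p)) := by
  have := hp.1
  refine CauchySeq.tendsto_limUnder ?_
  set K := exhaustion (D \ A) with hK
  have hKm : ∀ n, MeasurableSet (K n) := fun n => (isClosed_exhaustion (D \ A) n).measurableSet
  have h0 := tendsto_greenEnergy_restrict_compl_exhaustion h.isOpen_diff hp.2.2.ne
  refine cauchySeq_of_le_tendsto_0' (fun n => Real.sqrt (greenEnergy B Q (D \ A)
    (p.restrict (K n)ᶜ) (p.restrict (K n)ᶜ)).toReal) (fun n m hnm => ?_) ?_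
  · have e1 : p.restrict (K m) = p.restrict (K n) + p.restrict (K m \ K n) := by
      rw [← Measure.restrict_union disjoint_sdiff_right ((hKm m).diff (hKm n)),
        union_sdiff_cancel (monotone_exhaustion _ hnm)]
    have h1 : p.restrict (K n) ∈ energyMeasures B Q D := h.restrict_exhaustion_mem hp n subset_rfl
    have h2 : p.restrict (K m \ K n) ∈ energyMeasures B Q D :=
      h.restrict_exhaustion_mem hp m sdiff_subset
    rw [e1, h.innovation_add hι.isometry h1 h2, dist_self_add_right,
      norm_eq_sqrt_real_inner, h.inner_innovation hι.isometry h2 h2]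
    refine Real.sqrt_le_sqrt (ENNReal.toReal_mono ?_ (greenEnergy_mono ?_ ?_))
    · exact (restrict_mem_energyMeasures hp _).2.2.ne
    all_goals exact Measure.restrict_mono (fun x hx => hx.2) le_rfl
  · have h1 := (Real.continuous_sqrt.tendsto _).comp
      ((ENNReal.tendsto_toReal ENNReal.zero_ne_top).comp h0)
    rw [ENNReal.toReal_zero, Real.sqrt_zero] at h1
    exact h1

theorem IsFieldImage.innovationLimit_mem (hι : IsFieldImage B Q D Γ P ι S)
    (h : IsRegularPair B Q D A) {p : Measure (Space d)} (hp : p ∈ energyMeasures B Q (D \ A)) :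
    innovationLimit B Q D A ι p ∈ S :=
  hι.isClosed.mem_of_tendsto (hι.tendsto_innovationLimit h hp) (Filter.Eventually.of_forall
    fun n => hι.innovation_mem h (h.restrict_exhaustion_mem hp n subset_rfl))

theorem tendsto_greenEnergy_restrict_exhaustion {U : Set (Space d)} (hU : IsOpen U)
    (hG : IsEnergyKernel (green B Q U)) (p q : Measure (Space d)) [IsFiniteMeasure p]
    [IsFiniteMeasure q] :
    Filter.Tendsto (fun n => greenEnergy B Q U (p.restrict (exhaustion U n))
      (q.restrict (exhaustion U n))) Filter.atTop (nhds (greenEnergy B Q U p q)) := by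
  have hprod : ∀ s t : Set (Space d), greenEnergy B Q U (p.restrict s) (q.restrict t) =
      ∫⁻ r in s ×ˢ t, green B Q U r.1 r.2 ∂(p.prod q) := fun s t => by
    rw [← Measure.prod_restrict, lintegral_prod _ hG.measurable.aemeasurable]
    rfl
  have h1 : greenEnergy B Q U p q =
      ⨆ n, ∫⁻ r in exhaustion U n ×ˢ exhaustion U n, green B Q U r.1 r.2 ∂(p.prod q) := by
    have hmono : Monotone fun n => exhaustion U n ×ˢ exhaustion U n := fun m n hmn =>
      prod_mono (monotone_exhaustion U hmn) (monotone_exhaustion U hmn)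
    rw [← setLIntegral_iUnion_of_directed _ hmono.directed_le,
      iUnion_prod_of_monotone (monotone_exhaustion U) (monotone_exhaustion U),
      iUnion_exhaustion hU, ← hprod, greenEnergy_restrict_left, hG.greenEnergy_comm p,
      hG.greenEnergy_comm p, greenEnergy_restrict_left]
  rw [h1]
  simp_rw [hprod]
  refine tendsto_atTop_iSup fun m n hmn => lintegral_mono' (Measure.restrict_mono ?_ le_rfl) le_rfl
  exact prod_mono (monotone_exhaustion U hmn) (monotone_exhaustion U hmn)

theorem IsFieldImage.inner_innovationLimit (hι : IsFieldImage B Q D Γ P ι S)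
    (h : IsRegularPair B Q D A) {p q : Measure (Space d)} (hp : p ∈ energyMeasures B Q (D \ A))
    (hq : q ∈ energyMeasures B Q (D \ A)) :
    inner ℝ (innovationLimit B Q D A ι p) (innovationLimit B Q D A ι q) =
      (greenEnergy B Q (D \ A) p q).toReal := by
  have := hp.1
  have := hq.1
  refine tendsto_nhds_unique ((hι.tendsto_innovationLimit h hp).inner
    (hι.tendsto_innovationLimit h hq)) ?_
  have h1 := (ENNReal.tendsto_toReal (h.kernel_diff.greenEnergy_ne_top hp hq)).comp
    (tendsto_greenEnergy_restrict_exhaustion h.isOpen_diff h.kernel_diff p q)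
  refine h1.congr fun n => ?_
  exact (h.inner_innovation hι.isometry (h.restrict_exhaustion_mem hp n subset_rfl)
    (h.restrict_exhaustion_mem hq n subset_rfl)).symm

/-- For a measure of finite energy in `D`, the innovation misses the limiting sequence by the
innovation of the part off the exhausting set. Its squared norm is a `D \ A`-energy, which ignores
the mass on `A` and tends to `0`. -/
theorem IsFieldImage.innovationLimit_restrict (hι : IsFieldImage B Q D Γ P ι S)
    (h : IsRegularPair B Q D A) {p : Measure (Space d)} (hp : p ∈ energyMeasures B Q D) :
    innovationLimit B Q D A ι (p.restrict (D \ A)) = innovation B Q D A ι p := by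
  have := hp.1
  set K := exhaustion (D \ A) with hK
  have hKm : ∀ n, MeasurableSet (K n) := fun n => (isClosed_exhaustion (D \ A) n).measurableSet
  refine tendsto_nhds_unique (hι.tendsto_innovationLimit h (h.restrict_diff_mem hp)) ?_
  have hfin : greenEnergy B Q (D \ A) p p ≠ ∞ := by
    have h1 := (h.greenEnergy_eq_add p p).symm.trans_lt hp.2.2
    exact (ENNReal.add_lt_top.1 h1).2.ne
  have h0 := tendsto_greenEnergy_restrict_compl_exhaustion h.isOpen_diff hfin
  refine tendsto_iff_norm_sub_tendsto_zero.2 ?_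
  have h1 := (Real.continuous_sqrt.tendsto _).comp
    ((ENNReal.tendsto_toReal ENNReal.zero_ne_top).comp h0)
  rw [ENNReal.toReal_zero, Real.sqrt_zero] at h1
  refine h1.congr fun n => ?_
  have m1 := restrict_mem_energyMeasures hp (K n)
  have m2 := restrict_mem_energyMeasures hp (K n)ᶜ
  have e1 : innovation B Q D A ι p = innovation B Q D A ι (p.restrict (K n)) +
      innovation B Q D A ι (p.restrict (K n)ᶜ) := by
    rw [← h.innovation_add hι.isometry m1 m2, Measure.restrict_add_restrict_compl (hKm n)]
  have e2 : (p.restrict (D \ A)).restrict (K n) = p.restrict (K n) := by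
    rw [Measure.restrict_restrict (hKm n), inter_eq_left.2 (exhaustion_subset (D \ A) n)]
  rw [e2, e1, norm_sub_rev, add_sub_cancel_left, norm_eq_sqrt_real_inner,
    h.inner_innovation hι.isometry m2 m2]
  rfl

theorem IsFieldImage.exists_isGFF_diff (hι : IsFieldImage B Q D Γ P ι S)
    (h : IsRegularPair B Q D A) :
    ∃ ΓO : SignedMeasure (Space d) → Ω → ℝ, IsGFF B Q (D \ A) ΓO P ∧
      ∀ μ ∈ signedEnergyMeasures B Q D,
        μ.restrict (D \ A) ∈ signedEnergyMeasures B Q (D \ A) ∧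
        fieldOff B Q D A Γ μ =ᵐ[P] ΓO (μ.restrict (D \ A)) := by
  let Z : SignedMeasure (Space d) → Lp ℝ 2 P := fun σ =>
    innovationLimit B Q D A ι σ.toJordanDecomposition.posPart -
      innovationLimit B Q D A ι σ.toJordanDecomposition.negPart
  have hZS : ∀ σ ∈ signedEnergyMeasures B Q (D \ A), Z σ ∈ S := fun σ hσ => by
    obtain ⟨h1, h2⟩ := jordan_mem_energyMeasures hσ
    exact S.sub_mem (hι.innovationLimit_mem h h1) (hι.innovationLimit_mem h h2)
  refine ⟨fun σ => Z σ, ⟨hι.gaussian.isGaussianProcess fun σ => hZS σ σ.2,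
    fun σ hσ => hι.gaussian.integral_eq_zero (hZS σ hσ), fun σ hσ τ hτ => ?_⟩,
    fun μ hμ => ⟨h.restrict_diff_signed_mem hμ, ?_⟩⟩
  · obtain ⟨h1, h2⟩ := jordan_mem_energyMeasures hσ
    obtain ⟨h3, h4⟩ := jordan_mem_energyMeasures hτ
    rw [← inner_L2_eq]
    simp only [Z, inner_sub_left, inner_sub_right, hι.inner_innovationLimit h h1 h3,
      hι.inner_innovationLimit h h1 h4, hι.inner_innovationLimit h h2 h3,
      hι.inner_innovationLimit h h2 h4, greenCovariance]
    ring
  · obtain ⟨h1, h2⟩ := jordan_mem_energyMeasures hμ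
    obtain ⟨e1, e2⟩ := toJordanDecomposition_restrict μ h.isOpen_diff.measurableSet
    have e : Z (μ.restrict (D \ A)) = innovation B Q D A ι μ.toJordanDecomposition.posPart -
        innovation B Q D A ι μ.toJordanDecomposition.negPart := by
      simp only [Z]
      rw [e1, e2, hι.innovationLimit_restrict h h1, hι.innovationLimit_restrict h h2]
    change _ =ᵐ[P] Z (μ.restrict (D \ A))
    rw [e]
    exact (hι.fieldOff_ae_eq h hμ).symm

end Fields

/-! ### Harmonic versions of L²-valued fields -/

section HarmonicVersion

variable {d : ℕ}

/-- As a function of the centre, the mean is a convolution with a rescaled smooth bump; the sign in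
`k` matches the argument `z - y` of the convolution. -/
theorem contDiff_bumpMean {g : Space d → ℝ} (hg : Integrable g) {ρ : ℝ} (hρ : 0 < ρ) :
    ContDiff ℝ 2 fun z => bumpMean g z ρ := by
  let k : Space d → ℝ := fun x => radialBump ((-ρ⁻¹) • x)
  have hk : ContDiff ℝ 2 k := (contDiff_radialBump (n := 2)).comp (contDiff_const_smul _)
  have hkc : HasCompactSupport k :=
    hasCompactSupport_radialBump.comp_smul (neg_ne_zero.2 (inv_ne_zero hρ.ne'))
  have h1 := hkc.contDiff_convolution_right (n := 2) (ContinuousLinearMap.lsmul ℝ ℝ)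
    hg.locallyIntegrable hk
  have h2 : (fun z => bumpMean g z ρ) = fun z =>
      |(ρ ^ Module.finrank ℝ (Space d))⁻¹| •
        convolution g k (ContinuousLinearMap.lsmul ℝ ℝ) volume z := by
    ext z
    have e1 := Measure.integral_comp_smul volume
      (fun u : Space d => g (z + u) * k (z - (z + u))) ρ
    rw [integral_add_left_eq_self (fun y => g y * k (z - y)) z] at e1
    refine Eq.trans (integral_congr_ae (Filter.Eventually.of_forall fun v => ?_)) e1
    simp only [k]
    rw [sub_add_cancel_left, smul_neg, neg_smul, neg_neg, smul_smul, inv_mul_cancel₀ hρ.ne',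
      one_smul]
  rw [h2]
  exact h1.const_smul _

/-- The points with room for all the averages of index at least `n`. -/
def exhaustionCore (U : Set (Space d)) (n : ℕ) : Set (Space d) :=
  interior {z | ∀ k ≥ n, Metric.closedBall z (1 / ((k : ℝ) + 1)) ⊆ exhaustion U k}

theorem exists_subset_exhaustionCore {U C : Set (Space d)} (hU : IsOpen U) (hC : IsCompact C)
    (hCU : C ⊆ U) : ∃ n, C ⊆ exhaustionCore U n := by
  obtain ⟨δ, hδ, hsub⟩ := hC.exists_cthickening_subset_open hU hCU
  obtain ⟨N, hN⟩ := exists_subset_exhaustion hU hC.cthickening hsub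
  obtain ⟨l, hl⟩ := exists_nat_one_div_lt (half_pos hδ)
  refine ⟨max N l, (Metric.self_subset_thickening (half_pos hδ) C).trans
    (interior_maximal (fun z hz k hk y hy => ?_) Metric.isOpen_thickening)⟩
  obtain ⟨x, hx, hzx⟩ := Metric.mem_thickening_iff.1 hz
  refine monotone_exhaustion U ((le_max_left _ _).trans hk) (hN
    (Metric.thickening_subset_cthickening δ C (Metric.mem_thickening_iff.2 ⟨x, hx, ?_⟩)))
  have h1 : 1 / ((k : ℝ) + 1) ≤ 1 / ((l : ℝ) + 1) := by
    have : (l : ℝ) ≤ k := by exact_mod_cast (le_max_right _ _).trans hk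
    exact one_div_le_one_div_of_le (by positivity) (by linarith)
  have h2 := Metric.mem_closedBall.1 hy
  linarith [dist_triangle y z x]

theorem closedBall_subset_of_mem_exhaustionCore {U : Set (Space d)} {n k : ℕ} {z : Space d}
    (hz : z ∈ exhaustionCore U n) (hk : n ≤ k) :
    Metric.closedBall z (1 / ((k : ℝ) + 1)) ⊆ exhaustion U k :=
  interior_subset hz k hk

theorem exhaustionCore_subset (U : Set (Space d)) (n : ℕ) : exhaustionCore U n ⊆ U := fun z hz =>
  exhaustion_subset U n (closedBall_subset_of_mem_exhaustionCore hz le_rfl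
    (Metric.mem_closedBall_self (by positivity)))

variable {Ω : Type*} [MeasurableSpace Ω] {P : Measure Ω} [IsProbabilityMeasure P]
  {U : Set (Space d)} {m : Space d → Lp ℝ 2 P} {M : Space d × Ω → ℝ}

/-- Smooth averages of the paths of a random field. -/
noncomputable def smoothedField (U : Set (Space d)) (M : Space d × Ω → ℝ) (n : ℕ) (ω : Ω)
    (z : Space d) : ℝ :=
  (∫ v : Space d, radialBump v)⁻¹ *
    bumpMean ((exhaustion U n).indicator fun y => M (y, ω)) z (1 / ((n : ℝ) + 1))

theorem measurable_smoothedField (hM : Measurable M) (n : ℕ) :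
    Measurable fun q : Space d × Ω => smoothedField U M n q.2 q.1 := by
  have hN : Measurable ((Prod.fst ⁻¹' exhaustion U n).indicator M) :=
    hM.indicator (measurable_fst (isClosed_exhaustion U n).measurableSet)
  have h1 : Measurable fun r : (Space d × Ω) × Space d =>
      (r.1.1 + (1 / ((n : ℝ) + 1)) • r.2, r.1.2) := by fun_prop
  have h2 : Measurable fun r : (Space d × Ω) × Space d =>
      (Prod.fst ⁻¹' exhaustion U n).indicator M (r.1.1 + (1 / ((n : ℝ) + 1)) • r.2, r.1.2) *
        radialBump r.2 :=
    (hN.comp h1).mul (continuous_radialBump.measurable.comp measurable_snd)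
  exact (h2.stronglyMeasurable.integral_prod_right' (ν := volume)).measurable.const_mul _

theorem integrable_radialBump_smul_comp (hm : ContinuousOn m U) {z : Space d} {ρ : ℝ} (hρ : 0 < ρ)
    (hball : Metric.closedBall z ρ ⊆ U) : Integrable fun v => radialBump v • m (z + ρ • v) := by
  have h1 : ContinuousOn (fun v : Space d => radialBump v • m (z + ρ • v))
      (Metric.closedBall 0 1) := by
    refine continuous_radialBump.continuousOn.smul (hm.comp (by fun_prop) fun v hv => hball ?_)
    rw [mem_closedBall_zero_iff] at hv
    rw [Metric.mem_closedBall, dist_eq_norm, add_sub_cancel_left, norm_smul, Real.norm_eq_abs,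
      abs_of_pos hρ]
    nlinarith
  refine (integrableOn_iff_integrable_of_support_subset fun v hv => ?_).1
    (h1.integrableOn_compact (isCompact_closedBall 0 1))
  by_contra h
  rw [mem_closedBall_zero_iff, not_le] at h
  exact hv (by simp only [radialBump_eq_zero h.le, zero_smul])

/-- Pathwise averages represent L²-valued averages, and the mean value property of `m` says that
averaging changes nothing. -/
theorem smoothedField_ae_eq (hm : ContinuousOn m U)
    (hmean : ∀ z ρ, 0 < ρ → Metric.closedBall z ρ ⊆ U →
      ∫ v, radialBump v • m (z + ρ • v) = (∫ v : Space d, radialBump v) • m z)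
    (hM : Measurable M) (hMm : ∀ z ∈ U, (fun ω => M (z, ω)) =ᵐ[P] m z) {n : ℕ} {z : Space d}
    (hz : Metric.closedBall z (1 / ((n : ℝ) + 1)) ⊆ exhaustion U n) :
    (fun ω => smoothedField U M n ω z) =ᵐ[P] m z := by
  set ρ : ℝ := 1 / ((n : ℝ) + 1) with hρdef
  have hρ : 0 < ρ := by positivity
  have hball := hz.trans (exhaustion_subset U n)
  have h1 : Measurable fun r : Space d × Ω => M (z + ρ • r.1, r.2) * radialBump r.1 :=
    (hM.comp (by fun_prop)).mul (continuous_radialBump.measurable.comp measurable_fst)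
  have h2 := (ae_integrable_and_integral_eq_of_modification (lam := volume)
    (integrable_radialBump_smul_comp hm hρ hball) h1
    (Filter.Eventually.of_forall fun v => ?_)).2
  · rw [hmean z ρ hρ hball] at h2
    filter_upwards [h2, Lp.coeFn_smul (∫ v : Space d, radialBump v) (m z)] with ω hω hω'
    have e1 : bumpMean ((exhaustion U n).indicator fun y => M (y, ω)) z ρ =
        bumpMean (fun y => M (y, ω)) z ρ :=
      bumpMean_congr hρ.le fun x hx => indicator_of_mem (hz hx) _
    rw [smoothedField, e1, bumpMean, hω, hω', Pi.smul_apply, smul_eq_mul,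
      inv_mul_cancel_left₀ integral_radialBump_pos.ne']
  · by_cases hv : ‖v‖ ≤ 1
    · have hvU : z + ρ • v ∈ U := hball (by
        rw [Metric.mem_closedBall, dist_eq_norm, add_sub_cancel_left, norm_smul, Real.norm_eq_abs,
          abs_of_pos hρ]
        nlinarith)
      filter_upwards [hMm _ hvU, Lp.coeFn_smul (radialBump v) (m (z + ρ • v))] with ω e1 e2
      rw [e1, e2, Pi.smul_apply, smul_eq_mul, mul_comm]
    · simp only [radialBump_eq_zero (not_le.1 hv).le, mul_zero, zero_smul]
      exact (Lp.coeFn_zero ℝ 2 P).symm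

/-- The paths for which the smooth averages are consistent. -/
structure IsGoodPath (U : Set (Space d)) (M : Space d × Ω → ℝ) (ω : Ω) : Prop where
  integrable : ∀ n, Integrable ((exhaustion U n).indicator fun y => M (y, ω))
  eq : ∀ n, ∀ k ≥ n, ∀ z ∈ exhaustionCore U n, smoothedField U M k ω z = smoothedField U M n ω z
  ae_eq : ∀ n, ∀ᵐ z ∂(volume.restrict (exhaustionCore U n)), M (z, ω) = smoothedField U M n ω z

theorem IsGoodPath.contDiff {ω : Ω} (h : IsGoodPath U M ω) (n : ℕ) :
    ContDiff ℝ 2 (smoothedField U M n ω) :=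
  contDiff_const.mul (contDiff_bumpMean (h.integrable n) (by positivity))

/-- At each fixed point the averages of different index agree almost surely. A countable dense set
of points and the continuity of the averages make the exceptional event independent of the point.
The raw field `M` has no continuity, so Fubini's theorem compares it with the averages at almost
every point only. -/
theorem ae_isGoodPath (hm : ContinuousOn m U)
    (hmean : ∀ z ρ, 0 < ρ → Metric.closedBall z ρ ⊆ U →
      ∫ v, radialBump v • m (z + ρ • v) = (∫ v : Space d, radialBump v) • m z)
    (hM : Measurable M) (hMm : ∀ z ∈ U, (fun ω => M (z, ω)) =ᵐ[P] m z) :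
    ∀ᵐ ω ∂P, IsGoodPath U M ω := by
  have hKm : ∀ n, MeasurableSet (exhaustion U n) := fun n =>
    (isClosed_exhaustion U n).measurableSet
  have h1 : ∀ᵐ ω ∂P, ∀ n, Integrable ((exhaustion U n).indicator fun y => M (y, ω)) :=
    ae_all_iff.2 fun n => by
      have h2 := (ae_integrable_and_integral_eq_of_modification
        (lam := volume.restrict (exhaustion U n))
        ((hm.mono (exhaustion_subset U n)).integrableOn_compact (isCompact_exhaustion U n)) hM
        ((ae_restrict_iff' (hKm n)).2 (Filter.Eventually.of_forall fun z hz =>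
          hMm z (exhaustion_subset U n hz)))).1
      filter_upwards [h2] with ω hω
      exact (integrable_indicator_iff (hKm n)).2 hω
  have hs : ∀ n k, n ≤ k → ∀ z ∈ exhaustionCore U n,
      (fun ω => smoothedField U M k ω z) =ᵐ[P] m z := fun n k hnk z hz =>
    smoothedField_ae_eq hm hmean hM hMm (closedBall_subset_of_mem_exhaustionCore hz hnk)
  obtain ⟨T, hTc, hTd⟩ := TopologicalSpace.exists_countable_dense (Space d)
  have h2 : ∀ᵐ ω ∂P, ∀ n k, n ≤ k → ∀ z ∈ exhaustionCore U n ∩ T,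
      smoothedField U M k ω z = smoothedField U M n ω z := by
    refine ae_all_iff.2 fun n => ae_all_iff.2 fun k => ae_all_iff.2 fun hnk =>
      (ae_ball_iff (hTc.mono inter_subset_right)).2 fun z hz => ?_
    filter_upwards [hs n k hnk z hz.1, hs n n le_rfl z hz.1] with ω e1 e2
    rw [e1, e2]
  have h3 : ∀ᵐ ω ∂P, ∀ n, ∀ᵐ z ∂(volume.restrict (exhaustionCore U n)),
      M (z, ω) = smoothedField U M n ω z := by
    refine ae_all_iff.2 fun n => ?_
    have hset : MeasurableSet {q : Space d × Ω | M (q.1, q.2) = smoothedField U M n q.2 q.1} :=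
      measurableSet_eq_fun hM (measurable_smoothedField hM n)
    refine (Measure.ae_ae_comm (p := fun z ω => M (z, ω) = smoothedField U M n ω z) hset).1 ?_
    refine (ae_restrict_iff' isOpen_interior.measurableSet).2
      (Filter.Eventually.of_forall fun z hz => ?_)
    filter_upwards [hs n n le_rfl z hz, hMm z (exhaustionCore_subset U n hz)] with ω e1 e2
    rw [e1, e2]
  filter_upwards [h1, h2, h3] with ω i1 i2 i3
  have hc : ∀ n, Continuous (smoothedField U M n ω) := fun n =>
    (contDiff_const.mul (contDiff_bumpMean (i1 n) (by positivity))).continuous (n := 2)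
  refine ⟨i1, fun n k hnk z hz => ?_, i3⟩
  have h4 : EqOn (smoothedField U M k ω) (smoothedField U M n ω)
      (closure (exhaustionCore U n ∩ T)) :=
    EqOn.closure (fun z hz => i2 n k hnk z hz) (hc k) (hc n)
  exact h4 (hTd.open_subset_closure_inter isOpen_interior hz)

/-- The limit of the smooth averages of the paths. -/
noncomputable def limitField (U : Set (Space d)) (M : Space d × Ω → ℝ) (ω : Ω) (z : Space d) : ℝ :=
  Filter.limUnder Filter.atTop fun n => smoothedField U M n ω z

theorem IsGoodPath.limitField_eq {ω : Ω} (h : IsGoodPath U M ω) {n : ℕ} {z : Space d}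
    (hz : z ∈ exhaustionCore U n) : limitField U M ω z = smoothedField U M n ω z := by
  refine Filter.Tendsto.limUnder_eq (tendsto_const_nhds.congr' ?_)
  filter_upwards [Filter.eventually_ge_atTop n] with k hk
  exact (h.eq n k hk z hz).symm

/-- Near each point the limit is one of the smooth averages, hence C². It agrees with `M` almost
everywhere, so its own bump means at small radii are again these averages, and the converse of the
mean value property applies. -/
theorem IsGoodPath.harmonicOnNhd {ω : Ω} (hU : IsOpen U) (h : IsGoodPath U M ω) :
    InnerProductSpace.HarmonicOnNhd (limitField U M ω) U := by
  have hcore : ∀ z ∈ U, ∃ n, z ∈ exhaustionCore U n := fun z hz =>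
    (exists_subset_exhaustionCore hU isCompact_singleton (singleton_subset_iff.2 hz)).imp
      fun n hn => singleton_subset_iff.1 hn
  have hae : ∀ᵐ y : Space d, y ∈ U → M (y, ω) = limitField U M ω y := by
    have h1 : ∀ᵐ y : Space d, ∀ n, y ∈ exhaustionCore U n →
        M (y, ω) = smoothedField U M n ω y :=
      ae_all_iff.2 fun n => (ae_restrict_iff' isOpen_interior.measurableSet).1 (h.ae_eq n)
    filter_upwards [h1] with y hy hyU
    obtain ⟨n, hn⟩ := hcore y hyU
    rw [hy n hn, h.limitField_eq hn]
  refine harmonicOnNhd_of_bumpMean hU (fun z hz => ?_) (ρ := fun n => 1 / ((n : ℝ) + 1))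
    (fun n => by positivity) tendsto_one_div_add_atTop_nhds_zero_nat fun z hz => ?_
  · obtain ⟨n, hn⟩ := hcore z hz
    refine (h.contDiff n).contDiffAt.congr_of_eventuallyEq ?_
    filter_upwards [isOpen_interior.mem_nhds hn] with y hy
    exact h.limitField_eq hy
  · obtain ⟨n, hn⟩ := hcore z hz
    filter_upwards [Filter.eventually_ge_atTop n] with k hk
    have hρ : (0 : ℝ) < 1 / ((k : ℝ) + 1) := by positivity
    have hball := closedBall_subset_of_mem_exhaustionCore hn hk
    rw [h.limitField_eq hn, ← h.eq n k hk z hn, smoothedField, mul_comm,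
      mul_inv_cancel_left₀ integral_radialBump_pos.ne',
      bumpMean_congr hρ.le fun x hx => indicator_of_mem (hball hx) _]
    have hq : Measure.QuasiMeasurePreserving
        (fun v : Space d => z + (1 / ((k : ℝ) + 1)) • v) volume volume :=
      (measurePreserving_add_left volume z).quasiMeasurePreserving.comp
        (Measure.quasiMeasurePreserving_smul volume hρ.ne')
    refine integral_congr_ae ?_
    filter_upwards [hq.ae hae] with v hv
    by_cases hv1 : ‖v‖ ≤ 1
    · rw [hv (exhaustion_subset U k (hball (by
        rw [Metric.mem_closedBall, dist_eq_norm, add_sub_cancel_left, norm_smul, Real.norm_eq_abs,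
          abs_of_pos hρ]
        nlinarith)))]
    · simp only [radialBump_eq_zero (not_le.1 hv1).le, mul_zero]

/-- A continuous family of square-integrable variables with the mean value property has a version
with harmonic paths, and integrals may be computed pathwise. -/
theorem exists_harmonic_version (hU : IsOpen U) (hm : ContinuousOn m U)
    (hmean : ∀ z ρ, 0 < ρ → Metric.closedBall z ρ ⊆ U →
      ∫ v, radialBump v • m (z + ρ • v) = (∫ v : Space d, radialBump v) • m z) :
    ∃ h : Ω → Space d → ℝ, (∀ z ∈ U, (fun ω => h ω z) =ᵐ[P] m z) ∧
      (∀ᵐ ω ∂P, InnerProductSpace.HarmonicOnNhd (h ω) U) ∧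
      ∀ (p : Measure (Space d)) [IsFiniteMeasure p] (K : Set (Space d)), IsCompact K → K ⊆ U →
        p Kᶜ = 0 → Integrable m p ∧
          (fun ω => ∫ z, h ω z ∂p) =ᵐ[P] (∫ z, m z ∂p : Lp ℝ 2 P) := by
  obtain ⟨M, hM, hMm'⟩ := exists_measurable_modification
    (hm.stronglyMeasurable_indicator hU.measurableSet)
  have hMm : ∀ z ∈ U, (fun ω => M (z, ω)) =ᵐ[P] m z := fun z hz => by
    have h1 := hMm' z
    rwa [indicator_of_mem hz] at h1
  have hgood := ae_isGoodPath hm hmean hM hMm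
  have hs : ∀ n, ∀ z ∈ exhaustionCore U n, (fun ω => smoothedField U M n ω z) =ᵐ[P] m z :=
    fun n z hz => smoothedField_ae_eq hm hmean hM hMm
      (closedBall_subset_of_mem_exhaustionCore hz le_rfl)
  refine ⟨limitField U M, fun z hz => ?_, ?_, fun p _ K hK hKU hpK => ?_⟩
  · obtain ⟨n, hn⟩ := exists_subset_exhaustionCore hU isCompact_singleton
      (singleton_subset_iff.2 hz)
    rw [singleton_subset_iff] at hn
    filter_upwards [hgood, hs n z hn] with ω h1 h2
    rw [h1.limitField_eq hn, h2]
  · filter_upwards [hgood] with ω h1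
    exact h1.harmonicOnNhd hU
  · obtain ⟨n, hn⟩ := exists_subset_exhaustionCore hU hK hKU
    have hpK' : ∀ᵐ z ∂p, z ∈ K := hpK
    have hint : Integrable m p := by
      have h1 := (hm.mono hKU).integrableOn_compact (μ := p) hK
      rwa [IntegrableOn, Measure.restrict_eq_self_of_ae_mem hpK'] at h1
    refine ⟨hint, ?_⟩
    have h1 := (ae_integrable_and_integral_eq_of_modification hint
      (measurable_smoothedField (U := U) hM n) (hpK'.mono fun z hz => hs n z (hn hz))).2
    filter_upwards [h1, hgood] with ω h2 h3
    rw [← h2]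
    refine integral_congr_ae (hpK'.mono fun z hz => ?_)
    exact h3.limitField_eq (hn hz)

end HarmonicVersion

/-! ### Oscillation estimate, and vector integrals tested by inner products -/

section Oscillation

variable {d : ℕ}

/-- Functions with the mean value property are Lipschitz, with a constant depending only on a
bound. -/
theorem exists_abs_sub_le_of_bumpMean : ∃ L : ℝ, ∀ f : Space d → ℝ, Measurable f →
    ∀ r > 0, ∀ (z₀ : Space d) (C : ℝ), (∀ y ∈ Metric.closedBall z₀ (2 * r), |f y| ≤ C) →
      (∀ z ∈ Metric.closedBall z₀ r, bumpMean f z r = f z * ∫ v : Space d, radialBump v) →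
        ∀ z ∈ Metric.closedBall z₀ r, |f z - f z₀| ≤ L * C / r * ‖z - z₀‖ := by
  obtain ⟨l, hl⟩ := (contDiff_radialBump (d := d) (n := 1)).lipschitzWith_of_hasCompactSupport
    hasCompactSupport_radialBump one_ne_zero
  have hc := integral_radialBump_pos (d := d)
  set c := ∫ v : Space d, radialBump v with hcdef
  set V := (volume : Measure (Space d)).real (Metric.closedBall 0 2) with hV
  refine ⟨l * V / c, fun f hf r hr z₀ C hC hmean z hz => ?_⟩
  set u := r⁻¹ • (z - z₀) with hu
  have hzu : z = z₀ + r • u := by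
    rw [hu, smul_smul, mul_inv_cancel₀ hr.ne', one_smul, add_sub_cancel]
  have hun : ‖u‖ = r⁻¹ * ‖z - z₀‖ := by
    rw [hu, norm_smul, Real.norm_of_nonneg (inv_nonneg.2 hr.le)]
  have hu1 : ‖u‖ ≤ 1 := by
    rw [hun, inv_mul_le_iff₀ hr, mul_one]
    rwa [Metric.mem_closedBall, dist_eq_norm] at hz
  have hbd : ∀ v ∈ Metric.closedBall (0 : Space d) 2, |f (z₀ + r • v)| ≤ C := fun v hv => hC _ (by
    rw [mem_closedBall_zero_iff] at hv
    rw [Metric.mem_closedBall, dist_eq_norm, add_sub_cancel_left, norm_smul,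
      Real.norm_of_nonneg hr.le]
    nlinarith)
  have hC0 : 0 ≤ C := (abs_nonneg _).trans (hbd 0 (Metric.mem_closedBall_self zero_le_two))
  have hzero : ∀ w : Space d, ‖w‖ ≤ 1 → ∀ v ∉ Metric.closedBall (0 : Space d) 2,
      radialBump (v - w) = 0 := fun w hw v hv => radialBump_eq_zero (by
    rw [mem_closedBall_zero_iff, not_le] at hv
    linarith [norm_sub_norm_le v w])
  have hint : ∀ w : Space d, ‖w‖ ≤ 1 →
      Integrable fun v => f (z₀ + r • v) * radialBump (v - w) := fun w hw => by
    refine (integrableOn_iff_integrable_of_support_subset (s := Metric.closedBall 0 2)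
      fun v hv => ?_).1 (Measure.integrableOn_of_bounded (M := C) measure_closedBall_lt_top.ne
        (((hf.comp (by fun_prop)).mul
          (continuous_radialBump.measurable.comp (by fun_prop))).aestronglyMeasurable) ?_)
    · by_contra h
      exact hv (by simp only [hzero w hw v h, mul_zero])
    · refine (ae_restrict_iff' Metric.isClosed_closedBall.measurableSet).2
        (Filter.Eventually.of_forall fun v hv => ?_)
      rw [norm_mul, Real.norm_eq_abs, Real.norm_of_nonneg (radialBump_nonneg _)]
      exact (mul_le_of_le_one_right (abs_nonneg _) (radialBump_le_one _)).trans (hbd v hv)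
  -- After a translation, the values at `z` and `z₀` are integrals of the same function against two
  -- shifts of the bump. Their difference is controlled by the Lipschitz constant of the bump alone.
  have e1 : f z * c = ∫ v, f (z₀ + r • v) * radialBump (v - u) := by
    rw [← hmean z hz, bumpMean, ← integral_sub_right_eq_self
      (fun v => f (z + r • v) * radialBump v) u]
    refine integral_congr_ae (Filter.Eventually.of_forall fun v => ?_)
    simp only
    rw [hzu, add_assoc, ← smul_add, add_sub_cancel]
  have e2 : f z₀ * c = ∫ v, f (z₀ + r • v) * radialBump (v - 0) := by
    simp_rw [sub_zero]
    exact (hmean z₀ (Metric.mem_closedBall_self hr.le)).symm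
  have e3 : |f z - f z₀| * c ≤ C * (l * ‖u‖) * V := by
    have h1 : |f z - f z₀| * c = ‖f z * c - f z₀ * c‖ := by
      rw [← sub_mul, norm_mul, Real.norm_eq_abs, Real.norm_of_nonneg hc.le]
    rw [h1, e1, e2, ← integral_sub (hint u hu1) (hint 0 (by simp)),
      ← setIntegral_eq_integral_of_forall_compl_eq_zero (s := Metric.closedBall 0 2) fun v hv => by
        rw [hzero u hu1 v hv, hzero 0 (by simp) v hv, sub_self]]
    refine norm_setIntegral_le_of_norm_le_const measure_closedBall_lt_top fun v hv => ?_
    rw [← mul_sub, norm_mul]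
    refine mul_le_mul (hbd v hv) ?_ (norm_nonneg _) hC0
    have h2 := hl.dist_le_mul (v - u) (v - 0)
    rwa [dist_eq_norm, dist_eq_norm, sub_sub_sub_cancel_left, zero_sub, norm_neg] at h2
  rw [hun] at e3
  have e4 : l * V / c * C / r * ‖z - z₀‖ = C * (l * (r⁻¹ * ‖z - z₀‖)) * V / c := by
    field_simp
  rw [e4, le_div_iff₀ hc]
  exact e3

/-- The difference of the two sides is orthogonal to the span of `T`. Since `g` and almost all
values of `m` lie in this span, the difference is orthogonal to itself. -/
theorem integral_eq_of_forall_inner {α H : Type*} [MeasurableSpace α] [NormedAddCommGroup H]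
    [InnerProductSpace ℝ H] [CompleteSpace H] {lam : Measure α} {m : α → H} {g : H} {T : Set H}
    (hm : Integrable m lam) (hmT : ∀ᵐ x ∂lam, m x ∈ Submodule.span ℝ T)
    (hg : g ∈ Submodule.span ℝ T)
    (h : ∀ t ∈ T, ∫ x, inner ℝ t (m x) ∂lam = inner ℝ t g) : ∫ x, m x ∂lam = g := by
  set f := (∫ x, m x ∂lam) - g with hf
  have h1 : ∀ s ∈ Submodule.span ℝ T, inner ℝ f s = 0 := fun s hs => by
    have h2 : T ⊆ (LinearMap.ker (innerSL ℝ f).toLinearMap : Set H) := fun t ht => by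
      have h3 : inner ℝ f t = 0 := by
        rw [real_inner_comm, hf, inner_sub_right, ← integral_inner hm, h t ht, sub_self]
      exact h3
    exact Submodule.span_le.2 h2 hs
  have h4 : inner ℝ f f = 0 := by
    conv_lhs => rw [hf]
    rw [inner_sub_left, real_inner_comm, ← integral_inner hm, real_inner_comm, h1 g hg, sub_zero]
    exact integral_eq_zero_of_ae (hmT.mono fun x hx => h1 _ hx)
  exact sub_eq_zero.1 (inner_self_eq_zero.1 h4)

end Oscillation

/-! ### The field at harmonic measures, as a function of the starting point -/

section HarmonicPart

variable {d : ℕ} {Ω' : Type*} [MeasurableSpace Ω'] {B : ℝ≥0 → Ω' → Space d} {Q : Measure Ω'}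
  [IsProbabilityMeasure Q] {D A : Set (Space d)}

/-- The part in `D` of the harmonic measure of `D \ A`. -/
noncomputable def innerHarmonicMeasure (B : ℝ≥0 → Ω' → Space d) (Q : Measure Ω')
    (D A : Set (Space d)) (z : Space d) : Measure (Space d) :=
  (harmonicMeasure B Q (D \ A) z).restrict D

instance (z : Space d) : IsFiniteMeasure (innerHarmonicMeasure B Q D A z) := by
  unfold innerHarmonicMeasure
  infer_instance

theorem innerHarmonicMeasure_univ_le (z : Space d) : innerHarmonicMeasure B Q D A z univ ≤ 1 :=
  (Measure.restrict_apply_le _ _).trans (harmonicMeasure_univ_le B Q _ z)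

theorem IsRegularPair.ae_innerHarmonicMeasure (h : IsRegularPair B Q D A) (z : Space d) :
    ∀ᵐ y ∂(innerHarmonicMeasure B Q D A z), y ∉ D \ A :=
  ae_restrict_of_ae (h.bm.ae_harmonicMeasure h.isOpen_diff z)

/-- For a pole outside `D \ A` the balayage identity has no remainder: the average of `green B Q D`
over the harmonic measure from `z` is its value at `z`. -/
theorem IsRegularPair.greenEnergy_innerHarmonicMeasure (h : IsRegularPair B Q D A)
    {z : Space d} (hz : z ∈ D \ A) (q : Measure (Space d)) [IsFiniteMeasure q]
    (hq : ∀ᵐ y ∂q, y ∉ D \ A) :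
    greenEnergy B Q D (innerHarmonicMeasure B Q D A z) q = ∫⁻ y, green B Q D z y ∂q := by
  rw [innerHarmonicMeasure, greenEnergy_restrict_left, greenEnergy,
    lintegral_lintegral_swap h.kernel.measurable.aemeasurable]
  refine lintegral_congr_ae (hq.mono fun y hy => ?_)
  simp only
  rw [h.bm.green_balayage h.two_le h.isOpen_diff h.isOpen sdiff_subset h.regular_diff h.regular hz,
    green_of_notMem fun h' => hy h'.2, zero_add]

theorem IsRegularPair.lintegral_green_le (h : IsRegularPair B Q D A) {K : Set (Space d)}
    (hK : IsCompact K) (hKO : K ⊆ D \ A) : ∃ C : ℝ≥0, ∀ z ∈ K, ∀ w,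
      ∫⁻ y, green B Q D z y ∂(innerHarmonicMeasure B Q D A w) ≤ C := by
  obtain ⟨C, hC⟩ := h.bm.exists_green_le h.two_le h.isOpen h.ne_univ h.regular h.isOpen_diff
    sdiff_subset hK hKO
  refine ⟨C, fun z hz w => ?_⟩
  calc ∫⁻ y, green B Q D z y ∂(innerHarmonicMeasure B Q D A w)
      ≤ ∫⁻ _, (C : ℝ≥0∞) ∂(innerHarmonicMeasure B Q D A w) :=
        lintegral_mono_ae ((h.ae_innerHarmonicMeasure w).mono fun y hy => hC z hz y hy)
    _ ≤ C := by
        rw [lintegral_const]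
        exact mul_le_of_le_one_right zero_le (innerHarmonicMeasure_univ_le w)

theorem IsRegularPair.innerHarmonicMeasure_mem (h : IsRegularPair B Q D A) {z : Space d}
    (hz : z ∈ D \ A) : innerHarmonicMeasure B Q D A z ∈ energyMeasures B Q D := by
  refine ⟨inferInstance, ?_, ?_⟩
  · rw [innerHarmonicMeasure, Measure.restrict_apply h.isOpen.measurableSet.compl,
      compl_inter_self, measure_empty]
  · rw [h.greenEnergy_innerHarmonicMeasure hz _ (h.ae_innerHarmonicMeasure z)]
    obtain ⟨C, hC⟩ := h.lintegral_green_le isCompact_singleton (singleton_subset_iff.2 hz)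
    exact (hC z rfl z).trans_lt ENNReal.coe_lt_top

/-- The potential of the harmonic measure from `w`. -/
noncomputable def harmonicPotential (B : ℝ≥0 → Ω' → Space d) (Q : Measure Ω')
    (D A : Set (Space d)) (w z : Space d) : ℝ :=
  (∫⁻ y, green B Q D z y ∂(innerHarmonicMeasure B Q D A w)).toReal

/-- The potential is a superposition of Green's functions with poles outside `D \ A`, thus off the
ball. The bound of `lintegral_green_le` justifies the passage to real values. -/
theorem IsRegularPair.bumpMean_harmonicPotential (h : IsRegularPair B Q D A) (w : Space d)
    {z : Space d} {ρ : ℝ} (hρ : 0 < ρ) (hball : Metric.closedBall z ρ ⊆ D \ A) :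
    bumpMean (harmonicPotential B Q D A w) z ρ =
      harmonicPotential B Q D A w z * ∫ v : Space d, radialBump v := by
  have hF := h.kernel.measurable_lintegral (innerHarmonicMeasure B Q D A w)
  have hψ : Measurable (radialBump : Space d → ℝ) := continuous_radialBump.measurable
  obtain ⟨C, hC⟩ := h.lintegral_green_le (isCompact_closedBall z ρ) hball
  have h1 : ∫⁻ v, (∫⁻ y, green B Q D (z + ρ • v) y ∂(innerHarmonicMeasure B Q D A w)) *
      ENNReal.ofReal (radialBump v) = (∫⁻ y, green B Q D z y ∂(innerHarmonicMeasure B Q D A w)) *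
        ENNReal.ofReal (∫ v : Space d, radialBump v) := by
    rw [← lintegral_mul_const _ (h.kernel.measurable_left z)]
    have h2 : ∀ v : Space d, Measurable fun y => green B Q D (z + ρ • v) y := fun v =>
      h.kernel.measurable_left _
    simp_rw [fun v : Space d => (lintegral_mul_const (μ := innerHarmonicMeasure B Q D A w)
      (ENNReal.ofReal (radialBump v)) (h2 v)).symm]
    rw [lintegral_lintegral_swap]
    · refine lintegral_congr_ae ((h.ae_innerHarmonicMeasure w).mono fun y hy => ?_)
      exact h.bm.lintegral_green_bump h.two_le h.isOpen hρ (hball.trans sdiff_subset)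
        fun hy' => hy (hball hy')
    · have h3 : Measurable fun q : Space d × Space d => (z + ρ • q.1, q.2) := by fun_prop
      have h4 := h.kernel.measurable.comp h3
      exact (h4.mul (hψ.comp measurable_fst).ennreal_ofReal).aemeasurable
  have h5 : bumpMean (harmonicPotential B Q D A w) z ρ =
      ∫ v, ((∫⁻ y, green B Q D (z + ρ • v) y ∂(innerHarmonicMeasure B Q D A w)) *
        ENNReal.ofReal (radialBump v)).toReal :=
    integral_congr_ae (Filter.Eventually.of_forall fun v => by
      simp only [harmonicPotential]
      rw [ENNReal.toReal_mul, ENNReal.toReal_ofReal (radialBump_nonneg v)])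
  have h6 : Measurable fun v : Space d => z + ρ • v := by fun_prop
  rw [h5, integral_toReal, h1, ENNReal.toReal_mul, ENNReal.toReal_ofReal integral_radialBump_pos.le]
  · rfl
  · exact ((hF.comp h6).mul hψ.ennreal_ofReal).aemeasurable
  · refine Filter.Eventually.of_forall fun v => ?_
    by_cases hv : ‖v‖ ≤ 1
    · refine ENNReal.mul_lt_top ((hC _ ?_ w).trans_lt ENNReal.coe_lt_top) ENNReal.ofReal_lt_top
      rw [Metric.mem_closedBall, dist_eq_norm, add_sub_cancel_left, norm_smul,
        Real.norm_of_nonneg hρ.le]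
      nlinarith
    · rw [radialBump_eq_zero (not_le.1 hv).le, ENNReal.ofReal_zero, mul_zero]
      exact ENNReal.zero_lt_top

variable {H : Type*} [NormedAddCommGroup H] [InnerProductSpace ℝ H]
  {ι : SignedMeasure (Space d) → H}

theorem IsRegularPair.inner_innerHarmonicMeasure (h : IsRegularPair B Q D A)
    (hι : IsEnergyIsometry B Q D ι) {z w : Space d} (hz : z ∈ D \ A) (hw : w ∈ D \ A) :
    inner ℝ (positiveImage ι (innerHarmonicMeasure B Q D A w))
      (positiveImage ι (innerHarmonicMeasure B Q D A z)) = harmonicPotential B Q D A w z := by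
  rw [real_inner_comm, hι.inner_positiveImage h.kernel (h.innerHarmonicMeasure_mem hz)
    (h.innerHarmonicMeasure_mem hw), h.greenEnergy_innerHarmonicMeasure hz _
    (h.ae_innerHarmonicMeasure w), harmonicPotential]

/-- The squared distance between the vectors at `z` and `z₀` is a difference of increments of two
harmonic potentials, those from `w = z` and `w = z₀`. Both are Lipschitz near `z₀` with a constant
independent of `w`, so the map is locally Hölder of exponent `1 / 2`. -/
theorem IsRegularPair.continuousOn_innerHarmonicMeasure (h : IsRegularPair B Q D A)
    (hι : IsEnergyIsometry B Q D ι) :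
    ContinuousOn (fun z => positiveImage ι (innerHarmonicMeasure B Q D A z)) (D \ A) := by
  intro z₀ hz₀
  refine ContinuousAt.continuousWithinAt ?_
  obtain ⟨R, hR, hball⟩ := Metric.nhds_basis_closedBall.mem_iff.1 (h.isOpen_diff.mem_nhds hz₀)
  obtain ⟨r, hr, rfl⟩ : ∃ r > 0, R = 2 * r := ⟨R / 2, half_pos hR, by ring⟩
  obtain ⟨L, hL⟩ := exists_abs_sub_le_of_bumpMean (d := d)
  obtain ⟨C, hC⟩ := h.lintegral_green_le (isCompact_closedBall z₀ (2 * r)) hball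
  set m := fun z => positiveImage ι (innerHarmonicMeasure B Q D A z) with hm
  have hosc : ∀ w, ∀ z ∈ Metric.closedBall z₀ r,
      |harmonicPotential B Q D A w z - harmonicPotential B Q D A w z₀| ≤
        L * C / r * ‖z - z₀‖ := fun w => by
    refine hL _ (h.kernel.measurable_lintegral _).ennreal_toReal r hr z₀ C (fun y hy => ?_)
      fun z hz => h.bumpMean_harmonicPotential w hr (subset_trans ?_ hball)
    · rw [abs_of_nonneg ENNReal.toReal_nonneg]
      exact ENNReal.toReal_le_coe_of_le_coe (hC y hy w)
    · refine Metric.closedBall_subset_closedBall' ?_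
      linarith [Metric.mem_closedBall.1 hz]
  have hin : ∀ z ∈ Metric.closedBall z₀ r, z ∈ D \ A := fun z hz =>
    hball (Metric.closedBall_subset_closedBall (by linarith) hz)
  have hbd : ∀ z ∈ Metric.closedBall z₀ r, ‖m z - m z₀‖ ^ 2 ≤ 2 * (L * C / r) * ‖z - z₀‖ :=
    fun z hz => by
    have e1 : ‖m z - m z₀‖ ^ 2 =
        (harmonicPotential B Q D A z z - harmonicPotential B Q D A z z₀) -
          (harmonicPotential B Q D A z₀ z - harmonicPotential B Q D A z₀ z₀) := by
      rw [← real_inner_self_eq_norm_sq, inner_sub_left, inner_sub_right, inner_sub_right]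
      simp only [hm, h.inner_innerHarmonicMeasure hι hz₀ hz₀,
        h.inner_innerHarmonicMeasure hι (hin z hz) (hin z hz),
        h.inner_innerHarmonicMeasure hι (hin z hz) hz₀,
        h.inner_innerHarmonicMeasure hι hz₀ (hin z hz)]
    rw [e1]
    have h1 := abs_le.1 (hosc z z hz)
    have h2 := abs_le.1 (hosc z₀ z hz)
    linarith [h1.2, h2.1]
  refine tendsto_iff_norm_sub_tendsto_zero.2 ?_
  have h3 : Filter.Tendsto (fun z => √(2 * (L * C / r) * ‖z - z₀‖)) (nhds z₀) (nhds 0) := by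
    have h4 : Continuous fun z : Space d => √(2 * (L * C / r) * ‖z - z₀‖) := by fun_prop
    have h5 := h4.tendsto z₀
    simpa using h5
  refine squeeze_zero' (Filter.Eventually.of_forall fun _ => norm_nonneg _) ?_ h3
  filter_upwards [Metric.closedBall_mem_nhds z₀ hr] with z hz
  exact Real.le_sqrt_of_sq_le (hbd z hz)

/-- Tested against the vector of a harmonic measure from `w`, this is the mean value property of the
potential from `w`. -/
theorem IsRegularPair.integral_radialBump_smul (h : IsRegularPair B Q D A) [CompleteSpace H]
    (hι : IsEnergyIsometry B Q D ι) {z : Space d} {ρ : ℝ} (hρ : 0 < ρ)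
    (hball : Metric.closedBall z ρ ⊆ D \ A)
    (hint : Integrable fun v : Space d =>
      radialBump v • positiveImage ι (innerHarmonicMeasure B Q D A (z + ρ • v))) :
    ∫ v, radialBump v • positiveImage ι (innerHarmonicMeasure B Q D A (z + ρ • v)) =
      (∫ v : Space d, radialBump v) • positiveImage ι (innerHarmonicMeasure B Q D A z) := by
  have hz : z ∈ D \ A := hball (Metric.mem_closedBall_self hρ.le)
  have hin : ∀ v : Space d, ‖v‖ ≤ 1 → z + ρ • v ∈ D \ A := fun v hv => hball (by
    rw [Metric.mem_closedBall, dist_eq_norm, add_sub_cancel_left, norm_smul,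
      Real.norm_of_nonneg hρ.le]
    nlinarith)
  refine integral_eq_of_forall_inner
    (T := (fun z => positiveImage ι (innerHarmonicMeasure B Q D A z)) '' (D \ A)) hint
    (Filter.Eventually.of_forall fun v => ?_)
    (Submodule.smul_mem _ _ (Submodule.subset_span ⟨z, hz, rfl⟩)) ?_
  · by_cases hv : ‖v‖ ≤ 1
    · exact Submodule.smul_mem _ _ (Submodule.subset_span ⟨_, hin v hv, rfl⟩)
    · rw [radialBump_eq_zero (not_le.1 hv).le, zero_smul]
      exact Submodule.zero_mem _
  · rintro _ ⟨w, hw, rfl⟩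
    simp only [inner_smul_right]
    rw [h.inner_innerHarmonicMeasure hι hz hw, mul_comm, ← h.bumpMean_harmonicPotential w hρ hball]
    refine integral_congr_ae (Filter.Eventually.of_forall fun v => ?_)
    by_cases hv : ‖v‖ ≤ 1
    · simp only [h.inner_innerHarmonicMeasure hι (hin v hv) hw, mul_comm]
    · simp only [radialBump_eq_zero (not_le.1 hv).le, zero_mul, mul_zero]

/-- Tested against the image of a measure `q` of finite energy, this is the definition of the swept
measure: the energy of the swept `p` with `q` is the integral over `p` of the energies of the
harmonic measures. There is no mass on `A` to keep. -/
theorem IsRegularPair.integral_innerHarmonicMeasure (h : IsRegularPair B Q D A) [CompleteSpace H]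
    (hι : IsEnergyIsometry B Q D ι) {p : Measure (Space d)} (hp : p ∈ energyMeasures B Q D)
    (hpO : ∀ᵐ z ∂p, z ∈ D \ A)
    (hint : Integrable (fun z => positiveImage ι (innerHarmonicMeasure B Q D A z)) p) :
    ∫ z, positiveImage ι (innerHarmonicMeasure B Q D A z) ∂p =
      positiveImage ι (balayage B Q D A p) := by
  refine integral_eq_of_forall_inner (T := positiveImage ι '' energyMeasures B Q D) hint
    (hpO.mono fun z hz => Submodule.subset_span ⟨_, h.innerHarmonicMeasure_mem hz, rfl⟩)
    (Submodule.subset_span ⟨_, h.balayage_mem hp, rfl⟩) ?_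
  rintro _ ⟨q, hq, rfl⟩
  have := hp.1
  have := hq.1
  have hbal : balayage B Q D A p = (sweptMeasure B Q (D \ A) p).restrict D := by
    have h0 : A ⊆ {z | ¬ z ∈ D \ A} := fun z hz hz' => hz'.2 hz
    have h1 : p.restrict A = 0 := Measure.restrict_eq_zero.2
      (measure_mono_null h0 (ae_iff.1 hpO))
    rw [balayage, h1, zero_add]
  have hF := h.kernel.measurable_lintegral q
  have e1 : greenEnergy B Q D (balayage B Q D A p) q =
      ∫⁻ z, greenEnergy B Q D (innerHarmonicMeasure B Q D A z) q ∂p := by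
    simp only [innerHarmonicMeasure, greenEnergy_restrict_left, hbal]
    rw [greenEnergy, h.lintegral_sweptMeasure p hF, Measure.restrict_eq_self_of_ae_mem hpO]
    rfl
  rw [real_inner_comm, hι.inner_positiveImage h.kernel (h.balayage_mem hp) hq, e1,
    ← integral_toReal]
  · refine integral_congr_ae (hpO.mono fun z hz => ?_)
    simp only
    rw [real_inner_comm, hι.inner_positiveImage h.kernel (h.innerHarmonicMeasure_mem hz) hq]
  · simp only [innerHarmonicMeasure, greenEnergy_restrict_left]
    exact ((Measure.measurable_lintegral hF).comp h.measurable_harmonicMeasure).aemeasurable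
  · exact hpO.mono fun z hz =>
      (h.kernel.greenEnergy_ne_top (h.innerHarmonicMeasure_mem hz) hq).lt_top

end HarmonicPart

/-! ### The harmonic version of the conditional field -/

section HarmonicField

variable {d : ℕ} {Ω' : Type*} [MeasurableSpace Ω'] {B : ℝ≥0 → Ω' → Space d} {Q : Measure Ω'}
  [IsProbabilityMeasure Q]
  {Ω : Type*} [MeasurableSpace Ω] {P : Measure Ω} [IsProbabilityMeasure P]
  {Γ : SignedMeasure (Space d) → Ω → ℝ} {D A : Set (Space d)}
  {ι : SignedMeasure (Space d) → Lp ℝ 2 P} {S : Submodule ℝ (Lp ℝ 2 P)}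

theorem IsFieldImage.exists_harmonic_version (hι : IsFieldImage B Q D Γ P ι S)
    (h : IsRegularPair B Q D A) :
    ∃ (ΓA : SignedMeasure (Space d) → Ω → ℝ) (H : Ω → Space d → ℝ),
      (∀ μ ∈ signedEnergyMeasures B Q D, ΓA μ =ᵐ[P] fieldOn B Q D A Γ μ) ∧
      (∀ z ∈ D \ A,
        (innerHarmonicMeasure B Q D A z).toSignedMeasure ∈ signedEnergyMeasures B Q D ∧
        (fun ω => H ω z) =ᵐ[P] Γ (innerHarmonicMeasure B Q D A z).toSignedMeasure) ∧
      ∀ᵐ ω ∂P, InnerProductSpace.HarmonicOnNhd (H ω) (D \ A) ∧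
        ∀ μ ∈ signedEnergyMeasures B Q D, CompactlyCarriedIn (D \ A) μ →
          ΓA μ ω = ∫ z, H ω z ∂μ.toJordanDecomposition.posPart -
            ∫ z, H ω z ∂μ.toJordanDecomposition.negPart := by
  classical
  have hcont := h.continuousOn_innerHarmonicMeasure hι.isometry
  obtain ⟨H, hH, hharm, hint⟩ := _root_.exists_harmonic_version h.isOpen_diff hcont
    fun z ρ hρ hball => h.integral_radialBump_smul hι.isometry hρ hball
      (integrable_radialBump_smul_comp hcont hρ hball)
  have hpos : ∀ p ∈ energyMeasures B Q D, ∀ K, IsCompact K → K ⊆ D \ A → p Kᶜ = 0 →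
      (fun ω => ∫ z, H ω z ∂p) =ᵐ[P] ⇑(positiveImage ι (balayage B Q D A p)) :=
    fun p hp K hK hKO hpK => by
      have := hp.1
      have hpK' : ∀ᵐ z ∂p, z ∈ K := hpK
      obtain ⟨h1, h2⟩ := hint p K hK hKO hpK
      rwa [h.integral_innerHarmonicMeasure hι.isometry hp (hpK'.mono fun z hz => hKO hz) h1] at h2
  -- The version is the pathwise integral for compactly carried measures, so that the formula holds
  -- for all of them outside one null event, and the original field for the others.
  refine ⟨fun μ ω => if CompactlyCarriedIn (D \ A) μ then
    ∫ z, H ω z ∂μ.toJordanDecomposition.posPart - ∫ z, H ω z ∂μ.toJordanDecomposition.negPart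
    else fieldOn B Q D A Γ μ ω, H, fun μ hμ => ?_, fun z hz => ?_, ?_⟩
  · by_cases hc : CompactlyCarriedIn (D \ A) μ
    · simp only [if_pos hc]
      obtain ⟨K, hK, hKO, hμK⟩ := hc
      rw [SignedMeasure.totalVariation, Measure.add_apply, add_eq_zero] at hμK
      obtain ⟨h1, h2⟩ := jordan_mem_energyMeasures hμ
      refine Filter.EventuallyEq.trans ?_ (hι.fieldOn_ae_eq h hμ)
      filter_upwards [hpos _ h1 K hK hKO hμK.1, hpos _ h2 K hK hKO hμK.2, Lp.coeFn_sub
        (positiveImage ι (balayage B Q D A μ.toJordanDecomposition.posPart))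
        (positiveImage ι (balayage B Q D A μ.toJordanDecomposition.negPart))] with ω e1 e2 e3
      rw [e3, Pi.sub_apply, e1, e2]
    · simp only [if_neg hc]
      exact Filter.EventuallyEq.rfl
  · have h1 := toSignedMeasure_mem (h.innerHarmonicMeasure_mem hz)
    refine ⟨h1, (hH z hz).trans ?_⟩
    rw [positiveImage_eq]
    exact hι.ae_eq _ h1
  · filter_upwards [hharm] with ω hω
    exact ⟨hω, fun μ _ hc => if_pos hc⟩

end HarmonicField

/-! ### Invariance under a change of version of the Brownian motion -/

section Congr

variable {d : ℕ} {Ω' : Type*} [MeasurableSpace Ω'] {B B' : ℝ≥0 → Ω' → Space d} {Q : Measure Ω'}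

theorem green_congr (h : harmonicMeasure B Q = harmonicMeasure B' Q) : green B Q = green B' Q := by
  funext U x y
  simp only [green, boundedGreen, h]

theorem signedEnergyMeasures_congr (h : harmonicMeasure B Q = harmonicMeasure B' Q) :
    signedEnergyMeasures B Q = signedEnergyMeasures B' Q := by
  funext U
  simp only [signedEnergyMeasures, energyMeasures, greenEnergy, green_congr h]

theorem isGFF_congr (h : harmonicMeasure B Q = harmonicMeasure B' Q)
    {Ω : Type*} [MeasurableSpace Ω] (U : Set (Space d)) (Γ : SignedMeasure (Space d) → Ω → ℝ)
    (P : Measure Ω) : IsGFF B Q U Γ P ↔ IsGFF B' Q U Γ P := by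
  have e1 := signedEnergyMeasures_congr h
  have e2 : greenCovariance B Q = greenCovariance B' Q := by
    funext U μ ν
    simp only [greenCovariance, greenEnergy, green_congr h]
  constructor
  · rintro ⟨h1, h2, h3⟩
    rw [e1] at h1 h2 h3
    rw [e2] at h3
    exact ⟨h1, h2, h3⟩
  · rintro ⟨h1, h2, h3⟩
    rw [← e1] at h1 h2 h3
    rw [← e2] at h3
    exact ⟨h1, h2, h3⟩

theorem sweptSignedMeasure_congr [IsProbabilityMeasure Q]
    (h : harmonicMeasure B Q = harmonicMeasure B' Q) :
    sweptSignedMeasure B Q = sweptSignedMeasure B' Q := by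
  funext D U μ
  simp only [sweptSignedMeasure, sweptMeasure, h]

end Congr

/-! ### The Markov property -/

theorem mainTheorem7 {d : ℕ} (hd : 2 ≤ d)
    {Ω' : Type*} [MeasurableSpace Ω'] (Q : Measure Ω') [IsProbabilityMeasure Q]
    (B : ℝ≥0 → Ω' → Space d) (hB : IsBrownianMotion B Q)
    (D : Set (Space d)) (hD : IsOpen D) (hD2 : d = 2 → D ≠ univ)
    (hDreg : HasRegularBoundary B Q D)
    (A : Set (Space d)) (hA : IsCompact A) (hAD : A ⊆ closure D)
    (hOreg : HasRegularBoundary B Q (D \ A))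
    {Ω : Type*} [MeasurableSpace Ω] (P : Measure Ω) [IsProbabilityMeasure P]
    (Γ : SignedMeasure (Space d) → Ω → ℝ) (hΓ : IsGFF B Q D Γ P) :
    -- `Γ_A` is well defined on `M_D`
    (∀ μ ∈ signedEnergyMeasures B Q D,
      μ.restrict A ∈ signedEnergyMeasures B Q D ∧
      sweptSignedMeasure B Q D (D \ A) μ ∈ signedEnergyMeasures B Q D) ∧
    -- `Γ_A` and `Γ^A` are independent Gaussian processes indexed by `M_D`
    IsGaussianProcess (fun μ : signedEnergyMeasures B Q D => fieldOn B Q D A Γ μ) P ∧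
    IsGaussianProcess (fun μ : signedEnergyMeasures B Q D => fieldOff B Q D A Γ μ) P ∧
    IndepFun (fun ω (μ : signedEnergyMeasures B Q D) => fieldOn B Q D A Γ μ ω)
      (fun ω (μ : signedEnergyMeasures B Q D) => fieldOff B Q D A Γ μ ω) P ∧
    -- `Γ^A` is a Gaussian free field in `O = D \ A`
    (∃ ΓO : SignedMeasure (Space d) → Ω → ℝ, IsGFF B Q (D \ A) ΓO P ∧
      ∀ μ ∈ signedEnergyMeasures B Q D,
        μ.restrict (D \ A) ∈ signedEnergyMeasures B Q (D \ A) ∧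
        fieldOff B Q D A Γ μ =ᵐ[P] ΓO (μ.restrict (D \ A))) ∧
    -- a version of `Γ_A` is given in `O` by a random harmonic function `h_A`,
    -- with `h_A(z) = Γ(ν_{z, ∂O})` for each `z`
    (∃ (ΓA : SignedMeasure (Space d) → Ω → ℝ) (h : Ω → Space d → ℝ),
      (∀ μ ∈ signedEnergyMeasures B Q D, ΓA μ =ᵐ[P] fieldOn B Q D A Γ μ) ∧
      (∀ z ∈ D \ A,
        ((harmonicMeasure B Q (D \ A) z).restrict D).toSignedMeasure
          ∈ signedEnergyMeasures B Q D ∧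
        (fun ω => h ω z) =ᵐ[P]
          Γ ((harmonicMeasure B Q (D \ A) z).restrict D).toSignedMeasure) ∧
      ∀ᵐ ω ∂P, InnerProductSpace.HarmonicOnNhd (h ω) (D \ A) ∧
        ∀ μ ∈ signedEnergyMeasures B Q D, CompactlyCarriedIn (D \ A) μ →
          ΓA μ ω = ∫ z, h ω z ∂μ.toJordanDecomposition.posPart -
            ∫ z, h ω z ∂μ.toJordanDecomposition.negPart) := by
  -- Energies, fields and harmonic measures depend on the Brownian motion only through its harmonic
  -- measures, and regularity is an almost sure property of its paths. So a version with continuous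
  -- paths may be used.
  obtain ⟨B', hB', hBB'⟩ := hB.exists_continuous
  have e0 : harmonicMeasure B Q = harmonicMeasure B' Q := by
    funext U
    exact harmonicMeasure_congr hBB' U
  have e1 := signedEnergyMeasures_congr e0
  have e2 := sweptSignedMeasure_congr e0
  have e3 : fieldOn (Ω := Ω) B Q = fieldOn B' Q := by
    funext D A Γ μ ω
    simp only [fieldOn, e2]
  have e4 : fieldOff (Ω := Ω) B Q = fieldOff B' Q := by
    funext D A Γ μ ω
    simp only [fieldOff, e3]
  have h : IsRegularPair B' Q D A :=
    ⟨hd, hB', hD, hD2, hA, hDreg.congr hBB', hOreg.congr hBB'⟩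
  obtain ⟨ι, S, hι⟩ := ((isGFF_congr e0 D Γ P).1 hΓ).exists_isFieldImage
  rw [e1]
  simp only [e0, e2, e3, e4, isGFF_congr e0]
  obtain ⟨h1, h2, h3⟩ := hι.isGaussianProcess_and_indepFun h
  exact ⟨fun μ hμ => h.restrict_signed_mem hμ, h1, h2, h3, hι.exists_isGFF_diff h,
    hι.exists_harmonic_version h⟩
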